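/- **Setting.** Let $\sigma>0$, $\theta\in(0,1)$. For a real number $M\ge 3$ let $\mathcal G_M=\mathbb C^{[-M,M]\cap\mathbb Z}$, regarded as a real vector space and as a space of sequences on $\mathbb Z$ (extended by $0$), with the norm $\|z\|_\sigma=2\sum_{|a|\le M}e^{\sigma|a|^\theta}|z_a|$, and let $\mathbb B_M(0,\varrho)=\{z\in\mathcal G_M:\|z\|_\sigma<\varrho\}$. A map $\Psi$ is symplectic on an open set $\mathcal O\subset\mathcal G_M$ if $(\mathbf i\,\mathrm d\Psi(z)v,\mathrm d\Psi(z)w)=(\mathbf i v,w)$ for all $z\in\mathcal O$, $v,w\in\mathcal G_M$, where $(u,v)=\mathrm{Re}\sum_a u_a\overline{v_a}$. The Hamiltonian vector field of a real function $P$ is $(\boldsymbol X_P(z))_a=\mathbf i\,\partial_{\overline{z_a}}P(z)$ with $2\partial_{\overline{z_a}}=\partial_{\mathrm{Re} z_a}+\mathbf i\,\partial_{\mathrm{Im} z_a}$. *Multi-indices.* For $j=(\delta,a)\in\{-1,1\}\times\mathbb Z$ let $\bar j=(-\delta,a)$, $z_{(1,a)}=z_a$, $z_{(-1,a)}=\overline{z_a}$.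 For a finite sequence $\boldsymbol j=(\delta_\beta,a_\beta)_{1\le\beta\le\#\boldsymbol j}$ put $z_{\boldsymbol j}=\prod_\beta z_{j_\beta}$, $\bar{\boldsymbol j}=(\overline{j_\beta})_\beta$, $\Delta_{\boldsymbol j}=\sum_\beta\delta_\beta a_\beta^2$. Let $\mathcal M_m$ be the set of $\boldsymbol j$ with $\#\boldsymbol j=2m$, $\sum\delta_\beta=0$ and $\sum\delta_\beta a_\beta=0$; let $\mathcal R_m=\{\boldsymbol j\in\mathcal M_m:\Delta_{\boldsymbol j}=0\}$ and $\mathcal R=\bigcup_{m\ge1}\mathcal R_m$. Let $\mathcal N$ be the set of $\boldsymbol j\in\mathcal R$ such that $\bar{\boldsymbol j}$ is not a permutation of $\boldsymbol j$. *Small divisors.* For $z\in\mathcal G_M$, $$\omega^M_{\boldsymbol j}(z)=\sum_{\beta}\delta_\beta\sum_{a\ne a_\beta,\ |a|\le M}\frac{|z_a|^2}{(a-a_\beta)^2},$$ and, for $\gamma>0$, $\mathfrak U_\gamma^{s,M}$ is the set of $z\in\mathcal G_M$ such that $|\omega^M_{\boldsymbol j}(z)|>\gamma\|z\|_\sigma^2$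 for all $\boldsymbol j\in\mathcal N$ with $\#\boldsymbol j\le s$ and all modes $|a_\beta|\le M$. *Rational fractions.* $\mathscr H_q^M$ is the set of the finite families $(Q_{\boldsymbol j,\mathbf h})$ of complex coefficients, indexed by $\boldsymbol j\in\mathcal R$ and finite sequences $\mathbf h$ of elements of $\mathcal N$, such that $\overline{Q_{\boldsymbol j,\mathbf h}}=Q_{\bar{\boldsymbol j},\bar{\mathbf h}}$, and such that $Q_{\boldsymbol j,\mathbf h}\ne0$ implies $\#\boldsymbol j-2\#\mathbf h=2q$ and that all modes of $\boldsymbol j$ and of the $\mathbf h_\alpha$ are at most $M$ in absolute value. The associated function is $Q(z)=\sum_{\boldsymbol j,\mathbf h}Q_{\boldsymbol j,\mathbf h}\,z_{\boldsymbol j}\prod_\alpha\frac{\mathbf i}{\omega^M_{\mathbf h_\alpha}(z)}$. It is integrable, $Q\in\mathscr H_q^{M,\mathrm{Int}}$, if $Q_{\boldsymbol j,\mathbf h}=0$ for all $\boldsymbol j\in\mathcal N$. *The Hamiltonian.* Let $L_2=\sum_a a^2|z_a|^2$, $L_4=\sum_{a\ne b}\frac{|z_a|^2|z_b|^2}{2(a-b)^2}$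 and $P_4=\sum_{a_1+a_2=b_1+b_2,\,a_1\neq b_1}\frac{z_{a_1}z_{a_2}\overline{z_{b_1}z_{b_2}}}{2(a_1-b_1)^2}$, so that $L_2+P_4$ is the Hamiltonian of the Schrödinger–Poisson equation on the circle. Its resonant (Birkhoff) normal form is obtained as follows, with the bracket $\{P,Q\}=\mathbf i\sum_{j}\delta(j)\,\partial_{z_j}P\,\partial_{z_{\bar j}}Q$ of homogeneous polynomials $\sum_{\boldsymbol j\in\mathcal M_m}P_{\boldsymbol j}z_{\boldsymbol j}$ and $\mathsf{ad}_S P=\{P,S\}$. Start with $K_2=L_2$, $K_4=P_4$ and $K_{2n}=0$ for $n\ge3$. For $s=1,2,\dots,r-1$ successively, let $S=\sum_{\boldsymbol j\in\mathcal M_{s+1},\,\Delta_{\boldsymbol j}\ne0}\frac{-\mathbf i}{\Delta_{\boldsymbol j}}K_{2(s+1),\boldsymbol j}\,z_{\boldsymbol j}$ (so that $\{L_2,S\}+K_{2(s+1)}$ is the resonant part of $K_{2(s+1)}$) and replace all $K_{2m}$ simultaneously by $\sum_{ks+n=m,\ k\ge0,\ n\ge1}\frac1{k!}\mathsf{ad}_S^k(K_{2n})$.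 The final polynomials $K_{2m}$, $m\le r$, contain only monomials $z_{\boldsymbol j}$ with $\boldsymbol j\in\mathcal R_m$. Let $H^{(2r,M)}$ be the restriction to $\mathcal G_M$ of $L_2+L_4+\sum_{m=3}^rK_{2m}$, and let $L_2^{(M)},L_4^{(M)}$ be the restrictions of $L_2,L_4$. **Theorem.** There is a universal constant $\mathsf C>1$ such that for all $\sigma>0$, $\theta\in(0,1)$, all integers $r\ge3$, real $M\ge3$ and $\gamma\in(0,1)$, setting $$\varrho=\gamma^{3/2}\,\mathsf C^{-1}r^{-4},\qquad D_0=\mathbb B_M(0,\varrho)\cap\mathfrak U_\gamma^{6r,M},\qquad D_1=\mathbb B_M(0,2\varrho)\cap\mathfrak U_{\gamma/2}^{6r,M},$$ there exist two $\mathcal C^\infty$ symplectic maps $\varphi_{(0)}:D_0\to D_1$ and $\varphi_{(1)}:D_1\to\mathcal G_M$ with $\varphi_{(1)}\circ\varphi_{(0)}=\mathrm{id}$ on $D_0$, integrable rational fractions $L_{2q}^{(M)}\in\mathscr H_q^{M,\mathrm{Int}}$, $3\le q\le r$, whose denominators $\omega^M_{\mathbf h_\alpha}$ all satisfy $\#\mathbf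 h_\alpha\le 6r$ (so that they do not vanish on $D_1$), and a $\mathcal C^\infty$ function $\Upsilon:D_1\to\mathbb R$, such that on $D_1$ (in particular on $D_0\subset D_1$) $$H^{(2r,M)}\circ\varphi_{(1)}=L_2^{(M)}+L_4^{(M)}+\sum_{q=3}^rL_{2q}^{(M)}+\Upsilon,\qquad \|\boldsymbol X_\Upsilon(z)\|_\sigma\le\mathsf C^r r^{10r}\gamma^{-2r+3}\|z\|_\sigma^{2r+1}.$$ Moreover, for $\iota=0,1$, all $z\in D_\iota$ and all $w\in\mathcal G_M$, $$\|\varphi_{(\iota)}(z)-z\|_\sigma\le\mathsf C\gamma^{-2}\|z\|_\sigma^3,\qquad \|\mathrm d\varphi_{(\iota)}(z)(w)\|_\sigma\le2^{r-2}\|w\|_\sigma.$$ -/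

import Mathlib

open scoped ContDiff

noncomputable section

namespace SchrodingerPoisson

/-! ### Indices and multi-indices -/

/-- An index `j = (δ, a)` with sign `δ ∈ {-1, 1}` and Fourier mode `a ∈ ℤ`. -/
abbrev Idx := ℤˣ × ℤ

/-- Multi-indices: finite sequences of indices. -/
abbrev MultiIndex := List Idx

/-- The conjugate index `(-δ, a)` of `(δ, a)`. -/
def Idx.bar (j : Idx) : Idx := (-j.1, j.2)

/-- Componentwise conjugation of a multi-index. -/
def MultiIndex.bar (j : MultiIndex) : MultiIndex := j.map Idx.bar

/-- `∑ δ_α a_α ^ k`: for `k = 0, 1, 2` this is the mass, the momentum and the energy `Δ_j`. -/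
def moment (k : ℕ) (j : MultiIndex) : ℤ := (j.map fun i => (i.1 : ℤ) * i.2 ^ k).sum

/-- `j ∈ 𝓜_m`: length `2m`, zero mass and zero momentum. -/
def ZeroMomentum (m : ℕ) (j : MultiIndex) : Prop :=
  j.length = 2 * m ∧ moment 0 j = 0 ∧ moment 1 j = 0

/-- `j ∈ 𝓡_m`: moreover zero energy. -/
def Resonant (m : ℕ) (j : MultiIndex) : Prop :=
  ZeroMomentum m j ∧ moment 2 j = 0

/-- `𝓡 = ⋃_{m ≥ 1} 𝓡_m`. -/
def resonantSet : Set MultiIndex := {j | ∃ m, 1 ≤ m ∧ Resonant m j}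

/-- Integrable multi-indices: some permutation of the entries conjugates all of them. -/
def integrableSet : Set MultiIndex := {j | (MultiIndex.bar j).Perm j}

/-- `𝓝`: the multi-indices that are resonant and not integrable. -/
def nonIntegrableSet : Set MultiIndex := resonantSet \ integrableSet

/-- `μ₁(j) ≤ M`, where `μ₁(j)` is the largest of the numbers `⟨j_β⟩ = max (1, |a_β|)`. -/
def ModesLE (M : ℝ) (j : MultiIndex) : Prop := ∀ i ∈ j, max 1 |(i.2 : ℝ)| ≤ M

/-- `𝓝^{s,M}`. -/
def nonIntegrableSetLE (s : ℕ) (M : ℝ) : Set MultiIndex :=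
  {j | j ∈ nonIntegrableSet ∧ j.length ≤ s ∧ ModesLE M j}

/-! ### The space of truncated sequences -/

/-- The modes `[-M, M] ∩ ℤ`. -/
abbrev Modes (M : ℝ) := {a : ℤ // a ∈ Finset.Icc ⌈-M⌉ ⌊M⌋}

/-- `𝓖_M = ℂ^{[-M, M] ∩ ℤ}`, seen as a real vector space. The norm that Mathlib puts on this
type is used only for its topology; the Gevrey norm is `gnorm`. -/
abbrev GM (M : ℝ) := Modes M → ℂ

/-- `‖z‖_σ = 2 ∑_a exp (σ |a|^θ) |z_a|`. -/
def gnorm (σ θ : ℝ) {M : ℝ} (z : GM M) : ℝ :=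
  2 * ∑ a : Modes M, Real.exp (σ * |((a : ℤ) : ℝ)| ^ θ) * ‖z a‖

/-- Extension by zero of `z ∈ 𝓖_M` to a sequence on `ℤ`. -/
def extend {M : ℝ} (z : GM M) (a : ℤ) : ℂ :=
  if h : a ∈ Finset.Icc ⌈-M⌉ ⌊M⌋ then z ⟨a, h⟩ else 0

/-- `z_{(1,a)} = z_a` and `z_{(-1,a)} = conj z_a`. -/
def coord {M : ℝ} (z : GM M) (i : Idx) : ℂ :=
  if i.1 = 1 then extend z i.2 else (starRingEnd ℂ) (extend z i.2)

/-- The monomial `z_j = z_{j_1} ⋯ z_{j_n}`. -/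
def monomial {M : ℝ} (z : GM M) (j : MultiIndex) : ℂ := (j.map (coord z)).prod

/-- The real `L²` scalar product. -/
def l2inner {M : ℝ} (u v : GM M) : ℝ := (∑ a : Modes M, u a * (starRingEnd ℂ) (v a)).re

/-- `Ψ` is symplectic on `O`. -/
def SymplecticOn {M : ℝ} (Ψ : GM M → GM M) (O : Set (GM M)) : Prop :=
  ∀ z ∈ O, ∀ v w : GM M,
    l2inner (Complex.I • fderiv ℝ Ψ z v) (fderiv ℝ Ψ z w) = l2inner (Complex.I • v) w

/-- The Hamiltonian vector field `(X_P(z))_a = i ∂P/∂(conj z_a)` of a real valued function, with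
`2 ∂/∂(conj z_a) = ∂/∂(Re z_a) + i ∂/∂(Im z_a)`. -/
def hamVF {M : ℝ} (P : GM M → ℝ) (z : GM M) : GM M := fun a =>
  Complex.I * (((fderiv ℝ P z (Pi.single a 1) : ℝ) : ℂ)
    + Complex.I * ((fderiv ℝ P z (Pi.single a Complex.I) : ℝ) : ℂ)) / 2

/-! ### Small divisors and non-resonant sets -/

/-- `ω_j^M(z) = ∑_β δ_β ∑_{a ≠ a_β, |a| ≤ M} |z_a|² / (a - a_β)²`. -/
def omega {M : ℝ} (j : MultiIndex) (z : GM M) : ℝ :=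
  (j.map fun i => ((i.1 : ℤ) : ℝ) *
    ∑ a : Modes M, if (a : ℤ) = i.2 then 0 else ‖z a‖ ^ 2 / (((a : ℤ) : ℝ) - (i.2 : ℝ)) ^ 2).sum

/-- The non-resonant set `𝔘_γ^{s,M}`. -/
def nonResonantSet (σ θ M γ : ℝ) (s : ℕ) : Set (GM M) :=
  {z | ∀ j ∈ nonIntegrableSetLE s M, γ * gnorm σ θ z ^ 2 < |omega j z|}

/-- `𝔹_M(0, ϱ) ∩ 𝔘_γ^{s,M}`. -/
def domain (σ θ M ϱ γ : ℝ) (s : ℕ) : Set (GM M) :=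
  {z | gnorm σ θ z < ϱ} ∩ nonResonantSet σ θ M γ s

/-! ### Rational fractions -/

/-- Coefficients `Q_{j,h}` of formal rational fractions, indexed by a numerator `j` and a finite
sequence `h` of denominators; only finitely many of them are non-zero. -/
abbrev RatCoeff := (MultiIndex × List MultiIndex) →₀ ℂ

/-- `Q(z) = ∑_{j,h} Q_{j,h} z_j ∏_α i / ω_{h_α}^M(z)`. -/
def RatCoeff.eval {M : ℝ} (Q : RatCoeff) (z : GM M) : ℂ :=
  Q.sum fun p c => c * (p.2.map fun h => Complex.I / ((omega h z : ℝ) : ℂ)).prod * monomial z p.1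

/-- `Q ∈ 𝓗_q^M`: rational fractions of order `2q`. The degrees of the numerators and the lengths
of the denominators are bounded because `Q` has finitely many non-zero coefficients. -/
structure IsRational (q : ℕ) (M : ℝ) (Q : RatCoeff) : Prop where
  num_mem : ∀ j h, Q (j, h) ≠ 0 → j ∈ resonantSet
  den_mem : ∀ j h, Q (j, h) ≠ 0 → ∀ k ∈ h, k ∈ nonIntegrableSet
  order : ∀ j h, Q (j, h) ≠ 0 → j.length = 2 * q + 2 * h.length
  num_modes : ∀ j h, Q (j, h) ≠ 0 → ModesLE M j
  den_modes : ∀ j h, Q (j, h) ≠ 0 → ∀ k ∈ h, ModesLE M k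
  reality : ∀ j h, (starRingEnd ℂ) (Q (j, h)) = Q (MultiIndex.bar j, h.map MultiIndex.bar)

/-- `Q ∈ 𝓗_q^{M,Int}`: moreover `Q` depends only on the actions. -/
structure IsIntegrableRational (q : ℕ) (M : ℝ) (Q : RatCoeff) : Prop extends IsRational q M Q where
  integrable : ∀ j ∈ nonIntegrableSet, ∀ h, Q (j, h) = 0

/-- All denominators `ω_k` of `Q` have `k` of length at most `s` (that is, `𝔥_Q ≤ s`); then `Q` is
a genuine function on `𝔘_γ^{s,M}`, where these denominators do not vanish. -/
def DenominatorsLE (s : ℕ) (Q : RatCoeff) : Prop :=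
  ∀ j h, Q (j, h) ≠ 0 → ∀ k ∈ h, k.length ≤ s

/-! ### The resonant normal form of the Schrödinger-Poisson Hamiltonian

A homogeneous polynomial `∑_{j ∈ 𝓜_m} P_j z_j` of degree `2m` in infinitely many variables is
represented by its coefficients `P : MultiIndex → ℂ`, which vanish outside `𝓜_m`. -/

/-- Coefficients of a homogeneous polynomial. -/
abbrev Coeff := MultiIndex → ℂ

/-- Symmetrization of the coefficients (it does not change the polynomial). -/
def symmetrize (P : Coeff) : Coeff := fun j =>
  (j.permutations.map P).sum / (j.length.factorial : ℂ)

/-- Coefficients of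
`P₄ = ∑_{a₁ + a₂ = b₁ + b₂, a₁ ≠ b₁} z_{a₁} z_{a₂} conj z_{b₁} conj z_{b₂} / (2 (a₁ - b₁)²)`,
before symmetrization. -/
def rawP4 : Coeff
  | [(d₁, a₁), (d₂, a₂), (e₁, b₁), (e₂, b₂)] =>
    if d₁ = 1 ∧ d₂ = 1 ∧ e₁ = -1 ∧ e₂ = -1 ∧ a₁ + a₂ = b₁ + b₂ ∧ a₁ ≠ b₁ then
      1 / (2 * ((a₁ : ℂ) - (b₁ : ℂ)) ^ 2)
    else 0
  | _ => 0

/-- Coefficients of the Poisson bracket `{P, P'} = i ∑_j δ(j) ∂P/∂z_j ∂P'/∂z_{bar j}` of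
homogeneous polynomials of degrees `2m` and `2m'`: the factor `z_i` of a monomial of `P`, in
position `α`, is contracted with the factor `z_{bar i}` of a monomial of `P'`, in position `α'`.
By the zero mass and momentum conditions, at most one index `i` contributes. -/
def poisson (m m' : ℕ) (P P' : Coeff) : Coeff := symmetrize fun j =>
  ∑ α ∈ Finset.range (2 * m), ∑ α' ∈ Finset.range (2 * m'), ∑ᶠ i : Idx,
    Complex.I * (((i.1 : ℤ) : ℂ)) * P ((j.take (2 * m - 1)).insertIdx α i)
      * P' ((j.drop (2 * m - 1)).insertIdx α' (Idx.bar i))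

/-- The resonant part of a polynomial. -/
def resonantPart (P : Coeff) : Coeff := fun j => if moment 2 j = 0 then P j else 0

/-- The solution `S` of the homological equation `{L₂, S} + P = resonantPart P`, where
`L₂ = ∑ a² |z_a|²`. With the above bracket, `{L₂, z_j} = -i Δ_j z_j`. -/
def homological (P : Coeff) : Coeff := fun j =>
  if moment 2 j = 0 then 0 else -Complex.I * P j / ((moment 2 j : ℤ) : ℂ)

/-- `ad_S^k P` with `ad_S P = {P, S}`, for `P` of degree `2n` and `S` of degree `2(s+1)`. -/
def adPow (s : ℕ) (S : Coeff) (n : ℕ) (P : Coeff) : ℕ → Coeff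
  | 0 => P
  | k + 1 => poisson (n + k * s) (s + 1) (adPow s S n P k) S

/-- One step of the Birkhoff normal form. Let `K₂ = L₂` and let `K_{2n}`, `n ≥ 2`, have the
coefficients `K n`. The flow at time one of the solution `S` of the homological equation for
`K_{2(s+1)}` transforms `∑ K_{2n}` into the sum of the polynomials
`∑_{k s + n = m, k ≥ 0, n ≥ 1} ad_S^k (K_{2n}) / k!` of degree `2m`. In the terms with `n = 1`,
which form the second sum, `ad_S (L₂) = {L₂, S}` is `resonantPart - id` applied to `K_{2(s+1)}`. -/
def birkhoffStep (s : ℕ) (K : ℕ → Coeff) : ℕ → Coeff := fun m =>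
  let S := homological (K (s + 1))
  (∑ k ∈ Finset.range (m + 1),
    if k * s + 2 ≤ m then
      ((k.factorial : ℂ)⁻¹) • adPow s S (m - k * s) (K (m - k * s)) k
    else 0)
  + ∑ k ∈ Finset.Icc 1 m,
      if k * s + 1 = m then
        ((k.factorial : ℂ)⁻¹) •
          adPow s S (s + 1) (resonantPart (K (s + 1)) - K (s + 1)) (k - 1)
      else 0

/-- The Birkhoff normal form procedure for `L₂ + P₄`: the value at `n` and `m` is the polynomial of
degree `2m` (`m ≥ 2`) after the terms of degree at most `2(n+1)` have been made resonant. -/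
def birkhoff : ℕ → ℕ → Coeff
  | 0 => fun m => if m = 2 then symmetrize rawP4 else 0
  | n + 1 => birkhoffStep (n + 1) (birkhoff n)

/-- The resonant polynomial `K_{2m}`, for `m ≤ r`, of the resonant normal form of order `2r`. -/
def resonantK (r m : ℕ) : Coeff := birkhoff (r - 1) m

/-- `P(z) = ∑_{j ∈ 𝓜_m} P_j z_j` for `z ∈ 𝓖_M` (only finitely many terms are non-zero). -/
def Coeff.eval {M : ℝ} (m : ℕ) (P : Coeff) (z : GM M) : ℂ :=
  ∑ᶠ j ∈ {j | ZeroMomentum m j}, P j * monomial z j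

/-- `L₂^{(M)}(z) = ∑_{|a| ≤ M} a² |z_a|²`. -/
def L2 {M : ℝ} (z : GM M) : ℝ := ∑ a : Modes M, ((a : ℤ) : ℝ) ^ 2 * ‖z a‖ ^ 2

/-- `L₄^{(M)}(z) = ∑_{a ≠ b} |z_a|² |z_b|² / (2 (a - b)²)`. -/
def L4 {M : ℝ} (z : GM M) : ℝ :=
  ∑ a : Modes M, ∑ b : Modes M,
    if a = b then 0
    else ‖z a‖ ^ 2 * ‖z b‖ ^ 2 / (2 * (((a : ℤ) : ℝ) - ((b : ℤ) : ℝ)) ^ 2)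

/-- `H^{(2r,M)} = L₂ + L₄ + ∑_{m=3}^r K_{2m}` on `𝓖_M`. -/
def truncatedH (r : ℕ) {M : ℝ} (z : GM M) : ℂ :=
  (L2 z : ℂ) + (L4 z : ℂ) + ∑ m ∈ Finset.Icc 3 r, Coeff.eval m (resonantK r m) z

end SchrodingerPoisson

end

open SchrodingerPoisson

/-! The quartic part `L4` is a function of the actions alone, with {L₄, z_j} = -i ω_j(z) z_j. A
resonant term c z_j with j non-integrable is therefore removed by the generator -c z_j · i/ω_j, at
the price of a small divisor depending on z. Numerators of zero energy commute with `L2`, so the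
unbounded part of the Hamiltonian never interferes. The whole normal form is produced by a single
generator χ = Σ_n χ_n (`genQ`), where χ_n is a rational fraction of order 2(n+2): φ₁ is the time-one
flow of χ and φ₀ that of -χ.

Formal part. The coefficient of t^k in the Lie series of the Hamiltonian is expanded by order. Its
part of order 2(n+3) involves only χ_i with i < n, except for the bracket {L₄, χ_n}, so χ_n can be
chosen inductively to cancel the non-integrable part of the sum T_n over k (`nfData`,
`pb_cL4_homQ`). At time one the integrable part of T_n remains (`sum_nfP`). The term T_n carries at
most 2n denominators, hence numerators of length at most 2(n+3)+4n = 6(n+1); these numerators become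
denominators, which explains the bound 6r.

Size. A formal fraction is measured by `colNorm`: a sum over denominators, a supremum over
numerators. In a bracket the contracted index is determined by mass and momentum, so the number of
modes never enters: a bracket costs only O(r⁴) (`colNorm_br_le`), and the coefficients of χ_n are
O(r⁵)^n (`colNorm_nf_le`). The same momentum argument, with the submultiplicative Gevrey weight,
bounds the polynomials of the resonant normal form (`norm_resonantK_le`) and turns coefficients into
bounds of vector fields (`sum_weighted_grad_le`).

Analytic part. Treating z_a and its conjugate as independent makes all fractions holomorphic in a
complex neighbourhood of radius proportional to γ‖z‖/r, on which the divisors stay above γ‖z‖²/4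
(`region_of_mem_domain`). There the generator has a field of size γ^{-2}‖z‖³; Cauchy estimates bound
its differential by 1/4 when ‖z‖² is small compared with γ³/r (`generator_bounds`). The flow exists
up to time one, and depends smoothly on its initial point by the implicit function theorem in a
space of paths (`exists_flow`).

Remainder. If f_k are the truncated time coefficients and {f_k, χ} = (k+1) f_{k+1} + ρ_k, then
Σ(1-t)^k f_k(Φ^t) has derivative Σ(1-t)^k ρ_k(Φ^t), because the other terms telescope
(`abs_fderiv_remainder_le`). The functions ρ_k only contain orders above 2r. The bound for the
vector field of the remainder follows by duality, the symplecticity of Φ^t moving the pairing back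
to time zero (`IsFlowAt.abs_l2inner_fderiv_le`). -/

noncomputable section

namespace SchrodingerPoisson

open Set Metric Filter Topology

/-! ### Superposition operators on spaces of continuous paths -/

section Superposition

set_option linter.unusedSectionVars false

universe u

variable {I : Type*} [TopologicalSpace I] [CompactSpace I]
  {E F : Type u} [NormedAddCommGroup E] [NormedSpace ℝ E] [NormedAddCommGroup F] [NormedSpace ℝ F]

open Classical in
/-- The superposition operator `u ↦ X ∘ u` on continuous maps. -/
def superpos (X : E → F) (u : C(I, E)) : C(I, F) :=
  -- The default value 0 is harmless: the operator is only studied on paths whose values stay in a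
  -- set where X is continuous.
  if h : Continuous (X ∘ u) then ⟨X ∘ u, h⟩ else 0

lemma superpos_apply {X : E → F} {U : Set E} (hX : ContinuousOn X U) {u : C(I, E)}
    (hu : ∀ t, u t ∈ U) (t : I) : superpos X u t = X (u t) := by
  have h : Continuous (X ∘ u) := hX.comp_continuous u.continuous hu
  simp [superpos, h]

/-- Pointwise application of a path of operators to a path of vectors. -/
def applyPath : C(I, E →L[ℝ] F) →L[ℝ] C(I, E) →L[ℝ] C(I, F) :=
  LinearMap.mkContinuous₂
    (LinearMap.mk₂ ℝ (fun (A : C(I, E →L[ℝ] F)) (v : C(I, E)) =>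
        (⟨fun t => A t (v t), by fun_prop⟩ : C(I, F)))
      (fun _ _ _ => by ext; simp) (fun _ _ _ => by ext; simp)
      (fun _ _ _ => by ext; simp) (fun _ _ _ => by ext; simp)) 1
    (fun A v => by
      rw [one_mul]
      refine (ContinuousMap.norm_le _ (by positivity)).2 fun t => ?_
      exact ((A t).le_opNorm _).trans
        (mul_le_mul (A.norm_coe_le_norm t) (v.norm_coe_le_norm t) (norm_nonneg _) (by positivity)))

@[simp] lemma applyPath_apply (A : C(I, E →L[ℝ] F)) (v : C(I, E)) (t : I) :
    applyPath A v t = A t (v t) := rfl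

/-- The range of a path is compact, so both the room inside U and the modulus of continuity of X are
uniform along it. This turns the pointwise statements below into statements in the supremum norm. -/
lemma exists_forall_dist_lt {X : E → F} {U : Set E} (hU : IsOpen U) (hX : ContinuousOn X U)
    {u : C(I, E)} (hu : ∀ t, u t ∈ U) {ε : ℝ} (hε : 0 < ε) :
    ∃ δ > 0, ∀ t y, dist y (u t) < δ → y ∈ U ∧ dist (X y) (X (u t)) < ε := by
  have hK : IsCompact (range u) := isCompact_range u.continuous
  have hKU : range u ⊆ U := by rintro _ ⟨t, rfl⟩; exact hu t
  obtain ⟨δ₁, hδ₁, h₁⟩ := hK.exists_thickening_subset_open hU hKU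
  have h₂ := hK.uniformContinuousAt_of_continuousAt X
    (fun a ha => hX.continuousAt (hU.mem_nhds (hKU ha))) (dist_mem_uniformity hε)
  obtain ⟨δ₂, hδ₂, h₂⟩ := Metric.mem_uniformity_dist.1 h₂
  refine ⟨min δ₁ δ₂, lt_min hδ₁ hδ₂, fun t y hy => ⟨h₁ ?_, ?_⟩⟩
  · exact mem_thickening_iff.2 ⟨u t, mem_range_self t, hy.trans_le (min_le_left _ _)⟩
  · have := h₂ (a := u t) (b := y) (by rw [dist_comm]; exact hy.trans_le (min_le_right _ _))
      (mem_range_self t)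
    rw [dist_comm]; exact this

lemma isOpen_paths {U : Set E} (hU : IsOpen U) : IsOpen {u : C(I, E) | ∀ t, u t ∈ U} := by
  rw [Metric.isOpen_iff]
  intro u hu
  obtain ⟨δ, hδ, h⟩ := exists_forall_dist_lt (X := (id : E → E)) hU continuousOn_id hu
    one_pos
  exact ⟨δ, hδ, fun v hv t => (h t _ ((ContinuousMap.dist_apply_le_dist t).trans_lt hv)).1⟩

lemma continuousOn_superpos {X : E → F} {U : Set E} (hU : IsOpen U) (hX : ContinuousOn X U) :
    ContinuousOn (superpos X) {u : C(I, E) | ∀ t, u t ∈ U} := by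
  intro u hu
  refine ContinuousAt.continuousWithinAt (Metric.continuousAt_iff.2 fun ε hε => ?_)
  obtain ⟨δ, hδ, h⟩ := exists_forall_dist_lt hU hX hu (half_pos hε)
  refine ⟨δ, hδ, fun {v} hv => ?_⟩
  have hv' := fun t => h t (v t) ((ContinuousMap.dist_apply_le_dist t).trans_lt hv)
  refine lt_of_le_of_lt ((ContinuousMap.dist_le (half_pos hε).le).2 fun t => ?_) (half_lt_self hε)
  rw [superpos_apply hX (fun t => (hv' t).1), superpos_apply hX hu]
  exact (hv' t).2.le

/-- Mean value inequality in a ball around u(t) on which the differential of X oscillates by at most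
ε; the radius does not depend on t. -/
lemma hasFDerivAt_superpos {X : E → F} {U : Set E} (hU : IsOpen U) (hX : ContDiffOn ℝ 1 X U)
    {u : C(I, E)} (hu : ∀ t, u t ∈ U) :
    HasFDerivAt (superpos X) (applyPath (superpos (fderiv ℝ X) u)) u := by
  have hXc : ContinuousOn X U := hX.continuousOn
  have hDc : ContinuousOn (fderiv ℝ X) U := hX.continuousOn_fderiv_of_isOpen hU le_rfl
  rw [hasFDerivAt_iff_isLittleO, Asymptotics.isLittleO_iff]
  intro ε hε
  obtain ⟨δ, hδ, h⟩ := exists_forall_dist_lt hU hDc hu hε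
  filter_upwards [Metric.ball_mem_nhds u hδ] with v hv
  have hv' := fun t => h t (v t) ((ContinuousMap.dist_apply_le_dist t).trans_lt hv)
  refine (ContinuousMap.norm_le _ (by positivity)).2 fun t => ?_
  have key : ‖X (v t) - X (u t) - fderiv ℝ X (u t) (v t - u t)‖ ≤ ε * ‖v t - u t‖ := by
    refine (convex_ball (u t) δ).norm_image_sub_le_of_norm_fderiv_le' (𝕜 := ℝ) (f := X)
      (fun y hy => ?_) (fun y hy => ?_) (mem_ball_self hδ)
      ((ContinuousMap.dist_apply_le_dist t).trans_lt hv)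
    · exact (hX.differentiableOn one_ne_zero).differentiableAt (hU.mem_nhds (h t y hy).1)
    · rw [← dist_eq_norm]; exact (h t y hy).2.le
  simp only [ContinuousMap.sub_apply, applyPath_apply]
  rw [superpos_apply hXc (fun t => (hv' t).1), superpos_apply hXc hu, superpos_apply hDc hu]
  exact key.trans (mul_le_mul_of_nonneg_left ((v - u).norm_coe_le_norm t) hε.le)

/-- The derivative of `superpos X` is `superpos (fderiv ℝ X)` followed by the linear map
`applyPath`, so the induction passes from F to the operators E → F. This is why F varies in the
statement and shares its universe with E. -/
lemma contDiffOn_superpos_nat {U : Set E} (hU : IsOpen U) (n : ℕ) :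
    ∀ {F : Type u} [NormedAddCommGroup F] [NormedSpace ℝ F] {X : E → F}, ContDiffOn ℝ n X U →
      ContDiffOn ℝ n (superpos X) {u : C(I, E) | ∀ t, u t ∈ U} := by
  induction n with
  | zero =>
    intro F _ _ X hX
    exact contDiffOn_zero.2 (continuousOn_superpos hU hX.continuousOn)
  | succ n ih =>
    intro F _ _ X hX
    have hX1 : ContDiffOn ℝ 1 X U := hX.of_le (by exact_mod_cast Nat.le_add_left 1 n)
    push_cast at hX ⊢
    rw [contDiffOn_succ_iff_fderiv_of_isOpen (isOpen_paths hU)]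
    have hd := fun u (hu : u ∈ {u : C(I, E) | ∀ t, u t ∈ U}) => hasFDerivAt_superpos hU hX1 hu
    refine ⟨fun u hu => (hd u hu).differentiableAt.differentiableWithinAt, by simp, ?_⟩
    have := ih ((contDiffOn_succ_iff_fderiv_of_isOpen hU).1 hX).2.2
    have hL : ContDiff ℝ n (applyPath (I := I) (E := E) (F := F)) := by
      fun_prop
    exact (hL.comp_contDiffOn this).congr fun u hu => (hd u hu).fderiv

lemma contDiffOn_superpos {X : E → F} {U : Set E} (hU : IsOpen U) (hX : ContDiffOn ℝ ∞ X U) :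
    ContDiffOn ℝ ∞ (superpos X) {u : C(I, E) | ∀ t, u t ∈ U} :=
  contDiffOn_infty.2 fun n => contDiffOn_superpos_nat hU n (hX.of_le (by exact_mod_cast le_top))

end Superposition


/-! ### Smooth dependence of the flow on the initial condition -/

section Flow

set_option linter.unusedSectionVars false

variable {E : Type*} [NormedAddCommGroup E] [NormedSpace ℝ E] 

/-- Constant paths. -/
def constPath : E →L[ℝ] C(Icc (0 : ℝ) 1, E) :=
  LinearMap.mkContinuous
    { toFun := fun x => ContinuousMap.const _ x
      map_add' := fun _ _ => rfl
      map_smul' := fun _ _ => rfl } 1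
    fun x => by
      rw [one_mul]
      exact (ContinuousMap.norm_le _ (norm_nonneg x)).2 fun t => le_rfl

@[simp] lemma constPath_apply (x : E) (t : Icc (0 : ℝ) 1) : constPath x t = x := rfl

/-- A path on `[0, 1]`, extended to the real line. -/
def extendPath (u : C(Icc (0 : ℝ) 1, E)) (t : ℝ) : E := u (projIcc 0 1 zero_le_one t)

lemma continuous_extendPath (u : C(Icc (0 : ℝ) 1, E)) : Continuous (extendPath u) :=
  u.continuous.comp continuous_projIcc

lemma extendPath_of_mem (u : C(Icc (0 : ℝ) 1, E)) {t : ℝ} (ht : t ∈ Icc (0 : ℝ) 1) :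
    extendPath u t = u ⟨t, ht⟩ := by
  rw [extendPath, projIcc_of_mem _ ht]

lemma norm_extendPath_le (u : C(Icc (0 : ℝ) 1, E)) (t : ℝ) : ‖extendPath u t‖ ≤ ‖u‖ :=
  u.norm_coe_le_norm _

/-- The primitive of a path that vanishes at time `0`. -/
def primitivePath [CompleteSpace E] : C(Icc (0 : ℝ) 1, E) →L[ℝ] C(Icc (0 : ℝ) 1, E) :=
  LinearMap.mkContinuous
    { toFun := fun v => ⟨fun t => ∫ s in (0 : ℝ)..t, extendPath v s, by
        refine (intervalIntegral.continuous_primitive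
          (fun a b => (continuous_extendPath v).intervalIntegrable a b) 0).comp
            continuous_subtype_val⟩
      map_add' := fun v w => by
        ext t
        exact intervalIntegral.integral_add ((continuous_extendPath v).intervalIntegrable _ _)
          ((continuous_extendPath w).intervalIntegrable _ _)
      map_smul' := fun c v => by
        ext t
        exact intervalIntegral.integral_smul c _ } 1
    fun v => by
      rw [one_mul]
      refine (ContinuousMap.norm_le _ (norm_nonneg v)).2 fun t => ?_
      refine (intervalIntegral.norm_integral_le_of_norm_le_const
        fun s _ => norm_extendPath_le v s).trans ?_
      have ht := t.2
      rw [sub_zero, abs_of_nonneg ht.1]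
      exact mul_le_of_le_one_right (norm_nonneg v) ht.2

lemma norm_primitivePath_le [CompleteSpace E] (v : C(Icc (0 : ℝ) 1, E)) :
    ‖primitivePath v‖ ≤ ‖v‖ := by
  have := (primitivePath (E := E)).le_of_opNorm_le
    (LinearMap.mkContinuous_norm_le _ zero_le_one _) v
  rwa [one_mul] at this

lemma primitivePath_apply [CompleteSpace E] (v : C(Icc (0 : ℝ) 1, E)) (t : Icc (0 : ℝ) 1) :
    primitivePath v t = ∫ s in (0 : ℝ)..t, extendPath v s := rfl

lemma hasDerivWithinAt_primitivePath [CompleteSpace E] (v : C(Icc (0 : ℝ) 1, E)) {t : ℝ}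
    (ht : t ∈ Icc (0 : ℝ) 1) :
    HasDerivWithinAt (extendPath (primitivePath v)) (extendPath v t) (Icc 0 1) t := by
  have h : HasDerivAt (fun t : ℝ => ∫ s in (0 : ℝ)..t, extendPath v s) (extendPath v t) t :=
    intervalIntegral.integral_hasDerivAt_right ((continuous_extendPath v).intervalIntegrable _ _)
      ((continuous_extendPath v).stronglyMeasurableAtFilter _ _)
      (continuous_extendPath v).continuousAt
  refine h.hasDerivWithinAt.congr_of_mem (fun s hs => ?_) ht
  rw [extendPath_of_mem _ hs, primitivePath_apply]

lemma hasDerivWithinAt_of_eq_add_primitivePath [CompleteSpace E] {x : E}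
    {u v : C(Icc (0 : ℝ) 1, E)} (h : u = constPath x + primitivePath v) {t : ℝ}
    (ht : t ∈ Icc (0 : ℝ) 1) :
    HasDerivWithinAt (extendPath u) (extendPath v t) (Icc 0 1) t := by
  have : extendPath u = fun s => x + extendPath (primitivePath v) s := by
    rw [h]; rfl
  rw [this]
  exact (hasDerivWithinAt_primitivePath v ht).const_add x

/-- Fundamental theorem of calculus; it brings an arbitrary differentiable solution into the
integral form to which `path_unique` applies. -/
lemma eq_add_primitivePath [CompleteSpace E] {f f' : ℝ → E} {u v : C(Icc (0 : ℝ) 1, E)}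
    (hf : ∀ t ∈ Icc (0 : ℝ) 1, HasDerivWithinAt f (f' t) (Icc 0 1) t)
    (hu : ∀ t : Icc (0 : ℝ) 1, u t = f t) (hv : ∀ t : Icc (0 : ℝ) 1, v t = f' t) :
    u = constPath (f 0) + primitivePath v := by
  ext t
  have ht := t.2
  have hc : ContinuousOn f (Icc 0 1) := fun s hs => (hf s hs).continuousWithinAt
  have := intervalIntegral.integral_eq_sub_of_hasDeriv_right_of_le (f := f)
    (f' := extendPath v) ht.1 (hc.mono (Icc_subset_Icc le_rfl ht.2)) (fun s hs => by
      have hs' : s ∈ Icc (0 : ℝ) 1 := ⟨hs.1.le, (hs.2.trans_le ht.2).le⟩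
      rw [extendPath_of_mem v hs', hv ⟨s, hs'⟩]
      exact ((hf s hs').hasDerivAt (Icc_mem_nhds hs.1 (hs.2.trans_le ht.2))).hasDerivWithinAt)
    ((continuous_extendPath v).intervalIntegrable _ _)
  simp only [ContinuousMap.add_apply, constPath_apply, primitivePath_apply, this, hu]
  abel

variable [CompleteSpace E]

/-- Solutions of the integral equation in a ball on which the vector field is a contraction are
unique. -/
lemma path_unique {X : E → E} {c x : E} {ρ : ℝ} (hX : DifferentiableOn ℝ X (closedBall c ρ))
    (hXc : ContinuousOn X (closedBall c ρ))
    (hder : ∀ y ∈ closedBall c ρ, ‖fderivWithin ℝ X (closedBall c ρ) y‖ ≤ 1 / 4)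
    {u v : C(Icc (0 : ℝ) 1, E)}
    (hu : u = constPath x + primitivePath (superpos X u)) (hub : ∀ t, u t ∈ closedBall c ρ)
    (hv : v = constPath x + primitivePath (superpos X v)) (hvb : ∀ t, v t ∈ closedBall c ρ) :
    u = v := by
  have h1 : ‖superpos X u - superpos X v‖ ≤ 1 / 4 * ‖u - v‖ := by
    refine (ContinuousMap.norm_le _ (by positivity)).2 fun t => ?_
    rw [ContinuousMap.sub_apply, superpos_apply hXc hub, superpos_apply hXc hvb]
    refine ((convex_closedBall c ρ).norm_image_sub_le_of_norm_fderivWithin_le hX hder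
      (hvb t) (hub t)).trans ?_
    gcongr
    exact (u - v).norm_coe_le_norm t
  have h2 : u - v = primitivePath (superpos X u - superpos X v) := by
    rw [map_sub]
    nth_rw 1 [hu]
    nth_rw 1 [hv]
    abel
  have h3 := norm_primitivePath_le (superpos X u - superpos X v)
  rw [← h2] at h3
  have : ‖u - v‖ ≤ 0 := by linarith [norm_nonneg (u - v)]
  exact sub_eq_zero.1 (norm_le_zero_iff.1 this)

/-- The defining equation of the flow as an equation in a Banach space of paths. -/
def flowEq (X : E → E) (p : E × C(Icc (0 : ℝ) 1, E)) : C(Icc (0 : ℝ) 1, E) :=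
  p.2 - constPath p.1 - primitivePath (superpos X p.2)

lemma isInvertible_id_sub {G : Type*} [NormedAddCommGroup G] [NormedSpace ℝ G] [CompleteSpace G]
    {A : G →L[ℝ] G} (hA : ‖A‖ < 1) : (ContinuousLinearMap.id ℝ G - A).IsInvertible := by
  have h := isUnit_one_sub_of_norm_lt_one hA
  obtain ⟨v, hv⟩ := h
  refine ⟨ContinuousLinearEquiv.unitsEquiv ℝ G v, ?_⟩
  ext x
  change (v : G →L[ℝ] G) x = _
  rw [hv]
  rfl

/-- Implicit function theorem for `flowEq`. Its derivative in the path is the identity minus the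
primitive of DX(u)·, and the latter has norm at most 1/4, so a Neumann series inverts it. -/
lemma exists_contDiffAt_path {E : Type*} [NormedAddCommGroup E] [NormedSpace ℝ E] [CompleteSpace E]
    {X : E → E} {U : Set E} (hU : IsOpen U) (hX : ContDiffOn ℝ ∞ X U) {x : E}
    {u : C(Icc (0 : ℝ) 1, E)} (huU : ∀ t, u t ∈ U)
    (hder : ∀ t, ‖fderiv ℝ X (u t)‖ ≤ 1 / 4)
    (hu : u = constPath x + primitivePath (superpos X u)) :
    ∃ ψ : E → C(Icc (0 : ℝ) 1, E), ψ x = u ∧ ContDiffAt ℝ ∞ ψ x ∧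
      ∀ᶠ y in 𝓝 x, ψ y = constPath y + primitivePath (superpos X (ψ y)) := by
  have hopen := isOpen_paths (I := Icc (0 : ℝ) 1) hU
  have hS : ContDiffAt ℝ ∞ (superpos X) u :=
    (contDiffOn_superpos hU hX).contDiffAt (hopen.mem_nhds huU)
  have hF : ContDiffAt ℝ ∞ (flowEq X) (x, u) := by
    have h2 : ContDiffAt ℝ ∞ (fun p : E × C(Icc (0 : ℝ) 1, E) => superpos X p.2) (x, u) :=
      ContDiffAt.comp (x, u) hS contDiffAt_snd
    unfold flowEq
    exact (contDiffAt_snd.sub (constPath.contDiff.contDiffAt.comp _ contDiffAt_fst)).sub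
      (primitivePath.contDiff.contDiffAt.comp _ h2)
  have hDc : ContinuousOn (fderiv ℝ X) U := hX.continuousOn_fderiv_of_isOpen hU (by simp)
  have hSd : HasFDerivAt (superpos X) (applyPath (superpos (fderiv ℝ X) u)) u :=
    hasFDerivAt_superpos hU (hX.of_le (by simp)) huU
  have hF' : HasFDerivAt (fun v => flowEq X (x, v))
      (ContinuousLinearMap.id ℝ _ - primitivePath ∘L applyPath (superpos (fderiv ℝ X) u)) u := by
    have h3 : HasFDerivAt (primitivePath (E := E)) primitivePath (superpos X u) := by
      apply ContinuousLinearMap.hasFDerivAt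
    exact ((hasFDerivAt_id u).sub_const (constPath x)).sub (h3.comp u hSd)
  have hF'' : fderiv ℝ (flowEq X) (x, u) ∘L .inr ℝ E C(Icc (0 : ℝ) 1, E) =
      ContinuousLinearMap.id ℝ _ - primitivePath ∘L applyPath (superpos (fderiv ℝ X) u) := by
    refine HasFDerivAt.unique ?_ hF'
    exact (hF.differentiableAt (by simp)).hasFDerivAt.comp u (hasFDerivAt_prodMk_right x u)
  have hnorm : ‖primitivePath ∘L applyPath (superpos (fderiv ℝ X) u)‖ ≤ 1 / 4 := by
    refine ContinuousLinearMap.opNorm_le_bound _ (by norm_num) fun v => ?_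
    refine (norm_primitivePath_le _).trans ?_
    refine (ContinuousMap.norm_le _ (by positivity)).2 fun t => ?_
    change ‖superpos (fderiv ℝ X) u t (v t)‖ ≤ _
    rw [superpos_apply hDc huU]
    exact ((fderiv ℝ X (u t)).le_opNorm _).trans
      (mul_le_mul (hder t) (v.norm_coe_le_norm t) (norm_nonneg _) (by norm_num))
  have hinv : (fderiv ℝ (flowEq X) (x, u) ∘L .inr ℝ E C(Icc (0 : ℝ) 1, E)).IsInvertible := by
    rw [hF'']
    exact isInvertible_id_sub (hnorm.trans_lt (by norm_num))
  have hzero : flowEq X (x, u) = 0 := by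
    unfold flowEq
    nth_rw 1 [hu]
    simp
  refine ⟨hF.implicitFunction (by simp) hinv, hF.implicitFunction_apply_self (by simp) hinv,
    hF.contDiffAt_implicitFunction (by simp) hinv, ?_⟩
  filter_upwards [hF.eventually_apply_implicitFunction (by simp) hinv] with y hy
  rw [hzero, flowEq, sub_sub, sub_eq_zero] at hy
  exact hy

/-- A speed of at most ρ/4 during a unit of time cannot leave the ball of radius ρ/4. The remaining
part of the ball of radius ρ is the margin in which solutions from nearby points are compared. -/
lemma exists_path {X : E → E} {x : E} {ρ : ℝ} (hρ : 0 ≤ ρ)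
    (hX : DifferentiableOn ℝ X (closedBall x ρ))
    (hbd : ∀ y ∈ closedBall x ρ, ‖X y‖ ≤ ρ / 4)
    (hder : ∀ y ∈ closedBall x ρ, ‖fderivWithin ℝ X (closedBall x ρ) y‖ ≤ 1 / 4) :
    ∃ u : C(Icc (0 : ℝ) 1, E), u = constPath x + primitivePath (superpos X u) ∧
      ∀ t, u t ∈ closedBall x (ρ / 4) := by
  have hlip : LipschitzOnWith (1 / 4 : NNReal) X (closedBall x ρ) :=
    (convex_closedBall x ρ).lipschitzOnWith_of_nnnorm_fderivWithin_le hX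
      fun y hy => by exact_mod_cast hder y hy
  have hlip' := hlip.mono (closedBall_subset_closedBall (x := x) (by linarith : ρ / 4 ≤ ρ))
  have hpl : IsPicardLindelof (fun _ => X) (⟨0, by simp⟩ : Icc (0 : ℝ) 1) x ⟨ρ / 4, by positivity⟩ 0
      ⟨ρ / 4, by positivity⟩ (1 / 4) := by
    refine IsPicardLindelof.of_time_independent (fun y hy => ?_) hlip' ?_
    · exact hbd y (closedBall_subset_closedBall (x := x) (by linarith : ρ / 4 ≤ ρ) hy)
    · simp
  -- The Picard fixed point itself is needed, and not only the differential equation, since the flow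
  -- is characterized by the integral equation.
  obtain ⟨α, hα⟩ := ODE.FunSpace.exists_isFixedPt_next hpl (mem_closedBall_self le_rfl)
  have hmem : ∀ t : Icc (0 : ℝ) 1, α.toFun t ∈ closedBall x (ρ / 4) := fun t => by
    have : α.compProj t ∈ closedBall x (ρ / 4) := α.compProj_mem_closedBall hpl.mul_max_le
    rwa [α.compProj_val] at this
  refine ⟨⟨α.toFun, α.lipschitzWith.continuous⟩, ?_, hmem⟩
  ext t
  have h1 : α.toFun t = (ODE.FunSpace.next hpl (mem_closedBall_self le_rfl) α).toFun t := by
    rw [hα]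
  rw [ContinuousMap.coe_mk, h1, ContinuousMap.add_apply, constPath_apply, primitivePath_apply]
  refine (ODE.FunSpace.next_apply hpl (mem_closedBall_self le_rfl) α).trans ?_
  rw [ODE.picard_apply]
  congr 1
  refine intervalIntegral.integral_congr fun s _ => ?_
  rw [extendPath, superpos_apply hlip'.continuousOn hmem]
  rfl

/-- The flow for times in `[0, 1]` of a smooth vector field that is small and has a small
differential on balls of radii proportional to the norm of the centre. -/
theorem exists_flow {E : Type*} [NormedAddCommGroup E] [NormedSpace ℝ E] [CompleteSpace E]
    {X : E → E} {U D : Set E} {κ : ℝ} (hU : IsOpen U) (hX : ContDiffOn ℝ ∞ X U)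
    (hD : IsOpen D) (hκ : 0 < κ) (h0 : (0 : E) ∉ D)
    (hball : ∀ x ∈ D, closedBall x (κ * ‖x‖) ⊆ U)
    (hbd : ∀ x ∈ D, ∀ y ∈ closedBall x (κ * ‖x‖), ‖X y‖ ≤ κ * ‖x‖ / 4)
    (hder : ∀ x ∈ D, ∀ y ∈ closedBall x (κ * ‖x‖), ‖fderiv ℝ X y‖ ≤ 1 / 4) :
    ∃ Φ : ℝ → E → E, ∀ x ∈ D, Φ 0 x = x ∧
      (∀ t ∈ Icc (0 : ℝ) 1, HasDerivWithinAt (Φ · x) (X (Φ t x)) (Icc 0 1) t) ∧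
      (∀ t ∈ Icc (0 : ℝ) 1, Φ t x ∈ closedBall x (κ * ‖x‖ / 4)) ∧
      (∀ t ∈ Icc (0 : ℝ) 1, ContDiffAt ℝ ∞ (Φ t) x) ∧
      (∀ w, ∀ t ∈ Icc (0 : ℝ) 1, HasDerivWithinAt (fun s => fderiv ℝ (Φ s) x w)
        (fderiv ℝ X (Φ t x) (fderiv ℝ (Φ t) x w)) (Icc 0 1) t) ∧
      (∀ w, fderiv ℝ (Φ 0) x w = w) ∧
      (∀ w, ∀ t ∈ Icc (0 : ℝ) 1, ‖fderiv ℝ (Φ t) x w - w‖ ≤ 1 / 3 * ‖w‖) ∧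
      (∀ v : ℝ → E, (∀ t ∈ Icc (0 : ℝ) 1, HasDerivWithinAt v (X (v t)) (Icc 0 1) t) → v 0 = x →
        (∀ t ∈ Icc (0 : ℝ) 1, v t ∈ closedBall x (κ * ‖x‖)) → v 1 = Φ 1 x) := by
  have hXd : ∀ x ∈ D, ∀ y ∈ closedBall x (κ * ‖x‖), DifferentiableAt ℝ X y := fun x hx y hy =>
    (hX.differentiableOn (by simp)).differentiableAt (hU.mem_nhds (hball x hx hy))
  have hXd' : ∀ x ∈ D, DifferentiableOn ℝ X (closedBall x (κ * ‖x‖)) := fun x hx y hy =>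
    (hXd x hx y hy).differentiableWithinAt
  have hpos : ∀ x ∈ D, 0 < κ * ‖x‖ := fun x hx =>
    mul_pos hκ (norm_pos_iff.2 fun h => h0 (h ▸ hx))
  have hder' : ∀ x ∈ D, ∀ y ∈ closedBall x (κ * ‖x‖),
      ‖fderivWithin ℝ X (closedBall x (κ * ‖x‖)) y‖ ≤ 1 / 4 := fun x hx y hy => by
    rw [fderivWithin_eq_fderiv (uniqueDiffOn_convex (convex_closedBall _ _) (by
      rw [interior_closedBall _ (hpos x hx).ne']
      exact nonempty_ball.2 (hpos x hx)) y hy) (hXd x hx y hy)]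
    exact hder x hx y hy
  choose! u hueq hub using fun x hx =>
    exists_path (hpos x hx).le (hXd' x hx) (hbd x hx) (hder' x hx)
  have hquarter : ∀ x ∈ D, closedBall x (κ * ‖x‖ / 4) ⊆ closedBall x (κ * ‖x‖) := fun x hx =>
    closedBall_subset_closedBall (by linarith [hpos x hx])
  have huU : ∀ x ∈ D, ∀ t, u x t ∈ U := fun x hx t => hball x hx (hquarter x hx (hub x hx t))
  -- The paths `u y` are chosen point by point. Near x they agree with the smooth branch ψ of the
  -- implicit function theorem, since both stay in the ball around x where solutions are unique.
  have hsmooth : ∀ x ∈ D, ContDiffAt ℝ ∞ u x := by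
    intro x hx
    obtain ⟨ψ, hψx, hψ, hψeq⟩ := exists_contDiffAt_path hU hX (huU x hx)
      (fun t => hder x hx _ (hquarter x hx (hub x hx t))) (hueq x hx)
    refine hψ.congr_of_eventuallyEq ?_
    have e1 : ∀ᶠ y in 𝓝 x, dist (ψ y) (ψ x) < κ * ‖x‖ / 4 :=
      hψ.continuousAt.eventually (ball_mem_nhds _ (by linarith [hpos x hx]))
    -- The radius of the ball depends on its centre; the inequality is strict at y = x, where it
    -- reads κ‖x‖/4 < κ‖x‖, and persists nearby.
    have e2 : ∀ᶠ y in 𝓝 x, dist y x + κ * ‖y‖ / 4 < κ * ‖x‖ := by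
      have hc : ContinuousAt (fun y : E => dist y x + κ * ‖y‖ / 4) x := by fun_prop
      refine hc.eventually (gt_mem_nhds ?_)
      simp only [dist_self]; linarith [hpos x hx]
    filter_upwards [hψeq, e1, e2, hD.mem_nhds hx] with y hy h1 h2 hyD
    refine path_unique (hXd' x hx) (hXd' x hx).continuousOn (hder' x hx) (hueq y hyD) (fun t => ?_)
      hy (fun t => ?_)
    · have := hub y hyD t
      rw [mem_closedBall] at this ⊢
      linarith [dist_triangle (u y t) y x]
    · have h3 := hub x hx t
      have h4 := ContinuousMap.dist_apply_le_dist (f := ψ y) (g := ψ x) t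
      rw [hψx] at h4 h1
      rw [mem_closedBall] at h3 ⊢
      linarith [dist_triangle (ψ y t) (u x t) x, hpos x hx]
  have hDc : ContinuousOn (fderiv ℝ X) U := hX.continuousOn_fderiv_of_isOpen hU (by simp)
  -- The linearized equation comes from differentiating the fixed point equation, which holds on the
  -- open set D.
  have hvar : ∀ x ∈ D, ∀ w, fderiv ℝ u x w = constPath w +
      primitivePath (applyPath (superpos (fderiv ℝ X) (u x)) (fderiv ℝ u x w)) := by
    intro x hx w
    have h1 : HasFDerivAt u (fderiv ℝ u x) x :=
      ((hsmooth x hx).differentiableAt (by simp)).hasFDerivAt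
    have hSd : HasFDerivAt (superpos X) (applyPath (superpos (fderiv ℝ X) (u x))) (u x) :=
      hasFDerivAt_superpos hU (hX.of_le (by simp)) (huU x hx)
    have h3 : HasFDerivAt (primitivePath (E := E)) primitivePath (superpos X (u x)) := by
      apply ContinuousLinearMap.hasFDerivAt
    have h4 : HasFDerivAt (constPath (E := E)) constPath x := by
      apply ContinuousLinearMap.hasFDerivAt
    have h5 := h4.add (h3.comp x (hSd.comp x h1))
    have h6 := h1.unique (h5.congr_of_eventuallyEq
      (Filter.eventually_of_mem (hD.mem_nhds hx) fun y hy => hueq y hy))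
    exact congrArg (fun A : E →L[ℝ] C(Icc (0 : ℝ) 1, E) => A w) h6
  have hfd : ∀ x ∈ D, ∀ t, HasFDerivAt (fun y => extendPath (u y) t)
      (ContinuousMap.evalCLM ℝ (projIcc 0 1 zero_le_one t) ∘L fderiv ℝ u x) x := by
    intro x hx t
    have h1 : HasFDerivAt u (fderiv ℝ u x) x :=
      ((hsmooth x hx).differentiableAt (by simp)).hasFDerivAt
    exact (ContinuousMap.evalCLM ℝ (projIcc 0 1 zero_le_one t)).hasFDerivAt.comp x h1
  have hfd' : ∀ x ∈ D, ∀ t w, fderiv ℝ (fun y => extendPath (u y) t) x w =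
      extendPath (fderiv ℝ u x w) t := fun x hx t w => by
    rw [(hfd x hx t).fderiv]; rfl
  -- With d the differential applied to w, ‖d - w‖ ≤ ‖d‖/4 ≤ (‖d - w‖ + ‖w‖)/4, whence the factor
  -- 1/3.
  have hzero : ∀ x ∈ D, ∀ w, ‖fderiv ℝ u x w - constPath w‖ ≤ 1 / 3 * ‖w‖ := by
    intro x hx w
    have h1 : fderiv ℝ u x w - constPath w =
        primitivePath (applyPath (superpos (fderiv ℝ X) (u x)) (fderiv ℝ u x w)) :=
      sub_eq_of_eq_add' (hvar x hx w)
    have h2 : ‖applyPath (superpos (fderiv ℝ X) (u x)) (fderiv ℝ u x w)‖ ≤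
        1 / 4 * ‖fderiv ℝ u x w‖ := by
      refine (ContinuousMap.norm_le _ (by positivity)).2 fun t => ?_
      rw [applyPath_apply, superpos_apply hDc (huU x hx)]
      exact ((fderiv ℝ X _).le_opNorm _).trans
        (mul_le_mul (hder x hx _ (hquarter x hx (hub x hx t)))
          ((fderiv ℝ u x w).norm_coe_le_norm t) (norm_nonneg _) (by norm_num))
    have h3 : ‖constPath w‖ ≤ ‖w‖ :=
      (ContinuousMap.norm_le _ (norm_nonneg w)).2 fun t => le_rfl
    have h4 := norm_primitivePath_le (applyPath (superpos (fderiv ℝ X) (u x)) (fderiv ℝ u x w))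
    rw [← h1] at h4
    have h5 : ‖fderiv ℝ u x w‖ ≤ ‖fderiv ℝ u x w - constPath w‖ + ‖constPath w‖ := by
      simpa using norm_add_le (fderiv ℝ u x w - constPath w) (constPath w)
    linarith
  refine ⟨fun t x => extendPath (u x) t, fun x hx => ⟨?_, fun t ht => ?_, fun t ht => hub x hx _,
    fun t ht => ?_, fun w t ht => ?_, fun w => ?_, fun w t ht => ?_, fun v hv hv0 hvb => ?_⟩⟩
  · change extendPath (u x) 0 = x
    rw [hueq x hx]
    simp [extendPath, primitivePath_apply]
  · have := hasDerivWithinAt_of_eq_add_primitivePath (hueq x hx) ht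
    rwa [extendPath, superpos_apply hX.continuousOn (huU x hx)] at this
  · exact (ContinuousMap.evalCLM ℝ (projIcc 0 1 zero_le_one t)).contDiff.contDiffAt.comp x
      (hsmooth x hx)
  · simp only [hfd' x hx]
    have := hasDerivWithinAt_of_eq_add_primitivePath (hvar x hx w) ht
    rwa [extendPath, applyPath_apply, superpos_apply hDc (huU x hx)] at this
  · rw [hfd' x hx, hvar x hx w]
    simp [extendPath, primitivePath_apply]
  · rw [hfd' x hx]
    exact ((fderiv ℝ u x w - constPath w).norm_coe_le_norm _).trans (hzero x hx w)
  · have hvc : ContinuousOn v (Icc 0 1) := fun t ht => (hv t ht).continuousWithinAt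
    have hpath : (⟨fun t : Icc (0 : ℝ) 1 => v t, hvc.domRestrict⟩ : C(Icc (0 : ℝ) 1, E)) = u x := by
      refine path_unique (x := x) (hXd' x hx) (hXd' x hx).continuousOn (hder' x hx) ?_
        (fun t => hvb t t.2) (hueq x hx) fun t => hquarter x hx (hub x hx t)
      rw [← hv0]
      refine eq_add_primitivePath hv (fun t => rfl) fun t => ?_
      rw [superpos_apply (hXd' x hx).continuousOn
        (fun t : Icc (0 : ℝ) 1 => hvb t t.2)]
      rfl
    change v 1 = extendPath (u x) 1
    rw [← hpath, extendPath_of_mem _ (by simp)]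
    rfl

end Flow

/-! ### Coefficients of the resonant normal form -/

section Birkhoff

lemma bar_bar (i : Idx) : Idx.bar (Idx.bar i) = i := by simp [Idx.bar]

lemma MultiIndex.bar_bar (j : MultiIndex) : MultiIndex.bar (MultiIndex.bar j) = j := by
  simp [MultiIndex.bar, Function.comp_def, SchrodingerPoisson.bar_bar]

lemma moment_cons (k : ℕ) (i : Idx) (j : MultiIndex) :
    moment k (i :: j) = (i.1 : ℤ) * i.2 ^ k + moment k j := by simp [moment]

lemma moment_append (k : ℕ) (j j' : MultiIndex) :
    moment k (j ++ j') = moment k j + moment k j' := by simp [moment]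

lemma moment_perm (k : ℕ) {j j' : MultiIndex} (h : j.Perm j') : moment k j = moment k j' :=
  (h.map _).sum_eq

lemma moment_bar (k : ℕ) (j : MultiIndex) : moment k (MultiIndex.bar j) = -moment k j := by
  induction j with
  | nil => simp [moment, MultiIndex.bar]
  | cons i j ih =>
    rw [MultiIndex.bar, List.map_cons, moment_cons, moment_cons, ← MultiIndex.bar, ih]
    simp [Idx.bar]; ring

lemma length_bar (j : MultiIndex) : (MultiIndex.bar j).length = j.length := by
  simp [MultiIndex.bar]

lemma zeroMomentum_perm {m : ℕ} {j j' : MultiIndex} (h : j.Perm j') (hj : ZeroMomentum m j) :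
    ZeroMomentum m j' := by
  refine ⟨h.length_eq ▸ hj.1, ?_, ?_⟩
  · rw [← moment_perm 0 h]; exact hj.2.1
  · rw [← moment_perm 1 h]; exact hj.2.2

/-- An index is determined by its mass and its momentum. -/
lemma idx_eq_of_moments {i i' : Idx} (h0 : (i.1 : ℤ) = i'.1)
    (h1 : (i.1 : ℤ) * i.2 = i'.1 * i'.2) : i = i' := by
  have h : i.1 = i'.1 := Units.ext h0
  refine Prod.ext h ?_
  rw [h] at h1
  exact mul_left_cancel₀ (Units.ne_zero i'.1) h1

/-- A multi-index of `𝓜_m` is determined by what remains after deletion of one entry. -/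
lemma idx_eq_of_zeroMomentum {m m' : ℕ} {i i' : Idx} {l : MultiIndex}
    (h : ZeroMomentum m (i :: l)) (h' : ZeroMomentum m' (i' :: l)) : i = i' := by
  have a0 := h.2.1
  have a1 := h.2.2
  have b0 := h'.2.1
  have b1 := h'.2.2
  rw [moment_cons] at a0 a1 b0 b1
  simp only [pow_zero, pow_one, mul_one] at a0 a1 b0 b1
  exact idx_eq_of_moments (by omega) (by linarith)

/-- The coefficients vanish outside `𝓜_m`. -/
def CoeffSupp (m : ℕ) (P : Coeff) : Prop := ∀ j, P j ≠ 0 → ZeroMomentum m j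

/-- The coefficients define a real polynomial. -/
def CoeffReal (P : Coeff) : Prop := ∀ j, (starRingEnd ℂ) (P j) = P (MultiIndex.bar j)

lemma CoeffSupp.symmetrize {m : ℕ} {P : Coeff} (h : CoeffSupp m P) :
    CoeffSupp m (symmetrize P) := by
  intro j hj
  by_contra hm
  apply hj
  have : ∀ x ∈ j.permutations.map P, x = 0 := by
    intro x hx
    obtain ⟨j', hj', rfl⟩ := List.mem_map.1 hx
    by_contra hne
    exact hm (zeroMomentum_perm (List.mem_permutations.1 hj') (h j' hne))
  rw [SchrodingerPoisson.symmetrize, List.sum_eq_zero this, zero_div]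

lemma CoeffReal.symmetrize {P : Coeff} (h : CoeffReal P) : CoeffReal (symmetrize P) := by
  intro j
  rw [SchrodingerPoisson.symmetrize, SchrodingerPoisson.symmetrize, map_div₀, length_bar,
    MultiIndex.bar, ← List.map_permutations, map_list_sum, List.map_map, List.map_map]
  simp only [map_natCast]
  congr 3
  funext j'
  exact h j'

lemma norm_symmetrize_le {P : Coeff} {B : ℝ} (h : ∀ j, ‖P j‖ ≤ B) (j : MultiIndex) :
    ‖symmetrize P j‖ ≤ B := by
  rw [symmetrize, norm_div, Complex.norm_natCast, div_le_iff₀ (by positivity)]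
  have : ∀ l : List MultiIndex, ‖(l.map P).sum‖ ≤ B * l.length := by
    intro l
    induction l with
    | nil => simp
    | cons a l ih =>
      rw [List.map_cons, List.sum_cons, List.length_cons]
      push_cast
      linarith [norm_add_le (P a) (l.map P).sum, h a]
  simpa [List.length_permutations] using this j.permutations

/-- An insertion beyond the end of a list leaves it unchanged; the prescribed length 2m > α excludes
this case. -/
lemma perm_insertIdx_of_zeroMomentum {m α : ℕ} {i : Idx} {l : MultiIndex} (hα : α < 2 * m)
    (h : ZeroMomentum m (l.insertIdx α i)) :
    (l.insertIdx α i).Perm (i :: l) ∧ l.length + 1 = 2 * m := by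
  have h1 := h.1
  rw [List.length_insertIdx] at h1
  split_ifs at h1 with hα'
  · exact ⟨List.perm_insertIdx i l hα', by omega⟩
  · omega

lemma zeroMomentum_of_insertIdx {m m' α α' : ℕ} (hα : α < 2 * m) (hα' : α' < 2 * m')
    {i : Idx} {j : MultiIndex} (h : ZeroMomentum m ((j.take (2 * m - 1)).insertIdx α i))
    (h' : ZeroMomentum m' ((j.drop (2 * m - 1)).insertIdx α' (Idx.bar i))) :
    ZeroMomentum (m + m' - 1) j := by
  obtain ⟨p, hl⟩ := perm_insertIdx_of_zeroMomentum hα h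
  obtain ⟨p', hl'⟩ := perm_insertIdx_of_zeroMomentum hα' h'
  have z := zeroMomentum_perm p h
  have z' := zeroMomentum_perm p' h'
  have e : j = j.take (2 * m - 1) ++ j.drop (2 * m - 1) := (List.take_append_drop _ _).symm
  have z0 := z.2.1
  have z1 := z.2.2
  have z0' := z'.2.1
  have z1' := z'.2.2
  rw [moment_cons] at z0 z1 z0' z1'
  simp only [Idx.bar, Units.val_neg, pow_zero, pow_one, mul_one] at z0 z1 z0' z1'
  refine ⟨?_, ?_, ?_⟩
  · rw [e, List.length_append]; omega
  · rw [e, moment_append]; linarith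
  · rw [e, moment_append]; linarith

/-- Meant for the sum over the contracted index of a bracket: mass and momentum leave at most one
non-zero term, so the infinitely many modes cost nothing. -/
lemma norm_finsum_le_of_subsingleton {ι : Type*} {f : ι → ℂ} {B : ℝ} (hB : 0 ≤ B)
    (h : ∀ i, ‖f i‖ ≤ B) (hs : ∀ i i', f i ≠ 0 → f i' ≠ 0 → i = i') : ‖∑ᶠ i, f i‖ ≤ B := by
  by_cases hz : ∃ i, f i ≠ 0
  · obtain ⟨i, hi⟩ := hz
    rw [finsum_eq_single f i fun i' hi' => by
      by_contra hne
      exact hi' (hs _ _ hne hi)]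
    exact h i
  · push Not at hz
    simpa [hz] using hB

lemma CoeffSupp.poisson {m m' : ℕ} {P P' : Coeff} (hP : CoeffSupp m P) (hP' : CoeffSupp m' P') :
    CoeffSupp (m + m' - 1) (poisson m m' P P') := by
  refine CoeffSupp.symmetrize fun j hj => ?_
  obtain ⟨α, hα, hj⟩ := Finset.exists_ne_zero_of_sum_ne_zero hj
  obtain ⟨α', hα', hj⟩ := Finset.exists_ne_zero_of_sum_ne_zero hj
  obtain ⟨i, hi⟩ : ∃ i : Idx, _ ≠ (0 : ℂ) := by
    by_contra hne
    push Not at hne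
    exact hj (finsum_eq_zero_of_forall_eq_zero hne)
  exact zeroMomentum_of_insertIdx (Finset.mem_range.1 hα) (Finset.mem_range.1 hα')
    (hP _ (right_ne_zero_of_mul (left_ne_zero_of_mul hi))) (hP' _ (right_ne_zero_of_mul hi))

lemma bar_insertIdx (l : MultiIndex) (α : ℕ) (i : Idx) :
    MultiIndex.bar (l.insertIdx α i) = (MultiIndex.bar l).insertIdx α (Idx.bar i) :=
  List.map_insertIdx _ _ _ _

/-- Conjugation changes i into -i, and the substitution of the contracted index by its conjugate
changes δ into -δ; the two signs compensate. -/
lemma CoeffReal.poisson {m m' : ℕ} {P P' : Coeff} (hP : CoeffReal P) (hP' : CoeffReal P') :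
    CoeffReal (poisson m m' P P') := by
  refine CoeffReal.symmetrize fun j => ?_
  simp only [map_sum]
  refine Finset.sum_congr rfl fun α _ => Finset.sum_congr rfl fun α' _ => ?_
  let e : Idx ≃ Idx := ⟨Idx.bar, Idx.bar, bar_bar, bar_bar⟩
  rw [← finsum_comp_equiv e]
  have hc : ∀ f : Idx → ℂ, (starRingEnd ℂ) (∑ᶠ i, f i) = ∑ᶠ i, (starRingEnd ℂ) (f i) := by
    intro f
    exact (starRingEnd ℂ).toAddMonoidHom.map_finsum_of_injective
      (starRingEnd ℂ).injective f
  rw [hc]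
  refine finsum_congr fun i => ?_
  simp only [map_mul, hP _, hP' _, bar_insertIdx]
  simp only [e, Equiv.coe_fn_mk, Complex.conj_I, MultiIndex.bar, List.map_take, List.map_drop]
  simp [Idx.bar]

/-- There are 2m·2m' pairs of positions, and for each of them at most one contracted index by
`idx_eq_of_zeroMomentum`. Hence the supremum norm of the coefficients is enough. -/
lemma norm_poisson_le {m m' : ℕ} {P P' : Coeff} (hP : CoeffSupp m P) {B B' : ℝ}
    (hB : ∀ j, ‖P j‖ ≤ B) (hB' : ∀ j, ‖P' j‖ ≤ B') (j : MultiIndex) :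
    ‖poisson m m' P P' j‖ ≤ 2 * m * (2 * m') * (B * B') := by
  have hB0 : 0 ≤ B := (norm_nonneg _).trans (hB [])
  have hB0' : 0 ≤ B' := (norm_nonneg _).trans (hB' [])
  refine norm_symmetrize_le (fun j => ?_) j
  refine (norm_sum_le_of_le _ (n := fun _ => 2 * m' * (B * B')) fun α hα =>
    (norm_sum_le_of_le _ (n := fun _ => B * B') fun α' hα' => ?_).trans ?_).trans ?_
  · refine norm_finsum_le_of_subsingleton (by positivity) (fun i => ?_) fun i i' hi hi' => ?_
    · have h1 : ‖((i.1 : ℤ) : ℂ)‖ = 1 := by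
        rcases Int.units_eq_one_or i.1 with h | h <;> simp [h]
      rw [norm_mul, norm_mul, norm_mul, Complex.norm_I, one_mul, h1, one_mul]
      exact mul_le_mul (hB _) (hB' _) (norm_nonneg _) hB0
    · have h := hP _ (right_ne_zero_of_mul (left_ne_zero_of_mul hi))
      have h' := hP _ (right_ne_zero_of_mul (left_ne_zero_of_mul hi'))
      have hα := Finset.mem_range.1 hα
      exact idx_eq_of_zeroMomentum
        (zeroMomentum_perm (perm_insertIdx_of_zeroMomentum hα h).1 h)
        (zeroMomentum_perm (perm_insertIdx_of_zeroMomentum hα h').1 h')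
  · simp
  · simp [mul_assoc]

lemma CoeffSupp.adPow {s n : ℕ} {S P : Coeff} (hS : CoeffSupp (s + 1) S) (hP : CoeffSupp n P)
    (k : ℕ) : CoeffSupp (n + k * s) (adPow s S n P k) := by
  induction k with
  | zero => simpa [SchrodingerPoisson.adPow] using hP
  | succ k ih =>
    have := ih.poisson hS
    rwa [show n + k * s + (s + 1) - 1 = n + (k + 1) * s by rw [add_mul]; omega] at this

lemma CoeffReal.adPow {s n : ℕ} {S P : Coeff} (hS : CoeffReal S) (hP : CoeffReal P)
    (k : ℕ) : CoeffReal (adPow s S n P k) := by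
  induction k with
  | zero => exact hP
  | succ k ih => exact ih.poisson hS

/-- As long as all degrees stay at most 2r, each bracket costs at most (2r)² B. -/
lemma norm_adPow_le {s n r : ℕ} {S P : Coeff} (hS : CoeffSupp (s + 1) S) (hP : CoeffSupp n P)
    (hs : s + 1 ≤ r) {A B : ℝ} (hA : ∀ j, ‖P j‖ ≤ A) (hB : ∀ j, ‖S j‖ ≤ B) (k : ℕ)
    (hk : n + k * s ≤ r) (j : MultiIndex) :
    ‖adPow s S n P k j‖ ≤ (4 * r ^ 2 * B) ^ k * A := by
  have hA0 : 0 ≤ A := (norm_nonneg _).trans (hA [])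
  have hB0 : 0 ≤ B := (norm_nonneg _).trans (hB [])
  induction k generalizing j with
  | zero => simpa [adPow] using hA j
  | succ k ih =>
    have hk' : n + k * s ≤ r := by rw [add_mul] at hk; omega
    refine (norm_poisson_le (hS.adPow hP k) (ih hk') hB j).trans ?_
    have h1 : ((n + k * s : ℕ) : ℝ) ≤ r := by exact_mod_cast hk'
    have h2 : ((s + 1 : ℕ) : ℝ) ≤ r := by exact_mod_cast hs
    calc 2 * ((n + k * s : ℕ) : ℝ) * (2 * ((s + 1 : ℕ) : ℝ)) * ((4 * r ^ 2 * B) ^ k * A * B)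
        ≤ 2 * r * (2 * r) * ((4 * r ^ 2 * B) ^ k * A * B) := by gcongr
      _ = (4 * r ^ 2 * B) ^ (k + 1) * A := by ring

lemma CoeffSupp.zero (m : ℕ) : CoeffSupp m 0 := fun _ h => absurd rfl h

lemma CoeffSupp.add {m : ℕ} {P P' : Coeff} (hP : CoeffSupp m P) (hP' : CoeffSupp m P') :
    CoeffSupp m (P + P') := fun j hj => by
  by_cases h : P j = 0
  · exact hP' j fun h' => hj (by simp [h, h'])
  · exact hP j h

lemma CoeffSupp.smul {m : ℕ} {P : Coeff} (hP : CoeffSupp m P) (c : ℂ) : CoeffSupp m (c • P) :=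
  fun j hj => hP j fun h => hj (by simp [h])

lemma CoeffSupp.sum {ι : Type*} {m : ℕ} (t : Finset ι) {P : ι → Coeff}
    (h : ∀ i ∈ t, CoeffSupp m (P i)) : CoeffSupp m (∑ i ∈ t, P i) :=
  Finset.sum_induction P (CoeffSupp m) (fun _ _ => CoeffSupp.add) (CoeffSupp.zero m) h

lemma CoeffReal.zero : CoeffReal 0 := fun _ => by simp

lemma CoeffReal.add {P P' : Coeff} (hP : CoeffReal P) (hP' : CoeffReal P') :
    CoeffReal (P + P') := fun j => by simp [hP j, hP' j]

lemma CoeffReal.smul {P : Coeff} (hP : CoeffReal P) {c : ℂ} (hc : (starRingEnd ℂ) c = c) :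
    CoeffReal (c • P) := fun j => by simp [hP j, hc]

lemma CoeffReal.sum {ι : Type*} (t : Finset ι) {P : ι → Coeff}
    (h : ∀ i ∈ t, CoeffReal (P i)) : CoeffReal (∑ i ∈ t, P i) :=
  Finset.sum_induction P CoeffReal (fun _ _ => CoeffReal.add) CoeffReal.zero h

lemma CoeffSupp.homological {m : ℕ} {P : Coeff} (hP : CoeffSupp m P) :
    CoeffSupp m (homological P) := fun j hj => hP j fun h => hj (by
  simp [SchrodingerPoisson.homological, h])

lemma CoeffReal.homological {P : Coeff} (hP : CoeffReal P) : CoeffReal (homological P) := by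
  intro j
  by_cases h : moment 2 j = 0
  · simp [SchrodingerPoisson.homological, moment_bar, h]
  · simp [SchrodingerPoisson.homological, moment_bar, h, ← hP j, div_neg, neg_div]

/-- The energy is an integer, so a non-zero divisor has modulus at least one: there are no small
divisors at this stage. -/
lemma norm_homological_le {P : Coeff} {B : ℝ} (hB : ∀ j, ‖P j‖ ≤ B) (j : MultiIndex) :
    ‖homological P j‖ ≤ B := by
  rw [homological]
  split_ifs with h
  · simpa using (norm_nonneg _).trans (hB j)
  · rw [norm_div, norm_mul, norm_neg, Complex.norm_I, one_mul, Complex.norm_intCast]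
    have : (1 : ℝ) ≤ |((moment 2 j : ℤ) : ℝ)| := by exact_mod_cast Int.one_le_abs h
    exact (div_le_self (norm_nonneg _) this).trans (hB j)

lemma CoeffSupp.resonantPart_sub {m : ℕ} {P : Coeff} (hP : CoeffSupp m P) :
    CoeffSupp m (resonantPart P - P) := fun j hj => hP j fun h => hj (by
  simp [SchrodingerPoisson.resonantPart, h])

lemma CoeffReal.resonantPart_sub {P : Coeff} (hP : CoeffReal P) :
    CoeffReal (resonantPart P - P) := by
  intro j
  by_cases h : moment 2 j = 0
  · simp [SchrodingerPoisson.resonantPart, moment_bar, h]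
  · simp [SchrodingerPoisson.resonantPart, moment_bar, h, ← hP j]

lemma norm_resonantPart_sub_le {P : Coeff} {B : ℝ} (hB : ∀ j, ‖P j‖ ≤ B) (j : MultiIndex) :
    ‖(resonantPart P - P) j‖ ≤ B := by
  by_cases h : moment 2 j = 0
  · simpa [resonantPart, h] using (norm_nonneg _).trans (hB j)
  · simpa [resonantPart, h] using hB j

lemma CoeffSupp.birkhoffStep {s : ℕ} {K : ℕ → Coeff} (hK : ∀ m, CoeffSupp m (K m)) (m : ℕ) :
    CoeffSupp m (birkhoffStep s K m) := by
  refine CoeffSupp.add (CoeffSupp.sum _ fun k _ => ?_) (CoeffSupp.sum _ fun k _ => ?_)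
  · split_ifs with h
    · have := ((hK (s + 1)).homological.adPow (hK (m - k * s)) k).smul ((k.factorial : ℂ)⁻¹)
      rwa [Nat.sub_add_cancel (by omega)] at this
    · exact CoeffSupp.zero m
  · split_ifs with h
    · have := ((hK (s + 1)).homological.adPow (hK (s + 1)).resonantPart_sub (k - 1)).smul
        ((k.factorial : ℂ)⁻¹)
      rename_i hk
      have hk1 : 1 ≤ k := (Finset.mem_Icc.1 hk).1
      rwa [show s + 1 + (k - 1) * s = m by
        obtain ⟨k, rfl⟩ := Nat.exists_eq_add_of_le hk1
        rw [← h, Nat.add_sub_cancel_left]; ring] at this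
    · exact CoeffSupp.zero m

lemma CoeffReal.birkhoffStep {s : ℕ} {K : ℕ → Coeff} (hK : ∀ m, CoeffReal (K m)) (m : ℕ) :
    CoeffReal (birkhoffStep s K m) := by
  refine CoeffReal.add (CoeffReal.sum _ fun k _ => ?_) (CoeffReal.sum _ fun k _ => ?_)
  · split_ifs with h
    · exact ((hK (s + 1)).homological.adPow (hK (m - k * s)) k).smul (by simp)
    · exact CoeffReal.zero
  · split_ifs with h
    · exact ((hK (s + 1)).homological.adPow (hK (s + 1)).resonantPart_sub (k - 1)).smul (by simp)
    · exact CoeffReal.zero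

/-- Each bracket with S raises the index by s, so the terms below s+1 are left untouched by the
step. -/
lemma birkhoffStep_of_le {s m : ℕ} (hm : 2 ≤ m) (hms : m ≤ s) (K : ℕ → Coeff) :
    birkhoffStep s K m = K m := by
  rw [birkhoffStep]
  rw [Finset.sum_eq_single 0, Finset.sum_eq_zero]
  · simp [hm, adPow]
  · intro k hk
    rw [if_neg]
    have := (Finset.mem_Icc.1 hk).1
    have : s ≤ k * s := Nat.le_mul_of_pos_left s this
    omega
  · intro k _ hk
    rw [if_neg]
    have : s ≤ k * s := Nat.le_mul_of_pos_left s (Nat.pos_of_ne_zero hk)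
    omega
  · intro h; simp at h

/-- Only K itself (k = 0) and {L₂, S} (k = 1 in the second sum) reach this degree, and their sum is
the resonant part. -/
lemma birkhoffStep_succ {s : ℕ} (hs : 1 ≤ s) (K : ℕ → Coeff) :
    birkhoffStep s K (s + 1) = resonantPart (K (s + 1)) := by
  rw [birkhoffStep]
  rw [Finset.sum_eq_single 0, Finset.sum_eq_single 1]
  · simp [adPow, show 2 ≤ s + 1 by omega]
  · intro k hk hk1
    rw [if_neg]
    have := (Finset.mem_Icc.1 hk).1
    have : 2 * s ≤ k * s := Nat.mul_le_mul_right s (by omega)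
    omega
  · intro h; simp at h
  · intro k _ hk
    rw [if_neg]
    have : s ≤ k * s := Nat.le_mul_of_pos_left s (Nat.pos_of_ne_zero hk)
    omega
  · intro h; simp at h

/-- With L = 24r³, one bracket with S costs 4r²B L^{s-1} ≤ x L^s where x = 1/(4r), thanks to B ≤
3/2. The first sum is a geometric series in x, at most 1 + 2x, and the terms coming from L₂ add at
most x; the total is below 1 + 4x = 1 + 1/r. Such a factor can be paid at each of the r-1 steps. -/
lemma norm_birkhoffStep_le {r s : ℕ} (hs : 1 ≤ s) (hsr : s + 1 ≤ r) {K : ℕ → Coeff}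
    (hK : ∀ m, CoeffSupp m (K m)) {B : ℝ} (hB0 : 0 ≤ B) (hB : B ≤ 3 / 2)
    (hKB : ∀ m, 2 ≤ m → m ≤ r → ∀ j, ‖K m j‖ ≤ B * (24 * r ^ 3) ^ (m - 2))
    (m : ℕ) (hm : 2 ≤ m) (hmr : m ≤ r) (j : MultiIndex) :
    ‖birkhoffStep s K m j‖ ≤ B * (1 + 1 / r) * (24 * r ^ 3) ^ (m - 2) := by
  have hr : (2 : ℝ) ≤ r := by exact_mod_cast (by omega : 2 ≤ r)
  set L : ℝ := 24 * r ^ 3 with hL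
  have hL0 : 0 < L := by positivity
  set x : ℝ := 1 / (4 * r) with hx
  have hx0 : 0 < x := by positivity
  have hx4 : x ≤ 1 / 8 := by
    rw [hx]; exact one_div_le_one_div_of_le (by norm_num) (by linarith)
  have hxr : 1 / (r : ℝ) = 4 * x := by rw [hx]; field_simp
  have hSB : ∀ j, ‖homological (K (s + 1)) j‖ ≤ B * L ^ (s - 1) := by
    have := norm_homological_le (hKB (s + 1) (by omega) hsr)
    rwa [show s + 1 - 2 = s - 1 by omega] at this
  have hcost : 4 * (r : ℝ) ^ 2 * (B * L ^ (s - 1)) ≤ x * L ^ s := by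
    have e : L ^ s = L ^ (s - 1) * L := by rw [← pow_succ, Nat.sub_add_cancel hs]
    have h1 : 4 * (r : ℝ) ^ 2 * B ≤ x * L := by
      rw [hx, hL]
      have : 1 / (4 * (r : ℝ)) * (24 * r ^ 3) = 6 * r ^ 2 := by field_simp; norm_num
      rw [this]; nlinarith [sq_nonneg (r : ℝ)]
    calc 4 * (r : ℝ) ^ 2 * (B * L ^ (s - 1)) = (4 * (r : ℝ) ^ 2 * B) * L ^ (s - 1) := by ring
      _ ≤ x * L * L ^ (s - 1) := by gcongr
      _ = x * L ^ s := by rw [e]; ring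
  have hS := (hK (s + 1)).homological
  have hfac : ∀ k : ℕ, ‖((k.factorial : ℂ)⁻¹)‖ ≤ 1 := fun k => by
    rw [norm_inv, Complex.norm_natCast]
    exact inv_le_one_of_one_le₀ (by exact_mod_cast Nat.one_le_iff_ne_zero.2 k.factorial_ne_zero)
  by_cases hms : m = s + 1
  · subst hms
    rw [birkhoffStep_succ hs]
    have h1 : ‖resonantPart (K (s + 1)) j‖ ≤ ‖K (s + 1) j‖ := by
      rw [resonantPart]; split_ifs <;> simp
    refine h1.trans ((hKB _ hm hmr j).trans ?_)
    have : B * 1 ≤ B * (1 + 1 / r) := by gcongr; linarith [hxr ▸ (by positivity : 0 ≤ 4 * x)]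
    rw [mul_one] at this
    gcongr
  have first : ∀ k ∈ Finset.range (m + 1), ‖(if k * s + 2 ≤ m then
      ((k.factorial : ℂ)⁻¹) • adPow s (homological (K (s + 1))) (m - k * s) (K (m - k * s)) k
      else 0) j‖ ≤ x ^ k * (B * L ^ (m - 2)) := by
    intro k _
    split_ifs with h
    · rw [Pi.smul_apply, norm_smul]
      refine (mul_le_of_le_one_left (norm_nonneg _) (hfac k)).trans ?_
      refine (norm_adPow_le hS (hK _) hsr (hKB (m - k * s) (by omega) (by omega)) hSB k
        (by omega) j).trans ?_
      calc (4 * (r : ℝ) ^ 2 * (B * L ^ (s - 1))) ^ k * (B * L ^ (m - k * s - 2))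
          ≤ (x * L ^ s) ^ k * (B * L ^ (m - k * s - 2)) := by gcongr
        _ = x ^ k * (B * (L ^ (k * s) * L ^ (m - k * s - 2))) := by
          rw [mul_pow, ← pow_mul, mul_comm s k]; ring
        _ = x ^ k * (B * L ^ (m - 2)) := by
          rw [← pow_add, show k * s + (m - k * s - 2) = m - 2 by omega]
    · simp only [Pi.zero_apply, norm_zero]; positivity
  have second : ‖∑ k ∈ Finset.Icc 1 m, (if k * s + 1 = m then
      ((k.factorial : ℂ)⁻¹) • adPow s (homological (K (s + 1))) (s + 1)
        (resonantPart (K (s + 1)) - K (s + 1)) (k - 1) else 0) j‖ ≤ x * (B * L ^ (m - 2)) := by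
    by_cases hex : ∃ k, k * s + 1 = m
    · obtain ⟨k, hk⟩ := hex
      -- The cases k = 0 and k = 1 would give m = 1 and m = s + 1, which are excluded here; at least
      -- one genuine bracket supplies the factor x.
      have hk2 : 2 ≤ k := by
        by_contra hlt
        interval_cases k <;> omega
      have hkm : k ≤ m := by nlinarith
      rw [Finset.sum_eq_single k]
      · rw [if_pos hk, Pi.smul_apply, norm_smul]
        refine (mul_le_of_le_one_left (norm_nonneg _) (hfac k)).trans ?_
        obtain ⟨l, rfl⟩ := Nat.exists_eq_add_of_le hk2
        rw [show 2 + l - 1 = l + 1 by omega]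
        have hexp : s + 1 + (l + 1) * s = m := by rw [← hk]; ring
        refine (norm_adPow_le hS (hK (s + 1)).resonantPart_sub hsr
          (norm_resonantPart_sub_le (hKB (s + 1) (by omega) hsr)) hSB (l + 1)
          (by omega) j).trans ?_
        calc (4 * (r : ℝ) ^ 2 * (B * L ^ (s - 1))) ^ (l + 1) * (B * L ^ (s + 1 - 2))
            ≤ (x * L ^ s) ^ (l + 1) * (B * L ^ (s + 1 - 2)) := by gcongr
          _ = x ^ l * (x * (B * (L ^ ((l + 1) * s) * L ^ (s + 1 - 2)))) := by
            rw [mul_pow, ← pow_mul, mul_comm s]; ring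
          _ = x ^ l * (x * (B * L ^ (m - 2))) := by
            rw [← pow_add, show (l + 1) * s + (s + 1 - 2) = m - 2 by omega]
          _ ≤ 1 * (x * (B * L ^ (m - 2))) := by
            gcongr; exact pow_le_one₀ hx0.le (by linarith)
          _ = x * (B * L ^ (m - 2)) := one_mul _
      · intro k' _ hne
        rw [if_neg, Pi.zero_apply]
        intro h
        exact hne (Nat.eq_of_mul_eq_mul_right hs (by omega))
      · intro h
        exact absurd (Finset.mem_Icc.2 ⟨by omega, hkm⟩) h
    · push Not at hex
      simp only [hex, if_false, Pi.zero_apply, Finset.sum_const_zero, norm_zero]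
      positivity
  have geom : ∑ k ∈ Finset.range (m + 1), x ^ k ≤ 1 + 2 * x := by
    have h1 := geom_sum_mul_neg x (m + 1)
    have h2 : 0 ≤ x ^ (m + 1) := by positivity
    refine le_of_mul_le_mul_right (a := 1 - x) ?_ (by linarith)
    nlinarith
  rw [birkhoffStep, Pi.add_apply, Finset.sum_apply, Finset.sum_apply]
  refine (norm_add_le _ _).trans ?_
  refine (add_le_add (norm_sum_le_of_le _ first) second).trans ?_
  rw [← Finset.sum_mul, hxr]
  have hpos : 0 ≤ B * L ^ (m - 2) := by positivity
  nlinarith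

/-! ### The quartic polynomial of the Schrödinger–Poisson equation and the bounds of its normal form
-/

lemma rawP4_ne_zero {j : MultiIndex} (h : rawP4 j ≠ 0) : ∃ a₁ a₂ b₁ b₂ : ℤ,
    j = [(1, a₁), (1, a₂), (-1, b₁), (-1, b₂)] ∧ a₁ + a₂ = b₁ + b₂ ∧ a₁ ≠ b₁ ∧
      rawP4 j = 1 / (2 * ((a₁ : ℂ) - (b₁ : ℂ)) ^ 2) := by
  unfold rawP4 at h
  split at h
  · rename_i d₁ a₁ d₂ a₂ e₁ b₁ e₂ b₂
    split_ifs at h with hc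
    · obtain ⟨rfl, rfl, rfl, rfl, h1, h2⟩ := hc
      exact ⟨a₁, a₂, b₁, b₂, rfl, h1, h2, by simp [rawP4, h1, h2]⟩
    · exact absurd rfl h
  · exact absurd rfl h

lemma coeffSupp_rawP4 : CoeffSupp 2 rawP4 := by
  intro j hj
  obtain ⟨a₁, a₂, b₁, b₂, rfl, h, -⟩ := rawP4_ne_zero hj
  refine ⟨rfl, ?_, ?_⟩ <;> simp [moment]
  omega

lemma norm_rawP4_le (j : MultiIndex) : ‖rawP4 j‖ ≤ 1 / 2 := by
  by_cases h : rawP4 j = 0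
  · simp [h]
  obtain ⟨a₁, a₂, b₁, b₂, -, -, hne, heq⟩ := rawP4_ne_zero h
  rw [heq, norm_div, norm_one, norm_mul, norm_pow, ← Int.cast_sub, Complex.norm_intCast]
  have : (1 : ℝ) ≤ |((a₁ - b₁ : ℤ) : ℝ)| := by
    exact_mod_cast Int.one_le_abs (sub_ne_zero.2 hne)
  rw [Complex.norm_ofNat]
  exact one_div_le_one_div_of_le (by norm_num) (by nlinarith)

/-- Conjugation exchanges the two factors z with the two conjugate factors, and `rawP4` only accepts
the order (+,+,-,-). A rotation by two places restores it, so reality holds only after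
symmetrization. -/
lemma rawP4_bar (j : MultiIndex) : (starRingEnd ℂ) (rawP4 j) = rawP4 (MultiIndex.bar (j.rotate 2)) := by
  match j with
  | [] | [_] | [_, _] | [_, _, _] | _ :: _ :: _ :: _ :: _ :: _ =>
    have h1 : ∀ l : MultiIndex, l.length ≠ 4 → rawP4 l = 0 := by
      intro l hl
      by_contra hne
      exact hl (coeffSupp_rawP4 l hne).1
    rw [h1, h1] <;> simp [length_bar]
  | [(d₁, a₁), (d₂, a₂), (e₁, b₁), (e₂, b₂)] =>
    have hr : List.rotate [(d₁, a₁), (d₂, a₂), (e₁, b₁), (e₂, b₂)] 2 =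
        [(e₁, b₁), (e₂, b₂), (d₁, a₁), (d₂, a₂)] := rfl
    rw [hr]
    simp only [MultiIndex.bar, List.map, Idx.bar, rawP4]
    by_cases h : d₁ = 1 ∧ d₂ = 1 ∧ e₁ = -1 ∧ e₂ = -1 ∧ a₁ + a₂ = b₁ + b₂ ∧ a₁ ≠ b₁
    · obtain ⟨rfl, rfl, rfl, rfl, h1, h2⟩ := h
      rw [if_pos ⟨rfl, rfl, rfl, rfl, h1, h2⟩,
        if_pos ⟨by simp, by simp, rfl, rfl, h1.symm, Ne.symm h2⟩]
      simp only [map_div₀, map_one, map_mul, map_pow, map_sub, map_intCast, map_ofNat]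
      congr 2
      ring
    · rw [if_neg h, if_neg, map_zero]
      rintro ⟨h1, h2, h3, h4, h5, h6⟩
      exact h ⟨by simpa using h3, by simpa using h4, by rw [← h1]; simp, by rw [← h2]; simp,
        h5.symm, Ne.symm h6⟩

/-- The permutations of `List.finRange k` have no repetition, so there it suffices to compare
members; a general list, possibly with repeated entries, is an image of `List.finRange`. -/
lemma perm_map_rotate_permutations {α : Type*} (l : List α) (n : ℕ) :
    (l.permutations.map (·.rotate n)).Perm l.permutations := by
  have h : ∀ k : ℕ, ((List.finRange k).permutations.map (·.rotate n)).Perm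
      (List.finRange k).permutations := by
    intro k
    have hnd := List.nodup_permutations _ (List.nodup_finRange k)
    refine (List.perm_ext_iff_of_nodup (hnd.map (List.rotate_injective n)) hnd).2 fun a => ?_
    simp only [List.mem_map, List.mem_permutations]
    constructor
    · rintro ⟨b, hb, rfl⟩
      exact (List.rotate_perm b n).trans hb
    · intro ha
      obtain ⟨b, hb⟩ : ∃ b : List (Fin k), b.rotate n = a :=
        ⟨a.rotate (a.length * n - n), by
          rcases Nat.eq_zero_or_pos a.length with h0 | h0
          · simp [List.length_eq_zero_iff.1 h0]
          · rw [List.rotate_rotate, Nat.sub_add_cancel (Nat.le_mul_of_pos_left n h0),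
              List.rotate_length_mul]⟩
      exact ⟨b, (List.rotate_perm b n).symm.trans (hb ▸ ha), hb⟩
  have e : l = (List.finRange l.length).map l.get := by simp
  rw [e, ← List.map_permutations, List.map_map]
  have : ((fun x : List α => x.rotate n) ∘ List.map l.get) =
      (List.map l.get) ∘ (fun x => x.rotate n) := by
    funext x; simp
  rw [this, ← List.map_map]
  exact (h _).map _

lemma coeffReal_symmetrize_rawP4 : CoeffReal (symmetrize rawP4) := by
  intro j
  rw [symmetrize, symmetrize, map_div₀, length_bar, MultiIndex.bar, ← List.map_permutations,
    map_list_sum, List.map_map, List.map_map]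
  simp only [map_natCast]
  congr 1
  have h1 : ((starRingEnd ℂ) ∘ rawP4) = (rawP4 ∘ List.map Idx.bar) ∘ (·.rotate 2) := by
    funext l; exact rawP4_bar l
  rw [h1, ← List.map_map]
  exact ((perm_map_rotate_permutations j 2).map _).sum_eq

lemma coeffSupp_birkhoff (n m : ℕ) : CoeffSupp m (birkhoff n m) := by
  induction n generalizing m with
  | zero =>
    rw [birkhoff]
    beta_reduce
    split_ifs with h
    · subst h; exact coeffSupp_rawP4.symmetrize
    · exact CoeffSupp.zero m
  | succ n ih => exact CoeffSupp.birkhoffStep ih m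

lemma coeffReal_birkhoff (n m : ℕ) : CoeffReal (birkhoff n m) := by
  induction n generalizing m with
  | zero =>
    rw [birkhoff]
    beta_reduce
    split_ifs with h
    · exact coeffReal_symmetrize_rawP4
    · exact CoeffReal.zero
  | succ n ih => exact CoeffReal.birkhoffStep ih m

lemma norm_birkhoff_le {r : ℕ} (hr : 2 ≤ r) (n : ℕ) (hn : n + 1 ≤ r) (m : ℕ) (hm : 2 ≤ m)
    (hmr : m ≤ r) (j : MultiIndex) :
    ‖birkhoff n m j‖ ≤ 1 / 2 * (1 + 1 / r) ^ n * (24 * r ^ 3) ^ (m - 2) := by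
  induction n generalizing m j with
  | zero =>
    rw [birkhoff]
    beta_reduce
    split_ifs with h
    · subst h
      simpa using norm_symmetrize_le norm_rawP4_le j
    · simp only [Pi.zero_apply, norm_zero]; positivity
  | succ n ih =>
    -- Since (1 + 1/r)^r ≤ e < 3, the constant 1/2 of the quartic term never grows beyond the
    -- threshold 3/2 required by a step.
    have hexp : (1 + 1 / (r : ℝ)) ^ n ≤ 3 := by
      have h1 : (1 + 1 / (r : ℝ)) ^ n ≤ (1 + 1 / (r : ℝ)) ^ r :=
        pow_le_pow_right₀ (by simp) (by omega)
      have h2 : (1 + 1 / (r : ℝ)) ^ r ≤ Real.exp 1 := by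
        have hr0 : (r : ℝ) ≠ 0 := by positivity
        calc (1 + 1 / (r : ℝ)) ^ r ≤ Real.exp (1 / r) ^ r := by
              gcongr; rw [add_comm]; exact Real.add_one_le_exp _
          _ = Real.exp 1 := by rw [← Real.exp_nat_mul]; congr 1; field_simp
      linarith [Real.exp_one_lt_d9]
    have := norm_birkhoffStep_le (r := r) (s := n + 1) (by omega) hn (coeffSupp_birkhoff n)
      (B := 1 / 2 * (1 + 1 / r) ^ n) (by positivity) (by linarith)
      (fun m hm hmr j => ih (by omega) m hm hmr j) m hm hmr j
    rw [birkhoff, pow_succ, ← mul_assoc]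
    exact this

lemma birkhoff_add {n m : ℕ} (hm : 2 ≤ m) (hmn : m ≤ n + 1) (k : ℕ) :
    birkhoff (n + k) m = birkhoff n m := by
  induction k with
  | zero => rfl
  | succ k ih =>
    rw [← add_assoc, birkhoff, birkhoffStep_of_le hm (by omega), ih]

lemma resonantK_eq {r m : ℕ} (hm : 2 ≤ m) (hmr : m ≤ r) : resonantK r m = birkhoff (m - 1) m := by
  rw [resonantK]
  have := birkhoff_add (n := m - 1) hm (by omega) (r - m)
  rwa [show m - 1 + (r - m) = r - 1 by omega] at this

lemma coeffSupp_resonantK (r m : ℕ) : CoeffSupp m (resonantK r m) := coeffSupp_birkhoff _ _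

lemma coeffReal_resonantK (r m : ℕ) : CoeffReal (resonantK r m) := coeffReal_birkhoff _ _

lemma resonantK_resonant {r m : ℕ} (hm : 2 ≤ m) (hmr : m ≤ r) {j : MultiIndex}
    (hj : resonantK r m j ≠ 0) : moment 2 j = 0 := by
  rw [resonantK_eq hm hmr] at hj
  obtain ⟨s, rfl⟩ : ∃ s, m = s + 2 := ⟨m - 2, by omega⟩
  rw [show s + 2 - 1 = s + 1 by omega, birkhoff, birkhoffStep_succ (by omega), resonantPart] at hj
  by_contra h
  simp [h] at hj

/-- The polynomial of degree 2m is frozen after step m-1 (`resonantK_eq`), so the general bound can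
be used with m in place of r. This sharper form is what `colNorm_initQ_le` needs. -/
lemma norm_resonantK_le {r m : ℕ} (hm : 2 ≤ m) (hmr : m ≤ r) (j : MultiIndex) :
    ‖resonantK r m j‖ ≤ 3 / 2 * (24 * m ^ 3) ^ (m - 2) := by
  rw [resonantK_eq hm hmr]
  refine (norm_birkhoff_le hm (m - 1) (by omega) m hm le_rfl j).trans ?_
  have hm0 : (m : ℝ) ≠ 0 := by positivity
  have h2 : (1 + 1 / (m : ℝ)) ^ (m - 1) ≤ Real.exp 1 := by
    calc (1 + 1 / (m : ℝ)) ^ (m - 1) ≤ (1 + 1 / (m : ℝ)) ^ m :=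
          pow_le_pow_right₀ (by simp) (by omega)
      _ ≤ Real.exp (1 / m) ^ m := by
          gcongr; rw [add_comm]; exact Real.add_one_le_exp _
      _ = Real.exp 1 := by rw [← Real.exp_nat_mul]; congr 1; field_simp
  gcongr
  linarith [Real.exp_one_lt_d9]

end Birkhoff

/-! ### The Poisson bracket of formal rational fractions -/

section Bracket

lemma abs_sign (d : ℤˣ) : |((d : ℤ) : ℝ)| = 1 := by
  rcases Int.units_eq_one_or d with h | h <;> simp [h]

lemma norm_sign (d : ℤˣ) : ‖((d : ℤ) : ℂ)‖ = 1 := by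
  rcases Int.units_eq_one_or d with h | h <;> simp [h]

lemma abs_sum_map_le {α : Type*} (l : List α) (f : α → ℝ) {B : ℝ} (h : ∀ a ∈ l, |f a| ≤ B) :
    |(l.map f).sum| ≤ l.length * B := by
  induction l with
  | nil => simp
  | cons a l ih =>
    rw [List.map_cons, List.sum_cons, List.length_cons]
    have h1 := ih fun b hb => h b (List.mem_cons_of_mem _ hb)
    have h2 := h a List.mem_cons_self
    push_cast
    linarith [abs_add_le (f a) (l.map f).sum]

/-- The potential `∑_β δ_β / (a - a_β)²`, so that `ω_h = ∑_a pot h a |z_a|²`. -/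
def pot (h : MultiIndex) (a : ℤ) : ℝ :=
  (h.map fun i => ((i.1 : ℤ) : ℝ) * if a = i.2 then 0 else 1 / ((a : ℝ) - (i.2 : ℝ)) ^ 2).sum

lemma abs_pot_le (h : MultiIndex) (a : ℤ) : |pot h a| ≤ h.length := by
  refine (abs_sum_map_le h _ (B := 1) fun i _ => ?_).trans (by simp)
  rw [abs_mul, abs_sign, one_mul]
  split_ifs with hi
  · simp
  · have : (1 : ℝ) ≤ |((a - i.2 : ℤ) : ℝ)| := by exact_mod_cast Int.one_le_abs (sub_ne_zero.2 hi)
    push_cast at this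
    rw [abs_div, abs_one, abs_pow]
    exact div_le_one_of_le₀ (by nlinarith) (by positivity)

/-- The number `κ` such that `{i / ω_h, z_k} = κ (i / ω_h)² z_k`. -/
def coupling (h k : MultiIndex) : ℝ := (k.map fun i => ((i.1 : ℤ) : ℝ) * pot h i.2).sum

lemma abs_coupling_le (h k : MultiIndex) : |coupling h k| ≤ k.length * h.length := by
  refine abs_sum_map_le k _ fun i _ => ?_
  rw [abs_mul, abs_sign, one_mul]
  exact abs_pot_le h i.2

/-- The Poisson bracket of two elementary fractions. -/
def brBasis (x y : MultiIndex × List MultiIndex) : RatCoeff :=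
  (∑ α : Fin x.1.length, ∑ β : Fin y.1.length,
    if y.1[β] = Idx.bar x.1[α] then
      Finsupp.single (x.1.eraseIdx α ++ y.1.eraseIdx β, x.2 ++ y.2)
        (Complex.I * (((x.1[α]).1 : ℤ) : ℂ))
    else 0)
  + (x.2.map fun h => (Finsupp.single (x.1 ++ y.1, h :: (x.2 ++ y.2))
      ((coupling h y.1 : ℝ) : ℂ) : RatCoeff)).sum
  - (y.2.map fun g => (Finsupp.single (x.1 ++ y.1, g :: (x.2 ++ y.2))
      ((coupling g x.1 : ℝ) : ℂ) : RatCoeff)).sum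

/-- The Poisson bracket of formal rational fractions. -/
def br (P Q : RatCoeff) : RatCoeff :=
  ∑ x ∈ P.support, ∑ y ∈ Q.support, (P x * Q y) • brBasis x y

/-- Elementary fractions of order `2q`, with at most `n` denominators, all of them of length at
most `s`. -/
structure Good (M : ℝ) (s q n : ℕ) (x : MultiIndex × List MultiIndex) : Prop where
  len : x.1.length = 2 * q + 2 * x.2.length
  cnt : x.2.length ≤ n
  mass : moment 0 x.1 = 0
  momentum : moment 1 x.1 = 0
  energy : moment 2 x.1 = 0
  modes : ModesLE M x.1
  den : ∀ k ∈ x.2, k ∈ nonIntegrableSetLE s M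

lemma Good.zeroMomentum {M : ℝ} {s q n : ℕ} {x : MultiIndex × List MultiIndex}
    (h : Good M s q n x) : ZeroMomentum (q + x.2.length) x.1 :=
  ⟨by rw [h.len]; ring, h.mass, h.momentum⟩

/-- Formal rational fractions of order `2q`, with at most `n` denominators of length at most `s`. -/
def RatClass (M : ℝ) (s q n : ℕ) (Q : RatCoeff) : Prop := ∀ x, Q x ≠ 0 → Good M s q n x

lemma Good.mono {M : ℝ} {s s' q n n' : ℕ} {x : MultiIndex × List MultiIndex}
    (h : Good M s q n x) (hs : s ≤ s') (hn : n ≤ n') : Good M s' q n' x :=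
  ⟨h.len, h.cnt.trans hn, h.mass, h.momentum, h.energy, h.modes,
    fun k hk => ⟨(h.den k hk).1, (h.den k hk).2.1.trans hs, (h.den k hk).2.2⟩⟩

lemma RatClass.mono {M : ℝ} {s s' q n n' : ℕ} {Q : RatCoeff}
    (h : RatClass M s q n Q) (hs : s ≤ s') (hn : n ≤ n') : RatClass M s' q n' Q :=
  fun x hx => (h x hx).mono hs hn

lemma RatClass.zero (M : ℝ) (s q n : ℕ) : RatClass M s q n 0 := fun _ h => absurd rfl h

lemma RatClass.add {M : ℝ} {s q n : ℕ} {P Q : RatCoeff} (hP : RatClass M s q n P)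
    (hQ : RatClass M s q n Q) : RatClass M s q n (P + Q) := fun x hx => by
  by_cases h : P x = 0
  · exact hQ x fun h' => hx (by simp [h, h'])
  · exact hP x h

lemma RatClass.smul {M : ℝ} {s q n : ℕ} {P : RatCoeff} (hP : RatClass M s q n P) (c : ℂ) :
    RatClass M s q n (c • P) := fun x hx => hP x fun h => hx (by simp [h])

lemma RatClass.sum {ι : Type*} {M : ℝ} {s q n : ℕ} (t : Finset ι) {P : ι → RatCoeff}
    (h : ∀ i ∈ t, RatClass M s q n (P i)) : RatClass M s q n (∑ i ∈ t, P i) :=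
  Finset.sum_induction P (RatClass M s q n) (fun _ _ => RatClass.add) (RatClass.zero M s q n) h

lemma RatClass.single {M : ℝ} {s q n : ℕ} {x : MultiIndex × List MultiIndex}
    (h : Good M s q n x) (c : ℂ) : RatClass M s q n (Finsupp.single x c) := fun y hy => by
  rw [Finsupp.single_apply] at hy
  split_ifs at hy with hxy
  · exact hxy ▸ h
  · exact absurd rfl hy

lemma RatClass.list_sum {M : ℝ} {s q n : ℕ} {l : List RatCoeff}
    (h : ∀ P ∈ l, RatClass M s q n P) : RatClass M s q n l.sum := by
  induction l with
  | nil => exact RatClass.zero M s q n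
  | cons P l ih =>
    rw [List.sum_cons]
    exact (h P List.mem_cons_self).add (ih fun Q hQ => h Q (List.mem_cons_of_mem _ hQ))

lemma moment_eraseIdx (k : ℕ) (j : MultiIndex) (α : Fin j.length) :
    moment k (j.eraseIdx α) = moment k j - ((j[α]).1 : ℤ) * (j[α]).2 ^ k := by
  have h := moment_perm k (List.getElem_cons_eraseIdx_perm (l := j) α.2)
  rw [moment_cons] at h
  exact eq_sub_of_add_eq' h

lemma ModesLE.append {M : ℝ} {j k : MultiIndex} (hj : ModesLE M j) (hk : ModesLE M k) :
    ModesLE M (j ++ k) := fun i hi => by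
  rcases List.mem_append.1 hi with h | h
  · exact hj i h
  · exact hk i h

lemma ModesLE.eraseIdx {M : ℝ} {j : MultiIndex} (hj : ModesLE M j) (α : ℕ) :
    ModesLE M (j.eraseIdx α) := fun i hi => hj i (List.mem_of_mem_eraseIdx hi)

/-- The two contracted entries have the same mode and opposite signs, so their contributions to the
three moments cancel. Two entries disappear and no denominator is created, which lowers the sum of
the orders by one. -/
lemma Good.contract {M : ℝ} {s q n q' n' : ℕ} {x y : MultiIndex × List MultiIndex}
    (hx : Good M s q n x) (hy : Good M s q' n' y) (hq : 1 ≤ q) (α : Fin x.1.length)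
    (β : Fin y.1.length) (h : y.1[β] = Idx.bar x.1[α]) :
    Good M s (q + q' - 1) (n + n' + 1)
      (x.1.eraseIdx α ++ y.1.eraseIdx β, x.2 ++ y.2) := by
  have hmom : ∀ k, moment k x.1 = 0 → moment k y.1 = 0 →
      moment k (x.1.eraseIdx α ++ y.1.eraseIdx β) = 0 := by
    intro k h1 h2
    rw [moment_append, moment_eraseIdx, moment_eraseIdx, h1, h2, h]
    simp [Idx.bar]
  refine ⟨?_, ?_, hmom 0 hx.mass hy.mass, hmom 1 hx.momentum hy.momentum,
    hmom 2 hx.energy hy.energy, (hx.modes.eraseIdx α).append (hy.modes.eraseIdx β), ?_⟩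
  · have h1 := hx.len
    have h2 := hy.len
    have h3 := α.2
    have h4 := β.2
    simp only [List.length_append, List.length_eraseIdx_of_lt h3, List.length_eraseIdx_of_lt h4]
    omega
  · have h1 := hx.cnt
    have h2 := hy.cnt
    simp only [List.length_append]
    omega
  · intro k hk
    rcases List.mem_append.1 hk with h | h
    · exact hx.den k h
    · exact hy.den k h

/-- Differentiating a denominator squares it: the numerators are kept entirely, and the additional
denominator lowers the order by one. -/
lemma Good.product {M : ℝ} {s q n q' n' : ℕ} {x y : MultiIndex × List MultiIndex}
    (hx : Good M s q n x) (hy : Good M s q' n' y) (hq : 1 ≤ q) {g : MultiIndex}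
    (hg : g ∈ nonIntegrableSetLE s M) :
    Good M s (q + q' - 1) (n + n' + 1) (x.1 ++ y.1, g :: (x.2 ++ y.2)) := by
  refine ⟨?_, ?_, ?_, ?_, ?_, hx.modes.append hy.modes, ?_⟩
  · have h1 := hx.len
    have h2 := hy.len
    simp only [List.length_append, List.length_cons]
    omega
  · have h1 := hx.cnt
    have h2 := hy.cnt
    simp only [List.length_append, List.length_cons]
    omega
  · rw [moment_append, hx.mass, hy.mass, add_zero]
  · rw [moment_append, hx.momentum, hy.momentum, add_zero]
  · rw [moment_append, hx.energy, hy.energy, add_zero]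
  · intro k hk
    rcases List.mem_cons.1 hk with h | h
    · exact h ▸ hg
    · rcases List.mem_append.1 h with h | h
      · exact hx.den k h
      · exact hy.den k h

lemma ratClass_brBasis {M : ℝ} {s q n q' n' : ℕ} {x y : MultiIndex × List MultiIndex}
    (hx : Good M s q n x) (hy : Good M s q' n' y) (hq : 1 ≤ q) :
    RatClass M s (q + q' - 1) (n + n' + 1) (brBasis x y) := by
  rw [brBasis, sub_eq_add_neg, ← neg_one_smul ℂ]
  refine ((RatClass.sum _ fun α _ => RatClass.sum _ fun β _ => ?_).add
    (RatClass.list_sum ?_)).add (RatClass.smul (RatClass.list_sum ?_) _)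
  · split_ifs with h
    · exact RatClass.single (hx.contract hy hq α β h) _
    · exact RatClass.zero _ _ _ _
  · intro P hP
    obtain ⟨g, hg, rfl⟩ := List.mem_map.1 hP
    exact RatClass.single (hx.product hy hq (hx.den g hg)) _
  · intro P hP
    obtain ⟨g, hg, rfl⟩ := List.mem_map.1 hP
    exact RatClass.single (hx.product hy hq (hy.den g hg)) _

lemma RatClass.br {M : ℝ} {s q n q' n' : ℕ} {P Q : RatCoeff} (hP : RatClass M s q n P)
    (hQ : RatClass M s q' n' Q) (hq : 1 ≤ q) :
    RatClass M s (q + q' - 1) (n + n' + 1) (br P Q) :=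
  RatClass.sum _ fun x hx => RatClass.sum _ fun y hy =>
    (ratClass_brBasis (hP x (Finsupp.mem_support_iff.1 hx))
      (hQ y (Finsupp.mem_support_iff.1 hy)) hq).smul _

/-! ### The coefficient norm -/

/-- The sum of the moduli of the coefficients with a given numerator. -/
def colNorm (Q : RatCoeff) (j : MultiIndex) : ℝ := ∑ x ∈ Q.support, if x.1 = j then ‖Q x‖ else 0

lemma colNorm_nonneg (Q : RatCoeff) (j : MultiIndex) : 0 ≤ colNorm Q j :=
  Finset.sum_nonneg fun x _ => by split_ifs <;> positivity

lemma colNorm_eq_of_subset {Q : RatCoeff} {t : Finset (MultiIndex × List MultiIndex)}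
    (h : Q.support ⊆ t) (j : MultiIndex) :
    colNorm Q j = ∑ x ∈ t, if x.1 = j then ‖Q x‖ else 0 := by
  refine Finset.sum_subset h fun x _ hx => ?_
  rw [Finsupp.notMem_support_iff.1 hx, norm_zero, ite_self]

lemma colNorm_zero (j : MultiIndex) : colNorm 0 j = 0 := by simp [colNorm]

lemma colNorm_add_le (P Q : RatCoeff) (j : MultiIndex) :
    colNorm (P + Q) j ≤ colNorm P j + colNorm Q j := by
  rw [colNorm_eq_of_subset (Finsupp.support_add (g₁ := P) (g₂ := Q)),
    colNorm_eq_of_subset (Finset.subset_union_left (s₁ := P.support) (s₂ := Q.support)),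
    colNorm_eq_of_subset (Finset.subset_union_right (s₁ := P.support) (s₂ := Q.support)),
    ← Finset.sum_add_distrib]
  refine Finset.sum_le_sum fun x _ => ?_
  split_ifs
  · exact norm_add_le _ _
  · simp

lemma colNorm_smul_le (c : ℂ) (P : RatCoeff) (j : MultiIndex) :
    colNorm (c • P) j ≤ ‖c‖ * colNorm P j := by
  rw [colNorm_eq_of_subset (Finsupp.support_smul (b := c) (g := P)), colNorm, Finset.mul_sum]
  refine Finset.sum_le_sum fun x _ => ?_
  split_ifs
  · simp
  · simp

lemma colNorm_sum_le {ι : Type*} (t : Finset ι) (P : ι → RatCoeff) (j : MultiIndex) :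
    colNorm (∑ i ∈ t, P i) j ≤ ∑ i ∈ t, colNorm (P i) j :=
  Finset.le_sum_of_subadditive (fun Q => colNorm Q j) (colNorm_zero j).le
    (fun P Q => colNorm_add_le P Q j) t P

lemma colNorm_single (x : MultiIndex × List MultiIndex) (c : ℂ) (j : MultiIndex) :
    colNorm (Finsupp.single x c) j = if x.1 = j then ‖c‖ else 0 := by
  rw [colNorm_eq_of_subset (Finsupp.support_single_subset), Finset.sum_singleton,
    Finsupp.single_eq_same]

lemma colNorm_list_sum_le {α : Type*} (l : List α) (P : α → RatCoeff) (j : MultiIndex) {B : ℝ}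
    (h : ∀ a ∈ l, colNorm (P a) j ≤ B) : colNorm (l.map P).sum j ≤ l.length * B := by
  induction l with
  | nil => simp [colNorm_zero]
  | cons a l ih =>
    rw [List.map_cons, List.sum_cons, List.length_cons]
    have h1 := ih fun b hb => h b (List.mem_cons_of_mem _ hb)
    have h2 := h a List.mem_cons_self
    push_cast
    linarith [colNorm_add_le (P a) (l.map P).sum j]

/-- A contraction has a coefficient of modulus one. Differentiating a denominator brings in its
coupling with the other numerator, at most the product of the two lengths. -/
lemma colNorm_brBasis_le (x y : MultiIndex × List MultiIndex) (J : MultiIndex) {s : ℕ}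
    (hx : ∀ h ∈ x.2, h.length ≤ s) (hy : ∀ h ∈ y.2, h.length ≤ s) :
    colNorm (brBasis x y) J ≤
      (∑ α : Fin x.1.length, ∑ β : Fin y.1.length,
        if x.1.eraseIdx α ++ y.1.eraseIdx β = J then 1 else 0)
      + (x.2.length * (y.1.length * s) + y.2.length * (x.1.length * s) : ℝ) *
        if x.1 ++ y.1 = J then 1 else 0 := by
  have hW : ∀ (k : MultiIndex) (u : List MultiIndex), (∀ h ∈ u, h.length ≤ s) →
      colNorm (u.map fun h => (Finsupp.single (x.1 ++ y.1, h :: (x.2 ++ y.2))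
        ((coupling h k : ℝ) : ℂ) : RatCoeff)).sum J ≤
        u.length * (k.length * s * if x.1 ++ y.1 = J then 1 else 0) := by
    intro k u hu
    refine colNorm_list_sum_le u _ J fun h hh => ?_
    rw [colNorm_single]
    split_ifs
    · rw [mul_one, Complex.norm_real]
      refine (abs_coupling_le h k).trans ?_
      gcongr
      exact_mod_cast hu h hh
    · simp
  rw [brBasis, sub_eq_add_neg, ← neg_one_smul ℂ]
  refine (colNorm_add_le _ _ J).trans ?_
  have h1 := colNorm_add_le (∑ α : Fin x.1.length, ∑ β : Fin y.1.length,
    if y.1[β] = Idx.bar x.1[α] then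
      Finsupp.single (x.1.eraseIdx α ++ y.1.eraseIdx β, x.2 ++ y.2)
        (Complex.I * (((x.1[α]).1 : ℤ) : ℂ))
    else (0 : RatCoeff)) (x.2.map fun h => (Finsupp.single (x.1 ++ y.1, h :: (x.2 ++ y.2))
      ((coupling h y.1 : ℝ) : ℂ) : RatCoeff)).sum J
  have h2 := hW y.1 x.2 hx
  have h3 := colNorm_smul_le (-1) (y.2.map fun g => (Finsupp.single (x.1 ++ y.1, g :: (x.2 ++ y.2))
      ((coupling g x.1 : ℝ) : ℂ) : RatCoeff)).sum J
  have h4 := hW x.1 y.2 hy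
  have h5 : colNorm (∑ α : Fin x.1.length, ∑ β : Fin y.1.length,
      if y.1[β] = Idx.bar x.1[α] then
        Finsupp.single (x.1.eraseIdx α ++ y.1.eraseIdx β, x.2 ++ y.2)
          (Complex.I * (((x.1[α]).1 : ℤ) : ℂ))
      else (0 : RatCoeff)) J ≤ ∑ α : Fin x.1.length, ∑ β : Fin y.1.length,
        if x.1.eraseIdx α ++ y.1.eraseIdx β = J then 1 else 0 := by
    refine (colNorm_sum_le _ _ J).trans (Finset.sum_le_sum fun α _ => ?_)
    refine (colNorm_sum_le _ _ J).trans (Finset.sum_le_sum fun β _ => ?_)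
    by_cases hc : y.1[β] = Idx.bar x.1[α]
    · rw [if_pos hc, colNorm_single, norm_mul, Complex.norm_I, norm_sign, one_mul]
    · rw [if_neg hc, colNorm_zero]
      split_ifs <;> norm_num
  rw [norm_neg, norm_one, one_mul] at h3
  nlinarith

lemma eq_of_eraseIdx_eq {m m' α : ℕ} {j j' : MultiIndex} (h : ZeroMomentum m j)
    (h' : ZeroMomentum m' j') (hα : α < j.length) (hα' : α < j'.length)
    (he : j.eraseIdx α = j'.eraseIdx α) : j = j' := by
  have p := (List.getElem_cons_eraseIdx_perm hα).symm
  have p' := (List.getElem_cons_eraseIdx_perm hα').symm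
  rw [← he] at p'
  have := idx_eq_of_zeroMomentum (zeroMomentum_perm p h) (zeroMomentum_perm p' h')
  rw [← List.insertIdx_eraseIdx_getElem hα, ← List.insertIdx_eraseIdx_getElem hα', ← he, this]

/-- There is at most one numerator with a given result of the deletion of the `α`-th entry. -/
lemma exists_eq_of_eraseIdx (α : ℕ) (l : MultiIndex) : ∃ j₀ : MultiIndex, ∀ m j,
    ZeroMomentum m j → α < j.length → j.eraseIdx α = l → j = j₀ := by
  by_cases h : ∃ m j, ZeroMomentum m j ∧ α < j.length ∧ j.eraseIdx α = l
  · obtain ⟨m₀, j₀, h1, h2, h3⟩ := h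
    exact ⟨j₀, fun m j hj hα hl => eq_of_eraseIdx_eq hj h1 hα h2 (hl.trans h3.symm)⟩
  · push Not at h
    exact ⟨[], fun m j hj hα hl => absurd hl (h m j hj hα)⟩

/-- The indices i list candidate pairs of numerators. Each pair contributes a product of two column
sums, so only the number of candidates is lost. -/
lemma sum_mul_colNorm_le {P Q : RatCoeff} {A B : ℝ} (hA : ∀ j, colNorm P j ≤ A)
    (hB : ∀ j, colNorm Q j ≤ B) {ι : Type*} (t : Finset ι) (j k : ι → MultiIndex) :
    ∑ x ∈ P.support, ∑ y ∈ Q.support, ‖P x‖ * ‖Q y‖ *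
      (∑ i ∈ t, if x.1 = j i ∧ y.1 = k i then 1 else 0) ≤ t.card * (A * B) := by
  have hA0 : 0 ≤ A := (colNorm_nonneg P []).trans (hA [])
  calc ∑ x ∈ P.support, ∑ y ∈ Q.support, ‖P x‖ * ‖Q y‖ *
      (∑ i ∈ t, if x.1 = j i ∧ y.1 = k i then (1 : ℝ) else 0)
      = ∑ i ∈ t, colNorm P (j i) * colNorm Q (k i) := by
        have e : ∀ i, colNorm P (j i) * colNorm Q (k i) = ∑ x ∈ P.support, ∑ y ∈ Q.support,
            ‖P x‖ * ‖Q y‖ * (if x.1 = j i ∧ y.1 = k i then 1 else 0) := fun i => by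
          rw [colNorm, colNorm, Finset.sum_mul_sum]
          refine Finset.sum_congr rfl fun x _ => Finset.sum_congr rfl fun y _ => ?_
          by_cases h1 : x.1 = j i <;> by_cases h2 : y.1 = k i <;> simp [h1, h2]
        simp only [e, Finset.mul_sum]
        symm
        rw [Finset.sum_comm]
        exact Finset.sum_congr rfl fun x _ => Finset.sum_comm
    _ ≤ ∑ _i ∈ t, A * B := Finset.sum_le_sum fun i _ =>
        mul_le_mul (hA _) (hB _) (colNorm_nonneg _ _) hA0
    _ = t.card * (A * B) := by simp

/-- For a given numerator J of the bracket, the two numerators it comes from must be counted. For a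
contraction they are determined by the place where J is cut and the two deleted positions: at most
ℓ³ choices. For a product the cut alone determines them: ℓ+1 choices, each with total coupling at
most (n+n')ℓs. No factor depends on M. -/
lemma colNorm_br_le {M : ℝ} {s q n q' n' ℓ : ℕ} {P Q : RatCoeff} (hP : RatClass M s q n P)
    (hQ : RatClass M s q' n' Q) (hℓ : 2 * q + 2 * n ≤ ℓ) (hℓ' : 2 * q' + 2 * n' ≤ ℓ)
    {A B : ℝ} (hA : ∀ j, colNorm P j ≤ A) (hB : ∀ j, colNorm Q j ≤ B) (J : MultiIndex) :
    colNorm (br P Q) J ≤ (ℓ ^ 3 + (ℓ + 1) * ((n + n') * ℓ * s)) * (A * B) := by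
  have hP' : ∀ x ∈ P.support, Good M s q n x := fun x hx => hP x (Finsupp.mem_support_iff.1 hx)
  have hQ' : ∀ x ∈ Q.support, Good M s q' n' x := fun x hx => hQ x (Finsupp.mem_support_iff.1 hx)
  have hlP : ∀ x ∈ P.support, x.1.length ≤ ℓ := fun x hx => by
    have h1 := (hP' x hx).len
    have h2 := (hP' x hx).cnt
    omega
  have hlQ : ∀ x ∈ Q.support, x.1.length ≤ ℓ := fun x hx => by
    have h1 := (hQ' x hx).len
    have h2 := (hQ' x hx).cnt
    omega
  -- `F α l` is the only possible numerator of zero mass and momentum whose α-th deletion is l.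
  choose F hF using exists_eq_of_eraseIdx
  set t₁ : Finset (ℕ × ℕ × ℕ) := Finset.range ℓ ×ˢ Finset.range ℓ ×ˢ Finset.range ℓ with ht₁
  set t₂ : Finset ℕ := Finset.range (ℓ + 1) with ht₂
  have key : ∀ x ∈ P.support, ∀ y ∈ Q.support, colNorm ((P x * Q y) • brBasis x y) J ≤
      ‖P x‖ * ‖Q y‖ * (∑ i ∈ t₁, if x.1 = F i.1 (J.take i.2.2) ∧
        y.1 = F i.2.1 (J.drop i.2.2) then 1 else 0)
      + (n + n') * ℓ * s * (‖P x‖ * ‖Q y‖ *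
        (∑ m ∈ t₂, if x.1 = J.take m ∧ y.1 = J.drop m then 1 else 0)) := by
    intro x hx y hy
    refine (colNorm_smul_le _ _ _).trans ?_
    rw [norm_mul]
    have h1 := colNorm_brBasis_le x y J (fun h hh => ((hP' x hx).den h hh).2.1)
      (fun h hh => ((hQ' y hy).den h hh).2.1)
    have h2 : (∑ α : Fin x.1.length, ∑ β : Fin y.1.length,
        if x.1.eraseIdx α ++ y.1.eraseIdx β = J then (1 : ℝ) else 0) ≤
        ∑ i ∈ t₁, if x.1 = F i.1 (J.take i.2.2) ∧ y.1 = F i.2.1 (J.drop i.2.2) then 1 else 0 := by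
      rw [ht₁, Finset.sum_product]
      simp only [Finset.sum_product]
      rw [Fin.sum_univ_eq_sum_range (fun α => ∑ β : Fin y.1.length,
        if x.1.eraseIdx α ++ y.1.eraseIdx β = J then (1 : ℝ) else 0)]
      refine (Finset.sum_le_sum fun α hα => ?_).trans (Finset.sum_le_sum_of_subset_of_nonneg
        (Finset.range_subset_range.2 (hlP x hx)) fun _ _ _ => Finset.sum_nonneg fun _ _ =>
          Finset.sum_nonneg fun _ _ => by split_ifs <;> norm_num)
      rw [Fin.sum_univ_eq_sum_range (fun β =>
        if x.1.eraseIdx α ++ y.1.eraseIdx β = J then (1 : ℝ) else 0)]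
      refine (Finset.sum_le_sum fun β hβ => ?_).trans (Finset.sum_le_sum_of_subset_of_nonneg
        (Finset.range_subset_range.2 (hlQ y hy)) fun _ _ _ => Finset.sum_nonneg fun _ _ => by
          split_ifs <;> norm_num)
      have hα := Finset.mem_range.1 hα
      have hβ := Finset.mem_range.1 hβ
      split_ifs with h
      · have hlen := List.length_eraseIdx_of_lt hα
        have e1 : J.take (x.1.eraseIdx α).length = x.1.eraseIdx α := by rw [← h]; simp
        have e2 : J.drop (x.1.eraseIdx α).length = y.1.eraseIdx β := by rw [← h]; simp
        refine le_trans ?_ (Finset.single_le_sum (f := fun m => if x.1 = F α (J.take m) ∧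
          y.1 = F β (J.drop m) then (1 : ℝ) else 0) (fun _ _ => by split_ifs <;> norm_num)
          (Finset.mem_range.2 (by have := hlP x hx; omega : (x.1.eraseIdx α).length < ℓ)))
        rw [if_pos ⟨hF α _ _ _ (hP' x hx).zeroMomentum hα e1.symm,
          hF β _ _ _ (hQ' y hy).zeroMomentum hβ e2.symm⟩]
      · exact Finset.sum_nonneg fun _ _ => by split_ifs <;> norm_num
    have h3 : (if x.1 ++ y.1 = J then (1 : ℝ) else 0) ≤
        ∑ m ∈ t₂, if x.1 = J.take m ∧ y.1 = J.drop m then 1 else 0 := by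
      split_ifs with h
      · refine le_trans ?_ (Finset.single_le_sum (f := fun m => if x.1 = J.take m ∧
          y.1 = J.drop m then (1 : ℝ) else 0) (fun _ _ => by split_ifs <;> norm_num)
          (Finset.mem_range.2 (by have := hlP x hx; omega : x.1.length < ℓ + 1)))
        rw [if_pos]
        rw [← h]; simp
      · exact Finset.sum_nonneg fun _ _ => by split_ifs <;> norm_num
    have h4 : (x.2.length * (y.1.length * s) + y.2.length * (x.1.length * s) : ℝ) ≤
        (n + n') * ℓ * s := by
      have a1 : (x.2.length : ℝ) ≤ n := by exact_mod_cast (hP' x hx).cnt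
      have a2 : (y.2.length : ℝ) ≤ n' := by exact_mod_cast (hQ' y hy).cnt
      have a3 : (x.1.length : ℝ) ≤ ℓ := by exact_mod_cast hlP x hx
      have a4 : (y.1.length : ℝ) ≤ ℓ := by exact_mod_cast hlQ y hy
      calc (x.2.length * (y.1.length * s) + y.2.length * (x.1.length * s) : ℝ)
          ≤ n * (ℓ * s) + n' * (ℓ * s) := by gcongr
        _ = (n + n') * ℓ * s := by ring
    have h5 : 0 ≤ (if x.1 ++ y.1 = J then (1 : ℝ) else 0) := by split_ifs <;> norm_num
    have h6 : 0 ≤ ‖P x‖ * ‖Q y‖ := by positivity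
    calc ‖P x‖ * ‖Q y‖ * colNorm (brBasis x y) J
        ≤ ‖P x‖ * ‖Q y‖ * ((∑ i ∈ t₁, if x.1 = F i.1 (J.take i.2.2) ∧
            y.1 = F i.2.1 (J.drop i.2.2) then 1 else 0) + (n + n') * ℓ * s *
            (∑ m ∈ t₂, if x.1 = J.take m ∧ y.1 = J.drop m then 1 else 0)) := by
          refine mul_le_mul_of_nonneg_left (h1.trans (add_le_add h2 ?_)) h6
          exact mul_le_mul h4 h3 h5 (by positivity)
      _ = _ := by ring
  rw [br]
  refine (colNorm_sum_le _ _ _).trans ((Finset.sum_le_sum fun x hx =>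
    (colNorm_sum_le _ _ _).trans (Finset.sum_le_sum fun y hy => key x hx y hy)).trans ?_)
  simp only [Finset.sum_add_distrib, ← Finset.mul_sum]
  have e1 := sum_mul_colNorm_le hA hB t₁ (fun i => F i.1 (J.take i.2.2))
    (fun i => F i.2.1 (J.drop i.2.2))
  have e2 := sum_mul_colNorm_le hA hB t₂ (fun m => J.take m) (fun m => J.drop m)
  simp only [ht₁, ht₂, Finset.card_product, Finset.card_range] at e1 e2
  simp only [Finset.mul_sum] at e1 e2 ⊢
  have e3 : 0 ≤ ((n : ℝ) + n') * ℓ * s := by positivity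
  have e4 := mul_le_mul_of_nonneg_left e2 e3
  simp only [Finset.mul_sum] at e4
  push_cast at e1 e4
  refine (add_le_add e1 e4).trans (le_of_eq ?_)
  ring

end Bracket

/-! ### Rational fractions on the complexified phase space -/

section Complexification

variable {M : ℝ}

/-- The complexified phase space: `z_a` and `conj z_a` become independent variables. -/
abbrev CV (M : ℝ) := ℤˣ × Modes M → ℂ

/-- The index of a coordinate of the complexified phase space. -/
def toIdx (i : ℤˣ × Modes M) : Idx := (i.1, (i.2 : ℤ))

/-- The conjugate coordinate. -/
def cbar (i : ℤˣ × Modes M) : ℤˣ × Modes M := (-i.1, i.2)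

lemma cbar_cbar (i : ℤˣ × Modes M) : cbar (cbar i) = i := by simp [cbar]

lemma toIdx_cbar (i : ℤˣ × Modes M) : toIdx (cbar i) = Idx.bar (toIdx i) := rfl

lemma toIdx_injective : Function.Injective (toIdx (M := M)) := fun i i' h => by
  have h1 := congrArg Prod.fst h
  have h2 := congrArg Prod.snd h
  exact Prod.ext h1 (Subtype.ext h2)

/-- The involution `i ↦ cbar i`. -/
def cbarEquiv : (ℤˣ × Modes M) ≃ (ℤˣ × Modes M) := ⟨cbar, cbar, cbar_cbar, cbar_cbar⟩

/-- The embedding of the phase space into its complexification. -/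
def cx : GM M →L[ℝ] CV M := ContinuousLinearMap.pi fun i =>
  if i.1 = 1 then ContinuousLinearMap.proj i.2
  else (Complex.conjCLE : ℂ →L[ℝ] ℂ) ∘L ContinuousLinearMap.proj i.2

lemma cx_one (z : GM M) (a : Modes M) : cx z (1, a) = z a := by simp [cx]

lemma cx_neg_one (z : GM M) (a : Modes M) : cx z (-1, a) = (starRingEnd ℂ) (z a) := by simp [cx]

/-- The extension by zero of the coordinates. -/
def cext (ζ : CV M) (i : Idx) : ℂ :=
  if h : i.2 ∈ Finset.Icc ⌈-M⌉ ⌊M⌋ then ζ (i.1, ⟨i.2, h⟩) else 0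

lemma cext_toIdx (ζ : CV M) (i : ℤˣ × Modes M) : cext ζ (toIdx i) = ζ i := by
  rw [cext, dif_pos (show (toIdx i).2 ∈ _ from i.2.2)]
  rfl

lemma cext_cx (z : GM M) (i : Idx) : cext (cx z) i = coord z i := by
  obtain ⟨d, a⟩ := i
  by_cases h : a ∈ Finset.Icc ⌈-M⌉ ⌊M⌋
  · rcases Int.units_eq_one_or d with rfl | rfl <;>
      simp only [cext, coord, extend, dif_pos h, cx_one, cx_neg_one, if_true]
    simp
  · simp only [cext, coord, extend, dif_neg h, map_zero, ite_self]

/-- The monomial `ζ_j`. -/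
def cmon (ζ : CV M) (j : MultiIndex) : ℂ := (j.map (cext ζ)).prod

lemma cmon_cons (ζ : CV M) (i : Idx) (j : MultiIndex) : cmon ζ (i :: j) = cext ζ i * cmon ζ j := by
  simp [cmon]

lemma cmon_append (ζ : CV M) (j k : MultiIndex) : cmon ζ (j ++ k) = cmon ζ j * cmon ζ k := by
  simp [cmon]

lemma cmon_perm (ζ : CV M) {j k : MultiIndex} (h : j.Perm k) : cmon ζ j = cmon ζ k :=
  (h.map _).prod_eq

lemma cmon_eraseIdx (ζ : CV M) (j : MultiIndex) (α : Fin j.length) :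
    cext ζ j[α] * cmon ζ (j.eraseIdx α) = cmon ζ j := by
  rw [← cmon_cons]
  exact cmon_perm ζ (List.getElem_cons_eraseIdx_perm α.2)

lemma cmon_cx (z : GM M) (j : MultiIndex) : cmon (cx z) j = monomial z j := by
  rw [cmon, monomial]
  congr 2
  funext i
  exact cext_cx z i

/-- The quadratic function `∑_a f(a) |z_a|²`. -/
def quad (f : ℤ → ℂ) (ζ : CV M) : ℂ := ∑ a : Modes M, f a * (ζ (1, a) * ζ (-1, a))

/-- The small divisor `ω_h`. -/
def comega (h : MultiIndex) (ζ : CV M) : ℂ := quad (fun a => ((pot h a : ℝ) : ℂ)) ζ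

lemma comega_cx (z : GM M) (h : MultiIndex) : comega h (cx z) = ((omega h z : ℝ) : ℂ) := by
  have e : omega h z = ∑ a : Modes M, pot h a * ‖z a‖ ^ 2 := by
    rw [omega]
    induction h with
    | nil => simp [pot]
    | cons i h ih =>
      rw [List.map_cons, List.sum_cons, ih, Finset.mul_sum, ← Finset.sum_add_distrib]
      refine Finset.sum_congr rfl fun a _ => ?_
      rw [pot, pot, List.map_cons, List.sum_cons, add_mul]
      congr 1
      split_ifs <;> ring
  rw [e, comega, quad]
  push_cast
  refine Finset.sum_congr rfl fun a _ => ?_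
  rw [cx_one, cx_neg_one, Complex.mul_conj, Complex.normSq_eq_norm_sq]
  push_cast
  rfl

/-- The product of the inverses of the small divisors. -/
def cden (ζ : CV M) (h : List MultiIndex) : ℂ := (h.map fun g => Complex.I / comega g ζ).prod

lemma cden_cons (ζ : CV M) (g : MultiIndex) (h : List MultiIndex) :
    cden ζ (g :: h) = Complex.I / comega g ζ * cden ζ h := by simp [cden]

lemma cden_append (ζ : CV M) (g h : List MultiIndex) :
    cden ζ (g ++ h) = cden ζ g * cden ζ h := by simp [cden]

/-- An elementary fraction. -/
def cterm (ζ : CV M) (x : MultiIndex × List MultiIndex) : ℂ := cden ζ x.2 * cmon ζ x.1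

/-- The evaluation of a rational fraction on the complexified phase space. -/
def ceval (Q : RatCoeff) (ζ : CV M) : ℂ := ∑ x ∈ Q.support, Q x * cterm ζ x

lemma ceval_cx (Q : RatCoeff) (z : GM M) : ceval Q (cx z) = Q.eval z := by
  rw [ceval, RatCoeff.eval, Finsupp.sum]
  refine Finset.sum_congr rfl fun x _ => ?_
  rw [cterm, cden, cmon_cx, mul_assoc]
  simp only [comega_cx]

lemma ceval_eq_linearCombination (Q : RatCoeff) (ζ : CV M) :
    ceval Q ζ = Finsupp.linearCombination ℂ (cterm ζ) Q := by
  rw [Finsupp.linearCombination_apply, Finsupp.sum, ceval]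
  rfl

lemma ceval_zero (ζ : CV M) : ceval 0 ζ = 0 := by simp [ceval]

lemma ceval_add (P Q : RatCoeff) (ζ : CV M) : ceval (P + Q) ζ = ceval P ζ + ceval Q ζ := by
  simp [ceval_eq_linearCombination]

lemma ceval_sub (P Q : RatCoeff) (ζ : CV M) : ceval (P - Q) ζ = ceval P ζ - ceval Q ζ := by
  simp [ceval_eq_linearCombination]

lemma ceval_smul (c : ℂ) (P : RatCoeff) (ζ : CV M) : ceval (c • P) ζ = c * ceval P ζ := by
  simp [ceval_eq_linearCombination]

lemma ceval_sum {ι : Type*} (t : Finset ι) (P : ι → RatCoeff) (ζ : CV M) :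
    ceval (∑ i ∈ t, P i) ζ = ∑ i ∈ t, ceval (P i) ζ := by
  simp [ceval_eq_linearCombination]

lemma ceval_single (x : MultiIndex × List MultiIndex) (c : ℂ) (ζ : CV M) :
    ceval (Finsupp.single x c) ζ = c * cterm ζ x := by
  simp [ceval_eq_linearCombination]

lemma ceval_list_sum {α : Type*} (l : List α) (P : α → RatCoeff) (ζ : CV M) :
    ceval (l.map P).sum ζ = (l.map fun a => ceval (P a) ζ).sum := by
  induction l with
  | nil => simp [ceval_zero]
  | cons a l ih => simp [ceval_add, ih]

/-! ### Gradients -/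

/-- The vector of partial derivatives. -/
def grad (F : CV M → ℂ) (ζ : CV M) (i : ℤˣ × Modes M) : ℂ := fderiv ℂ F ζ (Pi.single i 1)

lemma fderiv_eq_sum_grad (F : CV M → ℂ) (ζ v : CV M) :
    fderiv ℂ F ζ v = ∑ i, v i * grad F ζ i := by
  have h : v = ∑ i, v i • (Pi.single i (1 : ℂ) : CV M) := by
    funext k
    simp [Finset.sum_apply, Pi.single_apply]
  conv_lhs => rw [h]
  simp [grad]

lemma grad_mul {F G : CV M → ℂ} {ζ : CV M} (hF : DifferentiableAt ℂ F ζ)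
    (hG : DifferentiableAt ℂ G ζ) (i : ℤˣ × Modes M) :
    grad (fun ζ => F ζ * G ζ) ζ i = F ζ * grad G ζ i + G ζ * grad F ζ i := by
  rw [grad, fderiv_fun_mul hF hG]
  simp [grad]

lemma differentiable_cext (i : Idx) : Differentiable ℂ (fun ζ : CV M => cext ζ i) := by
  unfold cext
  by_cases h : i.2 ∈ Finset.Icc ⌈-M⌉ ⌊M⌋
  · simp only [dif_pos h]; fun_prop
  · simp only [dif_neg h]; fun_prop

lemma contDiff_cext {n : WithTop ℕ∞} (i : Idx) : ContDiff ℂ n (fun ζ : CV M => cext ζ i) := by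
  unfold cext
  by_cases h : i.2 ∈ Finset.Icc ⌈-M⌉ ⌊M⌋
  · simp only [dif_pos h]; fun_prop
  · simp only [dif_neg h]; fun_prop

lemma grad_cext (i : Idx) (ζ : CV M) (k : ℤˣ × Modes M) :
    grad (fun ζ : CV M => cext ζ i) ζ k = if i = toIdx k then 1 else 0 := by
  unfold cext grad
  by_cases h : i.2 ∈ Finset.Icc ⌈-M⌉ ⌊M⌋
  · simp only [dif_pos h]
    have : fderiv ℂ (fun ζ : CV M => ζ (i.1, ⟨i.2, h⟩)) ζ =
        ContinuousLinearMap.proj (i.1, (⟨i.2, h⟩ : Modes M)) :=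
      (ContinuousLinearMap.proj (R := ℂ) (φ := fun _ : ℤˣ × Modes M => ℂ)
        (i.1, (⟨i.2, h⟩ : Modes M))).fderiv
    rw [this, ContinuousLinearMap.proj_apply, Pi.single_apply]
    have e : ((i.1, (⟨i.2, h⟩ : Modes M)) = k) ↔ i = toIdx k :=
      ⟨fun hk => by rw [← hk]; rfl, fun hk => toIdx_injective (hk ▸ rfl)⟩
    simp only [e]
  · simp only [dif_neg h, fderiv_const_apply]
    rw [if_neg]
    · rfl
    · rintro rfl
      exact h k.2.2

lemma contDiff_cmon {n : WithTop ℕ∞} (j : MultiIndex) :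
    ContDiff ℂ n (fun ζ : CV M => cmon ζ j) := by
  induction j with
  | nil => simpa [cmon] using contDiff_const
  | cons i j ih =>
    simp only [cmon_cons]
    exact (contDiff_cext i).mul ih

lemma differentiable_cmon (j : MultiIndex) : Differentiable ℂ (fun ζ : CV M => cmon ζ j) :=
  (contDiff_cmon (n := 1) j).differentiable one_ne_zero

/-- The partial derivatives of a monomial. -/
def dmon (ζ : CV M) (j : MultiIndex) (i : Idx) : ℂ :=
  ∑ α : Fin j.length, if j[α] = i then cmon ζ (j.eraseIdx α) else 0

lemma dmon_cons (ζ : CV M) (k : Idx) (j : MultiIndex) (i : Idx) :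
    dmon ζ (k :: j) i = (if k = i then cmon ζ j else 0) + cext ζ k * dmon ζ j i := by
  unfold dmon
  refine (Fin.sum_univ_succ (n := j.length) _).trans ?_
  congr 1
  rw [Finset.mul_sum]
  refine Finset.sum_congr rfl fun α _ => ?_
  simp [cmon_cons]

lemma grad_cmon (j : MultiIndex) (ζ : CV M) (i : ℤˣ × Modes M) :
    grad (fun ζ : CV M => cmon ζ j) ζ i = dmon ζ j (toIdx i) := by
  induction j with
  | nil => simp [cmon, grad, dmon]
  | cons k j ih =>
    simp only [cmon_cons]
    rw [grad_mul (differentiable_cext k ζ) (differentiable_cmon j ζ), ih, grad_cext, dmon_cons]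
    split_ifs <;> ring

lemma contDiff_quad {n : WithTop ℕ∞} (f : ℤ → ℂ) : ContDiff ℂ n (quad (M := M) f) := by
  unfold quad; fun_prop

lemma grad_quad (f : ℤ → ℂ) (ζ : CV M) (i : ℤˣ × Modes M) :
    grad (quad f) ζ i = ζ (cbar i) * f i.2 := by
  have h : ∀ k : ℤˣ × Modes M, HasFDerivAt (fun ζ : CV M => ζ k)
      (ContinuousLinearMap.proj (R := ℂ) (φ := fun _ : ℤˣ × Modes M => ℂ) k) ζ := fun k =>
    (ContinuousLinearMap.proj (R := ℂ) (φ := fun _ : ℤˣ × Modes M => ℂ) k).hasFDerivAt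
  have h2 : HasFDerivAt (quad (M := M) f) _ ζ := HasFDerivAt.fun_sum fun a _ =>
    ((h (1, a)).mul (h (-1, a))).const_mul (f a)
  rw [grad, h2.fderiv]
  simp only [sum_apply, smul_apply, add_apply, ContinuousLinearMap.proj_apply, smul_eq_mul, Pi.single_apply]
  obtain ⟨d, b⟩ := i
  rw [Finset.sum_eq_single b]
  · rcases Int.units_eq_one_or d with rfl | rfl <;> simp [cbar, mul_comm]
  · intro a _ hab
    have : ∀ e : ℤˣ, ¬ ((e, a) = (d, b)) := fun e he => hab (congrArg Prod.snd he)
    simp [this]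
  · simp

lemma contDiff_comega {n : WithTop ℕ∞} (h : MultiIndex) : ContDiff ℂ n (comega (M := M) h) :=
  contDiff_quad fun a => ((pot h a : ℝ) : ℂ)

lemma grad_comega (h : MultiIndex) (ζ : CV M) (i : ℤˣ × Modes M) :
    grad (comega h) ζ i = ζ (cbar i) * ((pot h i.2 : ℝ) : ℂ) :=
  grad_quad (fun a => ((pot h a : ℝ) : ℂ)) ζ i

lemma contDiffAt_cden {n : WithTop ℕ∞} {h : List MultiIndex} {ζ : CV M}
    (hω : ∀ g ∈ h, comega g ζ ≠ 0) : ContDiffAt ℂ n (fun ζ : CV M => cden ζ h) ζ := by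
  induction h with
  | nil => simpa [cden] using contDiffAt_const
  | cons g h ih =>
    simp only [cden_cons]
    refine ContDiffAt.mul ?_ (ih fun k hk => hω k (List.mem_cons_of_mem _ hk))
    exact contDiffAt_const.div (contDiff_comega g).contDiffAt (hω g List.mem_cons_self)

/-- The logarithmic derivative of a product of inverses of small divisors. -/
def dlog (ζ : CV M) (h : List MultiIndex) (a : ℤ) : ℂ :=
  Complex.I * (h.map fun g => ((pot g a : ℝ) : ℂ) * (Complex.I / comega g ζ)).sum

lemma grad_cden {h : List MultiIndex} {ζ : CV M} (hω : ∀ g ∈ h, comega g ζ ≠ 0)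
    (i : ℤˣ × Modes M) :
    grad (fun ζ : CV M => cden ζ h) ζ i = ζ (cbar i) * dlog ζ h i.2 * cden ζ h := by
  induction h with
  | nil => simp [cden, grad, dlog]
  | cons g h ih =>
    have hg := hω g List.mem_cons_self
    have hω' : ∀ k ∈ h, comega k ζ ≠ 0 := fun k hk => hω k (List.mem_cons_of_mem _ hk)
    simp only [cden_cons]
    have hd : DifferentiableAt ℂ (comega (M := M) g) ζ :=
      (contDiff_comega (n := 1) g).differentiable one_ne_zero ζ
    have h1 : grad (fun ζ : CV M => Complex.I / comega g ζ) ζ i =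
        -(Complex.I / comega g ζ ^ 2) * grad (comega g) ζ i := by
      have e : (fun ζ : CV M => Complex.I / comega g ζ) =
          fun ζ => Complex.I * (comega g ζ)⁻¹ := by funext; rw [div_eq_mul_inv]
      have := ((hasFDerivAt_inv hg).comp ζ hd.hasFDerivAt).const_mul Complex.I
      rw [grad, e, HasFDerivAt.fderiv (f := fun ζ : CV M => Complex.I * (comega g ζ)⁻¹) this]
      simp [grad]
      ring
    rw [grad_mul _ ((contDiffAt_cden (n := 1) hω').differentiableAt one_ne_zero), ih hω', h1,
      grad_comega, dlog, dlog, List.map_cons, List.sum_cons]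
    · have hI := Complex.I_sq
      field_simp
      ring_nf
      simp only [hI]
      ring
    · exact (contDiffAt_const.div (contDiff_comega (n := 1) g).contDiffAt hg).differentiableAt
        one_ne_zero

lemma contDiffAt_cterm {n : WithTop ℕ∞} {x : MultiIndex × List MultiIndex} {ζ : CV M}
    (hω : ∀ g ∈ x.2, comega g ζ ≠ 0) : ContDiffAt ℂ n (fun ζ : CV M => cterm ζ x) ζ :=
  (contDiffAt_cden hω).mul (contDiff_cmon x.1).contDiffAt

lemma grad_cterm {x : MultiIndex × List MultiIndex} {ζ : CV M} (hω : ∀ g ∈ x.2, comega g ζ ≠ 0)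
    (i : ℤˣ × Modes M) :
    grad (fun ζ : CV M => cterm ζ x) ζ i =
      cden ζ x.2 * dmon ζ x.1 (toIdx i) + ζ (cbar i) * dlog ζ x.2 i.2 * cterm ζ x := by
  unfold cterm
  rw [grad_mul ((contDiffAt_cden (n := 1) hω).differentiableAt one_ne_zero)
    (differentiable_cmon x.1 ζ), grad_cmon, grad_cden hω]
  ring

lemma contDiffAt_ceval {n : WithTop ℕ∞} {Q : RatCoeff} {ζ : CV M}
    (hω : ∀ x, Q x ≠ 0 → ∀ g ∈ x.2, comega g ζ ≠ 0) : ContDiffAt ℂ n (ceval Q) ζ := by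
  unfold ceval
  exact ContDiffAt.sum fun x hx => contDiffAt_const.mul
    (contDiffAt_cterm (hω x (Finsupp.mem_support_iff.1 hx)))

lemma grad_ceval {Q : RatCoeff} {ζ : CV M}
    (hω : ∀ x, Q x ≠ 0 → ∀ g ∈ x.2, comega g ζ ≠ 0) (i : ℤˣ × Modes M) :
    grad (ceval Q) ζ i = ∑ x ∈ Q.support, Q x * grad (fun ζ : CV M => cterm ζ x) ζ i := by
  unfold grad
  have h : HasFDerivAt (ceval (M := M) Q) _ ζ := HasFDerivAt.fun_sum fun x hx =>
    (((contDiffAt_cterm (n := 1) (hω x (Finsupp.mem_support_iff.1 hx))).differentiableAt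
      one_ne_zero).hasFDerivAt).const_mul (Q x)
  rw [h.fderiv]
  simp

/-! ### The Poisson bracket on the complexified phase space -/

/-- The Poisson bracket of two functions in terms of their gradients. -/
def pb (g g' : ℤˣ × Modes M → ℂ) : ℂ := Complex.I * ∑ i, ((i.1 : ℤ) : ℂ) * g i * g' (cbar i)

lemma pb_add_left (g₁ g₂ g' : ℤˣ × Modes M → ℂ) :
    pb (fun i => g₁ i + g₂ i) g' = pb g₁ g' + pb g₂ g' := by
  rw [pb, pb, pb, ← mul_add, ← Finset.sum_add_distrib]
  congr 1
  exact Finset.sum_congr rfl fun i _ => by ring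

lemma pb_mul_left (c : ℂ) (g g' : ℤˣ × Modes M → ℂ) :
    pb (fun i => c * g i) g' = c * pb g g' := by
  rw [pb, pb, mul_left_comm, Finset.mul_sum (a := c)]
  congr 1
  exact Finset.sum_congr rfl fun i _ => by ring

lemma pb_antisymm (g g' : ℤˣ × Modes M → ℂ) : pb g g' = -pb g' g := by
  rw [pb, pb, ← mul_neg, ← Finset.sum_neg_distrib, ← cbarEquiv.sum_comp]
  congr 1
  refine Finset.sum_congr rfl fun i _ => ?_
  simp [cbarEquiv, cbar]
  ring

lemma pb_add_right (g g₁ g₂ : ℤˣ × Modes M → ℂ) :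
    pb g (fun i => g₁ i + g₂ i) = pb g g₁ + pb g g₂ := by
  rw [pb_antisymm, pb_add_left, pb_antisymm g g₁, pb_antisymm g g₂]; ring

lemma pb_mul_right (c : ℂ) (g g' : ℤˣ × Modes M → ℂ) :
    pb g (fun i => c * g' i) = c * pb g g' := by
  rw [pb_antisymm, pb_mul_left, pb_antisymm g g']; ring

lemma pb_sum_left {ι : Type*} (t : Finset ι) (g : ι → ℤˣ × Modes M → ℂ)
    (g' : ℤˣ × Modes M → ℂ) : pb (fun i => ∑ x ∈ t, g x i) g' = ∑ x ∈ t, pb (g x) g' := by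
  classical
  induction t using Finset.induction_on with
  | empty => simp [pb]
  | insert a t ha ih =>
    simp only [Finset.sum_insert ha]
    rw [pb_add_left, ih]

lemma pb_sum_right {ι : Type*} (t : Finset ι) (g : ℤˣ × Modes M → ℂ)
    (g' : ι → ℤˣ × Modes M → ℂ) : pb g (fun i => ∑ x ∈ t, g' x i) = ∑ x ∈ t, pb g (g' x) := by
  rw [pb_antisymm, pb_sum_left, ← Finset.sum_neg_distrib]
  exact Finset.sum_congr rfl fun x _ => (pb_antisymm _ _).symm

/-- Functions of the actions commute: the sum is symmetric in f and f', while the bracket is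
antisymmetric. -/
lemma pb_action_action (ζ : CV M) (f f' : ℤ → ℂ) :
    pb (fun i => ζ (cbar i) * f i.2) (fun i => ζ (cbar i) * f' i.2) = 0 := by
  have h := pb_antisymm (fun i => ζ (cbar i) * f i.2) (fun i => ζ (cbar i) * f' i.2)
  have h2 : pb (fun i => ζ (cbar i) * f i.2) (fun i => ζ (cbar i) * f' i.2) =
      pb (fun i => ζ (cbar i) * f' i.2) (fun i => ζ (cbar i) * f i.2) := by
    unfold pb
    congr 1
    refine Finset.sum_congr rfl fun i _ => ?_
    simp only [cbar]
    ring
  rw [← h2] at h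
  exact self_eq_neg.1 h

lemma mem_modes_of_modesLE {j : MultiIndex} (h : ModesLE M j) {i : Idx} (hi : i ∈ j) :
    i.2 ∈ Finset.Icc ⌈-M⌉ ⌊M⌋ := by
  have h1 := (le_max_right _ _).trans (h i hi)
  rw [abs_le] at h1
  exact Finset.mem_Icc.2 ⟨Int.ceil_le.2 h1.1, Int.le_floor.2 h1.2⟩

lemma sum_ite_toIdx {i : Idx} (hi : i.2 ∈ Finset.Icc ⌈-M⌉ ⌊M⌋) (F : Idx → ℂ) :
    ∑ k : ℤˣ × Modes M, (if i = toIdx k then F (toIdx k) else 0) = F i := by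
  have e : i = toIdx ((i.1, ⟨i.2, hi⟩) : ℤˣ × Modes M) := rfl
  rw [Finset.sum_eq_single ((i.1, ⟨i.2, hi⟩) : ℤˣ × Modes M)]
  · rw [if_pos e, ← e]
  · intro k _ hk
    rw [if_neg]
    intro h
    exact hk (toIdx_injective (h.symm.trans e))
  · simp

/-- Only gradients enter, so f may itself be evaluated at ζ. This applies to logarithmic derivatives
of denominators and to the frequencies of L₄, exactly as to a quadratic action function. -/
lemma pb_action_dmon (ζ : CV M) (f : ℤ → ℂ) {k : MultiIndex} (hk : ModesLE M k) :
    pb (fun i => ζ (cbar i) * f i.2) (fun i => dmon ζ k (toIdx i)) =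
      -Complex.I * (k.map fun i => ((i.1 : ℤ) : ℂ) * f i.2).sum * cmon ζ k := by
  rw [pb, ← cbarEquiv.sum_comp]
  have h1 : ∀ i : ℤˣ × Modes M, (((cbarEquiv i).1 : ℤ) : ℂ) *
      (ζ (cbar (cbarEquiv i)) * f (cbarEquiv i).2) * dmon ζ k (toIdx (cbar (cbarEquiv i))) =
      ∑ β : Fin k.length, if k[β] = toIdx i then
        -(((toIdx i).1 : ℤ) : ℂ) * f (toIdx i).2 * (cext ζ (toIdx i) * cmon ζ (k.eraseIdx β))
      else 0 := by
    intro i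
    have e : cbarEquiv i = cbar i := rfl
    rw [e, cbar_cbar, dmon, Finset.mul_sum]
    refine Finset.sum_congr rfl fun β _ => ?_
    split_ifs
    · rw [cext_toIdx]
      simp [cbar, toIdx]
      ring
    · simp
  rw [Finset.sum_congr rfl fun i _ => h1 i, Finset.sum_comm]
  have h2 : ∀ β : Fin k.length, (∑ i : ℤˣ × Modes M, if k[β] = toIdx i then
        -(((toIdx i).1 : ℤ) : ℂ) * f (toIdx i).2 * (cext ζ (toIdx i) * cmon ζ (k.eraseIdx β))
      else 0) = -((((k[β]).1 : ℤ) : ℂ) * f (k[β]).2) * cmon ζ k := by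
    intro β
    rw [sum_ite_toIdx (i := k[β]) (mem_modes_of_modesLE hk (List.getElem_mem β.2))
      (fun i => -((i.1 : ℤ) : ℂ) * f i.2 * (cext ζ i * cmon ζ (k.eraseIdx β))),
      cmon_eraseIdx]
    ring
  rw [Finset.sum_congr rfl fun β _ => h2 β, ← Finset.sum_mul, Finset.sum_neg_distrib]
  have h3 : ∑ β : Fin k.length, (((k[β]).1 : ℤ) : ℂ) * f (k[β]).2 =
      (k.map fun i => ((i.1 : ℤ) : ℂ) * f i.2).sum := by
    rw [← Fin.sum_univ_fun_getElem]
    rfl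
  rw [h3]
  ring

lemma pb_dmon_dmon (ζ : CV M) {j k : MultiIndex} (hj : ModesLE M j) :
    pb (fun i : ℤˣ × Modes M => dmon ζ j (toIdx i)) (fun i => dmon ζ k (toIdx i)) =
      ∑ α : Fin j.length, ∑ β : Fin k.length, if k[β] = Idx.bar j[α] then
        Complex.I * (((j[α]).1 : ℤ) : ℂ) * (cmon ζ (j.eraseIdx α) * cmon ζ (k.eraseIdx β))
      else 0 := by
  rw [pb]
  have h1 : ∀ i : ℤˣ × Modes M, ((i.1 : ℤ) : ℂ) * dmon ζ j (toIdx i) * dmon ζ k (toIdx (cbar i)) =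
      ∑ α : Fin j.length, if j[α] = toIdx i then (((toIdx i).1 : ℤ) : ℂ) *
        cmon ζ (j.eraseIdx α) * dmon ζ k (Idx.bar (toIdx i)) else 0 := by
    intro i
    rw [toIdx_cbar, dmon, Finset.mul_sum, Finset.sum_mul]
    refine Finset.sum_congr rfl fun β _ => ?_
    split_ifs
    · rfl
    · simp
  rw [Finset.sum_congr rfl fun i _ => h1 i, Finset.sum_comm, Finset.mul_sum]
  refine Finset.sum_congr rfl fun α _ => ?_
  rw [sum_ite_toIdx (i := j[α]) (mem_modes_of_modesLE hj (List.getElem_mem α.2)) (fun i => ((i.1 : ℤ) : ℂ) *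
    cmon ζ (j.eraseIdx α) * dmon ζ k (Idx.bar i)), dmon, Finset.mul_sum, Finset.mul_sum]
  refine Finset.sum_congr rfl fun β _ => ?_
  split_ifs
  · ring
  · simp

/-- The bracket of a function of the actions with an elementary fraction. -/
lemma pb_action_cterm {ζ : CV M} (f : ℤ → ℂ) {x : MultiIndex × List MultiIndex}
    (hω : ∀ g ∈ x.2, comega g ζ ≠ 0) (hx : ModesLE M x.1) :
    pb (fun i => ζ (cbar i) * f i.2) (grad (fun ζ : CV M => cterm ζ x) ζ) =
      -Complex.I * (x.1.map fun i => ((i.1 : ℤ) : ℂ) * f i.2).sum * cterm ζ x := by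
  have e : grad (fun ζ : CV M => cterm ζ x) ζ = fun i => cden ζ x.2 * dmon ζ x.1 (toIdx i) +
      cterm ζ x * (ζ (cbar i) * dlog ζ x.2 i.2) := by
    funext i; rw [grad_cterm hω]; ring
  rw [e, pb_add_right, pb_mul_right, pb_mul_right, pb_action_action, pb_action_dmon ζ f hx, cterm]
  ring

lemma sum_dlog (ζ : CV M) (h : List MultiIndex) (k : MultiIndex) :
    (k.map fun i => ((i.1 : ℤ) : ℂ) * dlog ζ h i.2).sum =
      Complex.I * (h.map fun g => ((coupling g k : ℝ) : ℂ) * (Complex.I / comega g ζ)).sum := by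
  induction h with
  | nil => simp [dlog]
  | cons g h ih =>
    have e : ∀ i : Idx, ((i.1 : ℤ) : ℂ) * dlog ζ (g :: h) i.2 =
        Complex.I * (Complex.I / comega g ζ) * (((i.1 : ℤ) : ℂ) * ((pot g i.2 : ℝ) : ℂ)) +
          ((i.1 : ℤ) : ℂ) * dlog ζ h i.2 := by
      intro i
      rw [dlog, dlog, List.map_cons, List.sum_cons]
      ring
    have e2 : ((coupling g k : ℝ) : ℂ) =
        (k.map fun i => ((i.1 : ℤ) : ℂ) * ((pot g i.2 : ℝ) : ℂ)).sum := by
      rw [coupling]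
      clear ih e
      induction k with
      | nil => simp
      | cons i k ih => simp [ih]
    rw [List.map_cons, List.sum_cons, mul_add, ← ih, e2]
    simp only [e]
    rw [List.sum_map_add, List.sum_map_mul_left]
    ring

/-- The product rule splits each gradient into a numerator part and an action part coming from the
denominators. The numerator parts give the contractions, the two mixed brackets give the couplings,
and the action parts commute. -/
lemma pb_cterm_cterm {ζ : CV M} {x y : MultiIndex × List MultiIndex}
    (hωx : ∀ g ∈ x.2, comega g ζ ≠ 0) (hωy : ∀ g ∈ y.2, comega g ζ ≠ 0)
    (hx : ModesLE M x.1) (hy : ModesLE M y.1) :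
    pb (grad (fun ζ : CV M => cterm ζ x) ζ) (grad (fun ζ : CV M => cterm ζ y) ζ) =
      ceval (brBasis x y) ζ := by
  have e : ∀ x : MultiIndex × List MultiIndex, (∀ g ∈ x.2, comega g ζ ≠ 0) →
      grad (fun ζ : CV M => cterm ζ x) ζ = fun i => cden ζ x.2 * dmon ζ x.1 (toIdx i) +
      cterm ζ x * (ζ (cbar i) * dlog ζ x.2 i.2) := by
    intro x hω
    funext i; rw [grad_cterm hω]; ring
  have hW : ∀ (k : MultiIndex) (u : List MultiIndex),
      (u.map fun h => ceval (Finsupp.single (x.1 ++ y.1, h :: (x.2 ++ y.2))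
        ((coupling h k : ℝ) : ℂ) : RatCoeff) ζ).sum =
      (u.map fun h => ((coupling h k : ℝ) : ℂ) * (Complex.I / comega h ζ)).sum *
        (cterm ζ x * cterm ζ y) := by
    intro k u
    rw [← List.sum_map_mul_right]
    congr 2
    funext h
    rw [ceval_single, cterm, cterm, cterm, cden_cons, cden_append, cmon_append]
    ring
  have hI := Complex.I_mul_I
  rw [e x hωx, pb_add_left, pb_mul_left, pb_mul_left]
  rw [pb_action_cterm _ hωy hy, e y hωy, pb_add_right, pb_mul_right, pb_mul_right,
    pb_antisymm (fun i => dmon ζ x.1 (toIdx i)) (fun i => ζ (cbar i) * dlog ζ y.2 i.2),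
    pb_action_dmon ζ _ hx, pb_dmon_dmon ζ hx,
    brBasis, ceval_sub, ceval_add, ceval_sum, ceval_list_sum, ceval_list_sum, hW, hW,
    sum_dlog, sum_dlog]
  have h1 : cden ζ x.2 * (cden ζ y.2 * ∑ α : Fin x.1.length, ∑ β : Fin y.1.length,
      if y.1[β] = Idx.bar x.1[α] then
        Complex.I * (((x.1[α]).1 : ℤ) : ℂ) * (cmon ζ (x.1.eraseIdx α) * cmon ζ (y.1.eraseIdx β))
      else 0) = ∑ α : Fin x.1.length, ceval (∑ β : Fin y.1.length,
        if y.1[β] = Idx.bar x.1[α] then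
          Finsupp.single (x.1.eraseIdx α ++ y.1.eraseIdx β, x.2 ++ y.2)
            (Complex.I * (((x.1[α]).1 : ℤ) : ℂ))
        else (0 : RatCoeff)) ζ := by
    simp only [Finset.mul_sum]
    refine Finset.sum_congr rfl fun α _ => ?_
    rw [ceval_sum]
    refine Finset.sum_congr rfl fun β _ => ?_
    split_ifs
    · rw [ceval_single, cterm, cden_append, cmon_append]
      ring
    · simp [ceval_zero]
  rw [mul_add, h1, cterm, cterm]
  linear_combination (cden ζ x.2 * cmon ζ x.1 * cden ζ y.2 * cmon ζ y.1 *
    ((y.2.map fun h => ((coupling h x.1 : ℝ) : ℂ) * (Complex.I / comega h ζ)).sum -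
    (x.2.map fun h => ((coupling h y.1 : ℝ) : ℂ) * (Complex.I / comega h ζ)).sum)) * hI

/-- The formal bracket is the Poisson bracket of the associated functions. -/
lemma pb_ceval_ceval {s q n q' n' : ℕ} {P Q : RatCoeff} (hP : RatClass M s q n P)
    (hQ : RatClass M s q' n' Q) {ζ : CV M} (hω : ∀ g ∈ nonIntegrableSetLE s M, comega g ζ ≠ 0) :
    pb (grad (ceval P) ζ) (grad (ceval Q) ζ) = ceval (br P Q) ζ := by
  have eP : grad (ceval P) ζ = fun i => ∑ x ∈ P.support, P x * grad (fun ζ => cterm ζ x) ζ i :=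
    funext fun i => grad_ceval (fun x hx g hg => hω g ((hP x hx).den g hg)) i
  have eQ : grad (ceval Q) ζ = fun i => ∑ x ∈ Q.support, Q x * grad (fun ζ => cterm ζ x) ζ i :=
    funext fun i => grad_ceval (fun x hx g hg => hω g ((hQ x hx).den g hg)) i
  rw [eP, eQ, pb_sum_left, br, ceval_sum]
  refine Finset.sum_congr rfl fun x hx => ?_
  rw [pb_sum_right, ceval_sum]
  refine Finset.sum_congr rfl fun y hy => ?_
  have gx := hP x (Finsupp.mem_support_iff.1 hx)
  have gy := hQ y (Finsupp.mem_support_iff.1 hy)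
  rw [pb_mul_left, pb_mul_right, ceval_smul, pb_cterm_cterm (fun g hg => hω g (gx.den g hg))
    (fun g hg => hω g (gy.den g hg)) gx.modes gy.modes]
  ring

lemma pb_action_ceval {s q n : ℕ} {Q : RatCoeff} (hQ : RatClass M s q n Q) {ζ : CV M}
    (hω : ∀ g ∈ nonIntegrableSetLE s M, comega g ζ ≠ 0) (f : ℤ → ℂ) :
    pb (fun i => ζ (cbar i) * f i.2) (grad (ceval Q) ζ) = ∑ x ∈ Q.support,
      Q x * (-Complex.I * (x.1.map fun i => ((i.1 : ℤ) : ℂ) * f i.2).sum * cterm ζ x) := by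
  have eQ : grad (ceval Q) ζ = fun i => ∑ x ∈ Q.support, Q x * grad (fun ζ => cterm ζ x) ζ i :=
    funext fun i => grad_ceval (fun x hx g hg => hω g ((hQ x hx).den g hg)) i
  rw [eQ, pb_sum_right]
  refine Finset.sum_congr rfl fun x hx => ?_
  have gx := hQ x (Finsupp.mem_support_iff.1 hx)
  rw [pb_mul_right, pb_action_cterm f (fun g hg => hω g (gx.den g hg)) gx.modes]

end Complexification

/-! ### Reality of formal rational fractions -/

section Reality

/-- Conjugation of the index of an elementary fraction. -/
def barX (x : MultiIndex × List MultiIndex) : MultiIndex × List MultiIndex :=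
  (MultiIndex.bar x.1, x.2.map MultiIndex.bar)

lemma barX_barX (x : MultiIndex × List MultiIndex) : barX (barX x) = x := by
  obtain ⟨j, h⟩ := x
  simp [barX, MultiIndex.bar_bar, Function.comp_def]

lemma barX_injective : Function.Injective barX := fun x y h => by
  rw [← barX_barX x, h, barX_barX]

/-- Complex conjugation of formal rational fractions. -/
def conjQ : RatCoeff →+ RatCoeff :=
  (Finsupp.mapRange.addMonoidHom (starRingEnd ℂ : ℂ →+ ℂ)).comp
    (Finsupp.mapDomain.addMonoidHom barX)

lemma conjQ_apply (Q : RatCoeff) (x : MultiIndex × List MultiIndex) :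
    conjQ Q (barX x) = (starRingEnd ℂ) (Q x) := by
  simp only [conjQ, AddMonoidHom.comp_apply, Finsupp.mapRange.addMonoidHom_apply,
    Finsupp.mapDomain.addMonoidHom_apply, Finsupp.mapRange_apply]
  rw [Finsupp.mapDomain_apply barX_injective]
  rfl

lemma conjQ_single (x : MultiIndex × List MultiIndex) (c : ℂ) :
    conjQ (Finsupp.single x c) = Finsupp.single (barX x) ((starRingEnd ℂ) c) := by
  simp [conjQ, Finsupp.mapDomain_single, Finsupp.mapRange_single]

lemma conjQ_smul (c : ℂ) (Q : RatCoeff) : conjQ (c • Q) = (starRingEnd ℂ) c • conjQ Q := by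
  ext x
  rw [← barX_barX x, conjQ_apply, Finsupp.smul_apply, Finsupp.smul_apply, conjQ_apply]
  simp

lemma sum_conjQ {N : Type*} [AddCommMonoid N] (Q : RatCoeff)
    (F : MultiIndex × List MultiIndex → ℂ → N) (hF : ∀ x, F x 0 = 0) :
    (conjQ Q).sum F = Q.sum fun x c => F (barX x) ((starRingEnd ℂ) c) := by
  simp only [conjQ, AddMonoidHom.comp_apply, Finsupp.mapRange.addMonoidHom_apply,
    Finsupp.mapDomain.addMonoidHom_apply]
  rw [Finsupp.sum_mapRange_index hF, Finsupp.sum_mapDomain_index_inj barX_injective]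
  rfl

/-- The formal rational fraction is real. -/
def RatReal (Q : RatCoeff) : Prop := conjQ Q = Q

lemma RatReal.reality {Q : RatCoeff} (h : RatReal Q) (x : MultiIndex × List MultiIndex) :
    (starRingEnd ℂ) (Q x) = Q (barX x) := by
  rw [← conjQ_apply, h]

lemma RatReal.of_reality {Q : RatCoeff} (h : ∀ x, (starRingEnd ℂ) (Q x) = Q (barX x)) :
    RatReal Q := by
  refine Finsupp.ext fun x => ?_
  rw [← barX_barX x, conjQ_apply, h]

lemma RatReal.sub {P Q : RatCoeff} (hP : RatReal P) (hQ : RatReal Q) : RatReal (P - Q) := by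
  rw [RatReal, map_sub, hP, hQ]

lemma RatReal.sum {ι : Type*} (t : Finset ι) {P : ι → RatCoeff} (h : ∀ i ∈ t, RatReal (P i)) :
    RatReal (∑ i ∈ t, P i) := by
  rw [RatReal, map_sum]
  exact Finset.sum_congr rfl h

lemma RatReal.smul {P : RatCoeff} (hP : RatReal P) {c : ℂ} (hc : (starRingEnd ℂ) c = c) :
    RatReal (c • P) := by
  rw [RatReal, conjQ_smul, hP, hc]

/-- This sign justifies the factor i of i/ω_h: since ω changes sign under h ↦ h̄ and is real on the
phase space, complex conjugation of i/ω_h is the passage to h̄. -/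
lemma pot_bar (h : MultiIndex) (a : ℤ) : pot (MultiIndex.bar h) a = -pot h a := by
  induction h with
  | nil => simp [pot, MultiIndex.bar]
  | cons i h ih =>
    have e : ∀ (i : Idx) (h : MultiIndex), pot (i :: h) a =
      ((i.1 : ℤ) : ℝ) * (if a = i.2 then 0 else 1 / ((a : ℝ) - (i.2 : ℝ)) ^ 2) + pot h a :=
      fun i h => by simp [pot]
    rw [MultiIndex.bar, List.map_cons, ← MultiIndex.bar, e, e, ih]
    by_cases hi : a = i.2
    · simp [Idx.bar, hi]
    · simp only [Idx.bar, hi, if_false, Units.val_neg, Int.cast_neg]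
      ring

lemma coupling_bar (h k : MultiIndex) :
    coupling (MultiIndex.bar h) (MultiIndex.bar k) = coupling h k := by
  simp only [coupling, MultiIndex.bar, List.map_map]
  congr 2
  funext i
  have := pot_bar h i.2
  rw [MultiIndex.bar] at this
  simp [Idx.bar, this]

lemma conjQ_brBasis (x y : MultiIndex × List MultiIndex) :
    conjQ (brBasis x y) = brBasis (barX x) (barX y) := by
  have hl : ∀ x : MultiIndex × List MultiIndex, x.1.length = (barX x).1.length := fun x =>
    (length_bar x.1).symm
  have hget : ∀ (x : MultiIndex × List MultiIndex) (α : Fin x.1.length),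
      (barX x).1[finCongr (hl x) α] = Idx.bar x.1[α] := fun x α => by
    simp [barX, MultiIndex.bar]
    rfl
  have hbar : ∀ i k : Idx, (Idx.bar i = Idx.bar k) ↔ i = k := fun i k =>
    ⟨fun h => by rw [← bar_bar i, h, bar_bar], fun h => by rw [h]⟩
  rw [brBasis, brBasis, map_sub, map_add, map_sum]
  congr 1
  · congr 1
    · rw [← (finCongr (hl x)).sum_comp]
      refine Finset.sum_congr rfl fun α _ => ?_
      rw [map_sum, ← (finCongr (hl y)).sum_comp]
      refine Finset.sum_congr rfl fun β _ => ?_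
      rw [hget, hget]
      simp only [hbar]
      split_ifs
      · rw [conjQ_single]
        congr 1
        · simp [barX, MultiIndex.bar, List.eraseIdx_map]
          rfl
        · simp [Idx.bar]
      · simp
    · rw [map_list_sum, barX, barX]
      simp only [List.map_map]
      congr 2
      funext h
      simp only [Function.comp_apply, conjQ_single, coupling_bar, Complex.conj_ofReal]
      simp [barX, MultiIndex.bar]
  · rw [map_list_sum, barX, barX]
    simp only [List.map_map]
    congr 2
    funext h
    simp only [Function.comp_apply, conjQ_single, coupling_bar, Complex.conj_ofReal]
    simp [barX, MultiIndex.bar]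

lemma RatReal.br {P Q : RatCoeff} (hP : RatReal P) (hQ : RatReal Q) : RatReal (br P Q) := by
  have e : ∀ P Q : RatCoeff, SchrodingerPoisson.br P Q =
      P.sum fun x a => Q.sum fun y b => (a * b) • brBasis x y := fun _ _ => rfl
  have h : conjQ (SchrodingerPoisson.br P Q) = SchrodingerPoisson.br (conjQ P) (conjQ Q) := by
    rw [e, e, sum_conjQ _ _ (by simp [Finsupp.sum]), Finsupp.sum, map_sum, Finsupp.sum]
    refine Finset.sum_congr rfl fun x _ => ?_
    rw [sum_conjQ _ _ (by simp), Finsupp.sum, map_sum, Finsupp.sum]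
    refine Finset.sum_congr rfl fun y _ => ?_
    rw [conjQ_smul, conjQ_brBasis, map_mul]
  rw [RatReal, h, hP, hQ]

variable {M : ℝ}

lemma cterm_barX (z : GM M) (x : MultiIndex × List MultiIndex) :
    cterm (cx z) (barX x) = (starRingEnd ℂ) (cterm (cx z) x) := by
  have h1 : ∀ j : MultiIndex, cmon (cx z) (MultiIndex.bar j) = (starRingEnd ℂ) (cmon (cx z) j) := by
    intro j
    rw [cmon, cmon, MultiIndex.bar, List.map_map, map_list_prod, List.map_map]
    congr 2
    funext i
    simp only [Function.comp_apply, cext_cx, coord, Idx.bar]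
    rcases Int.units_eq_one_or i.1 with h | h <;> simp [h]
  have h2 : ∀ h : List MultiIndex, cden (cx z) (h.map MultiIndex.bar) =
      (starRingEnd ℂ) (cden (cx z) h) := by
    intro h
    rw [cden, cden, List.map_map, map_list_prod, List.map_map]
    congr 2
    funext g
    have : comega (MultiIndex.bar g) (cx z) = -comega g (cx z) := by
      rw [comega, comega, quad, quad, ← Finset.sum_neg_distrib]
      exact Finset.sum_congr rfl fun a _ => by rw [pot_bar]; push_cast; ring
    rw [Function.comp_apply, Function.comp_apply, this, comega_cx]
    simp [div_neg, neg_div]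
  rw [cterm, cterm, barX, h1, h2, map_mul]

lemma RatReal.conj_ceval {Q : RatCoeff} (hQ : RatReal Q) (z : GM M) :
    (starRingEnd ℂ) (ceval Q (cx z)) = ceval Q (cx z) := by
  have e : ∀ Q : RatCoeff, ceval Q (cx z) = Q.sum fun x c => c * cterm (cx z) x := fun _ => rfl
  conv_rhs => rw [← show conjQ Q = Q from hQ]
  rw [e, e, sum_conjQ _ _ (by simp), Finsupp.sum, map_sum, Finsupp.sum]
  refine Finset.sum_congr rfl fun x _ => ?_
  rw [cterm_barX, map_mul]

/-- The function on the phase space defined by a formal rational fraction. -/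
def rfun (Q : RatCoeff) (z : GM M) : ℝ := (ceval Q (cx z)).re

end Reality

/-! ### Real functions and their complexifications -/

section Restriction

variable {M : ℝ}

/-- `f` is the restriction of `F` to the real phase space. -/
def IsRestr (f : GM M → ℝ) (F : CV M → ℂ) : Prop := ∀ z, ((f z : ℝ) : ℂ) = F (cx z)

lemma RatReal.isRestr {Q : RatCoeff} (hQ : RatReal Q) : IsRestr (M := M) (rfun Q) (ceval Q) :=
  fun z => Complex.conj_eq_iff_re.1 (hQ.conj_ceval z)

lemma IsRestr.contDiffAt {f : GM M → ℝ} {F : CV M → ℂ} (h : IsRestr f F) {n : WithTop ℕ∞}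
    {z : GM M} (hF : ContDiffAt ℂ n F (cx z)) : ContDiffAt ℝ n f z := by
  have e : f = fun z => (F (cx z)).re := funext fun z => by rw [← h z, Complex.ofReal_re]
  rw [e]
  have h1 : ContDiffAt ℝ n (fun z : GM M => F (cx z)) z :=
    (hF.restrict_scalars ℝ).comp z (cx (M := M)).contDiff.contDiffAt
  exact Complex.reCLM.contDiff.contDiffAt.comp z h1

/-- The function z ↦ F(z, z̄) equals its real part, so its two expressions have the same derivative;
thus the complex differential is real on vectors of the real phase space. -/
lemma IsRestr.fderiv_eq {f : GM M → ℝ} {F : CV M → ℂ} (h : IsRestr f F) {z : GM M}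
    (hF : DifferentiableAt ℂ F (cx z)) (v : GM M) :
    ((fderiv ℝ f z v : ℝ) : ℂ) = fderiv ℂ F (cx z) (cx v) := by
  have h1 : HasFDerivAt (fun z : GM M => F (cx z))
      (((fderiv ℂ F (cx z)).restrictScalars ℝ).comp cx) z :=
    (hF.hasFDerivAt.restrictScalars ℝ).comp z (cx (M := M)).hasFDerivAt
  have e : f = fun z => (F (cx z)).re := funext fun z => by rw [← h z, Complex.ofReal_re]
  have h2 : HasFDerivAt f (Complex.reCLM.comp (((fderiv ℂ F (cx z)).restrictScalars ℝ).comp cx)) z := by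
    rw [e]
    exact Complex.reCLM.hasFDerivAt.comp z h1
  have h3 : HasFDerivAt (fun z : GM M => F (cx z)) (Complex.ofRealCLM.comp
      (Complex.reCLM.comp (((fderiv ℂ F (cx z)).restrictScalars ℝ).comp cx))) z := by
    have := Complex.ofRealCLM.hasFDerivAt.comp z h2
    refine this.congr_of_eventuallyEq (Filter.Eventually.of_forall fun y => ?_)
    exact (h y).symm
  have := congrArg (fun L => L v) (h1.unique h3)
  rw [h2.fderiv]
  simpa using this.symm

lemma cx_single_one (a : Modes M) :
    cx (Pi.single a (1 : ℂ) : GM M) = Pi.single (1, a) 1 + Pi.single (-1, a) 1 := by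
  funext ⟨d, b⟩
  rcases Int.units_eq_one_or d with rfl | rfl
  · rw [cx_one]; simp [Pi.single_apply]
  · rw [cx_neg_one]
    simp only [Pi.single_apply, Pi.add_apply, Prod.mk.injEq, true_and]
    split_ifs <;> simp_all

lemma cx_single_I (a : Modes M) : cx (Pi.single a Complex.I : GM M) =
    Complex.I • Pi.single (1, a) 1 - Complex.I • Pi.single (-1, a) 1 := by
  funext ⟨d, b⟩
  rcases Int.units_eq_one_or d with rfl | rfl
  · rw [cx_one]; simp [Pi.single_apply]
  · rw [cx_neg_one]
    simp only [Pi.single_apply, Pi.sub_apply, Pi.smul_apply, Prod.mk.injEq, true_and]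
    split_ifs <;> simp_all

lemma IsRestr.grad_eq {f : GM M → ℝ} {F : CV M → ℂ} (h : IsRestr f F) {z : GM M}
    (hF : DifferentiableAt ℂ F (cx z)) (a : Modes M) :
    ((fderiv ℝ f z (Pi.single a 1) : ℝ) : ℂ) = grad F (cx z) (1, a) + grad F (cx z) (-1, a) ∧
    ((fderiv ℝ f z (Pi.single a Complex.I) : ℝ) : ℂ) =
      Complex.I * (grad F (cx z) (1, a) - grad F (cx z) (-1, a)) := by
  rw [h.fderiv_eq hF, h.fderiv_eq hF, cx_single_one, cx_single_I]
  simp [grad]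
  ring

lemma IsRestr.hamVF_apply {f : GM M → ℝ} {F : CV M → ℂ} (h : IsRestr f F) {z : GM M}
    (hF : DifferentiableAt ℂ F (cx z)) (a : Modes M) :
    hamVF f z a = Complex.I * grad F (cx z) (-1, a) := by
  obtain ⟨h1, h2⟩ := h.grad_eq hF a
  rw [hamVF, h1, h2]
  linear_combination (Complex.I * (grad F (cx z) (1, a) - grad F (cx z) (-1, a))) / 2 * Complex.I_sq

lemma IsRestr.conj_grad {f : GM M → ℝ} {F : CV M → ℂ} (h : IsRestr f F) {z : GM M}
    (hF : DifferentiableAt ℂ F (cx z)) (a : Modes M) :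
    (starRingEnd ℂ) (grad F (cx z) (-1, a)) = grad F (cx z) (1, a) := by
  obtain ⟨h1, h2⟩ := h.grad_eq hF a
  have e1 : grad F (cx z) (-1, a) = (((fderiv ℝ f z (Pi.single a 1) : ℝ) : ℂ) +
      Complex.I * ((fderiv ℝ f z (Pi.single a Complex.I) : ℝ) : ℂ)) / 2 := by
    rw [h1, h2]
    linear_combination -(grad F (cx z) (1, a) - grad F (cx z) (-1, a)) / 2 * Complex.I_sq
  have e2 : grad F (cx z) (1, a) = (((fderiv ℝ f z (Pi.single a 1) : ℝ) : ℂ) -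
      Complex.I * ((fderiv ℝ f z (Pi.single a Complex.I) : ℝ) : ℂ)) / 2 := by
    rw [h1, h2]
    linear_combination (grad F (cx z) (1, a) - grad F (cx z) (-1, a)) / 2 * Complex.I_sq
  rw [e1, e2]
  simp [map_ofNat]
  ring

lemma sum_units_prod (u : ℤˣ × Modes M → ℂ) :
    ∑ i, u i = ∑ a : Modes M, (u (1, a) + u (-1, a)) := by
  rw [Fintype.sum_prod_type, show (Finset.univ : Finset ℤˣ) = {1, -1} from rfl,
    Finset.sum_pair (by decide), Finset.sum_add_distrib]

/-- The derivative along a Hamiltonian vector field is a Poisson bracket. -/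
lemma IsRestr.fderiv_hamVF {f χ : GM M → ℝ} {F Χ : CV M → ℂ} (h : IsRestr f F) (hχ : IsRestr χ Χ)
    {z : GM M} (hF : DifferentiableAt ℂ F (cx z)) (hΧ : DifferentiableAt ℂ Χ (cx z)) :
    ((fderiv ℝ f z (hamVF χ z) : ℝ) : ℂ) = pb (grad F (cx z)) (grad Χ (cx z)) := by
  rw [h.fderiv_eq hF, fderiv_eq_sum_grad, pb, sum_units_prod, sum_units_prod, Finset.mul_sum]
  refine Finset.sum_congr rfl fun a _ => ?_
  rw [cx_one, cx_neg_one, hχ.hamVF_apply hΧ, map_mul, hχ.conj_grad hΧ, Complex.conj_I]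
  simp [cbar]
  ring

/-- The Hamiltonian vector field is the symplectic gradient. -/
lemma fderiv_eq_l2inner (f : GM M → ℝ) (z v : GM M) :
    fderiv ℝ f z v = -2 * l2inner (Complex.I • hamVF f z) v := by
  have hv : v = ∑ a : Modes M, ((v a).re • (Pi.single a (1 : ℂ) : GM M) +
      (v a).im • (Pi.single a Complex.I : GM M)) := by
    funext b
    rw [Finset.sum_apply, Finset.sum_eq_single b]
    · simp [Complex.re_add_im]
    · intro a _ hab
      simp [hab.symm]
    · simp
  conv_lhs => rw [hv]
  rw [map_sum, l2inner, Complex.re_sum, Finset.mul_sum]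
  refine Finset.sum_congr rfl fun a _ => ?_
  rw [map_add, map_smul, map_smul]
  simp [hamVF]
  ring

lemma contDiffAt_hamVF {f : GM M → ℝ} {z : GM M} (hf : ContDiffAt ℝ ∞ f z) :
    ContDiffAt ℝ ∞ (hamVF f) z := by
  have h : ContDiffAt ℝ ∞ (fderiv ℝ f) z := hf.fderiv_right (m := ∞) (by simp)
  have h1 : ∀ v : GM M, ContDiffAt ℝ ∞ (fun z => ((fderiv ℝ f z v : ℝ) : ℂ)) z := fun v =>
    Complex.ofRealCLM.contDiff.contDiffAt.comp z (h.clm_apply contDiffAt_const)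
  refine contDiffAt_pi.2 fun a => ?_
  exact (contDiffAt_const.mul ((h1 _).add (contDiffAt_const.mul (h1 _)))).div_const _

lemma l2inner_eq_sum (u v : GM M) :
    l2inner u v = ∑ a, ((u a).re * (v a).re + (u a).im * (v a).im) := by
  rw [l2inner, Complex.re_sum]
  refine Finset.sum_congr rfl fun a _ => ?_
  simp

lemma l2inner_I_antisymm (u v : GM M) :
    l2inner (Complex.I • u) v = -l2inner (Complex.I • v) u := by
  rw [l2inner_eq_sum, l2inner_eq_sum, ← Finset.sum_neg_distrib]
  refine Finset.sum_congr rfl fun a _ => ?_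
  simp
  ring

/-- `u ↦ (i u, v)` as a continuous linear form. -/
def sympForm (v : GM M) : GM M →L[ℝ] ℝ :=
  ∑ a : Modes M, ((v a).im • Complex.reCLM - (v a).re • Complex.imCLM).comp
    (ContinuousLinearMap.proj a)

lemma sympForm_apply (u v : GM M) : sympForm v u = l2inner (Complex.I • u) v := by
  rw [l2inner_eq_sum, sympForm]
  simp only [sum_apply]
  refine Finset.sum_congr rfl fun a _ => ?_
  simp
  ring

/-- The linearization of a Hamiltonian vector field is an infinitesimal symplectic map. -/
lemma l2inner_fderiv_hamVF {χ : GM M → ℝ} {y : GM M} (h : ContDiffAt ℝ ∞ χ y) (v w : GM M) :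
    l2inner (Complex.I • fderiv ℝ (hamVF χ) y v) w +
      l2inner (Complex.I • v) (fderiv ℝ (hamVF χ) y w) = 0 := by
  have hX : DifferentiableAt ℝ (hamVF χ) y := (contDiffAt_hamVF h).differentiableAt (by simp)
  have hd : DifferentiableAt ℝ (fderiv ℝ χ) y :=
    (h.fderiv_right (m := ∞) (by simp)).differentiableAt (by simp)
  -- Differentiating dχ(y)w = -2 (iX(y), w) in y expresses the Hessian of χ through DX; the claim is
  -- then the symmetry of the Hessian.
  have key : ∀ v w : GM M, fderiv ℝ (fderiv ℝ χ) y v w =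
      -2 * l2inner (Complex.I • fderiv ℝ (hamVF χ) y v) w := by
    intro v w
    have h1 : HasFDerivAt (fun y => fderiv ℝ χ y w)
        ((fderiv ℝ (fderiv ℝ χ) y).flip w) y := by
      have := hd.hasFDerivAt.clm_apply (hasFDerivAt_const w y)
      simpa using this
    have h2 : HasFDerivAt (fun y => fderiv ℝ χ y w)
        ((-2 : ℝ) • (sympForm w).comp (fderiv ℝ (hamVF χ) y)) y := by
      have := ((sympForm w).hasFDerivAt.comp y hX.hasFDerivAt).const_mul (-2 : ℝ)
      refine this.congr_of_eventuallyEq (Filter.Eventually.of_forall fun y => ?_)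
      simp only [Function.comp_apply]
      rw [fderiv_eq_l2inner, sympForm_apply]
    have := congrArg (fun L => L v) (h1.unique h2)
    simpa [sympForm_apply] using this
  have hs : IsSymmSndFDerivAt ℝ χ y := h.isSymmSndFDerivAt (by simp; exact WithTop.coe_le_coe.2 (le_top (a := (2 : ℕ∞))))
  have h1 := key v w
  have h2 := key w v
  have h3 := hs.eq v w
  rw [l2inner_I_antisymm v]
  linarith

end Restriction

/-! ### The integrable Hamiltonian and its homological equation -/

section Homological

open Classical in
/-- The solution `χ` of `{L₄, χ} = -Q_nonint`. -/
def homQ (Q : RatCoeff) : RatCoeff :=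
  -Q.sum fun x c => if x.1 ∈ nonIntegrableSet then Finsupp.single (x.1, x.1 :: x.2) c else 0

open Classical in
/-- The part of a rational fraction which does not depend only on the actions. -/
def nonint (Q : RatCoeff) : RatCoeff := Q.filter fun x => x.1 ∈ nonIntegrableSet

open Classical in
/-- The integrable part of a rational fraction. -/
def intPart (Q : RatCoeff) : RatCoeff := Q.filter fun x => x.1 ∉ nonIntegrableSet

lemma intPart_add_nonint (Q : RatCoeff) : intPart Q + nonint Q = Q := by
  classical
  rw [add_comm]; exact Finsupp.filter_add_filter_not Q _

lemma RatClass.nonint {M : ℝ} {s q n : ℕ} {Q : RatCoeff} (h : RatClass M s q n Q) :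
    RatClass M s q n (nonint Q) := fun x hx => h x fun h0 => hx (by
  classical
  rw [SchrodingerPoisson.nonint, Finsupp.filter_apply, h0, ite_self])

lemma RatClass.intPart {M : ℝ} {s q n : ℕ} {Q : RatCoeff} (h : RatClass M s q n Q) :
    RatClass M s q n (intPart Q) := fun x hx => h x fun h0 => hx (by
  classical
  rw [SchrodingerPoisson.intPart, Finsupp.filter_apply, h0, ite_self])

lemma RatClass.neg {M : ℝ} {s q n : ℕ} {Q : RatCoeff} (h : RatClass M s q n Q) :
    RatClass M s q n (-Q) := fun x hx => h x (by simpa using hx)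

/-- A numerator becomes a denominator: the order drops by one, the count rises by one, and the new
denominator has length at most 2(q+1)+2n. -/
lemma RatClass.homQ {M : ℝ} {s q n : ℕ} {Q : RatCoeff} (h : RatClass M s (q + 1) n Q)
    (hs : 2 * (q + 1) + 2 * n ≤ s) : RatClass M s q (n + 1) (homQ Q) := by
  refine RatClass.neg (RatClass.sum _ fun x hx => ?_)
  have g := h x (Finsupp.mem_support_iff.1 hx)
  beta_reduce
  split_ifs with hN
  · refine RatClass.single (x := (x.1, x.1 :: x.2)) ⟨?_, ?_, g.mass, g.momentum, g.energy, g.modes, ?_⟩ _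
    · have := g.len
      simp only [List.length_cons]; omega
    · have := g.cnt
      simp only [List.length_cons]; omega
    · intro k hk
      rcases List.mem_cons.1 hk with rfl | hk
      · refine ⟨hN, ?_, g.modes⟩
        have := g.len
        have := g.cnt
        omega
      · exact g.den k hk
  · exact RatClass.zero _ _ _ _

lemma bar_mem_nonIntegrableSet {j : MultiIndex} :
    MultiIndex.bar j ∈ nonIntegrableSet ↔ j ∈ nonIntegrableSet := by
  have h : ∀ j : MultiIndex, j ∈ nonIntegrableSet → MultiIndex.bar j ∈ nonIntegrableSet := by
    rintro j ⟨⟨m, hm, hj⟩, hi⟩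
    refine ⟨⟨m, hm, ⟨by rw [length_bar]; exact hj.1.1, ?_, ?_⟩, ?_⟩, fun hp => hi ?_⟩
    · rw [moment_bar, hj.1.2.1, neg_zero]
    · rw [moment_bar, hj.1.2.2, neg_zero]
    · rw [moment_bar, hj.2, neg_zero]
    · have hp' : (MultiIndex.bar (MultiIndex.bar j)).Perm (MultiIndex.bar j) := hp
      rw [MultiIndex.bar_bar] at hp'
      exact hp'.symm
  exact ⟨fun hj => MultiIndex.bar_bar j ▸ h _ hj, h j⟩

lemma RatReal.homQ {Q : RatCoeff} (h : RatReal Q) : RatReal (homQ Q) := by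
  classical
  have : conjQ (SchrodingerPoisson.homQ Q) = SchrodingerPoisson.homQ (conjQ Q) := by
    rw [SchrodingerPoisson.homQ, SchrodingerPoisson.homQ, map_neg, sum_conjQ _ _ (by simp),
      Finsupp.sum, map_sum, Finsupp.sum]
    congr 1
    refine Finset.sum_congr rfl fun x _ => ?_
    have e : (barX x).1 ∈ nonIntegrableSet ↔ x.1 ∈ nonIntegrableSet := bar_mem_nonIntegrableSet
    by_cases hx : x.1 ∈ nonIntegrableSet
    · rw [if_pos hx, if_pos (e.2 hx), conjQ_single]
      rfl
    · rw [if_neg hx, if_neg fun h => hx (e.1 h), map_zero]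
  rw [RatReal, this, h]

lemma RatReal.nonint {Q : RatCoeff} (h : RatReal Q) : RatReal (nonint Q) := by
  classical
  refine RatReal.of_reality fun x => ?_
  have e : (barX x).1 ∈ nonIntegrableSet ↔ x.1 ∈ nonIntegrableSet := bar_mem_nonIntegrableSet
  rw [SchrodingerPoisson.nonint, Finsupp.filter_apply, Finsupp.filter_apply, ← h.reality]
  simp only [e]
  split_ifs <;> simp

lemma RatReal.intPart {Q : RatCoeff} (h : RatReal Q) : RatReal (intPart Q) := by
  have : SchrodingerPoisson.intPart Q = Q - SchrodingerPoisson.nonint Q := eq_sub_of_add_eq (intPart_add_nonint Q)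
  rw [this]
  exact h.sub h.nonint

lemma colNorm_neg (Q : RatCoeff) (j : MultiIndex) : colNorm (-Q) j = colNorm Q j := by
  simp [colNorm]

lemma colNorm_homQ_le (Q : RatCoeff) (j : MultiIndex) : colNorm (homQ Q) j ≤ colNorm Q j := by
  rw [homQ, colNorm_neg]
  refine (colNorm_sum_le _ _ j).trans (Finset.sum_le_sum fun x _ => ?_)
  beta_reduce
  split_ifs with h1 h2 h2
  · rw [colNorm_single, if_pos h2]
  · rw [colNorm_single, if_neg h2]
  · rw [colNorm_zero]; positivity
  · rw [colNorm_zero]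

lemma colNorm_nonint_le (Q : RatCoeff) (j : MultiIndex) : colNorm (nonint Q) j ≤ colNorm Q j := by
  classical
  rw [colNorm_eq_of_subset (t := Q.support)]
  · refine Finset.sum_le_sum fun x _ => ?_
    rw [nonint, Finsupp.filter_apply]
    split_ifs <;> simp
  · rw [nonint, Finsupp.support_filter]
    exact Finset.filter_subset _ _

variable {M : ℝ}

/-- The interaction potential. -/
def fpot (a b : ℤ) : ℂ := if a = b then 0 else 1 / ((a : ℂ) - (b : ℂ)) ^ 2

lemma fpot_comm (a b : ℤ) : fpot a b = fpot b a := by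
  by_cases h : a = b
  · rw [h]
  · rw [fpot, fpot, if_neg h, if_neg (Ne.symm h)]
    congr 1
    ring

/-- The frequencies of the Hamiltonian `L₄`. -/
def freq (ζ : CV M) (a : ℤ) : ℂ := quad (fpot a) ζ

lemma sum_sign_freq (ζ : CV M) (j : MultiIndex) :
    (j.map fun i => ((i.1 : ℤ) : ℂ) * freq ζ i.2).sum = comega j ζ := by
  induction j with
  | nil => simp [comega, quad, pot]
  | cons i j ih =>
    rw [List.map_cons, List.sum_cons, ih, comega, comega, freq, quad, quad, quad, Finset.mul_sum,
      ← Finset.sum_add_distrib]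
    refine Finset.sum_congr rfl fun a _ => ?_
    have e : pot (i :: j) a = ((i.1 : ℤ) : ℝ) *
      (if (a : ℤ) = i.2 then 0 else 1 / (((a : ℤ) : ℝ) - (i.2 : ℝ)) ^ 2) + pot j a := by simp [pot]
    rw [e, fpot_comm, fpot]
    split_ifs <;> push_cast <;> ring

/-- The complexification of `L₂`. -/
def cL2 : CV M → ℂ := quad fun a => (a : ℂ) ^ 2

/-- The complexification of `L₄`. -/
def cL4 (ζ : CV M) : ℂ := ∑ a : Modes M,
  (1 / 2 * quad (fun b => if b = a then 1 else 0) ζ) * quad (fpot a) ζ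

lemma isRestr_L2 : IsRestr (M := M) L2 cL2 := fun z => by
  rw [L2, cL2, quad]
  push_cast
  refine Finset.sum_congr rfl fun a _ => ?_
  rw [cx_one, cx_neg_one, Complex.mul_conj, Complex.normSq_eq_norm_sq]
  push_cast
  rfl

lemma quad_delta (a : Modes M) (ζ : CV M) :
    quad (fun b => if b = (a : ℤ) then 1 else 0) ζ = ζ (1, a) * ζ (-1, a) := by
  rw [quad, Finset.sum_eq_single a]
  · simp
  · intro b _ hb
    simp [Subtype.coe_injective.ne hb]
  · simp

lemma isRestr_L4 : IsRestr (M := M) L4 cL4 := fun z => by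
  rw [L4, cL4]
  push_cast
  refine Finset.sum_congr rfl fun a _ => ?_
  rw [quad_delta, quad, Finset.mul_sum]
  refine Finset.sum_congr rfl fun b _ => ?_
  rw [cx_one, cx_neg_one, cx_one, cx_neg_one, Complex.mul_conj, Complex.normSq_eq_norm_sq,
    Complex.mul_conj, Complex.normSq_eq_norm_sq, fpot]
  by_cases h : a = b
  · simp [h]
  · rw [if_neg h, if_neg (Subtype.coe_injective.ne h)]
    push_cast
    rw [div_mul_eq_mul_div, mul_div_assoc]
    field_simp

lemma contDiff_cL2 {n : WithTop ℕ∞} : ContDiff ℂ n (cL2 (M := M)) := contDiff_quad _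

lemma contDiff_cL4 {n : WithTop ℕ∞} : ContDiff ℂ n (cL4 (M := M)) := by
  unfold cL4
  exact ContDiff.sum fun a _ => (contDiff_const.mul (contDiff_quad _)).mul (contDiff_quad _)

/-- By symmetry of the potential, differentiating either factor of the double sum gives the same
result, which cancels the factor 1/2. The gradient is that of an action function with frequencies
`freq`. -/
lemma grad_cL4 (ζ : CV M) (i : ℤˣ × Modes M) : grad cL4 ζ i = ζ (cbar i) * freq ζ i.2 := by
  have hd : ∀ f : ℤ → ℂ, DifferentiableAt ℂ (quad (M := M) f) ζ := fun f =>
    (contDiff_quad (n := 1) f).differentiable one_ne_zero ζ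
  have hd' : ∀ a : Modes M, DifferentiableAt ℂ (fun ζ : CV M =>
      (1 / 2 * quad (fun b => if b = (a : ℤ) then 1 else 0) ζ)) ζ := fun a => (hd _).const_mul _
  have h1 : grad cL4 ζ i = ∑ a : Modes M, grad (fun ζ : CV M =>
      (1 / 2 * quad (fun b => if b = (a : ℤ) then 1 else 0) ζ) * quad (fpot a) ζ) ζ i := by
    unfold grad cL4
    have : HasFDerivAt (fun ζ : CV M => ∑ a : Modes M,
        (1 / 2 * quad (fun b => if b = (a : ℤ) then 1 else 0) ζ) * quad (fpot a) ζ) _ ζ :=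
      HasFDerivAt.fun_sum fun a _ =>
        ((hd' a).fun_mul (hd (fpot a)) : DifferentiableAt ℂ _ ζ).hasFDerivAt
    rw [this.fderiv, sum_apply]
  have h2 : ∀ a : Modes M, grad (fun ζ : CV M =>
      (1 / 2 * quad (fun b => if b = (a : ℤ) then 1 else 0) ζ) * quad (fpot a) ζ) ζ i =
      1 / 2 * ζ (cbar i) * (fpot i.2 a * (ζ (1, a) * ζ (-1, a))) +
      (if i.2 = a then 1 / 2 * ζ (cbar i) * freq ζ i.2 else 0) := by
    intro a
    have e : grad (fun ζ : CV M => (1 / 2 : ℂ) * quad (fun b => if b = (a : ℤ) then 1 else 0) ζ) ζ i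
        = 1 / 2 * (ζ (cbar i) * if (i.2 : ℤ) = a then 1 else 0) := by
      rw [← grad_quad (fun b => if b = (a : ℤ) then 1 else 0), grad, grad,
        fderiv_const_mul (hd _)]
      rfl
    rw [grad_mul (hd' a) (hd _), e, grad_quad, quad_delta, fpot_comm, freq]
    by_cases h : i.2 = a
    · rw [if_pos h, if_pos (congrArg _ h), h]; ring
    · rw [if_neg h, if_neg (Subtype.coe_injective.ne h)]; ring
  rw [h1, Finset.sum_congr rfl fun a _ => h2 a, Finset.sum_add_distrib, ← Finset.mul_sum,
    Finset.sum_ite_eq, if_pos (Finset.mem_univ _)]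
  rw [show (∑ a : Modes M, fpot i.2 a * (ζ (1, a) * ζ (-1, a))) = freq ζ i.2 from rfl]
  ring

/-- The bracket multiplies each term by the energy of its numerator, which vanishes by resonance,
and denominators commute with L₂. -/
lemma pb_cL2 {s q n : ℕ} {Q : RatCoeff} (hQ : RatClass M s q n Q) {ζ : CV M}
    (hω : ∀ g ∈ nonIntegrableSetLE s M, comega g ζ ≠ 0) :
    pb (grad cL2 ζ) (grad (ceval Q) ζ) = 0 := by
  have e : grad cL2 ζ = fun i => ζ (cbar i) * ((fun a : ℤ => (a : ℂ) ^ 2) i.2) :=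
    funext fun i => grad_quad _ ζ i
  rw [e, pb_action_ceval hQ hω fun a : ℤ => (a : ℂ) ^ 2]
  refine Finset.sum_eq_zero fun x hx => ?_
  have g := (hQ x (Finsupp.mem_support_iff.1 hx)).energy
  have h : ∀ j : MultiIndex, (j.map fun i => ((i.1 : ℤ) : ℂ) * (i.2 : ℂ) ^ 2).sum =
      ((moment 2 j : ℤ) : ℂ) := by
    intro j
    induction j with
    | nil => simp [moment]
    | cons i j ih => rw [moment_cons, List.map_cons, List.sum_cons, ih]; push_cast; ring
  rw [h, g]
  simp

/-- The homological equation. -/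
lemma pb_cL4_homQ {s q n : ℕ} {Q : RatCoeff} (hQ : RatClass M s (q + 1) n Q)
    (hs : 2 * (q + 1) + 2 * n ≤ s) {ζ : CV M}
    (hω : ∀ g ∈ nonIntegrableSetLE s M, comega g ζ ≠ 0) :
    pb (grad cL4 ζ) (grad (ceval (homQ Q)) ζ) = -ceval (nonint Q) ζ := by
  classical
  have e : grad cL4 ζ = fun i => ζ (cbar i) * (freq ζ i.2) := funext fun i => grad_cL4 ζ i
  rw [e, pb_action_ceval (hQ.homQ hs) hω]
  have e1 : ∀ P : RatCoeff, (∑ x ∈ P.support, P x *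
      (-Complex.I * (x.1.map fun i => ((i.1 : ℤ) : ℂ) * freq ζ i.2).sum * cterm ζ x)) =
      Finsupp.linearCombination ℂ (fun x : MultiIndex × List MultiIndex =>
        -Complex.I * comega x.1 ζ * cterm ζ x) P := by
    intro P
    rw [Finsupp.linearCombination_apply, Finsupp.sum]
    refine Finset.sum_congr rfl fun x _ => ?_
    rw [sum_sign_freq, smul_eq_mul]
  rw [e1, homQ, map_neg, Finsupp.sum, map_sum, ceval_eq_linearCombination, nonint,
    Finsupp.filter_eq_sum, map_sum, Finset.sum_filter]
  congr 1
  refine Finset.sum_congr rfl fun x hx => ?_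
  have g := hQ x (Finsupp.mem_support_iff.1 hx)
  split_ifs with hN
  · have : comega x.1 ζ ≠ 0 := hω _ ⟨hN, by have := g.len; have := g.cnt; omega, g.modes⟩
    rw [Finsupp.linearCombination_single, Finsupp.linearCombination_single, cterm, cterm, cden_cons,
      smul_eq_mul, smul_eq_mul]
    field_simp
    linear_combination -(Q x * cden ζ x.2 * cmon ζ x.1) * Complex.I_sq
  · simp

end Homological

/-! ### Analytic bounds -/

section Bounds

/-- The Gevrey weight. -/
def wt (σ θ : ℝ) (a : ℤ) : ℝ := Real.exp (σ * |(a : ℝ)| ^ θ)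

lemma wt_pos (σ θ : ℝ) (a : ℤ) : 0 < wt σ θ a := Real.exp_pos _

variable {σ θ : ℝ}

lemma one_le_wt (hσ : 0 < σ) (a : ℤ) : 1 ≤ wt σ θ a := by
  rw [wt, Real.one_le_exp_iff]
  positivity

/-- Subadditivity of t ↦ t^θ for 0 < θ < 1. -/
lemma wt_add_le (hσ : 0 < σ) (hθ : 0 < θ) (hθ1 : θ < 1) (a b : ℤ) :
    wt σ θ (a + b) ≤ wt σ θ a * wt σ θ b := by
  rw [wt, wt, wt, ← Real.exp_add, Real.exp_le_exp, ← mul_add]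
  refine mul_le_mul_of_nonneg_left ?_ hσ.le
  refine le_trans ?_ (Real.rpow_add_le_add_rpow (abs_nonneg _) (abs_nonneg _) hθ.le hθ1.le)
  refine Real.rpow_le_rpow (abs_nonneg _) ?_ hθ.le
  push_cast
  exact abs_add_le _ _

lemma wt_sign_mul (d : ℤˣ) (a : ℤ) : wt σ θ ((d : ℤ) * a) = wt σ θ a := by
  rw [wt, wt, Int.cast_mul, abs_mul, abs_sign, one_mul]

lemma wt_moment_le (hσ : 0 < σ) (hθ : 0 < θ) (hθ1 : θ < 1) (k : MultiIndex) :
    wt σ θ (moment 1 k) ≤ (k.map fun i => wt σ θ i.2).prod := by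
  induction k with
  | nil => simp [moment, wt, Real.zero_rpow hθ.ne']
  | cons i k ih =>
    rw [moment_cons, List.map_cons, List.prod_cons, pow_one]
    refine (wt_add_le hσ hθ hθ1 _ _).trans ?_
    rw [wt_sign_mul]
    exact mul_le_mul_of_nonneg_left ih (wt_pos _ _ _).le

/-- At zero momentum one mode is, up to sign, the momentum of the others. The Gevrey weight of a
component of a gradient can thus be distributed over the remaining factors of the monomial. -/
lemma wt_getElem_le (hσ : 0 < σ) (hθ : 0 < θ) (hθ1 : θ < 1) {j : MultiIndex}
    (hj : moment 1 j = 0) (α : Fin j.length) :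
    wt σ θ (j[α]).2 ≤ ((j.eraseIdx α).map fun i => wt σ θ i.2).prod := by
  have h := moment_eraseIdx 1 j α
  rw [hj, pow_one, zero_sub] at h
  have h2 := wt_moment_le hσ hθ hθ1 (j.eraseIdx α)
  rw [h] at h2
  rwa [← neg_mul, ← Units.val_neg, wt_sign_mul] at h2

/-- Expanding the power produces all words of length n in the alphabet F, each once, and T consists
of such words. -/
lemma sum_list_prod_le {f : Idx → ℝ} (hf : ∀ i, 0 ≤ f i) (F : Finset Idx) (n : ℕ)
    (T : Finset MultiIndex) (hT : ∀ k ∈ T, k.length = n) (hF : ∀ k ∈ T, ∀ i ∈ k, i ∈ F) :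
    ∑ k ∈ T, (k.map f).prod ≤ (∑ i ∈ F, f i) ^ n := by
  classical
  have hsub : T ⊆ (Fintype.piFinset fun _ : Fin n => F).image List.ofFn := by
    intro k hk
    have hl := hT k hk
    subst hl
    refine Finset.mem_image.2 ⟨fun i => k[i], Fintype.mem_piFinset.2 fun i => ?_, List.ofFn_getElem⟩
    exact hF k hk _ (List.getElem_mem i.2)
  have hnn : ∀ k : MultiIndex, 0 ≤ (k.map f).prod := fun k => by
    refine List.prod_nonneg fun a ha => ?_
    obtain ⟨i, _, rfl⟩ := List.mem_map.1 ha
    exact hf i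
  refine (Finset.sum_le_sum_of_subset_of_nonneg hsub fun k _ _ => hnn k).trans ?_
  rw [Finset.sum_image fun a _ b _ h => List.ofFn_injective h, Finset.sum_pow']
  refine le_of_eq (Finset.sum_congr rfl fun p _ => ?_)
  rw [List.map_ofFn, List.prod_ofFn]
  rfl

variable {M : ℝ}

variable (σ θ) in
/-- The weighted norm on the complexified phase space. -/
def cnorm (ζ : CV M) : ℝ := ∑ i, wt σ θ i.2 * ‖ζ i‖

lemma sum_units_prod_real (u : ℤˣ × Modes M → ℝ) :
    ∑ i, u i = ∑ a : Modes M, (u (1, a) + u (-1, a)) := by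
  rw [Fintype.sum_prod_type, show (Finset.univ : Finset ℤˣ) = {1, -1} from rfl,
    Finset.sum_pair (by decide), Finset.sum_add_distrib]

lemma cnorm_cx (z : GM M) : cnorm σ θ (cx z) = gnorm σ θ z := by
  rw [cnorm, gnorm, sum_units_prod_real, Finset.mul_sum]
  refine Finset.sum_congr rfl fun a _ => ?_
  rw [cx_one, cx_neg_one, Complex.norm_conj, wt]
  ring

lemma cnorm_nonneg (ζ : CV M) : 0 ≤ cnorm σ θ ζ :=
  Finset.sum_nonneg fun _ _ => mul_nonneg (wt_pos _ _ _).le (norm_nonneg _)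

lemma cnorm_add_le (ζ ζ' : CV M) : cnorm σ θ (ζ + ζ') ≤ cnorm σ θ ζ + cnorm σ θ ζ' := by
  rw [cnorm, cnorm, cnorm, ← Finset.sum_add_distrib]
  refine Finset.sum_le_sum fun i _ => ?_
  rw [← mul_add]
  exact mul_le_mul_of_nonneg_left (norm_add_le _ _) (wt_pos _ _ _).le

lemma cnorm_smul (c : ℂ) (ζ : CV M) : cnorm σ θ (c • ζ) = ‖c‖ * cnorm σ θ ζ := by
  rw [cnorm, cnorm, Finset.mul_sum]
  refine Finset.sum_congr rfl fun i _ => ?_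
  rw [Pi.smul_apply, norm_smul]
  ring

lemma norm_le_cnorm (hσ : 0 < σ) (ζ : CV M) (i : ℤˣ × Modes M) : ‖ζ i‖ ≤ cnorm σ θ ζ := by
  refine le_trans ?_ (Finset.single_le_sum (f := fun i => wt σ θ i.2 * ‖ζ i‖)
    (fun i _ => mul_nonneg (wt_pos _ _ _).le (norm_nonneg _)) (Finset.mem_univ i))
  exact le_mul_of_one_le_left (norm_nonneg _) (one_le_wt hσ _)

lemma cnorm_eq_sum (ζ : CV M) : ∑ i ∈ (Finset.univ : Finset (ℤˣ × Modes M)).map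
    ⟨toIdx, toIdx_injective⟩, wt σ θ i.2 * ‖cext ζ i‖ = cnorm σ θ ζ := by
  rw [Finset.sum_map, cnorm]
  refine Finset.sum_congr rfl fun i _ => ?_
  rw [Function.Embedding.coeFn_mk, cext_toIdx]
  rfl

lemma sum_weighted_mon_le (ζ : CV M) (n : ℕ) (T : Finset MultiIndex)
    (hT : ∀ k ∈ T, k.length = n) (hF : ∀ k ∈ T, ModesLE M k) :
    ∑ k ∈ T, (k.map fun i => wt σ θ i.2).prod * ‖cmon ζ k‖ ≤ cnorm σ θ ζ ^ n := by
  have h := sum_list_prod_le (f := fun i => wt σ θ i.2 * ‖cext ζ i‖)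
    (fun i => mul_nonneg (wt_pos _ _ _).le (norm_nonneg _))
    ((Finset.univ : Finset (ℤˣ × Modes M)).map ⟨toIdx, toIdx_injective⟩) n T hT
    (fun k hk i hi => Finset.mem_map.2 ⟨(i.1, ⟨i.2, mem_modes_of_modesLE (hF k hk) hi⟩),
      Finset.mem_univ _, rfl⟩)
  rw [cnorm_eq_sum] at h
  refine le_trans (le_of_eq (Finset.sum_congr rfl fun k hk => ?_)) h
  clear hk
  induction k with
  | nil => simp [cmon]
  | cons i k ih =>
    rw [List.map_cons, List.prod_cons, cmon_cons, norm_mul, List.map_cons, List.prod_cons, ← ih]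
    ring

lemma sum_mon_le (hσ : 0 < σ) (ζ : CV M) (n : ℕ) (T : Finset MultiIndex)
    (hT : ∀ k ∈ T, k.length = n) (hF : ∀ k ∈ T, ModesLE M k) :
    ∑ k ∈ T, ‖cmon ζ k‖ ≤ cnorm σ θ ζ ^ n := by
  refine le_trans (Finset.sum_le_sum fun k hk => ?_)
    (sum_weighted_mon_le (σ := σ) (θ := θ) ζ n T hT hF)
  clear hk
  refine le_mul_of_one_le_left (norm_nonneg _) ?_
  induction k with
  | nil => simp
  | cons i k ih =>
    rw [List.map_cons, List.prod_cons]
    exact one_le_mul_of_one_le_of_one_le (one_le_wt hσ _) ih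

/-- The weighted gradient of a polynomial with coefficients equal to one. -/
lemma sum_weighted_dmon_le (hσ : 0 < σ) (hθ : 0 < θ) (hθ1 : θ < 1) (ζ : CV M) (m : ℕ)
    (T : Finset MultiIndex) (hT : ∀ k ∈ T, ZeroMomentum m k) (hF : ∀ k ∈ T, ModesLE M k) :
    ∑ j ∈ T, ∑ i : ℤˣ × Modes M, wt σ θ i.2 * ‖dmon ζ j (toIdx i)‖ ≤
      (2 * m : ℕ) * cnorm σ θ ζ ^ (2 * m - 1) := by
  have h1 : ∀ j ∈ T, ∑ i : ℤˣ × Modes M, wt σ θ i.2 * ‖dmon ζ j (toIdx i)‖ ≤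
      ∑ α ∈ Finset.range (2 * m), ((j.eraseIdx α).map fun i => wt σ θ i.2).prod *
        ‖cmon ζ (j.eraseIdx α)‖ := by
    intro j hj
    have hl := (hT j hj).1
    have h2 : ∀ i : ℤˣ × Modes M, wt σ θ i.2 * ‖dmon ζ j (toIdx i)‖ ≤
        ∑ α : Fin j.length, if j[α] = toIdx i then wt σ θ (j[α]).2 * ‖cmon ζ (j.eraseIdx α)‖
          else 0 := by
      intro i
      rw [dmon]
      refine (mul_le_mul_of_nonneg_left (norm_sum_le _ _) (wt_pos _ _ _).le).trans ?_
      rw [Finset.mul_sum]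
      refine Finset.sum_le_sum fun α _ => ?_
      split_ifs with h
      · rw [h]; exact le_rfl
      · simp
    refine (Finset.sum_le_sum fun i _ => h2 i).trans ?_
    rw [Finset.sum_comm, ← hl, ← Fin.sum_univ_eq_sum_range (fun α =>
      ((j.eraseIdx α).map fun i => wt σ θ i.2).prod * ‖cmon ζ (j.eraseIdx α)‖)]
    refine Finset.sum_le_sum fun α _ => ?_
    refine le_trans ?_ (mul_le_mul_of_nonneg_right
      (wt_getElem_le hσ hθ hθ1 (hT j hj).2.2 α) (norm_nonneg _))
    have hmem := mem_modes_of_modesLE (hF j hj) (List.getElem_mem α.2)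
    rw [Finset.sum_eq_single ((j[α]).1, (⟨(j[α]).2, hmem⟩ : Modes M))]
    · split_ifs
      · exact le_rfl
      · exact mul_nonneg (wt_pos _ _ _).le (norm_nonneg _)
    · intro k _ hk
      rw [if_neg]
      intro h
      exact hk (toIdx_injective h.symm)
    · simp
  refine (Finset.sum_le_sum h1).trans ?_
  rw [Finset.sum_comm]
  have h3 : ∀ α ∈ Finset.range (2 * m), ∑ j ∈ T,
      ((j.eraseIdx α).map fun i => wt σ θ i.2).prod * ‖cmon ζ (j.eraseIdx α)‖ ≤
        cnorm σ θ ζ ^ (2 * m - 1) := by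
    intro α hα
    have hα' := Finset.mem_range.1 hα
    -- The deleted entry can be recovered from mass and momentum, so deletion at a fixed position
    -- produces distinct words, to which the ℓ¹ expansion applies.
    have hinj : Set.InjOn (fun j : MultiIndex => j.eraseIdx α) T := fun j hj j' hj' h =>
      eq_of_eraseIdx_eq (hT j hj) (hT j' hj') ((hT j hj).1 ▸ hα') ((hT j' hj').1 ▸ hα') h
    rw [← Finset.sum_image (f := fun k : MultiIndex => (k.map fun i => wt σ θ i.2).prod * ‖cmon ζ k‖)
      hinj]
    refine sum_weighted_mon_le ζ _ _ ?_ ?_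
    · intro k hk
      obtain ⟨j, hj, rfl⟩ := Finset.mem_image.1 hk
      rw [List.length_eraseIdx_of_lt ((hT j hj).1 ▸ hα'), (hT j hj).1]
    · intro k hk
      obtain ⟨j, hj, rfl⟩ := Finset.mem_image.1 hk
      exact (hF j hj).eraseIdx α
  refine (Finset.sum_le_sum h3).trans ?_
  rw [Finset.sum_const, Finset.card_range, nsmul_eq_mul]

lemma norm_cden_le {s : ℕ} {ζ : CV M} {δ : ℝ} (hδ : 0 < δ)
    (hω : ∀ h ∈ nonIntegrableSetLE s M, δ ≤ ‖comega h ζ‖) {h : List MultiIndex}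
    (hh : ∀ k ∈ h, k ∈ nonIntegrableSetLE s M) : ‖cden ζ h‖ ≤ δ⁻¹ ^ h.length := by
  induction h with
  | nil => simp [cden]
  | cons g h ih =>
    rw [cden_cons, norm_mul, List.length_cons, pow_succ']
    refine mul_le_mul ?_ (ih fun k hk => hh k (List.mem_cons_of_mem _ hk)) (norm_nonneg _)
      (by positivity)
    rw [norm_div, Complex.norm_I, one_div]
    exact inv_anti₀ hδ (hω g (hh g List.mem_cons_self))

lemma norm_dlog_le {s : ℕ} {ζ : CV M} {δ : ℝ} (hδ : 0 < δ)
    (hω : ∀ h ∈ nonIntegrableSetLE s M, δ ≤ ‖comega h ζ‖) {h : List MultiIndex}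
    (hh : ∀ k ∈ h, k ∈ nonIntegrableSetLE s M) (a : ℤ) :
    ‖dlog ζ h a‖ ≤ h.length * (s * δ⁻¹) := by
  rw [dlog, norm_mul, Complex.norm_I, one_mul]
  induction h with
  | nil => simp
  | cons g h ih =>
    rw [List.map_cons, List.sum_cons, List.length_cons]
    refine (norm_add_le _ _).trans ?_
    have h1 := ih fun k hk => hh k (List.mem_cons_of_mem _ hk)
    have hg := hh g List.mem_cons_self
    have h2 : ‖((pot g a : ℝ) : ℂ) * (Complex.I / comega g ζ)‖ ≤ s * δ⁻¹ := by
      rw [norm_mul, Complex.norm_real, norm_div, Complex.norm_I, one_div]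
      refine mul_le_mul ((abs_pot_le g a).trans (by exact_mod_cast hg.2.1))
        (inv_anti₀ hδ (hω g hg)) (by positivity) (by positivity)
    push_cast
    linarith

lemma ne_zero_of_le_comega {s : ℕ} {ζ : CV M} {δ : ℝ} (hδ : 0 < δ)
    (hω : ∀ h ∈ nonIntegrableSetLE s M, δ ≤ ‖comega h ζ‖) :
    ∀ h ∈ nonIntegrableSetLE s M, comega h ζ ≠ 0 := fun h hh h0 => by
  have := hω h hh
  rw [h0, norm_zero] at this
  linarith

lemma sum_weighted_grad_cterm_le {s q n : ℕ} {ζ : CV M} {δ : ℝ} (hδ : 0 < δ)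
    (hω : ∀ h ∈ nonIntegrableSetLE s M, δ ≤ ‖comega h ζ‖)
    {x : MultiIndex × List MultiIndex} (hx : Good M s q n x) :
    ∑ i : ℤˣ × Modes M, wt σ θ i.2 * ‖grad (fun ζ : CV M => cterm ζ x) ζ i‖ ≤
      δ⁻¹ ^ x.2.length * ((∑ i : ℤˣ × Modes M, wt σ θ i.2 * ‖dmon ζ x.1 (toIdx i)‖) +
        x.2.length * (s * δ⁻¹) * cnorm σ θ ζ * ‖cmon ζ x.1‖) := by
  have h1 := norm_cden_le hδ hω hx.den
  have hc : ∑ i : ℤˣ × Modes M, wt σ θ i.2 * ‖ζ (cbar i)‖ = cnorm σ θ ζ := by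
    rw [cnorm, ← cbarEquiv.sum_comp]
    exact Finset.sum_congr rfl fun i _ => by simp [cbarEquiv, cbar]
  rw [mul_add, Finset.mul_sum, ← hc]
  rw [show δ⁻¹ ^ x.2.length * (x.2.length * (s * δ⁻¹) * (∑ i : ℤˣ × Modes M, wt σ θ i.2 *
    ‖ζ (cbar i)‖) * ‖cmon ζ x.1‖) = ∑ i : ℤˣ × Modes M, wt σ θ i.2 * ‖ζ (cbar i)‖ *
      (δ⁻¹ ^ x.2.length * (x.2.length * (s * δ⁻¹)) * ‖cmon ζ x.1‖) by
        rw [← Finset.sum_mul]; ring, ← Finset.sum_add_distrib]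
  refine Finset.sum_le_sum fun i _ => ?_
  have hw := wt_pos σ θ i.2
  have h2 := norm_dlog_le hδ hω hx.den i.2
  rw [grad_cterm (fun g hg => ne_zero_of_le_comega hδ hω g (hx.den g hg)), cterm]
  have h3 : ‖cden ζ x.2 * dmon ζ x.1 (toIdx i) + ζ (cbar i) * dlog ζ x.2 i.2 *
      (cden ζ x.2 * cmon ζ x.1)‖ ≤ δ⁻¹ ^ x.2.length * ‖dmon ζ x.1 (toIdx i)‖ +
      ‖ζ (cbar i)‖ * (x.2.length * (s * δ⁻¹)) * (δ⁻¹ ^ x.2.length * ‖cmon ζ x.1‖) := by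
    refine (norm_add_le _ _).trans ?_
    simp only [norm_mul]
    gcongr
  refine (mul_le_mul_of_nonneg_left h3 hw.le).trans (le_of_eq ?_)
  ring

/-- The bound of the weighted gradient of a rational fraction. -/
lemma sum_weighted_grad_le (hσ : 0 < σ) (hθ : 0 < θ) (hθ1 : θ < 1) {s q n : ℕ} {Q : RatCoeff}
    (hQ : RatClass M s q n Q) (hq : 1 ≤ q) {A : ℝ} (hA : ∀ j, colNorm Q j ≤ A) {ζ : CV M}
    {g R : ℝ} (hg : 0 < g) (hg1 : g ≤ 1) (hR : 0 < R) (hζ : cnorm σ θ ζ ≤ 2 * R)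
    (hω : ∀ h ∈ nonIntegrableSetLE s M, g * R ^ 2 ≤ ‖comega h ζ‖) :
    ∑ i : ℤˣ × Modes M, wt σ θ i.2 * ‖grad (ceval Q) ζ i‖ ≤
      A * ((n + 1) * ((2 * q + 2 * n) + n * s) * 2 ^ (2 * q + 2 * n + 1)) *
        (g⁻¹ ^ (n + 1) * R ^ (2 * q - 1)) := by
  classical
  have hδ : 0 < g * R ^ 2 := by positivity
  have hA0 : 0 ≤ A := (colNorm_nonneg Q []).trans (hA [])
  have hne := ne_zero_of_le_comega hδ hω
  set δ := g * R ^ 2 with hδdef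
  let W : ℕ → MultiIndex → ℝ := fun m j => δ⁻¹ ^ m *
    ((∑ i : ℤˣ × Modes M, wt σ θ i.2 * ‖dmon ζ j (toIdx i)‖) +
      m * (s * δ⁻¹) * cnorm σ θ ζ * ‖cmon ζ j‖)
  have hW0 : ∀ m j, 0 ≤ W m j := fun m j => mul_nonneg (by positivity) (add_nonneg
    (Finset.sum_nonneg fun i _ => mul_nonneg (wt_pos _ _ _).le (norm_nonneg _))
    (mul_nonneg (mul_nonneg (by positivity) (cnorm_nonneg _)) (norm_nonneg _)))
  have h1 : ∑ i : ℤˣ × Modes M, wt σ θ i.2 * ‖grad (ceval Q) ζ i‖ ≤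
      ∑ x ∈ Q.support, ‖Q x‖ * W x.2.length x.1 := by
    calc ∑ i : ℤˣ × Modes M, wt σ θ i.2 * ‖grad (ceval Q) ζ i‖
        ≤ ∑ i : ℤˣ × Modes M, ∑ x ∈ Q.support, ‖Q x‖ *
          (wt σ θ i.2 * ‖grad (fun ζ : CV M => cterm ζ x) ζ i‖) := by
          refine Finset.sum_le_sum fun i _ => ?_
          rw [grad_ceval fun x hx g hg => hne g ((hQ x hx).den g hg)]
          refine (mul_le_mul_of_nonneg_left (norm_sum_le _ _) (wt_pos _ _ _).le).trans ?_
          rw [Finset.mul_sum]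
          refine le_of_eq (Finset.sum_congr rfl fun x _ => ?_)
          rw [norm_mul]
          ring
      _ = ∑ x ∈ Q.support, ‖Q x‖ * ∑ i : ℤˣ × Modes M,
          (wt σ θ i.2 * ‖grad (fun ζ : CV M => cterm ζ x) ζ i‖) := by
          rw [Finset.sum_comm]
          exact Finset.sum_congr rfl fun x _ => (Finset.mul_sum _ _ _).symm
      _ ≤ _ := by
          refine Finset.sum_le_sum fun x hx => mul_le_mul_of_nonneg_left ?_ (norm_nonneg _)
          exact sum_weighted_grad_cterm_le hδ hω (hQ x (Finsupp.mem_support_iff.1 hx))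
  -- The terms are grouped by their number m of denominators; the n+1 values of m give the factor
  -- n+1. For fixed m, the coefficients with a common numerator are summed by `colNorm`.
  have h2 : ∑ x ∈ Q.support, ‖Q x‖ * W x.2.length x.1 ≤ ∑ m ∈ Finset.range (n + 1),
      A * (((2 * q + 2 * n) + n * s) * 2 ^ (2 * q + 2 * n + 1) *
        (g⁻¹ ^ (n + 1) * R ^ (2 * q - 1))) := by
    rw [← Finset.sum_fiberwise_of_maps_to (s := Q.support) (t := Finset.range (n + 1))
      (g := fun x => x.2.length) fun x hx => by
        have := (hQ x (Finsupp.mem_support_iff.1 hx)).cnt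
        exact Finset.mem_range.2 (by omega)]
    refine Finset.sum_le_sum fun m hm => ?_
    have hmn : m ≤ n := by have := Finset.mem_range.1 hm; omega
    set S := Q.support.filter fun x => x.2.length = m with hS
    have hSg : ∀ x ∈ S, Good M s q n x ∧ x.2.length = m := fun x hx => by
      obtain ⟨h, h'⟩ := Finset.mem_filter.1 hx
      exact ⟨hQ x (Finsupp.mem_support_iff.1 h), h'⟩
    set T := S.image Prod.fst with hT
    have hTg : ∀ j ∈ T, ZeroMomentum (q + m) j ∧ ModesLE M j := fun j hj => by
      obtain ⟨x, hx, rfl⟩ := Finset.mem_image.1 hj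
      obtain ⟨gx, hl⟩ := hSg x hx
      exact ⟨hl ▸ gx.zeroMomentum, gx.modes⟩
    calc ∑ x ∈ S, ‖Q x‖ * W x.2.length x.1 = ∑ x ∈ S, ‖Q x‖ * W m x.1 :=
          Finset.sum_congr rfl fun x hx => by rw [(hSg x hx).2]
      _ = ∑ j ∈ T, ∑ x ∈ S with x.1 = j, ‖Q x‖ * W m x.1 :=
          (Finset.sum_fiberwise_of_maps_to (fun x hx => Finset.mem_image_of_mem _ hx) _).symm
      _ ≤ ∑ j ∈ T, A * W m j := by
          refine Finset.sum_le_sum fun j _ => ?_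
          have e : ∑ x ∈ S with x.1 = j, ‖Q x‖ * W m x.1 =
              (∑ x ∈ S with x.1 = j, ‖Q x‖) * W m j := by
            rw [Finset.sum_mul]
            exact Finset.sum_congr rfl fun x hx => by rw [(Finset.mem_filter.1 hx).2]
          rw [e]
          refine mul_le_mul_of_nonneg_right (le_trans ?_ (hA j)) (hW0 m j)
          rw [colNorm, Finset.sum_filter]
          refine Finset.sum_le_sum_of_subset_of_nonneg (Finset.filter_subset _ _) fun x _ _ => ?_
          split_ifs <;> positivity
      _ = A * (δ⁻¹ ^ m * ((∑ j ∈ T, ∑ i : ℤˣ × Modes M, wt σ θ i.2 * ‖dmon ζ j (toIdx i)‖) +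
          m * (s * δ⁻¹) * cnorm σ θ ζ * ∑ j ∈ T, ‖cmon ζ j‖)) := by
          rw [← Finset.mul_sum, ← Finset.mul_sum, Finset.sum_add_distrib, ← Finset.mul_sum]
      _ ≤ A * (δ⁻¹ ^ m * ((2 * (q + m) : ℕ) * (2 * R) ^ (2 * (q + m) - 1) +
          m * (s * δ⁻¹) * (2 * R) * (2 * R) ^ (2 * (q + m)))) := by
          have hc0 := cnorm_nonneg (σ := σ) (θ := θ) ζ
          have t1 := sum_weighted_dmon_le hσ hθ hθ1 ζ (q + m) T (fun j hj => (hTg j hj).1)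
            fun j hj => (hTg j hj).2
          have t2 := sum_mon_le (θ := θ) hσ ζ (2 * (q + m)) T (fun j hj => (hTg j hj).1.1)
            fun j hj => (hTg j hj).2
          have t3 : cnorm σ θ ζ ^ (2 * (q + m) - 1) ≤ (2 * R) ^ (2 * (q + m) - 1) :=
            pow_le_pow_left₀ hc0 hζ _
          have t4 : cnorm σ θ ζ ^ (2 * (q + m)) ≤ (2 * R) ^ (2 * (q + m)) :=
            pow_le_pow_left₀ hc0 hζ _
          refine mul_le_mul_of_nonneg_left (mul_le_mul_of_nonneg_left (add_le_add ?_ ?_)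
            (by positivity)) hA0
          · exact t1.trans (mul_le_mul_of_nonneg_left t3 (by positivity))
          · refine mul_le_mul (mul_le_mul_of_nonneg_left hζ (by positivity)) (t2.trans t4)
              (Finset.sum_nonneg fun _ _ => norm_nonneg _) (by positivity)
      _ ≤ _ := by
          refine mul_le_mul_of_nonneg_left ?_ hA0
          -- Homogeneity: each denominator costs g⁻¹R⁻² and is accompanied by two more numerator
          -- factors, so the power of R does not depend on m.
          have e1 : δ⁻¹ ^ m * (2 * R) ^ (2 * (q + m) - 1) =
              g⁻¹ ^ m * (2 ^ (2 * (q + m) - 1) * R ^ (2 * q - 1)) := by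
            rw [show 2 * (q + m) - 1 = 2 * q - 1 + 2 * m by omega, hδdef, mul_inv, mul_pow,
              mul_pow, pow_add R, pow_mul R 2 m, inv_pow (R ^ 2) m]
            field_simp
          have e2 : δ⁻¹ ^ m * (δ⁻¹ * ((2 * R) * (2 * R) ^ (2 * (q + m)))) =
              g⁻¹ ^ (m + 1) * (2 ^ (2 * (q + m) + 1) * R ^ (2 * q - 1)) := by
            rw [← pow_succ' (2 * R), ← mul_assoc, ← pow_succ,
              show 2 * (q + m) + 1 = 2 * q - 1 + 2 * (m + 1) by omega, hδdef, mul_inv, mul_pow,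
              mul_pow, pow_add R, pow_mul R 2 (m + 1), inv_pow (R ^ 2) (m + 1)]
            field_simp
          have hg' : 1 ≤ g⁻¹ := (one_le_inv₀ hg).2 hg1
          have e3 : g⁻¹ ^ m ≤ g⁻¹ ^ (n + 1) := pow_le_pow_right₀ hg' (by omega)
          have e4 : g⁻¹ ^ (m + 1) ≤ g⁻¹ ^ (n + 1) := pow_le_pow_right₀ hg' (by omega)
          have e5 : (2 : ℝ) ^ (2 * (q + m) - 1) ≤ 2 ^ (2 * q + 2 * n + 1) :=
            pow_le_pow_right₀ (by norm_num) (by omega)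
          have e6 : (2 : ℝ) ^ (2 * (q + m) + 1) ≤ 2 ^ (2 * q + 2 * n + 1) :=
            pow_le_pow_right₀ (by norm_num) (by omega)
          have hmn' : (m : ℝ) ≤ n := by exact_mod_cast hmn
          calc δ⁻¹ ^ m * ((2 * (q + m) : ℕ) * (2 * R) ^ (2 * (q + m) - 1) +
                m * (s * δ⁻¹) * (2 * R) * (2 * R) ^ (2 * (q + m)))
              = (2 * (q + m) : ℕ) * (δ⁻¹ ^ m * (2 * R) ^ (2 * (q + m) - 1)) +
                m * s * (δ⁻¹ ^ m * (δ⁻¹ * ((2 * R) * (2 * R) ^ (2 * (q + m))))) := by ring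
            _ ≤ (2 * q + 2 * n) * (g⁻¹ ^ (n + 1) * (2 ^ (2 * q + 2 * n + 1) * R ^ (2 * q - 1))) +
                n * s * (g⁻¹ ^ (n + 1) * (2 ^ (2 * q + 2 * n + 1) * R ^ (2 * q - 1))) := by
                rw [e1, e2]
                gcongr
                push_cast
                linarith
            _ = _ := by ring
  refine (h1.trans h2).trans (le_of_eq ?_)
  rw [Finset.sum_const, Finset.card_range, nsmul_eq_mul]
  push_cast
  ring

/-- Lipschitz bound of the small divisors. -/
lemma norm_comega_sub_le (hσ : 0 < σ) (h : MultiIndex) (ζ ζ' : CV M) :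
    ‖comega h ζ - comega h ζ'‖ ≤
      h.length * (cnorm σ θ (ζ - ζ') * (cnorm σ θ ζ + cnorm σ θ ζ')) := by
  rw [comega, comega, quad, quad, ← Finset.sum_sub_distrib]
  refine (norm_sum_le _ _).trans ?_
  have h1 : ∀ a : Modes M, ‖((pot h a : ℝ) : ℂ) * (ζ (1, a) * ζ (-1, a)) -
      ((pot h a : ℝ) : ℂ) * (ζ' (1, a) * ζ' (-1, a))‖ ≤ h.length *
      (wt σ θ a * ‖(ζ - ζ') (1, a)‖ * (cnorm σ θ ζ + cnorm σ θ ζ') +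
        wt σ θ a * ‖(ζ - ζ') (-1, a)‖ * (cnorm σ θ ζ + cnorm σ θ ζ')) := by
    intro a
    have hw := one_le_wt (θ := θ) hσ (a : ℤ)
    rw [← mul_sub, norm_mul, Complex.norm_real]
    refine mul_le_mul (abs_pot_le h a) ?_ (norm_nonneg _) (by positivity)
    have e : ζ (1, a) * ζ (-1, a) - ζ' (1, a) * ζ' (-1, a) =
        (ζ - ζ') (1, a) * ζ (-1, a) + (ζ - ζ') (-1, a) * ζ' (1, a) := by
      simp only [Pi.sub_apply]; ring
    rw [e]
    refine (norm_add_le _ _).trans ?_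
    rw [norm_mul, norm_mul]
    have c1 := cnorm_nonneg (σ := σ) (θ := θ) ζ
    have c2 := cnorm_nonneg (σ := σ) (θ := θ) ζ'
    have n1 := norm_le_cnorm (θ := θ) hσ ζ (-1, a)
    have n2 := norm_le_cnorm (θ := θ) hσ ζ' (1, a)
    refine add_le_add ?_ ?_
    · refine mul_le_mul (le_mul_of_one_le_left (norm_nonneg _) hw) (by linarith)
        (norm_nonneg _) (by positivity)
    · refine mul_le_mul (le_mul_of_one_le_left (norm_nonneg _) hw) (by linarith)
        (norm_nonneg _) (by positivity)
  refine (Finset.sum_le_sum fun a _ => h1 a).trans (le_of_eq ?_)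
  rw [← Finset.mul_sum]
  congr 1
  conv_rhs => rw [cnorm, sum_units_prod_real, Finset.sum_mul]
  exact Finset.sum_congr rfl fun a _ => by ring

/-- The bound of the second derivatives by the Cauchy estimates. -/
lemma sum_weighted_fderiv_grad_le {F : CV M → ℂ} {ζ η : CV M} {ρ B : ℝ} (hρ : 0 < ρ)
    (hF : ∀ s : ℂ, ‖s‖ ≤ ρ → ContDiffAt ℂ ∞ F (ζ + s • η))
    (hB : ∀ s : ℂ, ‖s‖ ≤ ρ → ∑ i, wt σ θ i.2 * ‖grad F (ζ + s • η) i‖ ≤ B) :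
    ∑ i, wt σ θ i.2 * ‖fderiv ℂ (fun ζ => grad F ζ i) ζ η‖ ≤ B / ρ := by
  have hgd : ∀ s : ℂ, ‖s‖ ≤ ρ → ∀ i, DifferentiableAt ℂ (fun ζ => grad F ζ i) (ζ + s • η) := by
    intro s hs i
    have h1 : DifferentiableAt ℂ (fderiv ℂ F) (ζ + s • η) :=
      ((hF s hs).fderiv_right (m := ∞) (by simp)).differentiableAt (by simp)
    exact h1.clm_apply (differentiableAt_const _)
  have hline : ∀ s : ℂ, HasDerivAt (fun s : ℂ => ζ + s • η) η s := fun s => by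
    simpa using ((hasDerivAt_id s).smul_const η).const_add ζ
  set d : ℤˣ × Modes M → ℂ := fun i => fderiv ℂ (fun ζ => grad F ζ i) ζ η with hd
  -- Phases that align all components: the weighted sum of moduli becomes one scalar holomorphic
  -- derivative, and a single Cauchy estimate bounds it without loss in the number of modes.
  have hu : ∀ i, ∃ u : ℂ, ‖u‖ ≤ 1 ∧ u * d i = (‖d i‖ : ℂ) := by
    intro i
    by_cases h : d i = 0
    · exact ⟨0, by simp, by simp [h]⟩
    · refine ⟨‖d i‖ / d i, ?_, ?_⟩
      · rw [norm_div, Complex.norm_real, norm_norm, div_self (norm_ne_zero_iff.2 h)]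
      · field_simp
  choose u hu1 hu2 using hu
  let G : ℂ → ℂ := fun s => ∑ i, ((wt σ θ i.2 : ℝ) : ℂ) * u i * grad F (ζ + s • η) i
  have hGd : ∀ s : ℂ, ‖s‖ ≤ ρ → HasDerivAt G (∑ i, ((wt σ θ i.2 : ℝ) : ℂ) * u i *
      fderiv ℂ (fun ζ => grad F ζ i) (ζ + s • η) η) s := fun s hs =>
    HasDerivAt.fun_sum fun i _ =>
      (((hgd s hs i).hasFDerivAt.comp_hasDerivAt s (hline s)).const_mul _)
  have hG0 : deriv G 0 = ((∑ i, wt σ θ i.2 * ‖d i‖ : ℝ) : ℂ) := by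
    rw [(hGd 0 (by simpa using hρ.le)).deriv]
    push_cast
    refine Finset.sum_congr rfl fun i _ => ?_
    rw [mul_assoc, ← hu2 i, zero_smul, add_zero]
  have hbound : ∀ s ∈ Metric.sphere (0 : ℂ) ρ, ‖G s‖ ≤ B := by
    intro s hs
    have hs' : ‖s‖ = ρ := by simpa using hs
    refine (norm_sum_le _ _).trans (le_trans (Finset.sum_le_sum fun i _ => ?_) (hB s hs'.le))
    rw [norm_mul, norm_mul, Complex.norm_real, Real.norm_of_nonneg (wt_pos _ _ _).le]
    exact mul_le_mul_of_nonneg_right (mul_le_of_le_one_right (wt_pos _ _ _).le (hu1 i))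
      (norm_nonneg _)
  have hdiff : DiffContOnCl ℂ G (Metric.ball 0 ρ) := by
    refine DifferentiableOn.diffContOnCl fun s hs => ?_
    rw [closure_ball _ hρ.ne', Metric.mem_closedBall, dist_zero_right] at hs
    exact (hGd s hs).differentiableAt.differentiableWithinAt
  have := Complex.norm_deriv_le_of_forall_mem_sphere_norm_le hρ hdiff hbound
  rw [hG0, Complex.norm_real, Real.norm_of_nonneg (Finset.sum_nonneg fun i _ =>
    mul_nonneg (wt_pos _ _ _).le (norm_nonneg _))] at this
  exact this

/-! ### Norms of Hamiltonian vector fields -/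

lemma IsRestr.gnorm_hamVF {f : GM M → ℝ} {F : CV M → ℂ} (h : IsRestr f F) {z : GM M}
    (hF : DifferentiableAt ℂ F (cx z)) :
    gnorm σ θ (hamVF f z) = ∑ i, wt σ θ i.2 * ‖grad F (cx z) i‖ := by
  rw [gnorm, sum_units_prod_real, Finset.mul_sum]
  refine Finset.sum_congr rfl fun a _ => ?_
  rw [h.hamVF_apply hF, ← h.conj_grad hF, norm_mul, Complex.norm_I, one_mul, Complex.norm_conj, wt]
  ring

/-- The factor 2 of `gnorm` is kept and the components (1,a) are added for free, so the constant is
not optimal but no conjugation symmetry of second derivatives is needed. -/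
lemma IsRestr.gnorm_fderiv_hamVF_le {f : GM M → ℝ} {F : CV M → ℂ} (h : IsRestr f F) {z : GM M}
    (hF : ContDiffAt ℂ ∞ F (cx z)) (w : GM M) :
    gnorm σ θ (fderiv ℝ (hamVF f) z w) ≤
      2 * ∑ i, wt σ θ i.2 * ‖fderiv ℂ (fun ζ => grad F ζ i) (cx z) (cx w)‖ := by
  have hev : ∀ᶠ y in nhds z, DifferentiableAt ℂ F (cx y) := by
    have h1 : ∀ᶠ ζ in nhds (cx z), DifferentiableAt ℂ F ζ := by
      filter_upwards [(hF.of_le (m := 1) (by simp)).eventually (by simp)] with ζ hζ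
      exact hζ.differentiableAt one_ne_zero
    exact (cx (M := M)).continuous.continuousAt.eventually h1
  have hd : ∀ i, DifferentiableAt ℂ (fun ζ => grad F ζ i) (cx z) := fun i =>
    ((hF.fderiv_right (m := ∞) (by simp)).differentiableAt (by simp)).clm_apply
      (differentiableAt_const _)
  have h2 : HasFDerivAt (hamVF f) (ContinuousLinearMap.pi fun a : Modes M =>
      Complex.I • ((fderiv ℂ (fun ζ => grad F ζ (-1, a)) (cx z)).restrictScalars ℝ).comp cx) z := by
    refine HasFDerivAt.congr_of_eventuallyEq
      (f := fun (y : GM M) (a : Modes M) => Complex.I * grad F (cx y) (-1, a)) ?_ ?_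
    · refine hasFDerivAt_pi.2 fun a => ?_
      exact (((hd (-1, a)).hasFDerivAt.restrictScalars ℝ).comp z
        (cx (M := M)).hasFDerivAt).const_mul Complex.I
    · filter_upwards [hev] with y hy
      funext a
      exact h.hamVF_apply hy a
  rw [h2.fderiv, gnorm, sum_units_prod_real]
  refine mul_le_mul_of_nonneg_left (Finset.sum_le_sum fun a _ => ?_) zero_le_two
  simp only [ContinuousLinearMap.pi_apply, smul_apply, ContinuousLinearMap.comp_apply,
    ContinuousLinearMap.coe_restrictScalars', smul_eq_mul, norm_mul, Complex.norm_I, one_mul]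
  have : 0 ≤ wt σ θ a * ‖fderiv ℂ (fun ζ => grad F ζ (1, a)) (cx z) (cx w)‖ :=
    mul_nonneg (wt_pos _ _ _).le (norm_nonneg _)
  rw [wt] at *
  linarith

/-- Duality between the weighted ℓ¹ norm and the weighted supremum norm, attained at a suitable w.
With `fderiv_eq_l2inner` it reduces the norm of a Hamiltonian field to one directional derivative.
-/
lemma gnorm_eq_l2inner (X : GM M) : ∃ w : GM M, (∀ a, ‖w a‖ ≤ wt σ θ a) ∧
    gnorm σ θ X = -2 * l2inner (Complex.I • X) w := by
  -- The phase of w is that of -iX. Where X vanishes, the division by zero gives the component 0, as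
  -- desired.
  refine ⟨fun a => -(wt σ θ a : ℂ) * (Complex.I * X a) / ‖X a‖, fun a => ?_, ?_⟩
  · rw [norm_div, norm_mul, norm_mul, norm_neg, Complex.norm_real, Complex.norm_real, norm_norm,
      Complex.norm_I, one_mul, Real.norm_of_nonneg (wt_pos _ _ _).le]
    by_cases h : ‖X a‖ = 0
    · rw [h]; simpa using (wt_pos σ θ a).le
    · rw [mul_div_assoc, div_self h, mul_one]
  · rw [gnorm, l2inner, Complex.re_sum, Finset.mul_sum, Finset.mul_sum]
    refine Finset.sum_congr rfl fun a _ => ?_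
    have e : (Complex.I • X) a * (starRingEnd ℂ) (-(wt σ θ a : ℂ) * (Complex.I * X a) / ‖X a‖) =
        ((-(wt σ θ a * ‖X a‖) : ℝ) : ℂ) := by
      by_cases h : X a = 0
      · simp [h]
      · have h' : (‖X a‖ : ℂ) ≠ 0 := by exact_mod_cast norm_ne_zero_iff.2 h
        have h2 : X a * (starRingEnd ℂ) (X a) = (‖X a‖ : ℂ) ^ 2 := by
          rw [Complex.mul_conj, Complex.normSq_eq_norm_sq]; push_cast; rfl
        simp only [Pi.smul_apply, smul_eq_mul, map_div₀, map_mul, map_neg, Complex.conj_ofReal,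
          Complex.conj_I]
        push_cast
        field_simp
        linear_combination (wt σ θ a : ℂ) * (Complex.I ^ 2) * h2 +
          (wt σ θ a : ℂ) * ‖X a‖ ^ 2 * Complex.I_sq
    rw [e, Complex.ofReal_re, wt]
    ring

lemma abs_l2inner_le {u w : GM M} (hw : ∀ a, ‖w a‖ ≤ wt σ θ a) :
    |2 * l2inner (Complex.I • u) w| ≤ gnorm σ θ u := by
  rw [abs_mul, abs_two, gnorm]
  refine mul_le_mul_of_nonneg_left ?_ zero_le_two
  refine (Complex.abs_re_le_norm _).trans ((norm_sum_le _ _).trans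
    (Finset.sum_le_sum fun a _ => ?_))
  rw [norm_mul, Complex.norm_conj, Pi.smul_apply, smul_eq_mul, norm_mul, Complex.norm_I, one_mul,
    mul_comm]
  exact mul_le_mul_of_nonneg_right (hw a) (norm_nonneg _)

end Bounds

/-! ### The construction of the generator and of the normal form -/

section NormalForm

/-- One step of the construction: from the previous terms `D i` (the coefficients in time and the
generator) to the terms of the next order, before the homological correction. -/
def nfPre (K : RatCoeff) (n : ℕ) (D : Fin n → (ℕ → RatCoeff) × RatCoeff) : ℕ → RatCoeff
  | 0 => K
  -- The index `i.rev` is n-1-i, so that (i+3)+(i.rev+2)-1 = n+3; the factor 1/(k+1) comes from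
  -- integrating t^k.
  | k + 1 => ((k : ℂ) + 1)⁻¹ • ∑ i : Fin n, br ((D i).1 k) (D i.rev).2

/-- The coefficients in time and the generator, order by order. -/
def nfData (K : ℕ → RatCoeff) (N : ℕ) (n : ℕ) : (ℕ → RatCoeff) × RatCoeff :=
  let P := nfPre (K n) n fun i => nfData K N i
  let T := ∑ k ∈ Finset.range N, P k
  -- The bracket {L₄, χ_n} = -`nonint T` is of the first power of t and has the same order as T,
  -- hence the correction at k = 1.
  (fun k => if k = 1 then P 1 - nonint T else P k, homQ T)
termination_by n
decreasing_by exact i.2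

variable (K : ℕ → RatCoeff) (N : ℕ)

/-- The coefficients in time before the homological correction. -/
def nfR (n : ℕ) : ℕ → RatCoeff := nfPre (K n) n fun i => nfData K N i

/-- The term to be normalized. -/
def nfT (n : ℕ) : RatCoeff := ∑ k ∈ Finset.range N, nfR K N n k

/-- The coefficients in time. -/
def nfP (n k : ℕ) : RatCoeff := (nfData K N n).1 k

/-- The generator. -/
def nfX (n : ℕ) : RatCoeff := (nfData K N n).2

lemma nfR_zero (n : ℕ) : nfR K N n 0 = K n := rfl

lemma nfR_succ (n k : ℕ) : nfR K N n (k + 1) =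
    ((k : ℂ) + 1)⁻¹ • ∑ i : Fin n, br (nfP K N i k) (nfX K N i.rev) := rfl

lemma nfP_eq (n k : ℕ) :
    nfP K N n k = if k = 1 then nfR K N n 1 - nonint (nfT K N n) else nfR K N n k := by
  rw [nfP, nfData]
  rfl

lemma nfX_eq (n : ℕ) : nfX K N n = homQ (nfT K N n) := by
  rw [nfX, nfData]
  rfl

lemma br_zero_left (Q : RatCoeff) : br 0 Q = 0 := by simp [br]

/-- At n = 0 only the powers 0 and 1 of t occur, and each further bracket consumes at least one unit
of n. So at most n+2 time coefficients are non-zero, and the truncation of the time series loses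
nothing. -/
lemma nfP_eq_zero {n k : ℕ} (hk : n + 2 ≤ k) : nfP K N n k = 0 := by
  induction n using Nat.strong_induction_on generalizing k with
  | _ n ih =>
    obtain ⟨k, rfl⟩ : ∃ l, k = l + 1 := ⟨k - 1, by omega⟩
    rw [nfP_eq, if_neg (by omega), nfR_succ, Finset.sum_eq_zero, smul_zero]
    intro i _
    rw [ih i i.2 (by omega), br_zero_left]

/-- Evaluation at time one: the correction at k = 1 removes exactly the non-integrable part. The
condition 2 ≤ N ensures that k = 1 belongs to the range. -/
lemma sum_nfP (hN : 2 ≤ N) (n : ℕ) :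
    ∑ k ∈ Finset.range N, nfP K N n k = intPart (nfT K N n) := by
  have h : ∀ k, nfP K N n k = nfR K N n k + if k = 1 then -nonint (nfT K N n) else 0 := by
    intro k
    rw [nfP_eq]
    split_ifs with h
    · rw [h, sub_eq_add_neg]
    · rw [add_zero]
  rw [Finset.sum_congr rfl fun k _ => h k, Finset.sum_add_distrib, Finset.sum_ite_eq',
    if_pos (Finset.mem_range.2 (by omega)), ← nfT]
  conv_lhs => rw [← intPart_add_nonint (nfT K N n)]
  rw [intPart_add_nonint, ← sub_eq_add_neg]
  exact sub_eq_of_eq_add (intPart_add_nonint (nfT K N n)).symm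

variable {K N}

/-- The classes of the terms of the construction. -/
lemma ratClass_nf {M : ℝ} {ν : ℕ} (hK : ∀ n < ν, RatClass M (6 * (n + 1)) (n + 3) 0 (K n))
    {n : ℕ} (hn : n < ν) :
    (∀ k, RatClass M (6 * (n + 1)) (n + 3) (2 * n) (nfR K N n k)) ∧
    RatClass M (6 * (n + 1)) (n + 3) (2 * n) (nfT K N n) ∧
    (∀ k, RatClass M (6 * (n + 1)) (n + 3) (2 * n) (nfP K N n k)) ∧
    RatClass M (6 * (n + 1)) (n + 2) (2 * n + 1) (nfX K N n) := by
  induction n using Nat.strong_induction_on with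
  | _ n ih =>
    have hR : ∀ k, RatClass M (6 * (n + 1)) (n + 3) (2 * n) (nfR K N n k) := by
      intro k
      cases k with
      | zero => exact (hK n hn).mono le_rfl (by omega)
      | succ k =>
        rw [nfR_succ]
        refine RatClass.smul (RatClass.sum _ fun i _ => ?_) _
        have hi := i.2
        have hr : (i.rev : ℕ) + i + 1 = n := by rw [Fin.val_rev]; omega
        have h1 := (ih i hi (by omega)).2.2.1 k
        have h2 := (ih i.rev (by omega) (by omega)).2.2.2
        have h3 := (h1.mono (s' := 6 * (n + 1)) (by omega) le_rfl).br
          (h2.mono (s' := 6 * (n + 1)) (by omega) le_rfl) (by omega)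
        rw [show (i : ℕ) + 3 + (i.rev + 2) - 1 = n + 3 by omega,
          show 2 * (i : ℕ) + (2 * i.rev + 1) + 1 = 2 * n by omega] at h3
        exact h3
    have hT : RatClass M (6 * (n + 1)) (n + 3) (2 * n) (nfT K N n) := RatClass.sum _ fun k _ => hR k
    refine ⟨hR, hT, fun k => ?_, ?_⟩
    · rw [nfP_eq]
      split_ifs
      · rw [sub_eq_add_neg]
        exact (hR 1).add hT.nonint.neg
      · exact hR k
    · rw [nfX_eq]
      -- The new denominators are numerators of T, of length at most 2(n+3) + 2·2n = 6(n+1).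
      exact hT.homQ (by omega)

lemma ratReal_nf {ν : ℕ} (hK : ∀ n < ν, RatReal (K n)) {n : ℕ} (hn : n < ν) :
    RatReal (nfT K N n) ∧ (∀ k, RatReal (nfP K N n k)) ∧ RatReal (nfX K N n) := by
  induction n using Nat.strong_induction_on with
  | _ n ih =>
    have hR : ∀ k, RatReal (nfR K N n k) := by
      intro k
      cases k with
      | zero => exact hK n hn
      | succ k =>
        rw [nfR_succ]
        refine RatReal.smul (RatReal.sum _ fun i _ => ?_) (by simp)
        have hi := i.2
        have hr : (i.rev : ℕ) + i + 1 = n := by rw [Fin.val_rev]; omega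
        exact ((ih i hi (by omega)).2.1 k).br (ih i.rev (by omega) (by omega)).2.2
    have hT : RatReal (nfT K N n) := RatReal.sum _ fun k _ => hR k
    refine ⟨hT, fun k => ?_, ?_⟩
    · rw [nfP_eq]
      split_ifs
      · exact (hR 1).sub hT.nonint
      · exact hR k
    · rw [nfX_eq]
      exact hT.homQ

/-- The bound of the brackets which occur in the construction. -/
lemma colNorm_br_le_of_lt {M : ℝ} {r i j : ℕ} (hr : 3 ≤ r) (hi : i < r) (hj : j < r)
    {P Q : RatCoeff} (hP : RatClass M (6 * (i + 1)) (i + 3) (2 * i) P)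
    (hQ : RatClass M (6 * (j + 1)) (j + 2) (2 * j + 1) Q) {A B : ℝ} (hA : ∀ k, colNorm P k ≤ A)
    (hB : ∀ k, colNorm Q k ≤ B) (k : MultiIndex) :
    colNorm (br P Q) k ≤ 1000 * r ^ 4 * (A * B) := by
  have hA0 : 0 ≤ A := (colNorm_nonneg P []).trans (hA [])
  have hB0 : 0 ≤ B := (colNorm_nonneg Q []).trans (hB [])
  have h := colNorm_br_le (ℓ := 6 * r) (hP.mono (s' := 6 * r) (by omega) le_rfl)
    (hQ.mono (s' := 6 * r) (by omega) le_rfl) (by omega) (by omega) hA hB k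
  refine h.trans (mul_le_mul_of_nonneg_right ?_ (by positivity))
  have hr' : (3 : ℝ) ≤ r := by exact_mod_cast hr
  have h1 : ((2 * i : ℕ) + (2 * j + 1 : ℕ) : ℝ) ≤ 4 * r := by
    exact_mod_cast (by omega : 2 * i + (2 * j + 1) ≤ 4 * r)
  have h2 : ((6 * r : ℕ) : ℝ) = 6 * r := by push_cast; ring
  rw [h2]
  calc (6 * (r : ℝ)) ^ 3 + (6 * r + 1) * (((2 * i : ℕ) + (2 * j + 1 : ℕ) : ℝ) * (6 * r) * (6 * r))
      ≤ (6 * (r : ℝ)) ^ 3 + (6 * r + 1) * ((4 * r) * (6 * r) * (6 * r)) := by gcongr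
    _ = 864 * (r : ℝ) ^ 4 + 360 * (r : ℝ) ^ 3 := by ring
    _ ≤ 1000 * (r : ℝ) ^ 4 := by nlinarith [pow_pos (by linarith : (0 : ℝ) < r) 3]

/-- The coefficients grow geometrically. -/
lemma colNorm_nf_le {M : ℝ} {r ν : ℕ} (hr : 3 ≤ r) (hν : ν ≤ r) {A l : ℝ} (hA : 0 ≤ A)
    (hl : l = 16 * r * (1000 * r ^ 4) * A)
    (hK : ∀ n < ν, RatClass M (6 * (n + 1)) (n + 3) 0 (K n))
    (hKb : ∀ n < ν, ∀ j, colNorm (K n) j ≤ A / 4 * l ^ n) {n : ℕ} (hn : n < ν) :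
    (∀ k j, colNorm (nfP K N n k) j ≤ 2 * A * l ^ n * (1 / 2) ^ k) ∧
    (∀ j, colNorm (nfX K N n) j ≤ A * l ^ n) := by
  have hl0 : 0 ≤ l := by rw [hl]; positivity
  induction n using Nat.strong_induction_on with
  | _ n ih =>
    -- The rate l makes r·1000r⁴·(2A 2^{-k})·A·l^{n-1} equal to (A/4) l^n 2^{-(k+1)}. Summing over k
    -- gives A/2 for T, which leaves room for the correction at k = 1.
    have hR : ∀ k j, colNorm (nfR K N n k) j ≤ A / 4 * l ^ n * (1 / 2) ^ k := by
      intro k j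
      cases k with
      | zero => simpa [nfR_zero] using hKb n hn j
      | succ k =>
        rw [nfR_succ]
        refine (colNorm_smul_le _ _ _).trans ?_
        have hk : ‖((k : ℂ) + 1)⁻¹‖ ≤ 1 := by
          rw [norm_inv]
          have : ‖((k : ℂ) + 1)‖ = k + 1 := by
            rw [← Nat.cast_succ, Complex.norm_natCast]; push_cast; ring
          rw [this]
          exact inv_le_one_of_one_le₀ (by linarith [Nat.cast_nonneg (α := ℝ) k])
        refine (mul_le_of_le_one_left (colNorm_nonneg _ _) hk).trans ?_
        have hi : ∀ i : Fin n, colNorm (br (nfP K N i k) (nfX K N i.rev)) j ≤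
            1000 * r ^ 4 * ((2 * A * (1 / 2) ^ k) * A * l ^ (n - 1)) := by
          intro i
          have hi := i.2
          have hrev : (i.rev : ℕ) + i + 1 = n := by rw [Fin.val_rev]; omega
          have h := colNorm_br_le_of_lt hr (by omega) (by omega)
            ((ratClass_nf (N := N) hK (n := i) (by omega)).2.2.1 k)
            (ratClass_nf (N := N) hK (n := i.rev) (by omega)).2.2.2
            ((ih i hi (by omega)).1 k) (ih i.rev (by omega) (by omega)).2 j
          refine h.trans (le_of_eq ?_)
          rw [show n - 1 = (i : ℕ) + i.rev by omega, pow_add]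
          ring
        refine (colNorm_sum_le _ _ _).trans ((Finset.sum_le_sum fun i _ => hi i).trans ?_)
        rw [Finset.sum_const, Finset.card_univ, Fintype.card_fin, nsmul_eq_mul]
        rcases Nat.eq_zero_or_pos n with h0 | h0
        · rw [h0, Nat.cast_zero, zero_mul]; positivity
        · have hnr : (n : ℝ) ≤ r := by exact_mod_cast (by omega : n ≤ r)
          calc (n : ℝ) * (1000 * r ^ 4 * ((2 * A * (1 / 2) ^ k) * A * l ^ (n - 1)))
              ≤ r * (1000 * r ^ 4 * ((2 * A * (1 / 2) ^ k) * A * l ^ (n - 1))) := by gcongr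
            _ = A / 4 * (l * l ^ (n - 1)) * (1 / 2) ^ (k + 1) := by
                rw [hl]; ring
            _ = _ := by rw [← pow_succ', Nat.sub_add_cancel h0]
    have hT : ∀ j, colNorm (nfT K N n) j ≤ A / 2 * l ^ n := by
      intro j
      refine (colNorm_sum_le _ _ _).trans ((Finset.sum_le_sum fun k _ => hR k j).trans ?_)
      rw [← Finset.mul_sum]
      have := sum_geometric_two_le N
      have h0 : 0 ≤ A / 4 * l ^ n := by positivity
      nlinarith
    have hln : 0 ≤ A * l ^ n := by positivity
    refine ⟨fun k j => ?_, fun j => ?_⟩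
    · rw [nfP_eq]
      split_ifs with h
      · rw [h, sub_eq_add_neg]
        refine (colNorm_add_le _ _ _).trans ?_
        rw [colNorm_neg]
        have h1 := hR 1 j
        have h2 := (colNorm_nonint_le (nfT K N n) j).trans (hT j)
        nlinarith
      · refine (hR k j).trans (mul_le_mul_of_nonneg_right (by nlinarith) (by positivity))
    · rw [nfX_eq]
      refine (colNorm_homQ_le _ _).trans ((hT j).trans ?_)
      nlinarith

end NormalForm

/-! ### The initial Hamiltonian -/

section Initial

/-- The multi-indices of length `n` with modes in `[-M, M]`. -/
def boundedLists (M : ℝ) (n : ℕ) : Finset MultiIndex :=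
  (Fintype.piFinset fun _ : Fin n => (Finset.univ : Finset ℤˣ) ×ˢ Finset.Icc ⌈-M⌉ ⌊M⌋).map
    ⟨List.ofFn, List.ofFn_injective⟩

lemma mem_boundedLists {M : ℝ} {n : ℕ} {j : MultiIndex} :
    j ∈ boundedLists M n ↔ j.length = n ∧ ∀ i ∈ j, i.2 ∈ Finset.Icc ⌈-M⌉ ⌊M⌋ := by
  rw [boundedLists, Finset.mem_map]
  constructor
  · rintro ⟨p, hp, rfl⟩
    refine ⟨by simp, fun i hi => ?_⟩
    obtain ⟨k, rfl⟩ := List.mem_ofFn.1 hi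
    exact (Finset.mem_product.1 (Fintype.mem_piFinset.1 hp k)).2
  · rintro ⟨rfl, h⟩
    refine ⟨fun k => j[k], Fintype.mem_piFinset.2 fun k => Finset.mem_product.2
      ⟨Finset.mem_univ _, h _ (List.getElem_mem k.2)⟩, List.ofFn_getElem⟩

/-- The resonant terms of degree `2(n+3)` as a formal rational fraction. -/
def initQ (M : ℝ) (r n : ℕ) : RatCoeff :=
  ∑ j ∈ boundedLists M (2 * (n + 3)), Finsupp.single (j, []) (resonantK r (n + 3) j)

lemma modesLE_of_mem {M : ℝ} (hM : 1 ≤ M) {j : MultiIndex}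
    (h : ∀ i ∈ j, i.2 ∈ Finset.Icc ⌈-M⌉ ⌊M⌋) : ModesLE M j := fun i hi => by
  have := Finset.mem_Icc.1 (h i hi)
  exact max_le hM (abs_le.2 ⟨Int.ceil_le.1 this.1, Int.le_floor.1 this.2⟩)

lemma ratClass_initQ {M : ℝ} (hM : 1 ≤ M) {r n : ℕ} (hn : n + 3 ≤ r) :
    RatClass M (6 * (n + 1)) (n + 3) 0 (initQ M r n) := by
  refine RatClass.sum _ fun j hj => ?_
  by_cases h : resonantK r (n + 3) j = 0
  · rw [h, Finsupp.single_zero]; exact RatClass.zero _ _ _ _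
  have hz := coeffSupp_resonantK r (n + 3) j h
  refine RatClass.single (x := (j, [])) ⟨?_, by simp, hz.2.1, hz.2.2,
    resonantK_resonant (by omega) hn h, modesLE_of_mem hM (mem_boundedLists.1 hj).2, by simp⟩ _
  simpa using hz.1

lemma ratReal_initQ (M : ℝ) (r n : ℕ) : RatReal (initQ M r n) := by
  rw [RatReal, initQ, map_sum]
  refine Finset.sum_bij' (fun j _ => MultiIndex.bar j) (fun j _ => MultiIndex.bar j) ?_ ?_
    (fun j _ => MultiIndex.bar_bar j) (fun j _ => MultiIndex.bar_bar j) ?_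
  · intro j hj
    rw [mem_boundedLists] at hj ⊢
    refine ⟨by rw [length_bar]; exact hj.1, fun i hi => ?_⟩
    obtain ⟨k, hk, rfl⟩ := List.mem_map.1 hi
    exact hj.2 k hk
  · intro j hj
    rw [mem_boundedLists] at hj ⊢
    refine ⟨by rw [length_bar]; exact hj.1, fun i hi => ?_⟩
    obtain ⟨k, hk, rfl⟩ := List.mem_map.1 hi
    exact hj.2 k hk
  · intro j _
    rw [conjQ_single, coeffReal_resonantK r (n + 3) j]
    rfl

/-- Of the n+1 factors 24(n+3)³, n are bounded by 24r³ and the last one by 24·27·4^n. This gives 972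
= (3/2)·24·27 and the rate 96 = 4·24, without an extra power of r. -/
lemma colNorm_initQ_le {M : ℝ} {r n : ℕ} (hn : n + 3 ≤ r) (j : MultiIndex) :
    colNorm (initQ M r n) j ≤ 972 * (96 * (r : ℝ) ^ 3) ^ n := by
  have h1 : colNorm (initQ M r n) j ≤ ‖resonantK r (n + 3) j‖ := by
    refine (colNorm_sum_le _ _ _).trans ?_
    simp only [colNorm_single]
    rw [Finset.sum_ite_eq']
    split_ifs
    · exact le_rfl
    · exact norm_nonneg _
  refine h1.trans ((norm_resonantK_le (by omega) hn j).trans ?_)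
  have h2 : ∀ n : ℕ, ((n : ℝ) + 3) ^ 3 ≤ 27 * 4 ^ n := by
    intro n
    induction n with
    | zero => norm_num
    | succ n ih =>
      have hn0 : (0 : ℝ) ≤ n := Nat.cast_nonneg n
      push_cast
      rw [pow_succ (4 : ℝ)]
      have : ((n : ℝ) + 1 + 3) ^ 3 ≤ 4 * (n + 3) ^ 3 := by nlinarith [pow_nonneg hn0 3, pow_nonneg hn0 2]
      linarith
  rw [show n + 3 - 2 = n + 1 by omega, pow_succ]
  push_cast
  have hnr : (n : ℝ) + 3 ≤ r := by exact_mod_cast hn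
  calc 3 / 2 * ((24 * ((n : ℝ) + 3) ^ 3) ^ n * (24 * ((n : ℝ) + 3) ^ 3))
      ≤ 3 / 2 * ((24 * (r : ℝ) ^ 3) ^ n * (24 * (27 * 4 ^ n))) := by
        gcongr
        exact h2 n
    _ = 972 * (4 * (24 * (r : ℝ) ^ 3)) ^ n := by rw [mul_pow 4]; ring
    _ = _ := by ring

lemma eval_initQ {M : ℝ} (r n : ℕ) (z : GM M) :
    ceval (initQ M r n) (cx z) = Coeff.eval (n + 3) (resonantK r (n + 3)) z := by
  rw [initQ, ceval_sum, Coeff.eval]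
  have h0 : ∀ j : MultiIndex, (∃ i ∈ j, i.2 ∉ Finset.Icc ⌈-M⌉ ⌊M⌋) → monomial z j = 0 := by
    rintro j ⟨i, hi, hm⟩
    refine List.prod_eq_zero (List.mem_map.2 ⟨i, hi, ?_⟩)
    simp [coord, extend, hm]
  rw [finsum_mem_eq_sum_of_inter_support_eq (t := (boundedLists M (2 * (n + 3))))]
  · refine Finset.sum_congr rfl fun j _ => ?_
    rw [ceval_single, cterm, cmon_cx]
    simp [cden]
  · ext j
    simp only [Set.mem_inter_iff, Set.mem_ofPred_eq, Function.mem_support, Finset.mem_coe]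
    refine and_congr_left fun hj => ?_
    have hz := coeffSupp_resonantK r (n + 3) j (left_ne_zero_of_mul hj)
    refine ⟨fun _ => mem_boundedLists.2 ⟨hz.1, fun i hi => ?_⟩, fun _ => hz⟩
    by_contra hc
    exact right_ne_zero_of_mul hj (h0 j ⟨i, hi, hc⟩)

end Initial

/-! ### Hamiltonian flows on the phase space -/

section GevreyFlow

variable {M : ℝ} (σ θ : ℝ)

/-- The phase space with the Gevrey norm is a weighted `ℓ¹` space. -/
def gevreyEquiv : GM M ≃L[ℝ] PiLp 1 (fun _ : Modes M => ℂ) :=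
  (ContinuousLinearEquiv.piCongrRight fun a : Modes M =>
    ContinuousLinearEquiv.smulLeft (R₁ := ℝ) (M₁ := ℂ)
      (Units.mk0 (2 * wt σ θ a) (mul_pos two_pos (wt_pos σ θ a)).ne')).trans
    (PiLp.continuousLinearEquiv 1 ℝ fun _ : Modes M => ℂ).symm

lemma norm_gevreyEquiv (z : GM M) : ‖gevreyEquiv σ θ z‖ = gnorm σ θ z := by
  rw [PiLp.norm_eq_of_L1, gnorm, Finset.mul_sum]
  refine Finset.sum_congr rfl fun a _ => ?_
  have : (gevreyEquiv σ θ z).ofLp a = (2 * wt σ θ a) • z a := rfl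
  rw [this, norm_smul, Real.norm_of_nonneg (mul_pos two_pos (wt_pos σ θ a)).le, wt]
  ring

variable {σ θ}

lemma gnorm_nonneg (z : GM M) : 0 ≤ gnorm σ θ z := norm_gevreyEquiv σ θ z ▸ norm_nonneg _

lemma gnorm_add_le (z z' : GM M) : gnorm σ θ (z + z') ≤ gnorm σ θ z + gnorm σ θ z' := by
  rw [← norm_gevreyEquiv, map_add, ← norm_gevreyEquiv, ← norm_gevreyEquiv]
  exact norm_add_le _ _

lemma gnorm_sub_rev (z z' : GM M) : gnorm σ θ (z - z') = gnorm σ θ (z' - z) := by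
  rw [← norm_gevreyEquiv, map_sub, ← norm_gevreyEquiv σ θ (z' - z), map_sub, norm_sub_rev]

lemma gnorm_zero : gnorm σ θ (0 : GM M) = 0 := by
  rw [← norm_gevreyEquiv, map_zero, norm_zero]

lemma gnorm_eq_zero {z : GM M} : gnorm σ θ z = 0 ↔ z = 0 := by
  rw [← norm_gevreyEquiv, norm_eq_zero, map_eq_zero_iff _ (gevreyEquiv σ θ).injective]

lemma continuous_gnorm : Continuous (gnorm σ θ : GM M → ℝ) := by
  have : (gnorm σ θ : GM M → ℝ) = fun z => ‖gevreyEquiv σ θ z‖ :=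
    funext fun z => (norm_gevreyEquiv σ θ z).symm
  rw [this]
  exact (gevreyEquiv σ θ).continuous.norm

/-- The flow of a small vector field, in the Gevrey norm. -/
lemma exists_gevrey_flow {X : GM M → GM M} {U D : Set (GM M)} {κ : ℝ} (hU : IsOpen U)
    (hX : ContDiffOn ℝ ∞ X U) (hD : IsOpen D) (hκ : 0 < κ) (h0 : (0 : GM M) ∉ D)
    (hball : ∀ x ∈ D, ∀ y, gnorm σ θ (y - x) ≤ κ * gnorm σ θ x → y ∈ U)
    (hbd : ∀ x ∈ D, ∀ y, gnorm σ θ (y - x) ≤ κ * gnorm σ θ x →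
      gnorm σ θ (X y) ≤ κ * gnorm σ θ x / 4)
    (hder : ∀ x ∈ D, ∀ y, gnorm σ θ (y - x) ≤ κ * gnorm σ θ x → ∀ w,
      gnorm σ θ (fderiv ℝ X y w) ≤ 1 / 4 * gnorm σ θ w) :
    ∃ Φ : ℝ → GM M → GM M, ∀ x ∈ D, Φ 0 x = x ∧
      (∀ t ∈ Set.Icc (0 : ℝ) 1, HasDerivWithinAt (Φ · x) (X (Φ t x)) (Set.Icc 0 1) t) ∧
      (∀ t ∈ Set.Icc (0 : ℝ) 1, gnorm σ θ (Φ t x - x) ≤ κ * gnorm σ θ x / 4) ∧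
      (∀ t ∈ Set.Icc (0 : ℝ) 1, ContDiffAt ℝ ∞ (Φ t) x) ∧
      (∀ w, ∀ t ∈ Set.Icc (0 : ℝ) 1, HasDerivWithinAt (fun s => fderiv ℝ (Φ s) x w)
        (fderiv ℝ X (Φ t x) (fderiv ℝ (Φ t) x w)) (Set.Icc 0 1) t) ∧
      (∀ w, fderiv ℝ (Φ 0) x w = w) ∧
      (∀ w, ∀ t ∈ Set.Icc (0 : ℝ) 1,
        gnorm σ θ (fderiv ℝ (Φ t) x w - w) ≤ 1 / 3 * gnorm σ θ w) ∧
      (∀ v : ℝ → GM M, (∀ t ∈ Set.Icc (0 : ℝ) 1,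
        HasDerivWithinAt v (X (v t)) (Set.Icc 0 1) t) → v 0 = x →
        (∀ t ∈ Set.Icc (0 : ℝ) 1, gnorm σ θ (v t - x) ≤ κ * gnorm σ θ x) → v 1 = Φ 1 x) := by
  set e : GM M ≃L[ℝ] PiLp 1 (fun _ : Modes M => ℂ) := gevreyEquiv σ θ with he
  have hn : ∀ z, ‖e z‖ = gnorm σ θ z := norm_gevreyEquiv σ θ
  have hn' : ∀ y, ‖y‖ = gnorm σ θ (e.symm y) := fun y => by rw [← hn, e.apply_symm_apply]
  -- The field is transported by the isometry onto a weighted ℓ¹ space, where the Gevrey norm is the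
  -- ambient norm and the abstract flow theorem applies.
  let Y := fun y => e (X (e.symm y))
  have hmem : ∀ x y, y ∈ Metric.closedBall x (κ * ‖x‖) →
      gnorm σ θ (e.symm y - e.symm x) ≤ κ * gnorm σ θ (e.symm x) := fun x y hy => by
    rwa [Metric.mem_closedBall, dist_eq_norm, hn', hn', map_sub] at hy
  have hYd : ∀ y, e.symm y ∈ U → HasFDerivAt Y
      ((e : GM M →L[ℝ] _).comp ((fderiv ℝ X (e.symm y)).comp (e.symm : _ →L[ℝ] GM M))) y :=
    fun y hy => e.hasFDerivAt.comp y ((((hX.contDiffAt (hU.mem_nhds hy)).differentiableAt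
      (by simp)).hasFDerivAt).comp y e.symm.hasFDerivAt)
  obtain ⟨Ψ, hΨ⟩ := exists_flow (X := Y) (U := e.symm ⁻¹' U) (D := e.symm ⁻¹' D) (κ := κ)
    (hU.preimage e.symm.continuous)
    (e.contDiff.comp_contDiffOn (hX.comp e.symm.contDiff.contDiffOn fun _ h => h))
    (hD.preimage e.symm.continuous) hκ (fun h => h0 (by simpa using h))
    (fun x hx y hy => hball _ hx _ (hmem x y hy))
    (fun x hx y hy => by
      rw [hn, hn']
      exact hbd _ hx _ (hmem x y hy))
    (fun x hx y hy => by
      rw [(hYd y (hball _ hx _ (hmem x y hy))).fderiv]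
      refine ContinuousLinearMap.opNorm_le_bound _ (by norm_num) fun w => ?_
      rw [hn' w]
      simp only [ContinuousLinearMap.comp_apply, ContinuousLinearEquiv.coe_coe]
      rw [hn]
      exact hder _ hx _ (hmem x y hy) _)
  refine ⟨fun t x => e.symm (Ψ t (e x)), fun x hx => ?_⟩
  obtain ⟨p0, p1, p2, p3, p4, p5, p6, p7⟩ := hΨ (e x) (by simpa using hx)
  have hfd : ∀ t ∈ Set.Icc (0 : ℝ) 1, ∀ w, fderiv ℝ (fun x => e.symm (Ψ t (e x))) x w =
      e.symm (fderiv ℝ (Ψ t) (e x) (e w)) := fun t ht w => by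
    have h1 : HasFDerivAt (fun x => e.symm (Ψ t (e x))) ((e.symm : _ →L[ℝ] GM M).comp
        ((fderiv ℝ (Ψ t) (e x)).comp (e : GM M →L[ℝ] _))) x :=
      e.symm.hasFDerivAt.comp x ((((p3 t ht).differentiableAt (by simp)).hasFDerivAt).comp x
        e.hasFDerivAt)
    rw [h1.fderiv]
    rfl
  have h01 : (0 : ℝ) ∈ Set.Icc (0 : ℝ) 1 := ⟨le_rfl, zero_le_one⟩
  have hpU : ∀ t ∈ Set.Icc (0 : ℝ) 1, e.symm (Ψ t (e x)) ∈ U := fun t ht => by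
    refine hball x hx _ ?_
    have h := p2 t ht
    rw [Metric.mem_closedBall, dist_eq_norm, hn', hn', map_sub, e.symm_apply_apply] at h
    have : 0 ≤ κ * gnorm σ θ x := mul_nonneg hκ.le (gnorm_nonneg x)
    linarith
  refine ⟨by simp [p0], fun t ht => ?_, fun t ht => ?_, fun t ht => ?_, fun w t ht => ?_,
    fun w => ?_, fun w t ht => ?_, fun v hv hv0 hvb => ?_⟩
  · have := e.symm.hasFDerivAt.comp_hasDerivWithinAt t (p1 t ht)
    simpa [Y, Function.comp_def] using this
  · have h := p2 t ht
    rwa [Metric.mem_closedBall, dist_eq_norm, hn', hn', map_sub, e.symm_apply_apply] at h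
  · exact e.symm.contDiff.contDiffAt.comp x ((p3 t ht).comp x e.contDiff.contDiffAt)
  · have := e.symm.hasFDerivAt.comp_hasDerivWithinAt t (p4 (e w) t ht)
    rw [(hYd _ (hpU t ht)).fderiv] at this
    rw [hfd t ht]
    simp only [ContinuousLinearMap.comp_apply, ContinuousLinearEquiv.coe_coe,
      e.symm_apply_apply] at this
    exact this.congr (fun s hs => hfd s hs w) (hfd t ht w)
  · rw [hfd 0 h01, p5, e.symm_apply_apply]
  · have h := p6 (e w) t ht
    rw [hn', hn', map_sub, e.symm_apply_apply] at h
    rwa [hfd t ht]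
  · have h := p7 (fun t => e (v t)) (fun t ht => by
      have := e.hasFDerivAt.comp_hasDerivWithinAt t (hv t ht)
      simpa [Y, Function.comp_def] using this) (by rw [hv0]) (fun t ht => by
      rw [Metric.mem_closedBall, dist_eq_norm, ← map_sub, hn, hn]
      exact hvb t ht)
    change v 1 = e.symm (Ψ 1 (e x))
    rw [← h, e.symm_apply_apply]

lemma hasDerivWithinAt_l2inner {v w : ℝ → GM M} {v' w' : GM M} {s : Set ℝ} {t : ℝ}
    (hv : HasDerivWithinAt v v' s t) (hw : HasDerivWithinAt w w' s t) :
    HasDerivWithinAt (fun t => l2inner (Complex.I • v t) (w t))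
      (l2inner (Complex.I • v') (w t) + l2inner (Complex.I • v t) w') s t := by
  rw [hasDerivWithinAt_pi] at hv hw
  have h : ∀ a, HasDerivWithinAt (fun t => (Complex.I • v t) a * (starRingEnd ℂ) (w t a))
      ((Complex.I • v') a * (starRingEnd ℂ) (w t a) +
        (Complex.I • v t) a * (starRingEnd ℂ) (w' a)) s t := fun a =>
    ((hv a).const_smul Complex.I).mul
      (Complex.conjCLE.hasFDerivAt.comp_hasDerivWithinAt t (hw a))
  have h2 := Complex.reCLM.hasFDerivAt.comp_hasDerivWithinAt t
    (HasDerivWithinAt.fun_sum (u := Finset.univ) fun a _ => h a)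
  rw [Finset.sum_add_distrib, map_add] at h2
  exact h2

/-- The linearized flow of a Hamiltonian vector field preserves the symplectic form. -/
lemma l2inner_linearized_flow {χ : GM M → ℝ} {u v w : ℝ → GM M}
    (hχ : ∀ t ∈ Set.Icc (0 : ℝ) 1, ContDiffAt ℝ ∞ χ (u t)) {c : ℝ}
    (hv : ∀ t ∈ Set.Icc (0 : ℝ) 1,
      HasDerivWithinAt v (fderiv ℝ (fun y => c • hamVF χ y) (u t) (v t)) (Set.Icc 0 1) t)
    (hw : ∀ t ∈ Set.Icc (0 : ℝ) 1,
      HasDerivWithinAt w (fderiv ℝ (fun y => c • hamVF χ y) (u t) (w t)) (Set.Icc 0 1) t) :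
    ∀ t ∈ Set.Icc (0 : ℝ) 1,
      l2inner (Complex.I • v t) (w t) = l2inner (Complex.I • v 0) (w 0) := by
  have hd : ∀ t ∈ Set.Icc (0 : ℝ) 1, HasDerivWithinAt (fun t => l2inner (Complex.I • v t) (w t))
      0 (Set.Icc 0 1) t := by
    intro t ht
    have h := hasDerivWithinAt_l2inner (hv t ht) (hw t ht)
    have hX : DifferentiableAt ℝ (hamVF χ) (u t) :=
      (contDiffAt_hamVF (hχ t ht)).differentiableAt (by simp)
    have e : ∀ x, fderiv ℝ (fun y => c • hamVF χ y) (u t) x = c • fderiv ℝ (hamVF χ) (u t) x :=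
      fun x => by rw [fderiv_fun_const_smul hX]; rfl
    rw [e, e, smul_comm] at h
    have hl : ∀ x y : GM M, l2inner (c • x) y = c * l2inner x y := fun x y => by
      simp only [l2inner_eq_sum, Finset.mul_sum]
      exact Finset.sum_congr rfl fun a _ => by simp; ring
    have hl' : ∀ x y : GM M, l2inner x (c • y) = c * l2inner x y := fun x y => by
      simp only [l2inner_eq_sum, Finset.mul_sum]
      exact Finset.sum_congr rfl fun a _ => by simp; ring
    rwa [hl, hl', ← mul_add, l2inner_fderiv_hamVF (hχ t ht), mul_zero] at h
  refine constant_of_derivWithin_zero (fun t ht => (hd t ht).differentiableWithinAt) fun t ht => ?_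
  exact (hd t ⟨ht.1, ht.2.le⟩).derivWithin (uniqueDiffOn_Icc zero_lt_one t ⟨ht.1, ht.2.le⟩)

end GevreyFlow

/-! ### Taylor formula with remainder along a flow -/

section Remainder

variable {E : Type*} [NormedAddCommGroup E] [NormedSpace ℝ E]

/-- The derivative of `Df(u)(v)` along the flow and the linearized flow of a vector field. -/
lemma hasDerivWithinAt_fderiv_flow {f : E → ℝ} {X : E → E} {u v : ℝ → E} {s : Set ℝ} {t : ℝ}
    (hf : ContDiffAt ℝ ∞ f (u t)) (hX : DifferentiableAt ℝ X (u t))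
    (hu : HasDerivWithinAt u (X (u t)) s t)
    (hv : HasDerivWithinAt v (fderiv ℝ X (u t) (v t)) s t) :
    HasDerivWithinAt (fun t => fderiv ℝ f (u t) (v t))
      (fderiv ℝ (fun y => fderiv ℝ f y (X y)) (u t) (v t)) s t := by
  have hd : DifferentiableAt ℝ (fderiv ℝ f) (u t) :=
    (hf.fderiv_right (m := ∞) (by simp)).differentiableAt (by simp)
  have h1 := (hd.hasFDerivAt.comp_hasDerivWithinAt t hu).clm_apply hv
  have h2 := (hd.hasFDerivAt.clm_apply hX.hasFDerivAt).fderiv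
  have hs : IsSymmSndFDerivAt ℝ f (u t) :=
    hf.isSymmSndFDerivAt (by simp; exact WithTop.coe_le_coe.2 (le_top (a := (2 : ℕ∞))))
  rw [h2]
  refine h1.congr_deriv ?_
  simp only [add_apply, ContinuousLinearMap.comp_apply, ContinuousLinearMap.flip_apply]
  -- Symmetry of the second derivative identifies the order of differentiation along the flow with
  -- that of the derivative of y ↦ Df(y)X(y) in the direction v.
  rw [hs.eq (v t) (X (u t))]
  exact add_comm _ _

/-- The remainder of the Lie series, in terms of the remainders of the Lie derivatives. -/
lemma abs_fderiv_remainder_le {f ρ : ℕ → E → ℝ} {X : E → E} {U : Set E} (hU : IsOpen U) {N : ℕ}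
    (hf : ∀ k, ∀ y ∈ U, ContDiffAt ℝ ∞ (f k) y) (hX : ∀ y ∈ U, DifferentiableAt ℝ X y)
    (hfX : ∀ k < N, ∀ y ∈ U, fderiv ℝ (f k) y (X y) = (k + 1) * f (k + 1) y + ρ k y)
    (hN : ∀ y ∈ U, f N y = 0) {u v : ℝ → E} (huU : ∀ t ∈ Set.Icc (0 : ℝ) 1, u t ∈ U)
    (hu : ∀ t ∈ Set.Icc (0 : ℝ) 1, HasDerivWithinAt u (X (u t)) (Set.Icc 0 1) t)
    (hv : ∀ t ∈ Set.Icc (0 : ℝ) 1, HasDerivWithinAt v (fderiv ℝ X (u t) (v t)) (Set.Icc 0 1) t)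
    {B : ℝ} (hB : ∀ t ∈ Set.Icc (0 : ℝ) 1,
      |∑ k ∈ Finset.range N, (1 - t) ^ k * fderiv ℝ (ρ k) (u t) (v t)| ≤ B) (hN0 : 0 < N) :
    |fderiv ℝ (f 0) (u 1) (v 1) - ∑ k ∈ Finset.range N, fderiv ℝ (f k) (u 0) (v 0)| ≤ B := by
  -- At t = 0 all weights are 1 and at t = 1 only k = 0 survives. In the derivative, -k(1-t)^{k-1}
  -- f_k cancels against the term (k+1)(1-t)^k f_{k+1} of the preceding index, so only the ρ_k
  -- remain, because f_N = 0.
  let g : ℝ → ℝ := fun t => ∑ k ∈ Finset.range N, (1 - t) ^ k * fderiv ℝ (f k) (u t) (v t)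
  have hg : ∀ t ∈ Set.Icc (0 : ℝ) 1, HasDerivWithinAt g
      (∑ k ∈ Finset.range N, (1 - t) ^ k * fderiv ℝ (ρ k) (u t) (v t)) (Set.Icc 0 1) t := by
    intro t ht
    have hut := huU t ht
    have h1 : ∀ k ∈ Finset.range N, HasDerivWithinAt
        (fun t => (1 - t) ^ k * fderiv ℝ (f k) (u t) (v t))
        ((k * (1 - t) ^ (k - 1) * (-1)) * fderiv ℝ (f k) (u t) (v t) +
          (1 - t) ^ k * fderiv ℝ (fun y => fderiv ℝ (f k) y (X y)) (u t) (v t))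
        (Set.Icc 0 1) t := fun k _ => by
      have hp : HasDerivWithinAt (fun t : ℝ => (1 - t) ^ k) (k * (1 - t) ^ (k - 1) * (-1))
          (Set.Icc 0 1) t := (((hasDerivAt_id t).const_sub 1).pow k).hasDerivWithinAt
      exact hp.mul (hasDerivWithinAt_fderiv_flow (hf k _ hut) (hX _ hut) (hu t ht) (hv t ht))
    have h2 := HasDerivWithinAt.fun_sum h1
    refine h2.congr_deriv ?_
    have h3 : ∀ k ∈ Finset.range N, fderiv ℝ (fun y => fderiv ℝ (f k) y (X y)) (u t) (v t) =
        (k + 1) * fderiv ℝ (f (k + 1)) (u t) (v t) + fderiv ℝ (ρ k) (u t) (v t) := by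
      intro k hk
      have hk' := Finset.mem_range.1 hk
      have hev : (fun y => fderiv ℝ (f k) y (X y)) =ᶠ[nhds (u t)]
          fun y => ((k : ℝ) + 1) * f (k + 1) y + ρ k y := by
        filter_upwards [hU.mem_nhds hut] with y hy
        exact hfX k hk' y hy
      have hev' : ρ k =ᶠ[nhds (u t)]
          fun y => fderiv ℝ (f k) y (X y) - ((k : ℝ) + 1) * f (k + 1) y := by
        filter_upwards [hU.mem_nhds hut] with y hy
        rw [hfX k hk' y hy]; ring
      have d1 : DifferentiableAt ℝ (f (k + 1)) (u t) := (hf _ _ hut).differentiableAt (by simp)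
      have d2 : DifferentiableAt ℝ (ρ k) (u t) := by
        refine DifferentiableAt.congr_of_eventuallyEq ?_ hev'
        have hd : DifferentiableAt ℝ (fderiv ℝ (f k)) (u t) :=
          ((hf k _ hut).fderiv_right (m := ∞) (by simp)).differentiableAt (by simp)
        exact (hd.clm_apply (hX _ hut)).fun_sub (d1.const_mul _)
      rw [hev.fderiv_eq, fderiv_fun_add (d1.const_mul _) d2, fderiv_const_mul d1]
      rfl
    have h4 : ∑ k ∈ Finset.range N,
        ((((k + 1 : ℕ) : ℝ) * (1 - t) ^ (k + 1 - 1) * fderiv ℝ (f (k + 1)) (u t) (v t)) -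
          (k * (1 - t) ^ (k - 1) * fderiv ℝ (f k) (u t) (v t))) = 0 := by
      rw [Finset.sum_range_sub (fun k : ℕ => (k : ℝ) * (1 - t) ^ (k - 1) *
        fderiv ℝ (f k) (u t) (v t))]
      have hz : fderiv ℝ (f N) (u t) = 0 := by
        have : f N =ᶠ[nhds (u t)] fun _ => 0 := by
          filter_upwards [hU.mem_nhds hut] with y hy
          exact hN y hy
        rw [this.fderiv_eq, fderiv_fun_const]
        rfl
      rw [hz]
      simp
    rw [← sub_eq_zero, ← Finset.sum_sub_distrib, ← h4]
    refine Finset.sum_congr rfl fun k hk => ?_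
    rw [h3 k hk]
    push_cast
    ring
  have hmv := norm_image_sub_le_of_norm_deriv_le_segment' hg
    (fun t ht => hB t ⟨ht.1, ht.2.le⟩) 1 ⟨zero_le_one, le_rfl⟩
  have e1 : g 1 = fderiv ℝ (f 0) (u 1) (v 1) := by
    simp only [g]
    rw [Finset.sum_eq_single 0]
    · simp
    · intro k _ hk
      simp [hk]
    · intro h
      exact absurd (Finset.mem_range.2 hN0) h
  have e0 : g 0 = ∑ k ∈ Finset.range N, fderiv ℝ (f k) (u 0) (v 0) := by
    simp [g]
  rw [e1, e0, sub_zero, mul_one] at hmv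
  exact hmv

end Remainder

/-! ### The domains -/

section Domain

variable {M σ θ : ℝ}

/-- The modes -3, 1, 2 and -2, -1, 3 both sum to 0 and have squares summing to 14, but the two sets
differ. This example is where M ≥ 3 and length 6 enter. -/
lemma exists_mem_nonIntegrableSetLE (hM : 3 ≤ M) {s : ℕ} (hs : 6 ≤ s) :
    ∃ h, h ∈ nonIntegrableSetLE s M := by
  refine ⟨[(1, -3), (1, 1), (1, 2), (-1, -2), (-1, -1), (-1, 3)], ⟨⟨3, by norm_num, ⟨rfl, ?_, ?_⟩,
    ?_⟩, fun hp => ?_⟩, hs, ?_⟩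
  · decide
  · decide
  · decide
  · have h1 : ((-1, -3) : Idx) ∈ MultiIndex.bar
        [(1, -3), (1, 1), (1, 2), (-1, -2), (-1, -1), (-1, 3)] := by decide
    have h2 := hp.mem_iff.1 h1
    revert h2
    decide
  · intro i hi
    simp only [List.mem_cons, List.not_mem_nil, or_false] at hi
    rcases hi with rfl | rfl | rfl | rfl | rfl | rfl <;> refine max_le (by linarith) ?_ <;>
      norm_num [abs_of_nonneg, abs_of_neg] <;> linarith

lemma finite_nonIntegrableSetLE (s : ℕ) : (nonIntegrableSetLE s M).Finite := by
  refine Set.Finite.subset (Finset.finite_toSet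
    ((Finset.range (s + 1)).biUnion fun n => boundedLists M n)) fun j hj => ?_
  rw [Finset.mem_coe, Finset.mem_biUnion]
  exact ⟨j.length, Finset.mem_range.2 (Nat.lt_succ_of_le hj.2.1), mem_boundedLists.2
    ⟨rfl, fun i hi => mem_modes_of_modesLE hj.2.2 hi⟩⟩

lemma continuous_omega (h : MultiIndex) : Continuous (omega h : GM M → ℝ) := by
  have e : (omega h : GM M → ℝ) = fun z => (comega h (cx z)).re := funext fun z => by
    rw [comega_cx, Complex.ofReal_re]
  rw [e]
  exact Complex.continuous_re.comp ((contDiff_comega (n := 1) h).continuous.comp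
    (cx (M := M)).continuous)

lemma isOpen_domain (ϱ γ : ℝ) (s : ℕ) : IsOpen (domain σ θ M ϱ γ s) := by
  refine (isOpen_lt continuous_gnorm continuous_const).inter ?_
  have e : nonResonantSet σ θ M γ s = ⋂ j ∈ nonIntegrableSetLE s M,
      {z | γ * gnorm σ θ z ^ 2 < |omega j z|} := by
    ext z
    simp [nonResonantSet]
  rw [e]
  exact (finite_nonIntegrableSetLE s).isOpen_biInter fun j _ =>
    isOpen_lt (continuous_const.mul (continuous_gnorm.pow 2)) (continuous_omega j).abs

/-- The points where no small divisor vanishes. -/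
def regularSet (M : ℝ) (s : ℕ) : Set (GM M) := {z | ∀ h ∈ nonIntegrableSetLE s M, omega h z ≠ 0}

lemma isOpen_regularSet (s : ℕ) : IsOpen (regularSet M s) := by
  have e : regularSet M s = ⋂ j ∈ nonIntegrableSetLE s M, {z | omega j z ≠ 0} := by
    ext z
    simp [regularSet]
  rw [e]
  exact (finite_nonIntegrableSetLE s).isOpen_biInter fun j _ =>
    isOpen_ne_fun (continuous_omega j) continuous_const

lemma comega_ne_zero_of_mem {s : ℕ} {z : GM M} (hz : z ∈ regularSet M s) :
    ∀ h ∈ nonIntegrableSetLE s M, comega h (cx z) ≠ 0 := fun h hh => by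
  rw [comega_cx]
  exact_mod_cast hz h hh

/-- The non-resonance inequality is strict and is required of at least one multi-index, which
excludes the origin. Balls of radius proportional to the norm of their centre are therefore
non-degenerate. -/
lemma gnorm_pos_of_mem_domain (hM : 3 ≤ M) {ϱ γ : ℝ} {s : ℕ} (hs : 6 ≤ s) {z : GM M}
    (hz : z ∈ domain σ θ M ϱ γ s) : 0 < gnorm σ θ z := by
  obtain ⟨h, hh⟩ := exists_mem_nonIntegrableSetLE hM hs
  have h1 := hz.2 h hh
  refine lt_of_le_of_ne (gnorm_nonneg z) fun h0 => ?_
  have hz0 : z = 0 := gnorm_eq_zero.1 h0.symm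
  rw [hz0] at h1
  simp [omega, gnorm] at h1

/-- The small divisors near a point of the domain. -/
lemma region_of_mem_domain (hσ : 0 < σ) {r : ℕ} (hr : 1 ≤ r) {ϱ γ : ℝ} (hγ : 0 < γ) (hγ1 : γ < 1)
    {x : GM M} (hx : x ∈ domain σ θ M ϱ (γ / 2) (6 * r)) {ζ : CV M}
    (hζ : cnorm σ θ (ζ - cx x) ≤ 2 * (γ / (144 * r) * gnorm σ θ x)) :
    cnorm σ θ ζ ≤ 2 * gnorm σ θ x ∧
      ∀ h ∈ nonIntegrableSetLE (6 * r) M, γ / 4 * gnorm σ θ x ^ 2 ≤ ‖comega h ζ‖ := by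
  set R := gnorm σ θ x with hR
  have hR0 : 0 ≤ R := gnorm_nonneg x
  have hr' : (1 : ℝ) ≤ r := by exact_mod_cast hr
  have hκ : γ / (144 * r) ≤ 1 / 2 := by
    rw [div_le_div_iff₀ (by positivity) (by norm_num)]
    nlinarith
  -- The divisor moves by at most 6r·(2κR)·(R + 2R) = 36rκR²; κ = γ/(144r) makes this γR²/4, half of
  -- the available γR²/2.
  have hκr : γ / (144 * r) * (36 * r) = γ / 4 := by
    field_simp
    norm_num
  have h1 : cnorm σ θ ζ ≤ 2 * R := by
    have h := cnorm_add_le (σ := σ) (θ := θ) (ζ - cx x) (cx x)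
    rw [sub_add_cancel, cnorm_cx] at h
    nlinarith
  refine ⟨h1, fun h hh => ?_⟩
  have h2 := norm_comega_sub_le (θ := θ) hσ h (cx x) ζ
  have h3 : cnorm σ θ (cx x - ζ) = cnorm σ θ (ζ - cx x) := by
    have := cnorm_smul (σ := σ) (θ := θ) (-1) (ζ - cx x)
    rw [norm_neg, norm_one, one_mul, neg_one_smul, neg_sub] at this
    exact this
  rw [h3, cnorm_cx] at h2
  have h4 : (h.length : ℝ) ≤ 6 * r := by exact_mod_cast hh.2.1
  have h5 : ‖comega h (cx x) - comega h ζ‖ ≤ γ / 4 * R ^ 2 := by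
    refine h2.trans ?_
    calc (h.length : ℝ) * (cnorm σ θ (ζ - cx x) * (R + cnorm σ θ ζ))
        ≤ 6 * r * (2 * (γ / (144 * r) * R) * (R + 2 * R)) := by
          have := cnorm_nonneg (σ := σ) (θ := θ) (ζ - cx x)
          have := cnorm_nonneg (σ := σ) (θ := θ) ζ
          gcongr
      _ = γ / (144 * r) * (36 * r) * R ^ 2 := by ring
      _ = γ / 4 * R ^ 2 := by rw [hκr]
  have h6 : γ / 2 * R ^ 2 ≤ ‖comega h (cx x)‖ := by
    rw [comega_cx, Complex.norm_real, Real.norm_eq_abs]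
    exact (hx.2 h hh).le
  have h7 := norm_sub_norm_le (comega h (cx x)) (comega h ζ)
  linarith

end Domain

/-! ### Algebraic identities of the normal form -/

section Identities

variable {M : ℝ}

/-- The generator of the normal form transformation. -/
def genQ (M : ℝ) (r : ℕ) : RatCoeff := ∑ n ∈ Finset.range (r - 2), nfX (initQ M r) r n

/-- The coefficient of order `k` in time of the transformed Hamiltonian. -/
def famQ (M : ℝ) (r k : ℕ) : RatCoeff := ∑ n ∈ Finset.range (r - 2), nfP (initQ M r) r n k

/-- The pairs of orders whose brackets are left in the remainder. -/
def remPairs (r : ℕ) : Finset (ℕ × ℕ) :=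
  (Finset.range (r - 2) ×ˢ Finset.range (r - 2)).filter fun p => ¬ p.1 + p.2 + 1 < r - 2

/-- The remainder of order `k` in time. -/
def remQ (M : ℝ) (r k : ℕ) : RatCoeff :=
  ∑ p ∈ remPairs r, br (nfP (initQ M r) r p.1 k) (nfX (initQ M r) r p.2)

/-- Regrouping by n = i + j + 1, the order of the bracket of terms i and j. -/
lemma sum_pairs_lt {N : Type*} [AddCommMonoid N] (ν : ℕ) (a : ℕ → ℕ → N) :
    ∑ p ∈ (Finset.range ν ×ˢ Finset.range ν).filter (fun p => p.1 + p.2 + 1 < ν), a p.1 p.2 =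
      ∑ n ∈ Finset.range ν, ∑ i : Fin n, a i i.rev := by
  have e : ∀ n, ∑ i : Fin n, a i i.rev = ∑ i ∈ Finset.range n, a i (n - 1 - i) := fun n => by
    rw [← Fin.sum_univ_eq_sum_range (fun i => a i (n - 1 - i))]
    refine Finset.sum_congr rfl fun i _ => ?_
    congr 1
    rw [Fin.val_rev]
    omega
  simp only [e]
  rw [Finset.sum_sigma']
  refine Finset.sum_bij' (fun p _ => (⟨p.1 + p.2 + 1, p.1⟩ : (_ : ℕ) × ℕ))
    (fun q _ => (q.2, q.1 - 1 - q.2)) ?_ ?_ ?_ ?_ ?_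
  · rintro ⟨i, j⟩ h
    simp only [Finset.mem_filter, Finset.mem_product, Finset.mem_range, Finset.mem_sigma] at h ⊢
    omega
  · rintro ⟨n, i⟩ h
    simp only [Finset.mem_filter, Finset.mem_product, Finset.mem_range, Finset.mem_sigma] at h ⊢
    omega
  · rintro ⟨i, j⟩ h
    simp only [Prod.mk.injEq, true_and]
    omega
  · rintro ⟨n, i⟩ h
    simp only [Finset.mem_range, Finset.mem_sigma] at h
    simp only [Sigma.mk.injEq, heq_eq_eq, and_true]
    omega
  · rintro ⟨i, j⟩ h
    congr 1
    simp only
    omega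

lemma nf_class (hM : 3 ≤ M) {r n : ℕ} (hn : n < r - 2) :
    (∀ k, RatClass M (6 * (n + 1)) (n + 3) (2 * n) (nfR (initQ M r) r n k)) ∧
    RatClass M (6 * (n + 1)) (n + 3) (2 * n) (nfT (initQ M r) r n) ∧
    (∀ k, RatClass M (6 * (n + 1)) (n + 3) (2 * n) (nfP (initQ M r) r n k)) ∧
    RatClass M (6 * (n + 1)) (n + 2) (2 * n + 1) (nfX (initQ M r) r n) :=
  ratClass_nf (K := initQ M r) (N := r) (ν := r - 2)
    (fun n hn => ratClass_initQ (by linarith) (by omega)) hn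

lemma nf_real {r n : ℕ} (hn : n < r - 2) :
    RatReal (nfT (initQ M r) r n) ∧ (∀ k, RatReal (nfP (initQ M r) r n k)) ∧
    RatReal (nfX (initQ M r) r n) :=
  ratReal_nf (K := initQ M r) (N := r) (ν := r - 2) (fun n _ => ratReal_initQ M r n) hn

lemma ratReal_genQ (r : ℕ) : RatReal (genQ M r) :=
  RatReal.sum _ fun _ hn => (nf_real (Finset.mem_range.1 hn)).2.2

lemma ratReal_famQ (r k : ℕ) : RatReal (famQ M r k) :=
  RatReal.sum _ fun _ hn => (nf_real (Finset.mem_range.1 hn)).2.1 k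

lemma mem_remPairs {r : ℕ} {p : ℕ × ℕ} :
    p ∈ remPairs r ↔ p.1 < r - 2 ∧ p.2 < r - 2 ∧ r - 2 ≤ p.1 + p.2 + 1 := by
  simp only [remPairs, Finset.mem_filter, Finset.mem_product, Finset.mem_range]
  omega

lemma ratReal_remQ (r k : ℕ) : RatReal (remQ M r k) :=
  RatReal.sum _ fun p hp => by
    obtain ⟨h1, h2, _⟩ := mem_remPairs.1 hp
    exact ((nf_real h1).2.1 k).br (nf_real h2).2.2

/-- The denominators of the rational fraction have length at most `s`. -/
def DenClass (M : ℝ) (s : ℕ) (Q : RatCoeff) : Prop :=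
  ∀ x, Q x ≠ 0 → ∀ g ∈ x.2, g ∈ nonIntegrableSetLE s M

lemma RatClass.denClass {s s' q n : ℕ} {Q : RatCoeff} (h : RatClass M s q n Q) (hs : s ≤ s') :
    DenClass M s' Q := fun x hx g hg => ((h x hx).mono hs le_rfl).den g hg

lemma DenClass.sum {ι : Type*} {s : ℕ} (t : Finset ι) {P : ι → RatCoeff}
    (h : ∀ i ∈ t, DenClass M s (P i)) : DenClass M s (∑ i ∈ t, P i) := fun x hx => by
  rw [Finsupp.finsetSum_apply] at hx
  obtain ⟨i, hi, hx⟩ := Finset.exists_ne_zero_of_sum_ne_zero hx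
  exact h i hi x hx

lemma DenClass.contDiffAt {s : ℕ} {Q : RatCoeff} (h : DenClass M s Q) {n : WithTop ℕ∞} {ζ : CV M}
    (hω : ∀ g ∈ nonIntegrableSetLE s M, comega g ζ ≠ 0) : ContDiffAt ℂ n (ceval Q) ζ :=
  contDiffAt_ceval fun x hx g hg => hω g (h x hx g hg)

lemma DenClass.differentiableAt {s : ℕ} {Q : RatCoeff} (h : DenClass M s Q) {ζ : CV M}
    (hω : ∀ g ∈ nonIntegrableSetLE s M, comega g ζ ≠ 0) : DifferentiableAt ℂ (ceval Q) ζ :=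
  (h.contDiffAt (n := 1) hω).differentiableAt one_ne_zero

lemma grad_ceval_sum {ι : Type*} {s : ℕ} (t : Finset ι) {P : ι → RatCoeff}
    (h : ∀ i ∈ t, DenClass M s (P i)) {ζ : CV M}
    (hω : ∀ g ∈ nonIntegrableSetLE s M, comega g ζ ≠ 0) :
    grad (ceval (∑ i ∈ t, P i)) ζ = fun k => ∑ i ∈ t, grad (ceval (P i)) ζ k := by
  funext k
  have e : ceval (M := M) (∑ i ∈ t, P i) = fun ζ => ∑ i ∈ t, ceval (P i) ζ :=
    funext fun ζ => ceval_sum t P ζ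
  rw [e, grad, fderiv_fun_sum fun i hi => (h i hi).differentiableAt hω]
  simp [grad]

variable {r : ℕ}

lemma denClass_nfX (hM : 3 ≤ M) {n : ℕ} (hn : n < r - 2) :
    DenClass M (6 * r) (nfX (initQ M r) r n) :=
  (nf_class hM hn).2.2.2.denClass (by omega)

lemma denClass_nfP (hM : 3 ≤ M) {n : ℕ} (hn : n < r - 2) (k : ℕ) :
    DenClass M (6 * r) (nfP (initQ M r) r n k) :=
  ((nf_class hM hn).2.2.1 k).denClass (by omega)

lemma denClass_genQ (hM : 3 ≤ M) : DenClass M (6 * r) (genQ M r) :=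
  DenClass.sum _ fun _ hn => denClass_nfX hM (Finset.mem_range.1 hn)

lemma denClass_famQ (hM : 3 ≤ M) (k : ℕ) : DenClass M (6 * r) (famQ M r k) :=
  DenClass.sum _ fun _ hn => denClass_nfP hM (Finset.mem_range.1 hn) k

/-- The class of the brackets in the remainder. -/
lemma ratClass_br_nf (hM : 3 ≤ M) {i j : ℕ} (hi : i < r - 2) (hj : j < r - 2) (k : ℕ) :
    RatClass M (6 * r) (i + j + 4) (2 * (i + j + 1))
      (br (nfP (initQ M r) r i k) (nfX (initQ M r) r j)) := by
  have h := (((nf_class hM hi).2.2.1 k).mono (s' := 6 * r) (by omega) le_rfl).br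
    ((nf_class hM hj).2.2.2.mono (s' := 6 * r) (by omega) le_rfl) (by omega)
  rwa [show i + 3 + (j + 2) - 1 = i + j + 4 by omega,
    show 2 * i + (2 * j + 1) + 1 = 2 * (i + j + 1) by omega] at h

lemma denClass_remQ (hM : 3 ≤ M) (k : ℕ) : DenClass M (6 * r) (remQ M r k) :=
  DenClass.sum _ fun p hp => by
    obtain ⟨h1, h2, _⟩ := mem_remPairs.1 hp
    exact (ratClass_br_nf hM h1 h2 k).denClass le_rfl

/-- The brackets with i+j+1 < r-2 have order at most 2r and reproduce the recursion for `nfR`; the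
other pairs are put into `remQ`. -/
lemma pb_famQ_genQ (hM : 3 ≤ M) (k : ℕ) {ζ : CV M}
    (hω : ∀ g ∈ nonIntegrableSetLE (6 * r) M, comega g ζ ≠ 0) :
    pb (grad (ceval (famQ M r k)) ζ) (grad (ceval (genQ M r)) ζ) =
      (k + 1) * (∑ n ∈ Finset.range (r - 2), ceval (nfR (initQ M r) r n (k + 1)) ζ) +
        ceval (remQ M r k) ζ := by
  have h1 : pb (grad (ceval (famQ M r k)) ζ) (grad (ceval (genQ M r)) ζ) =
      ∑ p ∈ Finset.range (r - 2) ×ˢ Finset.range (r - 2),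
        ceval (br (nfP (initQ M r) r p.1 k) (nfX (initQ M r) r p.2)) ζ := by
    rw [famQ, genQ, grad_ceval_sum _ (fun n hn => denClass_nfP hM (Finset.mem_range.1 hn) k) hω,
      grad_ceval_sum _ (fun n hn => denClass_nfX hM (Finset.mem_range.1 hn)) hω, pb_sum_left,
      Finset.sum_product]
    refine Finset.sum_congr rfl fun i hi => ?_
    rw [pb_sum_right]
    refine Finset.sum_congr rfl fun j hj => ?_
    have hi := Finset.mem_range.1 hi
    have hj := Finset.mem_range.1 hj
    exact pb_ceval_ceval (((nf_class hM hi).2.2.1 k).mono (s' := 6 * r) (by omega) le_rfl)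
      ((nf_class hM hj).2.2.2.mono (s' := 6 * r) (by omega) le_rfl) hω
  rw [h1, ← Finset.sum_filter_add_sum_filter_not _ (fun p : ℕ × ℕ => p.1 + p.2 + 1 < r - 2), remQ,
    ceval_sum]
  congr 1
  rw [sum_pairs_lt (r - 2) (fun i j => ceval (br (nfP (initQ M r) r i k) (nfX (initQ M r) r j)) ζ),
    Finset.mul_sum]
  refine Finset.sum_congr rfl fun n _ => ?_
  have hk : ((k : ℂ) + 1) ≠ 0 := by exact_mod_cast Nat.succ_ne_zero k
  rw [nfR_succ, ceval_smul, ceval_sum, mul_inv_cancel_left₀ hk]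

lemma pb_cL4_genQ (hM : 3 ≤ M) {ζ : CV M}
    (hω : ∀ g ∈ nonIntegrableSetLE (6 * r) M, comega g ζ ≠ 0) :
    pb (grad cL4 ζ) (grad (ceval (genQ M r)) ζ) =
      -∑ n ∈ Finset.range (r - 2), ceval (nonint (nfT (initQ M r) r n)) ζ := by
  rw [genQ, grad_ceval_sum _ (fun n hn => denClass_nfX hM (Finset.mem_range.1 hn)) hω, pb_sum_right,
    ← Finset.sum_neg_distrib]
  refine Finset.sum_congr rfl fun n hn => ?_
  have hn := Finset.mem_range.1 hn
  rw [nfX_eq]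
  exact pb_cL4_homQ (s := 6 * r) (q := n + 2) (n := 2 * n) ((nf_class hM hn).2.1.mono (by omega) le_rfl) (by omega) hω

lemma pb_cL2_genQ (hM : 3 ≤ M) {ζ : CV M}
    (hω : ∀ g ∈ nonIntegrableSetLE (6 * r) M, comega g ζ ≠ 0) :
    pb (grad cL2 ζ) (grad (ceval (genQ M r)) ζ) = 0 := by
  rw [genQ, grad_ceval_sum _ (fun n hn => denClass_nfX hM (Finset.mem_range.1 hn)) hω, pb_sum_right]
  refine Finset.sum_eq_zero fun n hn => ?_
  have hn := Finset.mem_range.1 hn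
  exact pb_cL2 (s := 6 * r) ((nf_class hM hn).2.2.2.mono (by omega) le_rfl) hω

/-- The coefficient of order `k` in time of the transformed Hamiltonian, as a function. -/
def lieF (r k : ℕ) (z : GM M) : ℝ := (if k = 0 then L2 z + L4 z else 0) + rfun (famQ M r k) z

lemma contDiffAt_rfun {Q : RatCoeff} (hQ : RatReal Q) (hd : DenClass M (6 * r) Q) {z : GM M}
    (hz : z ∈ regularSet M (6 * r)) : ContDiffAt ℝ ∞ (rfun Q) z :=
  hQ.isRestr.contDiffAt (hd.contDiffAt (comega_ne_zero_of_mem hz))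

lemma contDiff_L2 : ContDiff ℝ ∞ (L2 : GM M → ℝ) :=
  contDiff_iff_contDiffAt.2 fun _ => isRestr_L2.contDiffAt contDiff_cL2.contDiffAt

lemma contDiff_L4 : ContDiff ℝ ∞ (L4 : GM M → ℝ) :=
  contDiff_iff_contDiffAt.2 fun _ => isRestr_L4.contDiffAt contDiff_cL4.contDiffAt

lemma contDiffAt_lieF (hM : 3 ≤ M) (k : ℕ) {z : GM M} (hz : z ∈ regularSet M (6 * r)) :
    ContDiffAt ℝ ∞ (lieF r k) z := by
  unfold lieF
  refine ContDiffAt.add ?_ (contDiffAt_rfun (ratReal_famQ r k) (denClass_famQ hM k) hz)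
  split_ifs
  · exact contDiff_L2.contDiffAt.add contDiff_L4.contDiffAt
  · exact contDiffAt_const

lemma lieF_eq_zero (hr : 3 ≤ r) (z : GM M) : lieF r r z = 0 := by
  have h : famQ M r r = 0 := Finset.sum_eq_zero fun n hn => nfP_eq_zero _ _ (by
    have := Finset.mem_range.1 hn
    omega)
  rw [lieF, if_neg (by omega), h, rfun, ceval_zero]
  simp

/-- The Lie derivative of the coefficients of the transformed Hamiltonian. -/
lemma fderiv_lieF (hM : 3 ≤ M) (k : ℕ) {z : GM M} (hz : z ∈ regularSet M (6 * r)) :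
    fderiv ℝ (lieF r k) z (hamVF (rfun (genQ M r)) z) =
      (k + 1) * lieF r (k + 1) z + rfun (remQ M r k) z := by
  have hω := comega_ne_zero_of_mem hz
  have hχ := (ratReal_genQ (M := M) r).isRestr (M := M)
  have hχd := (denClass_genQ (r := r) hM).differentiableAt hω
  have hf := (ratReal_famQ (M := M) r k).isRestr (M := M)
  have hfd := (denClass_famQ (r := r) hM k).differentiableAt hω
  have e1 := hf.fderiv_hamVF hχ hfd hχd
  rw [pb_famQ_genQ hM k hω] at e1
  have d2 : DifferentiableAt ℂ (cL2 (M := M)) (cx z) :=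
    (contDiff_cL2 (n := 1)).differentiable one_ne_zero _
  have d4 : DifferentiableAt ℂ (cL4 (M := M)) (cx z) :=
    (contDiff_cL4 (n := 1)).differentiable one_ne_zero _
  have e2 := isRestr_L2.fderiv_hamVF hχ d2 hχd
  have e4 := isRestr_L4.fderiv_hamVF hχ d4 hχd
  rw [pb_cL2_genQ hM hω] at e2
  rw [pb_cL4_genQ hM hω] at e4
  have dfam : DifferentiableAt ℝ (rfun (M := M) (famQ M r k)) z :=
    (contDiffAt_rfun (ratReal_famQ r k) (denClass_famQ hM k) hz).differentiableAt (by simp)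
  have d24 : DifferentiableAt ℝ (fun z : GM M => L2 z + L4 z) z :=
    (contDiff_L2.differentiable (by simp) z).fun_add (contDiff_L4.differentiable (by simp) z)
  have hrem := (ratReal_remQ (M := M) r k).isRestr z
  have hfam := (ratReal_famQ (M := M) r (k + 1)).isRestr z
  -- The non-integrable part subtracted at the first power of t is what the bracket of L₄ with the
  -- generator supplies when k = 0.
  have hsucc : ceval (famQ M r (k + 1)) (cx z) =
      (∑ n ∈ Finset.range (r - 2), ceval (nfR (initQ M r) r n (k + 1)) (cx z)) -
      if k = 0 then ∑ n ∈ Finset.range (r - 2), ceval (nonint (nfT (initQ M r) r n)) (cx z)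
      else 0 := by
    rw [famQ, ceval_sum]
    by_cases hk : k = 0
    · rw [if_pos hk, ← Finset.sum_sub_distrib]
      refine Finset.sum_congr rfl fun n _ => ?_
      rw [nfP_eq, if_pos (by omega), ceval_sub, hk]
    · rw [if_neg hk, sub_zero]
      refine Finset.sum_congr rfl fun n _ => ?_
      rw [nfP_eq, if_neg (by omega)]
  rw [← Complex.ofReal_inj]
  by_cases hk : k = 0
  · have hl : lieF (M := M) r k = fun z => (L2 z + L4 z) + rfun (famQ M r k) z := by
      funext y; rw [lieF, if_pos hk]
    rw [hl, fderiv_fun_add d24 dfam, fderiv_fun_add (contDiff_L2.differentiable (by simp) z)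
      (contDiff_L4.differentiable (by simp) z), lieF, if_neg (by omega)]
    simp only [add_apply]
    push_cast
    rw [e1, e2, e4, hrem, hfam, hsucc, if_pos hk, hk]
    push_cast
    ring
  · have hl : lieF (M := M) r k = rfun (famQ M r k) := by
      funext y; rw [lieF, if_neg hk, zero_add]
    rw [hl, lieF, if_neg (by omega)]
    push_cast
    rw [e1, hrem, hfam, hsucc, if_neg hk]
    ring

lemma sum_lieF (hr : 3 ≤ r) (z : GM M) : ∑ k ∈ Finset.range r, lieF r k z =
    L2 z + L4 z + ∑ n ∈ Finset.range (r - 2), rfun (intPart (nfT (initQ M r) r n)) z := by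
  have h : ∀ k, lieF r k z = (if k = 0 then L2 z + L4 z else 0) +
      ∑ n ∈ Finset.range (r - 2), rfun (nfP (initQ M r) r n k) z := fun k => by
    rw [lieF, famQ, rfun, ceval_sum, Complex.re_sum]
    rfl
  rw [Finset.sum_congr rfl fun k _ => h k, Finset.sum_add_distrib, Finset.sum_ite_eq',
    if_pos (Finset.mem_range.2 (by omega)), Finset.sum_comm]
  congr 1
  refine Finset.sum_congr rfl fun n _ => ?_
  rw [← sum_nfP _ _ (by omega), rfun, ceval_sum, Complex.re_sum]
  rfl

lemma lieF_zero (hr : 3 ≤ r) (z : GM M) : ((lieF r 0 z : ℝ) : ℂ) = truncatedH r z := by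
  rw [lieF, if_pos rfl, Complex.ofReal_add, (ratReal_famQ (M := M) r 0).isRestr z, truncatedH,
    famQ, ceval_sum, Complex.ofReal_add]
  congr 1
  have h : Finset.Icc 3 r = (Finset.range (r - 2)).map (addRightEmbedding 3) := by
    ext m
    simp only [Finset.mem_Icc, Finset.mem_map, Finset.mem_range, addRightEmbedding_apply]
    constructor
    · intro hm
      exact ⟨m - 3, by omega, by omega⟩
    · rintro ⟨n, hn, rfl⟩
      omega
  rw [h, Finset.sum_map]
  refine Finset.sum_congr rfl fun n _ => ?_
  rw [nfP_eq, if_neg (by omega), nfR_zero, eval_initQ]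
  rfl

end Identities

/-! ### Quantitative bounds of the generator and of the remainder -/

section Quantitative

/-- The growth rate of the coefficients of the normal form. -/
def growth (r : ℕ) : ℝ := 16 * r * (1000 * r ^ 4) * 3888

lemma growth_eq (r : ℕ) : growth r = 62208000 * (r : ℝ) ^ 5 := by
  rw [growth]; ring

variable {M σ θ : ℝ} {r : ℕ}

/-- The constant is A = 3888 = 4·972, so that A/4 bounds the initial coefficients; their rate 96r³
is far below `growth r`. -/
lemma colNorm_nf_initQ_le (hM : 3 ≤ M) (hr : 3 ≤ r) {n : ℕ} (hn : n < r - 2) :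
    (∀ k j, colNorm (nfP (initQ M r) r n k) j ≤ 2 * 3888 * growth r ^ n * (1 / 2) ^ k) ∧
    (∀ j, colNorm (nfX (initQ M r) r n) j ≤ 3888 * growth r ^ n) := by
  refine colNorm_nf_le (ν := r - 2) hr (by omega) (by norm_num) rfl
    (fun n hn => ratClass_initQ (by linarith) (by omega)) (fun n hn j => ?_) hn
  refine (colNorm_initQ_le (by omega) j).trans ?_
  have hr' : (3 : ℝ) ≤ r := by exact_mod_cast hr
  have h : 96 * (r : ℝ) ^ 3 ≤ growth r := by
    rw [growth_eq, show (r : ℝ) ^ 5 = r ^ 3 * r ^ 2 by ring]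
    have h3 : 0 ≤ (r : ℝ) ^ 3 := by positivity
    have h2 : 1 ≤ (r : ℝ) ^ 2 := by nlinarith
    nlinarith
  have := pow_le_pow_left₀ (by positivity) h n
  change _ ≤ 3888 / 4 * growth r ^ n
  linarith

lemma sum_weighted_grad_sum_le {ι : Type*} {s : ℕ} (t : Finset ι) {P : ι → RatCoeff}
    (h : ∀ i ∈ t, DenClass M s (P i)) {ζ : CV M}
    (hω : ∀ g ∈ nonIntegrableSetLE s M, comega g ζ ≠ 0) :
    ∑ k, wt σ θ k.2 * ‖grad (ceval (∑ i ∈ t, P i)) ζ k‖ ≤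
      ∑ i ∈ t, ∑ k, wt σ θ k.2 * ‖grad (ceval (P i)) ζ k‖ := by
  rw [grad_ceval_sum t h hω, Finset.sum_comm]
  refine Finset.sum_le_sum fun k _ => ?_
  rw [← Finset.mul_sum]
  exact mul_le_mul_of_nonneg_left (norm_sum_le _ _) (wt_pos _ _ _).le

/-- The bound of the gradient of the generator. -/
lemma sum_weighted_grad_genQ_le (hσ : 0 < σ) (hθ : 0 < θ) (hθ1 : θ < 1) (hM : 3 ≤ M) (hr : 3 ≤ r)
    {g R : ℝ} (hg : 0 < g) (hg1 : g ≤ 1) (hR : 0 < R)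
    (hsmall : 512 * growth r * (g⁻¹ ^ 2 * R ^ 2) ≤ 1 / 2) {ζ : CV M} (hζ : cnorm σ θ ζ ≤ 2 * R)
    (hω : ∀ h ∈ nonIntegrableSetLE (6 * r) M, g * R ^ 2 ≤ ‖comega h ζ‖) :
    ∑ i, wt σ θ i.2 * ‖grad (ceval (genQ M r)) ζ i‖ ≤ 23887872 * (g⁻¹ ^ 2 * R ^ 3) := by
  have hne := ne_zero_of_le_comega (by positivity) hω
  have hgr : 0 ≤ growth r := by rw [growth_eq]; positivity
  refine (sum_weighted_grad_sum_le _ (fun n hn => denClass_nfX hM (Finset.mem_range.1 hn))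
    hne).trans ?_
  have h1 : ∀ n ∈ Finset.range (r - 2), ∑ i : ℤˣ × Modes M,
      wt σ θ i.2 * ‖grad (ceval (nfX (initQ M r) r n)) ζ i‖ ≤
      11943936 * (g⁻¹ ^ 2 * R ^ 3) * (1 / 2) ^ n := by
    intro n hn
    have hn := Finset.mem_range.1 hn
    have h := sum_weighted_grad_le hσ hθ hθ1 (nf_class hM hn).2.2.2 (by omega)
      (colNorm_nf_initQ_le hM hr hn).2 hg hg1 hR hζ
      (fun h hh => hω h ⟨hh.1, hh.2.1.trans (by omega), hh.2.2⟩)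
    refine h.trans ?_
    -- The left side equals 24(n+1)³ exactly. Together with 128·64^n it produces 3888·24·128 =
    -- 11943936 and the ratio 8·64 = 512 of the series.
    have hpoly : ((2 * n + 1 : ℕ) + 1 : ℝ) * ((2 * (n + 2 : ℕ) + 2 * (2 * n + 1 : ℕ)) +
        (2 * n + 1 : ℕ) * (6 * (n + 1) : ℕ)) ≤ 24 * 8 ^ n := by
      have h2 : ((n : ℝ) + 1) ≤ 2 ^ n := by exact_mod_cast Nat.lt_two_pow_self (n := n)
      have h3 : ((n : ℝ) + 1) ^ 3 ≤ 8 ^ n := by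
        calc ((n : ℝ) + 1) ^ 3 ≤ (2 ^ n) ^ 3 := by gcongr
          _ = 8 ^ n := by rw [← pow_mul, mul_comm, pow_mul]; norm_num
      push_cast
      calc _ = 24 * ((n : ℝ) + 1) ^ 3 := by ring
        _ ≤ _ := by linarith
    have e1 : (2 : ℝ) ^ (2 * (n + 2) + 2 * (2 * n + 1) + 1) = 128 * 64 ^ n := by
      rw [show 2 * (n + 2) + 2 * (2 * n + 1) + 1 = 7 + 6 * n by ring, pow_add, pow_mul]
      norm_num
    have e2 : g⁻¹ ^ (2 * n + 1 + 1) * R ^ (2 * (n + 2) - 1) =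
        (g⁻¹ ^ 2 * R ^ 3) * (g⁻¹ ^ 2 * R ^ 2) ^ n := by
      rw [show 2 * n + 1 + 1 = 2 + 2 * n by ring, show 2 * (n + 2) - 1 = 3 + 2 * n by omega,
        pow_add, pow_add, mul_pow, ← pow_mul, ← pow_mul]
      ring
    rw [e1, e2]
    calc 3888 * growth r ^ n * (((2 * n + 1 : ℕ) + 1 : ℝ) * ((2 * (n + 2 : ℕ) +
          2 * (2 * n + 1 : ℕ)) + (2 * n + 1 : ℕ) * (6 * (n + 1) : ℕ)) * (128 * 64 ^ n)) *
          ((g⁻¹ ^ 2 * R ^ 3) * (g⁻¹ ^ 2 * R ^ 2) ^ n)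
        ≤ 3888 * growth r ^ n * (24 * 8 ^ n * (128 * 64 ^ n)) *
          ((g⁻¹ ^ 2 * R ^ 3) * (g⁻¹ ^ 2 * R ^ 2) ^ n) := by gcongr
      _ = 11943936 * (g⁻¹ ^ 2 * R ^ 3) * (512 * growth r * (g⁻¹ ^ 2 * R ^ 2)) ^ n := by
          rw [mul_pow (512 * growth r), mul_pow 512, show (512 : ℝ) = 8 * 64 by norm_num,
            mul_pow 8]
          ring
      _ ≤ _ := by gcongr
  refine (Finset.sum_le_sum h1).trans ?_
  rw [← Finset.mul_sum]
  have := sum_geometric_two_le (r - 2)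
  have h0 : 0 ≤ 11943936 * (g⁻¹ ^ 2 * R ^ 3) := by positivity
  nlinarith

/-- The remainder at a given time. -/
def remT (M : ℝ) (r : ℕ) (t : ℝ) : RatCoeff := ∑ p ∈ remPairs r, ∑ k ∈ Finset.range r,
  (((1 - t) ^ k : ℝ) : ℂ) • br (nfP (initQ M r) r p.1 k) (nfX (initQ M r) r p.2)

lemma ratReal_remT (t : ℝ) : RatReal (remT M r t) :=
  RatReal.sum _ fun p hp => RatReal.sum _ fun k _ => by
    obtain ⟨h1, h2, _⟩ := mem_remPairs.1 hp
    exact (((nf_real h1).2.1 k).br (nf_real h2).2.2).smul (Complex.conj_ofReal _)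

lemma rfun_remT (t : ℝ) (z : GM M) :
    rfun (remT M r t) z = ∑ k ∈ Finset.range r, (1 - t) ^ k * rfun (remQ M r k) z := by
  simp only [rfun, remT, remQ, ceval_sum, ceval_smul, Complex.re_sum, Complex.re_ofReal_mul,
    Finset.mul_sum]
  exact Finset.sum_comm

lemma ratClass_remT_pair (hM : 3 ≤ M) {p : ℕ × ℕ} (hp : p ∈ remPairs r) (t : ℝ) :
    RatClass M (6 * r) (p.1 + p.2 + 4) (2 * (p.1 + p.2 + 1)) (∑ k ∈ Finset.range r,
      (((1 - t) ^ k : ℝ) : ℂ) • br (nfP (initQ M r) r p.1 k) (nfX (initQ M r) r p.2)) := by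
  obtain ⟨h1, h2, _⟩ := mem_remPairs.1 hp
  exact RatClass.sum _ fun k _ => (ratClass_br_nf hM h1 h2 k).smul _

lemma denClass_remT (hM : 3 ≤ M) (t : ℝ) : DenClass M (6 * r) (remT M r t) :=
  DenClass.sum _ fun _ hp => (ratClass_remT_pair hM hp t).denClass le_rfl

lemma colNorm_remT_pair_le (hM : 3 ≤ M) (hr : 3 ≤ r) {p : ℕ × ℕ} (hp : p ∈ remPairs r) {t : ℝ}
    (ht : t ∈ Set.Icc (0 : ℝ) 1) (j : MultiIndex) :
    colNorm (∑ k ∈ Finset.range r, (((1 - t) ^ k : ℝ) : ℂ) •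
      br (nfP (initQ M r) r p.1 k) (nfX (initQ M r) r p.2)) j ≤
      4000 * 3888 ^ 2 * r ^ 4 * growth r ^ (p.1 + p.2) := by
  obtain ⟨h1, h2, _⟩ := mem_remPairs.1 hp
  have hgr : 0 ≤ growth r := by rw [growth_eq]; positivity
  have hk : ∀ k ∈ Finset.range r, colNorm ((((1 - t) ^ k : ℝ) : ℂ) •
      br (nfP (initQ M r) r p.1 k) (nfX (initQ M r) r p.2)) j ≤
      2000 * 3888 ^ 2 * r ^ 4 * growth r ^ (p.1 + p.2) * (1 / 2) ^ k := by
    intro k _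
    refine (colNorm_smul_le _ _ _).trans ?_
    have hc : ‖(((1 - t) ^ k : ℝ) : ℂ)‖ ≤ 1 := by
      rw [Complex.norm_real, Real.norm_of_nonneg (pow_nonneg (by linarith [ht.2]) _)]
      exact pow_le_one₀ (by linarith [ht.2]) (by linarith [ht.1])
    refine (mul_le_of_le_one_left (colNorm_nonneg _ _) hc).trans ?_
    refine (colNorm_br_le_of_lt hr (by omega) (by omega) ((nf_class hM h1).2.2.1 k)
      (nf_class hM h2).2.2.2 ((colNorm_nf_initQ_le hM hr h1).1 k)
      (colNorm_nf_initQ_le hM hr h2).2 j).trans (le_of_eq ?_)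
    rw [pow_add]
    ring
  refine (colNorm_sum_le _ _ _).trans ((Finset.sum_le_sum hk).trans ?_)
  rw [← Finset.mul_sum]
  have := sum_geometric_two_le r
  have h0 : 0 ≤ 2000 * 3888 ^ 2 * (r : ℝ) ^ 4 * growth r ^ (p.1 + p.2) := by positivity
  nlinarith

/-- The bound of the gradient of the remainder. -/
lemma sum_weighted_grad_remT_le (hσ : 0 < σ) (hθ : 0 < θ) (hθ1 : θ < 1) (hM : 3 ≤ M) (hr : 3 ≤ r)
    {g R : ℝ} (hg : 0 < g) (hg1 : g ≤ 1) (hR : 0 < R)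
    (hsmall : 512 * growth r * (g⁻¹ ^ 2 * R ^ 2) ≤ 1 / 2) {ζ : CV M} (hζ : cnorm σ θ ζ ≤ 2 * R)
    (hω : ∀ h ∈ nonIntegrableSetLE (6 * r) M, g * R ^ 2 ≤ ‖comega h ζ‖) {t : ℝ}
    (ht : t ∈ Set.Icc (0 : ℝ) 1) :
    ∑ i, wt σ θ i.2 * ‖grad (ceval (remT M r t)) ζ i‖ ≤
      r ^ 2 * (76800000 * 3888 ^ 2 * r ^ 7 * (g⁻¹ * R ^ 5) *
        (growth r ^ (r - 3) * (64 * (g⁻¹ ^ 2 * R ^ 2)) ^ (r - 2))) := by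
  have hne := ne_zero_of_le_comega (by positivity) hω
  have hgr : 0 ≤ growth r := by rw [growth_eq]; positivity
  have hr' : (3 : ℝ) ≤ r := by exact_mod_cast hr
  refine (sum_weighted_grad_sum_le _ (fun p hp => (ratClass_remT_pair hM hp t).denClass le_rfl)
    hne).trans ?_
  have h1 : ∀ p ∈ remPairs r, ∑ i : ℤˣ × Modes M, wt σ θ i.2 * ‖grad (ceval (∑ k ∈ Finset.range r,
      (((1 - t) ^ k : ℝ) : ℂ) • br (nfP (initQ M r) r p.1 k) (nfX (initQ M r) r p.2))) ζ i‖ ≤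
      76800000 * 3888 ^ 2 * r ^ 7 * (g⁻¹ * R ^ 5) *
        (growth r ^ (r - 3) * (64 * (g⁻¹ ^ 2 * R ^ 2)) ^ (r - 2)) := by
    intro p hp
    have h := sum_weighted_grad_le hσ hθ hθ1 (ratClass_remT_pair hM hp t) (by omega)
      (colNorm_remT_pair_le hM hr hp ht) hg hg1 hR hζ hω
    refine h.trans ?_
    obtain ⟨q1, q2, q3⟩ := mem_remPairs.1 hp
    -- d is the excess over the lowest order of the remainder; each unit of it costs `growth r`·64Y
    -- ≤ 1, so the pairs with d = 0 dominate.
    obtain ⟨d, hd⟩ : ∃ d, p.1 + p.2 + 1 = (r - 2) + d := ⟨p.1 + p.2 + 1 - (r - 2), by omega⟩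
    have he2 : ((p.1 + p.2 + 1 : ℕ) : ℝ) ≤ 2 * r := by exact_mod_cast (by omega)
    rw [show p.1 + p.2 + 4 = p.1 + p.2 + 1 + 3 by ring, show p.1 + p.2 = p.1 + p.2 + 1 - 1 by omega]
    rw [show p.1 + p.2 + 1 - 1 + 1 = p.1 + p.2 + 1 by omega]
    set e := p.1 + p.2 + 1 with he
    have hpoly : ((2 * e : ℕ) + 1 : ℝ) * ((2 * (e + 3 : ℕ) + 2 * (2 * e : ℕ)) +
        (2 * e : ℕ) * (6 * r : ℕ)) ≤ 150 * r ^ 3 := by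
      push_cast
      have h0 : (0 : ℝ) ≤ e := Nat.cast_nonneg e
      calc (2 * (e : ℝ) + 1) * (2 * (e + 3) + 2 * (2 * e) + 2 * e * (6 * r))
          ≤ (2 * (2 * (r : ℝ)) + r) * (2 * (2 * r + 3) + 2 * (2 * (2 * r)) + 2 * (2 * r) * (6 * r))
            := by gcongr; linarith
        _ ≤ (5 * (r : ℝ)) * (30 * r ^ 2) := by
            refine mul_le_mul (by linarith) (by nlinarith) (by positivity) (by positivity)
        _ = 150 * r ^ 3 := by ring
    have e1 : (2 : ℝ) ^ (2 * (e + 3) + 2 * (2 * e) + 1) = 128 * 64 ^ e := by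
      rw [show 2 * (e + 3) + 2 * (2 * e) + 1 = 7 + 6 * e by ring, pow_add, pow_mul]
      norm_num
    -- At the lowest order e = r-2 this is g^{-(2r-3)} R^{2r+1}, the powers announced for the
    -- remainder.
    have e2 : g⁻¹ ^ (2 * e + 1) * R ^ (2 * (e + 3) - 1) =
        (g⁻¹ * R ^ 5) * (g⁻¹ ^ 2 * R ^ 2) ^ e := by
      rw [show 2 * (e + 3) - 1 = 5 + 2 * e by omega, pow_succ, pow_add, mul_pow, ← pow_mul,
        ← pow_mul]
      ring
    rw [e1, e2]
    have hY : 0 ≤ g⁻¹ ^ 2 * R ^ 2 := by positivity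
    set Y := g⁻¹ ^ 2 * R ^ 2 with hYdef
    have hlY : growth r * (64 * Y) ≤ 1 := by
      have : 0 ≤ growth r * Y := mul_nonneg hgr hY
      nlinarith
    have hfin : growth r ^ (e - 1) * (64 * Y) ^ e ≤ growth r ^ (r - 3) * (64 * Y) ^ (r - 2) := by
      rw [hd, show r - 2 + d - 1 = (r - 3) + d by omega, pow_add, pow_add]
      calc growth r ^ (r - 3) * growth r ^ d * ((64 * Y) ^ (r - 2) * (64 * Y) ^ d)
          = growth r ^ (r - 3) * (64 * Y) ^ (r - 2) * (growth r * (64 * Y)) ^ d := by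
            rw [mul_pow (growth r)]; ring
        _ ≤ growth r ^ (r - 3) * (64 * Y) ^ (r - 2) * 1 := by
            gcongr
            exact pow_le_one₀ (by positivity) hlY
        _ = _ := mul_one _
    calc 4000 * 3888 ^ 2 * (r : ℝ) ^ 4 * growth r ^ (e - 1) * (((2 * e : ℕ) + 1 : ℝ) *
          ((2 * (e + 3 : ℕ) + 2 * (2 * e : ℕ)) + (2 * e : ℕ) * (6 * r : ℕ)) * (128 * 64 ^ e)) *
          ((g⁻¹ * R ^ 5) * Y ^ e)
        ≤ 4000 * 3888 ^ 2 * (r : ℝ) ^ 4 * growth r ^ (e - 1) * (150 * r ^ 3 * (128 * 64 ^ e)) *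
          ((g⁻¹ * R ^ 5) * Y ^ e) := by gcongr
      _ = 76800000 * 3888 ^ 2 * r ^ 7 * (g⁻¹ * R ^ 5) * (growth r ^ (e - 1) * (64 * Y) ^ e) := by
          rw [mul_pow 64]; ring
      _ ≤ _ := by gcongr
  refine (Finset.sum_le_sum h1).trans ?_
  rw [Finset.sum_const, nsmul_eq_mul]
  refine mul_le_mul_of_nonneg_right ?_ (by positivity)
  have hc : (remPairs r).card ≤ r ^ 2 := by
    refine (Finset.card_filter_le _ _).trans ?_
    rw [Finset.card_product, Finset.card_range, sq]
    exact Nat.mul_le_mul (by omega) (by omega)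
  exact_mod_cast hc

/-- The numerical constants of the remainder. -/
lemma remainder_const_le (hr : 3 ≤ r) {γ R : ℝ} (hγ : 0 < γ) (hR : 0 < R) :
    3 / 2 * (r ^ 2 * (76800000 * 3888 ^ 2 * (r : ℝ) ^ 7 * ((γ / 4)⁻¹ * R ^ 5) *
        (growth r ^ (r - 3) * (64 * ((γ / 4)⁻¹ ^ 2 * R ^ 2)) ^ (r - 2)))) ≤
      (10 ^ 12) ^ r * (r : ℝ) ^ (10 * r) * γ ^ (-2 * (r : ℤ) + 3) * R ^ (2 * r + 1) := by
  obtain ⟨m, rfl⟩ : ∃ m, r = m + 3 := ⟨r - 3, by omega⟩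
  set ρ : ℝ := ((m + 3 : ℕ) : ℝ) with hρ
  have hρ1 : 1 ≤ ρ := by rw [hρ]; push_cast; linarith [Nat.cast_nonneg (α := ℝ) m]
  have hz : γ ^ (-2 * ((m + 3 : ℕ) : ℤ) + 3) = γ⁻¹ ^ (2 * m + 3) := by
    rw [show (-2 * ((m + 3 : ℕ) : ℤ) + 3) = -((2 * m + 3 : ℕ) : ℤ) by push_cast; ring, zpow_neg,
      zpow_natCast, inv_pow]
  rw [hz, growth_eq, ← hρ, show m + 3 - 3 = m by omega, show m + 3 - 2 = m + 1 by omega]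
  have e : 3 / 2 * (ρ ^ 2 * (76800000 * 3888 ^ 2 * ρ ^ 7 * ((γ / 4)⁻¹ * R ^ 5) *
      ((62208000 * ρ ^ 5) ^ m * (64 * ((γ / 4)⁻¹ ^ 2 * R ^ 2)) ^ (m + 1)))) =
      (3 / 2 * 76800000 * 3888 ^ 2 * 4 * 1024) * (62208000 * 1024) ^ m * ρ ^ (9 + 5 * m) *
        γ⁻¹ ^ (2 * m + 3) * R ^ (2 * (m + 3) + 1) := by
    have h1 : 64 * ((γ / 4)⁻¹ ^ 2 * R ^ 2) = 1024 * (γ⁻¹ ^ 2 * R ^ 2) := by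
      rw [div_eq_mul_inv, mul_inv, inv_inv]; ring
    have h2 : (γ / 4)⁻¹ = 4 * γ⁻¹ := by rw [div_eq_mul_inv, mul_inv, inv_inv]; ring
    rw [h1, h2, mul_pow 1024, mul_pow (γ⁻¹ ^ 2), mul_pow 62208000, mul_pow 62208000 1024,
      ← pow_mul, ← pow_mul, ← pow_mul]
    ring
  rw [e]
  have hc : (3 / 2 * 76800000 * 3888 ^ 2 * 4 * 1024) * (62208000 * 1024 : ℝ) ^ m ≤
      (10 ^ 12) ^ (m + 3) := by
    rw [pow_add, mul_comm]
    exact mul_le_mul (pow_le_pow_left₀ (by norm_num) (by norm_num) m) (by norm_num) (by norm_num)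
      (by positivity)
  -- The estimate gives the exponent 9 + 5m = 5r - 6 of r, well below 10r.
  have hp : ρ ^ (9 + 5 * m) ≤ ρ ^ (10 * (m + 3)) := pow_le_pow_right₀ hρ1 (by omega)
  gcongr

end Quantitative

/-! ### The flow of the generator -/

section GeneratorFlow

variable {M σ θ : ℝ} {r : ℕ} {γ ϱ : ℝ}

lemma gnorm_smul (c : ℝ) (z : GM M) : gnorm σ θ (c • z) = |c| * gnorm σ θ z := by
  rw [← norm_gevreyEquiv, map_smul, norm_smul, Real.norm_eq_abs, norm_gevreyEquiv]

/-- The bound of the vector field of the generator at distance `R` from the origin. -/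
def genBound (γ R : ℝ) : ℝ := 23887872 * ((γ / 4)⁻¹ ^ 2 * R ^ 3)

lemma sq_mul_le (hr : 3 ≤ r) (hγ : 0 < γ) (hϱ : ϱ = γ ^ (3 / 2 : ℝ) * (10 ^ 12)⁻¹ * ((r : ℝ) ^ 4)⁻¹)
    {R : ℝ} (hR : 0 < R) (hRϱ : R < 2 * ϱ) : R ^ 2 * (r : ℝ) ^ 8 * 10 ^ 24 ≤ 4 * γ ^ 3 := by
  have hr' : (0 : ℝ) < r := by exact_mod_cast (by omega : 0 < r)
  have hp : (γ ^ (3 / 2 : ℝ)) ^ 2 = γ ^ 3 := by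
    rw [← Real.rpow_natCast, ← Real.rpow_mul hγ.le, ← Real.rpow_natCast]
    norm_num
  have h1 : R ^ 2 ≤ (2 * ϱ) ^ 2 := pow_le_pow_left₀ hR.le hRϱ.le 2
  have h2 : (2 * ϱ) ^ 2 * ((r : ℝ) ^ 8 * 10 ^ 24) = 4 * γ ^ 3 := by
    rw [← hp, hϱ]
    field_simp
    norm_num
  calc R ^ 2 * (r : ℝ) ^ 8 * 10 ^ 24 = R ^ 2 * ((r : ℝ) ^ 8 * 10 ^ 24) := by ring
    _ ≤ (2 * ϱ) ^ 2 * ((r : ℝ) ^ 8 * 10 ^ 24) := by gcongr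
    _ = _ := h2

/-- The three conditions ensure convergence of the series for the generator, control of the flow and
of its differential, and closeness to the identity. The second one reads γ⁻²R³ ≲ γR/r, that is R² ≲
γ³/r; it is the source of the exponent 3/2 of γ in the radius. -/
lemma smallness (hr : 3 ≤ r) (hγ : 0 < γ)
    (hϱ : ϱ = γ ^ (3 / 2 : ℝ) * (10 ^ 12)⁻¹ * ((r : ℝ) ^ 4)⁻¹)
    {R : ℝ} (hR : 0 < R) (hRϱ : R < 2 * ϱ) (hγ1 : γ < 1) :
    512 * growth r * ((γ / 4)⁻¹ ^ 2 * R ^ 2) ≤ 1 / 2 ∧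
      8 * genBound γ R ≤ γ / (144 * r) * R ∧
      genBound γ R ≤ 10 ^ 12 * γ ^ (-2 : ℤ) * R ^ 3 := by
  have hr' : (1 : ℝ) ≤ r := by exact_mod_cast (by omega : 1 ≤ r)
  have h := sq_mul_le hr hγ hϱ hR hRϱ
  have e : (γ / 4)⁻¹ ^ 2 = 16 / γ ^ 2 := by
    rw [inv_div, div_pow]; norm_num
  have h3 : γ ^ 3 ≤ γ ^ 2 := pow_le_pow_of_le_one hγ.le hγ1.le (by norm_num)
  have hs : ∀ k : ℕ, k ≤ 8 → R ^ 2 * (r : ℝ) ^ k * 10 ^ 24 ≤ 4 * γ ^ 3 := fun k hk =>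
    le_trans (by gcongr) h
  refine ⟨?_, ?_, ?_⟩
  · have h5 := hs 5 (by norm_num)
    rw [growth_eq, e, show 512 * (62208000 * (r : ℝ) ^ 5) * (16 / γ ^ 2 * R ^ 2) =
      509607936000 * (R ^ 2 * (r : ℝ) ^ 5) / γ ^ 2 by ring, div_le_iff₀ (by positivity)]
    nlinarith [sq_nonneg γ]
  · have h1 := hs 1 (by norm_num)
    rw [pow_one] at h1
    rw [genBound, e, show 8 * (23887872 * (16 / γ ^ 2 * R ^ 3)) =
      3057647616 * R ^ 3 / γ ^ 2 by ring, show γ / (144 * (r : ℝ)) * R = γ * R / (144 * r) by ring,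
      div_le_div_iff₀ (by positivity) (by positivity)]
    have h2 : 3057647616 * 144 * (R ^ 2 * r) ≤ γ ^ 3 := by
      nlinarith [pow_pos hγ 3]
    calc 3057647616 * R ^ 3 * (144 * (r : ℝ)) = 3057647616 * 144 * (R ^ 2 * r) * R := by ring
      _ ≤ γ ^ 3 * R := by gcongr
      _ = γ * R * γ ^ 2 := by ring
  · rw [genBound, e, zpow_neg, show (2 : ℤ) = ((2 : ℕ) : ℤ) by rfl, zpow_natCast,
      show 23887872 * (16 / γ ^ 2 * R ^ 3) = 382205952 * ((γ ^ 2)⁻¹ * R ^ 3) by ring, mul_assoc]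
    gcongr
    norm_num

/-- The gradient of the generator in a complex neighbourhood of a point of the domain. -/
lemma sum_weighted_grad_genQ_le_of_mem (hσ : 0 < σ) (hθ : 0 < θ) (hθ1 : θ < 1) (hM : 3 ≤ M)
    (hr : 3 ≤ r) (hγ : 0 < γ) (hγ1 : γ < 1)
    (hϱ : ϱ = γ ^ (3 / 2 : ℝ) * (10 ^ 12)⁻¹ * ((r : ℝ) ^ 4)⁻¹) {x : GM M}
    (hx : x ∈ domain σ θ M (2 * ϱ) (γ / 2) (6 * r)) {ζ : CV M}
    (hζ : cnorm σ θ (ζ - cx x) ≤ 2 * (γ / (144 * r) * gnorm σ θ x)) :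
    (∀ h ∈ nonIntegrableSetLE (6 * r) M, comega h ζ ≠ 0) ∧
    ∑ i, wt σ θ i.2 * ‖grad (ceval (genQ M r)) ζ i‖ ≤ genBound γ (gnorm σ θ x) := by
  have hR := gnorm_pos_of_mem_domain hM (by omega) hx
  obtain ⟨h1, h2⟩ := region_of_mem_domain hσ (by omega) hγ hγ1 hx hζ
  exact ⟨ne_zero_of_le_comega (by positivity) h2,
    sum_weighted_grad_genQ_le hσ hθ hθ1 hM hr (by positivity) (by linarith) hR
      (smallness hr hγ hϱ hR hx.1 hγ1).1 h1 h2⟩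

/-- A complex ball of radius κR around y stays at distance 2κR from x, where the gradient of the
generator is controlled. A Cauchy estimate bounds the differential of the field by
2·`genBound`/(κR), at most 1/4. -/
lemma generator_bounds (hσ : 0 < σ) (hθ : 0 < θ) (hθ1 : θ < 1) (hM : 3 ≤ M)
    (hr : 3 ≤ r) (hγ : 0 < γ) (hγ1 : γ < 1)
    (hϱ : ϱ = γ ^ (3 / 2 : ℝ) * (10 ^ 12)⁻¹ * ((r : ℝ) ^ 4)⁻¹) {x : GM M}
    (hx : x ∈ domain σ θ M (2 * ϱ) (γ / 2) (6 * r)) {y : GM M}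
    (hy : gnorm σ θ (y - x) ≤ γ / (144 * r) * gnorm σ θ x) :
    y ∈ regularSet M (6 * r) ∧
      gnorm σ θ (hamVF (rfun (genQ M r)) y) ≤ genBound γ (gnorm σ θ x) ∧
      ∀ w, gnorm σ θ (fderiv ℝ (hamVF (rfun (genQ M r))) y w) ≤ 1 / 4 * gnorm σ θ w := by
  have hR := gnorm_pos_of_mem_domain hM (by omega) hx
  set R := gnorm σ θ x with hRdef
  have hr' : (0 : ℝ) < r := by exact_mod_cast (by omega : 0 < r)
  set κ : ℝ := γ / (144 * r) with hκ
  have hκ0 : 0 < κ := by positivity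
  obtain ⟨-, hB, -⟩ := smallness hr hγ hϱ hR hx.1 hγ1
  have hζ : cnorm σ θ (cx y - cx x) ≤ κ * R := by rwa [← map_sub, cnorm_cx]
  have hloc : ∀ ζ : CV M, cnorm σ θ (ζ - cx y) ≤ κ * R →
      (∀ h ∈ nonIntegrableSetLE (6 * r) M, comega h ζ ≠ 0) ∧
      ∑ i, wt σ θ i.2 * ‖grad (ceval (genQ M r)) ζ i‖ ≤ genBound γ R := fun ζ h =>
    sum_weighted_grad_genQ_le_of_mem hσ hθ hθ1 hM hr hγ hγ1 hϱ hx (by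
      have := cnorm_add_le (σ := σ) (θ := θ) (ζ - cx y) (cx y - cx x)
      rw [sub_add_sub_cancel] at this
      linarith)
  have hres := (ratReal_genQ (M := M) r).isRestr (M := M)
  have hy0 := hloc (cx y) (by
    rw [sub_self, ← map_zero (cx (M := M)), cnorm_cx, gnorm_zero]; positivity)
  refine ⟨fun h hh h0 => hy0.1 h hh (by rw [comega_cx, h0, Complex.ofReal_zero]), ?_, fun w => ?_⟩
  · rw [hres.gnorm_hamVF ((denClass_genQ hM).differentiableAt hy0.1)]
    exact hy0.2
  · by_cases hw : w = 0
    · rw [hw, map_zero, gnorm_zero, mul_zero]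
    have hw0 : 0 < gnorm σ θ w :=
      lt_of_le_of_ne (gnorm_nonneg w) fun h => hw (gnorm_eq_zero.1 h.symm)
    have hs : ∀ s : ℂ, ‖s‖ ≤ κ * R / gnorm σ θ w →
        cnorm σ θ (cx y + s • cx w - cx y) ≤ κ * R := fun s hs => by
      rw [add_sub_cancel_left, cnorm_smul, cnorm_cx]
      exact (le_div_iff₀ hw0).1 hs
    have h1 := sum_weighted_fderiv_grad_le (σ := σ) (θ := θ) (F := ceval (genQ M r)) (ζ := cx y)
      (η := cx w) (ρ := κ * R / gnorm σ θ w) (B := genBound γ R) (by positivity)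
      (fun s h => (denClass_genQ hM).contDiffAt (hloc _ (hs s h)).1)
      (fun s h => (hloc _ (hs s h)).2)
    have h2 := hres.gnorm_fderiv_hamVF_le (σ := σ) (θ := θ)
      ((denClass_genQ hM).contDiffAt hy0.1) w
    refine h2.trans ?_
    have h3 : genBound γ R / (κ * R / gnorm σ θ w) ≤ 1 / 8 * gnorm σ θ w := by
      rw [div_div_eq_mul_div, div_le_iff₀ (by positivity)]
      nlinarith
    linarith

/-- The properties at `x` of the flow `Φ` on `[0, 1]` of a vector field. -/
structure IsFlowAt (σ θ κ : ℝ) (X : GM M → GM M) (Φ : ℝ → GM M → GM M) (x : GM M) : Prop where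
  init : Φ 0 x = x
  deriv : ∀ t ∈ Set.Icc (0 : ℝ) 1, HasDerivWithinAt (Φ · x) (X (Φ t x)) (Set.Icc 0 1) t
  dist_le : ∀ t ∈ Set.Icc (0 : ℝ) 1, gnorm σ θ (Φ t x - x) ≤ κ * gnorm σ θ x / 4
  smooth : ∀ t ∈ Set.Icc (0 : ℝ) 1, ContDiffAt ℝ ∞ (Φ t) x
  linearized : ∀ w, ∀ t ∈ Set.Icc (0 : ℝ) 1, HasDerivWithinAt (fun s => fderiv ℝ (Φ s) x w)
    (fderiv ℝ X (Φ t x) (fderiv ℝ (Φ t) x w)) (Set.Icc 0 1) t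
  linearized_init : ∀ w, fderiv ℝ (Φ 0) x w = w
  linearized_le : ∀ w, ∀ t ∈ Set.Icc (0 : ℝ) 1,
    gnorm σ θ (fderiv ℝ (Φ t) x w - w) ≤ 1 / 3 * gnorm σ θ w
  unique : ∀ v : ℝ → GM M, (∀ t ∈ Set.Icc (0 : ℝ) 1,
    HasDerivWithinAt v (X (v t)) (Set.Icc 0 1) t) → v 0 = x →
    (∀ t ∈ Set.Icc (0 : ℝ) 1, gnorm σ θ (v t - x) ≤ κ * gnorm σ θ x) → v 1 = Φ 1 x

lemma exists_generator_flow (hσ : 0 < σ) (hθ : 0 < θ) (hθ1 : θ < 1) (hM : 3 ≤ M)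
    (hr : 3 ≤ r) (hγ : 0 < γ) (hγ1 : γ < 1)
    (hϱ : ϱ = γ ^ (3 / 2 : ℝ) * (10 ^ 12)⁻¹ * ((r : ℝ) ^ 4)⁻¹) {c : ℝ} (hc : |c| = 1) :
    ∃ Φ : ℝ → GM M → GM M, ∀ x ∈ domain σ θ M (2 * ϱ) (γ / 2) (6 * r),
      IsFlowAt σ θ (γ / (144 * r)) (fun y => c • hamVF (rfun (genQ M r)) y) Φ x := by
  have hr' : (0 : ℝ) < r := by exact_mod_cast (by omega : 0 < r)
  have hsm : ∀ y ∈ regularSet M (6 * r), ContDiffAt ℝ ∞ (hamVF (rfun (M := M) (genQ M r))) y :=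
    fun y hy => contDiffAt_hamVF (contDiffAt_rfun (ratReal_genQ r) (denClass_genQ hM) hy)
  obtain ⟨Φ, hΦ⟩ := exists_gevrey_flow (σ := σ) (θ := θ)
    (X := fun y => c • hamVF (rfun (genQ M r)) y) (U := regularSet M (6 * r))
    (D := domain σ θ M (2 * ϱ) (γ / 2) (6 * r)) (κ := γ / (144 * r)) (isOpen_regularSet _)
    (fun y hy => ((hsm y hy).const_smul c).contDiffWithinAt) (isOpen_domain _ _ _) (by positivity)
    (fun h => (gnorm_pos_of_mem_domain hM (by omega) h).ne' gnorm_zero)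
    (fun x hx y hy => (generator_bounds hσ hθ hθ1 hM hr hγ hγ1 hϱ hx hy).1)
    (fun x hx y hy => by
      have h1 := (generator_bounds hσ hθ hθ1 hM hr hγ hγ1 hϱ hx hy).2.1
      have h2 := (smallness hr hγ hϱ (gnorm_pos_of_mem_domain hM (by omega) hx) hx.1 hγ1).2.1
      have h3 : 0 ≤ genBound γ (gnorm σ θ x) := (gnorm_nonneg _).trans h1
      rw [gnorm_smul, hc]
      linarith)
    (fun x hx y hy w => by
      have h1 := generator_bounds hσ hθ hθ1 hM hr hγ hγ1 hϱ hx hy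
      rw [fderiv_fun_const_smul ((hsm y h1.1).differentiableAt (by simp)),
        smul_apply, gnorm_smul, hc, one_mul]
      exact h1.2.2 w)
  refine ⟨Φ, fun x hx => ?_⟩
  obtain ⟨h1, h2, h3, h4, h5, h6, h7, h8⟩ := hΦ x hx
  exact ⟨h1, h2, h3, h4, h5, h6, h7, h8⟩

namespace IsFlowAt

variable {κ : ℝ} {X : GM M → GM M} {Φ : ℝ → GM M → GM M} {x : GM M}

lemma gnorm_sub_le (h : IsFlowAt σ θ κ X Φ x) {B : ℝ}
    (hB : ∀ t ∈ Set.Icc (0 : ℝ) 1, gnorm σ θ (X (Φ t x)) ≤ B) : gnorm σ θ (Φ 1 x - x) ≤ B := by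
  have h1 := norm_image_sub_le_of_norm_deriv_le_segment' (f := fun t => gevreyEquiv σ θ (Φ t x))
    (f' := fun t => gevreyEquiv σ θ (X (Φ t x))) (a := 0) (b := 1) (C := B)
    (fun t ht => (gevreyEquiv σ θ).toContinuousLinearMap.hasFDerivAt.comp_hasDerivWithinAt t
      (h.deriv t ht))
    (fun t ht => by
      rw [norm_gevreyEquiv]
      exact hB t ⟨ht.1, ht.2.le⟩) 1 ⟨zero_le_one, le_rfl⟩
  rwa [← map_sub, norm_gevreyEquiv, h.init, sub_zero, mul_one] at h1

lemma gnorm_fderiv_le (h : IsFlowAt σ θ κ X Φ x) (w : GM M) {t : ℝ} (ht : t ∈ Set.Icc (0 : ℝ) 1) :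
    gnorm σ θ (fderiv ℝ (Φ t) x w) ≤ 4 / 3 * gnorm σ θ w := by
  have h1 := gnorm_add_le (σ := σ) (θ := θ) (fderiv ℝ (Φ t) x w - w) w
  rw [sub_add_cancel] at h1
  linarith [h.linearized_le w t ht]

lemma gnorm_le_gnorm_fderiv (h : IsFlowAt σ θ κ X Φ x) (w : GM M) {t : ℝ}
    (ht : t ∈ Set.Icc (0 : ℝ) 1) : gnorm σ θ w ≤ 3 / 2 * gnorm σ θ (fderiv ℝ (Φ t) x w) := by
  have h1 := gnorm_add_le (σ := σ) (θ := θ) (w - fderiv ℝ (Φ t) x w) (fderiv ℝ (Φ t) x w)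
  rw [sub_add_cancel, gnorm_sub_rev] at h1
  linarith [h.linearized_le w t ht]

/-- The differential is within 1/3 of the identity, hence injective, and the dimension is finite. -/
lemma surjective_fderiv (h : IsFlowAt σ θ κ X Φ x) {t : ℝ} (ht : t ∈ Set.Icc (0 : ℝ) 1) :
    Function.Surjective (fderiv ℝ (Φ t) x) := by
  refine LinearMap.injective_iff_surjective (f := (fderiv ℝ (Φ t) x : GM M →ₗ[ℝ] GM M)).1 ?_
  refine (injective_iff_map_eq_zero _).2 fun w hw => ?_
  have h1 := h.gnorm_le_gnorm_fderiv w ht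
  rw [show fderiv ℝ (Φ t) x w = 0 from hw, gnorm_zero, mul_zero] at h1
  exact gnorm_eq_zero.1 (le_antisymm h1 (gnorm_nonneg w))

lemma l2inner_fderiv {χ : GM M → ℝ} {c : ℝ} (h : IsFlowAt σ θ κ (fun y => c • hamVF χ y) Φ x)
    (hχ : ∀ t ∈ Set.Icc (0 : ℝ) 1, ContDiffAt ℝ ∞ χ (Φ t x)) (v w : GM M) {t : ℝ}
    (ht : t ∈ Set.Icc (0 : ℝ) 1) :
    l2inner (Complex.I • fderiv ℝ (Φ t) x v) (fderiv ℝ (Φ t) x w) = l2inner (Complex.I • v) w := by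
  have h1 := l2inner_linearized_flow hχ (h.linearized v) (h.linearized w) t ht
  rwa [h.linearized_init, h.linearized_init] at h1

/-- A Hamiltonian flow transports a form `(i Y, ·)` with little loss. -/
lemma abs_l2inner_fderiv_le {χ : GM M → ℝ} {c : ℝ}
    (h : IsFlowAt σ θ κ (fun y => c • hamVF χ y) Φ x)
    (hχ : ∀ t ∈ Set.Icc (0 : ℝ) 1, ContDiffAt ℝ ∞ χ (Φ t x)) {w : GM M}
    (hw : ∀ a, ‖w a‖ ≤ wt σ θ a) (Y : GM M) {t : ℝ} (ht : t ∈ Set.Icc (0 : ℝ) 1) :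
    |2 * l2inner (Complex.I • Y) (fderiv ℝ (Φ t) x w)| ≤ 3 / 2 * gnorm σ θ Y := by
  -- Writing Y as the image of u and using symplecticity moves the pairing to time zero, where w has
  -- its prescribed weights. Thus no bound of the linearized flow in the dual norm is needed.
  obtain ⟨u, rfl⟩ := h.surjective_fderiv ht Y
  rw [h.l2inner_fderiv hχ u w ht]
  exact (abs_l2inner_le hw).trans (h.gnorm_le_gnorm_fderiv u ht)

end IsFlowAt

end GeneratorFlow

/-! ### The normal form -/

section NormalForm

variable {M σ θ : ℝ} {r : ℕ} {γ ϱ : ℝ}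

lemma domain_subset (hϱ : 0 ≤ ϱ) (hγ : 0 < γ) (s : ℕ) :
    domain σ θ M ϱ γ s ⊆ domain σ θ M (2 * ϱ) (γ / 2) s := fun z hz => by
  have h1 : gnorm σ θ z < ϱ := hz.1
  refine ⟨show gnorm σ θ z < 2 * ϱ by linarith, fun j hj => lt_of_le_of_lt ?_ (hz.2 j hj)⟩
  exact mul_le_mul_of_nonneg_right (by linarith) (sq_nonneg _)

/-- A displacement of κR/4 changes a divisor by at most γR²/32 and the norm by a factor at most 1 +
1/576, so halving γ and doubling the radius is more than enough. -/
lemma mem_domain_of_gnorm_sub_le (hσ : 0 < σ) (hM : 3 ≤ M) (hr : 1 ≤ r) (hγ : 0 < γ) (hγ1 : γ < 1)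
    {z z' : GM M} (hz : z ∈ domain σ θ M ϱ γ (6 * r))
    (h : gnorm σ θ (z' - z) ≤ γ / (144 * r) * gnorm σ θ z / 4) :
    z' ∈ domain σ θ M (2 * ϱ) (γ / 2) (6 * r) := by
  have hR := gnorm_pos_of_mem_domain hM (by omega) hz
  have hRϱ : gnorm σ θ z < ϱ := hz.1
  set R := gnorm σ θ z with hRdef
  have hr' : (1 : ℝ) ≤ r := by exact_mod_cast hr
  have hd : gnorm σ θ (z' - z) ≤ R / 576 := by
    refine h.trans ?_
    have : γ / (144 * r) ≤ 1 / 144 := by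
      rw [div_le_div_iff₀ (by positivity) (by norm_num)]
      nlinarith
    nlinarith
  have h1 : gnorm σ θ z' ≤ R + R / 576 := by
    have := gnorm_add_le (σ := σ) (θ := θ) (z' - z) z
    rw [sub_add_cancel] at this
    linarith
  refine ⟨show gnorm σ θ z' < 2 * ϱ by linarith, fun j hj => ?_⟩
  have h2 := hz.2 j hj
  have h3 := norm_comega_sub_le (θ := θ) hσ j (cx z') (cx z)
  rw [← map_sub, cnorm_cx, cnorm_cx, cnorm_cx, comega_cx, comega_cx, ← Complex.ofReal_sub,
    Complex.norm_real, Real.norm_eq_abs] at h3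
  have h4 : (j.length : ℝ) * (gnorm σ θ (z' - z) * (gnorm σ θ z' + R)) ≤ γ * R ^ 2 / 32 := by
    have hl : (j.length : ℝ) ≤ 6 * r := by exact_mod_cast hj.2.1
    calc (j.length : ℝ) * (gnorm σ θ (z' - z) * (gnorm σ θ z' + R))
        ≤ 6 * r * (γ / (144 * r) * R / 4 * (3 * R)) := by
          have h0 := gnorm_nonneg (σ := σ) (θ := θ) z'
          have h0' := gnorm_nonneg (σ := σ) (θ := θ) (z' - z)
          gcongr
          linarith
      _ = γ * R ^ 2 / 32 := by field_simp; ring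
  have h5 : |omega j z| - |omega j z'| ≤ |omega j z' - omega j z| := by
    rw [abs_sub_comm]
    exact abs_sub_abs_le_abs_sub _ _
  have h6 : gnorm σ θ z' ^ 2 ≤ (R + R / 576) ^ 2 :=
    pow_le_pow_left₀ (gnorm_nonneg _) h1 2
  have h7 : γ / 2 * gnorm σ θ z' ^ 2 ≤ γ / 2 * (R + R / 576) ^ 2 := by gcongr
  have h8 : γ / 2 * (R + R / 576) ^ 2 ≤ 3 / 4 * (γ * R ^ 2) := by
    have : 0 < γ * R ^ 2 := by positivity
    nlinarith
  have h9 : 0 < γ * R ^ 2 := by positivity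
  rw [← hRdef] at h2
  linarith

/-- The backward flow is inverted by the forward flow. -/
lemma flow_comp_backward {κ : ℝ} (hκ : 0 < κ) (hκ1 : κ ≤ 1) {X : GM M → GM M} {Φ Ψ : ℝ → GM M → GM M}
    {z : GM M} (hΨ : IsFlowAt σ θ κ (fun y => (-1 : ℝ) • X y) Ψ z)
    (hΦ : IsFlowAt σ θ κ (fun y => (1 : ℝ) • X y) Φ (Ψ 1 z)) : Φ 1 (Ψ 1 z) = z := by
  have hmem : ∀ t ∈ Set.Icc (0 : ℝ) 1, 1 - t ∈ Set.Icc (0 : ℝ) 1 := fun t ht =>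
    ⟨by linarith [ht.2], by linarith [ht.1]⟩
  have hone : (1 : ℝ) ∈ Set.Icc (0 : ℝ) 1 := ⟨zero_le_one, le_rfl⟩
  -- The time-reversed backward orbit solves the forward equation from its end point. It stays
  -- within κ‖z‖/2 of that point, and ‖z‖/2 ≤ ‖Ψ₁(z)‖, so it lies in the ball where solutions are
  -- unique.
  have h := hΦ.unique (fun t => Ψ (1 - t) z) (fun t ht => ?_) (by simp) (fun t ht => ?_)
  · rw [← h]
    simpa using hΨ.init
  · have h1 : HasDerivWithinAt (fun t : ℝ => 1 - t) (-1) (Set.Icc 0 1) t :=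
      ((hasDerivAt_id t).const_sub 1).hasDerivWithinAt
    have h2 := (hΨ.deriv (1 - t) (hmem t ht)).scomp t h1 hmem
    rw [smul_smul, neg_one_mul, neg_neg] at h2
    exact h2
  · have h1 := hΨ.dist_le (1 - t) (hmem t ht)
    have h2 := hΨ.dist_le 1 hone
    have h3 := gnorm_add_le (σ := σ) (θ := θ) (Ψ (1 - t) z - z) (z - Ψ 1 z)
    have h4 := gnorm_add_le (σ := σ) (θ := θ) (z - Ψ 1 z) (Ψ 1 z)
    rw [sub_add_sub_cancel, gnorm_sub_rev z] at h3
    rw [sub_add_cancel, gnorm_sub_rev z] at h4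
    have h5 := gnorm_nonneg (σ := σ) (θ := θ) z
    have h6 : gnorm σ θ z / 2 ≤ gnorm σ θ (Ψ 1 z) := by nlinarith
    nlinarith

lemma isIntegrableRational_intPart (hM : 3 ≤ M) {n : ℕ} (hn : n < r - 2) :
    IsIntegrableRational (n + 3) M (intPart (nfT (initQ M r) r n)) ∧
      DenominatorsLE (6 * r) (intPart (nfT (initQ M r) r n)) := by
  have hc := ((nf_class hM hn).2.1.mono (s' := 6 * r) (by omega) le_rfl).intPart
  have hreal := (nf_real (M := M) hn).1.intPart
  refine ⟨⟨⟨fun j h hj => ?_, fun j h hj k hk => ((hc _ hj).den k hk).1, fun j h hj => (hc _ hj).len,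
    fun j h hj => (hc _ hj).modes, fun j h hj k hk => ((hc _ hj).den k hk).2.2,
    fun j h => hreal.reality (j, h)⟩, fun j hj h => ?_⟩, fun j h hj k hk => ((hc _ hj).den k hk).2.1⟩
  · have hg := hc _ hj
    have hl : j.length = 2 * (n + 3) + 2 * h.length := hg.len
    exact ⟨n + 3 + h.length, by omega, ⟨by omega, hg.mass, hg.momentum⟩, hg.energy⟩
  · classical
    exact Finsupp.filter_apply_neg _ _ (by simpa using hj)

/-- The remainder of the normal form. -/
def remainder (r : ℕ) (Φ : ℝ → GM M → GM M) (z : GM M) : ℝ :=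
  lieF r 0 (Φ 1 z) - ∑ k ∈ Finset.range r, lieF r k z

lemma truncatedH_eq (hr : 3 ≤ r) (Φ : ℝ → GM M → GM M) (z : GM M) :
    truncatedH r (Φ 1 z) = (L2 z : ℂ) + (L4 z : ℂ) +
      ∑ q ∈ Finset.Icc 3 r, (intPart (nfT (initQ M r) r (q - 3))).eval z +
        (remainder r Φ z : ℂ) := by
  have h : Finset.Icc 3 r = (Finset.range (r - 2)).map (addRightEmbedding 3) := by
    ext m
    simp only [Finset.mem_Icc, Finset.mem_map, Finset.mem_range, addRightEmbedding_apply]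
    exact ⟨fun hm => ⟨m - 3, by omega, by omega⟩, by rintro ⟨n, hn, rfl⟩; omega⟩
  have e : ∑ q ∈ Finset.Icc 3 r, (intPart (nfT (initQ M r) r (q - 3))).eval z =
      ((∑ n ∈ Finset.range (r - 2), rfun (intPart (nfT (initQ M r) r n)) z : ℝ) : ℂ) := by
    rw [h, Finset.sum_map, Complex.ofReal_sum]
    refine Finset.sum_congr rfl fun n hn => ?_
    rw [addRightEmbedding_apply, Nat.add_sub_cancel, ← ceval_cx]
    exact ((nf_real (Finset.mem_range.1 hn)).1.intPart.isRestr z).symm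
  rw [e, remainder, sum_lieF hr, ← lieF_zero hr]
  push_cast
  ring

variable {Φ : ℝ → GM M → GM M} {z : GM M}

lemma IsFlowAt.mem_regularSet (hσ : 0 < σ) (hθ : 0 < θ) (hθ1 : θ < 1) (hM : 3 ≤ M)
    (hr : 3 ≤ r) (hγ : 0 < γ) (hγ1 : γ < 1)
    (hϱ : ϱ = γ ^ (3 / 2 : ℝ) * (10 ^ 12)⁻¹ * ((r : ℝ) ^ 4)⁻¹)
    (hz : z ∈ domain σ θ M (2 * ϱ) (γ / 2) (6 * r)) {X : GM M → GM M}
    (h : IsFlowAt σ θ (γ / (144 * r)) X Φ z) {t : ℝ} (ht : t ∈ Set.Icc (0 : ℝ) 1) :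
    Φ t z ∈ regularSet M (6 * r) ∧
      gnorm σ θ (hamVF (rfun (genQ M r)) (Φ t z)) ≤ genBound γ (gnorm σ θ z) := by
  have hR := gnorm_pos_of_mem_domain hM (by omega) hz
  have h1 := generator_bounds hσ hθ hθ1 hM hr hγ hγ1 hϱ hz (y := Φ t z) (by
    have h1 := h.dist_le t ht
    have : 0 ≤ γ / (144 * r) * gnorm σ θ z := by positivity
    linarith)
  exact ⟨h1.1, h1.2.1⟩

lemma mem_regularSet_of_mem_domain (hγ : 0 < γ) {s : ℕ} (hz : z ∈ domain σ θ M ϱ γ s) :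
    z ∈ regularSet M s := fun h hh h0 => by
  have h1 := hz.2 h hh
  rw [h0, abs_zero] at h1
  have : 0 ≤ γ * gnorm σ θ z ^ 2 := by positivity
  linarith

lemma contDiffAt_remainder (hM : 3 ≤ M) (hz : z ∈ regularSet M (6 * r))
    (hz1 : Φ 1 z ∈ regularSet M (6 * r)) (hΦ : ContDiffAt ℝ ∞ (Φ 1) z) :
    ContDiffAt ℝ ∞ (remainder r Φ) z :=
  ((contDiffAt_lieF hM 0 hz1).comp z hΦ).sub
    (ContDiffAt.sum fun k _ => contDiffAt_lieF hM k hz)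

lemma fderiv_remainder (hM : 3 ≤ M) (hz : z ∈ regularSet M (6 * r))
    (hz1 : Φ 1 z ∈ regularSet M (6 * r)) (hΦ : ContDiffAt ℝ ∞ (Φ 1) z) (w : GM M) :
    fderiv ℝ (remainder r Φ) z w = fderiv ℝ (lieF r 0) (Φ 1 z) (fderiv ℝ (Φ 1) z w) -
      ∑ k ∈ Finset.range r, fderiv ℝ (lieF r k) z w := by
  have h1 := (((contDiffAt_lieF hM 0 hz1).differentiableAt (by simp)).hasFDerivAt).comp z
    (hΦ.differentiableAt (by simp)).hasFDerivAt
  have h2 := HasFDerivAt.fun_sum (u := Finset.range r) fun k _ =>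
    ((contDiffAt_lieF hM k hz).differentiableAt (by simp)).hasFDerivAt
  have h3 : HasFDerivAt (remainder r Φ) _ z := h1.sub h2
  rw [h3.fderiv]
  simp

/-- By duality the norm is one derivative dΥ(z)w, which is the error of the differentiated Taylor
formula in time. Its integrand is the derivative of `remT` along the linearized flow, and
`IsFlowAt.abs_l2inner_fderiv_le` bounds it by 3/2 of the field of `remT`. -/
lemma gnorm_hamVF_remainder_le (hσ : 0 < σ) (hθ : 0 < θ) (hθ1 : θ < 1) (hM : 3 ≤ M)
    (hr : 3 ≤ r) (hγ : 0 < γ) (hγ1 : γ < 1)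
    (hϱ : ϱ = γ ^ (3 / 2 : ℝ) * (10 ^ 12)⁻¹ * ((r : ℝ) ^ 4)⁻¹)
    (hz : z ∈ domain σ θ M (2 * ϱ) (γ / 2) (6 * r))
    (h : IsFlowAt σ θ (γ / (144 * r)) (fun y => (1 : ℝ) • hamVF (rfun (genQ M r)) y) Φ z) :
    gnorm σ θ (hamVF (remainder r Φ) z) ≤
      (10 ^ 12) ^ r * (r : ℝ) ^ (10 * r) * γ ^ (-2 * (r : ℤ) + 3) * gnorm σ θ z ^ (2 * r + 1) := by
  have hR := gnorm_pos_of_mem_domain hM (by omega) hz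
  have hone : (1 : ℝ) ∈ Set.Icc (0 : ℝ) 1 := ⟨zero_le_one, le_rfl⟩
  have hreg : ∀ t ∈ Set.Icc (0 : ℝ) 1, Φ t z ∈ regularSet M (6 * r) := fun t ht =>
    (h.mem_regularSet hσ hθ hθ1 hM hr hγ hγ1 hϱ hz ht).1
  have hχ : ∀ y ∈ regularSet M (6 * r), ContDiffAt ℝ ∞ (rfun (M := M) (genQ M r)) y :=
    fun y hy => contDiffAt_rfun (ratReal_genQ r) (denClass_genQ hM) hy
  obtain ⟨w, hw, hX⟩ := gnorm_eq_l2inner (σ := σ) (θ := θ) (hamVF (remainder r Φ) z)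
  rw [hX, ← fderiv_eq_l2inner, fderiv_remainder hM
    (mem_regularSet_of_mem_domain (by positivity) hz) (hreg 1 hone) (h.smooth 1 hone)]
  refine le_trans (le_abs_self _) (le_trans ?_ (remainder_const_le hr hγ hR))
  have hX1 : ∀ y ∈ regularSet M (6 * r),
      DifferentiableAt ℝ (fun y : GM M => (1 : ℝ) • hamVF (rfun (genQ M r)) y) y := fun y hy =>
    ((contDiffAt_hamVF (hχ y hy)).const_smul (1 : ℝ)).differentiableAt (by simp)
  refine (Eq.le ?_).trans (abs_fderiv_remainder_le (f := lieF (M := M) r) (ρ := fun k => rfun (remQ M r k))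
    (X := fun y : GM M => (1 : ℝ) • hamVF (rfun (genQ M r)) y) (N := r)
    (u := fun t => Φ t z) (v := fun t => fderiv ℝ (Φ t) z w)
    (isOpen_regularSet (6 * r)) (fun k y hy => contDiffAt_lieF hM k hy) hX1
    (fun k _ y hy => by simpa only [one_smul] using fderiv_lieF hM k hy)
    (fun y _ => lieF_eq_zero hr y) hreg h.deriv (h.linearized w) (fun t ht => ?_) (by omega))
  · simp only [h.init, h.linearized_init]
  · have hy := hreg t ht
    have e : ∑ k ∈ Finset.range r, (1 - t) ^ k *
        fderiv ℝ (rfun (remQ M r k)) (Φ t z) (fderiv ℝ (Φ t) z w) =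
        fderiv ℝ (rfun (remT M r t)) (Φ t z) (fderiv ℝ (Φ t) z w) := by
      have h1 : rfun (M := M) (remT M r t) =
          fun y => ∑ k ∈ Finset.range r, (1 - t) ^ k * rfun (remQ M r k) y :=
        funext fun y => rfun_remT t y
      have h2 := HasFDerivAt.fun_sum (u := Finset.range r) fun k _ =>
        ((contDiffAt_rfun (ratReal_remQ r k) (denClass_remQ hM k) hy).differentiableAt
          (by simp)).hasFDerivAt.const_mul ((1 - t) ^ k)
      rw [h1, h2.fderiv]
      simp
    rw [e, fderiv_eq_l2inner, neg_mul, abs_neg]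
    refine (h.abs_l2inner_fderiv_le (fun t ht => hχ _ (hreg t ht)) hw _ ht).trans ?_
    have hζ := region_of_mem_domain hσ (by omega) hγ hγ1 hz (ζ := cx (Φ t z)) (by
      rw [← map_sub, cnorm_cx]
      have h1 := h.dist_le t ht
      have : 0 ≤ γ / (144 * r) * gnorm σ θ z := by positivity
      linarith)
    rw [(ratReal_remT t).isRestr.gnorm_hamVF
      ((denClass_remT hM t).differentiableAt (comega_ne_zero_of_mem hy))]
    exact mul_le_mul_of_nonneg_left (sum_weighted_grad_remT_le hσ hθ hθ1 hM hr (by positivity)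
      (by linarith) hR (smallness hr hγ hϱ hR hz.1 hγ1).1 hζ.1 hζ.2 ht) (by norm_num)

end NormalForm

end SchrodingerPoisson

end

/-! ### The normal form theorem -/

theorem theorem5p1 :
    ∃ C : ℝ, 1 < C ∧
      ∀ σ θ : ℝ, 0 < σ → 0 < θ → θ < 1 →
      ∀ (r : ℕ) (M γ : ℝ), 3 ≤ r → 3 ≤ M → 0 < γ → γ < 1 →
      ∀ ϱ : ℝ, ϱ = γ ^ (3 / 2 : ℝ) * C⁻¹ * ((r : ℝ) ^ 4)⁻¹ →
      ∃ (φ₀ φ₁ : GM M → GM M) (L : ℕ → RatCoeff) (Υ : GM M → ℝ),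
        -- the two maps are smooth and symplectic, and the diagram commutes
        ContDiffOn ℝ ∞ φ₀ (domain σ θ M ϱ γ (6 * r)) ∧
        ContDiffOn ℝ ∞ φ₁ (domain σ θ M (2 * ϱ) (γ / 2) (6 * r)) ∧
        SymplecticOn φ₀ (domain σ θ M ϱ γ (6 * r)) ∧
        SymplecticOn φ₁ (domain σ θ M (2 * ϱ) (γ / 2) (6 * r)) ∧
        Set.MapsTo φ₀ (domain σ θ M ϱ γ (6 * r)) (domain σ θ M (2 * ϱ) (γ / 2) (6 * r)) ∧
        (∀ z ∈ domain σ θ M ϱ γ (6 * r), φ₁ (φ₀ z) = z) ∧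
        -- the decomposition of the Hamiltonian
        (∀ q : ℕ, 3 ≤ q → q ≤ r →
          IsIntegrableRational q M (L q) ∧ DenominatorsLE (6 * r) (L q)) ∧
        (∀ z ∈ domain σ θ M (2 * ϱ) (γ / 2) (6 * r),
          truncatedH r (φ₁ z) =
            (L2 z : ℂ) + (L4 z : ℂ) + ∑ q ∈ Finset.Icc 3 r, (L q).eval z + (Υ z : ℂ)) ∧
        -- the remainder
        ContDiffOn ℝ ∞ Υ (domain σ θ M (2 * ϱ) (γ / 2) (6 * r)) ∧
        (∀ z ∈ domain σ θ M (2 * ϱ) (γ / 2) (6 * r),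
          gnorm σ θ (hamVF Υ z) ≤
            C ^ r * (r : ℝ) ^ (10 * r) * γ ^ (-2 * (r : ℤ) + 3) * gnorm σ θ z ^ (2 * r + 1)) ∧
        -- closeness to the identity
        (∀ z ∈ domain σ θ M ϱ γ (6 * r),
          gnorm σ θ (φ₀ z - z) ≤ C * γ ^ (-2 : ℤ) * gnorm σ θ z ^ 3) ∧
        (∀ z ∈ domain σ θ M (2 * ϱ) (γ / 2) (6 * r),
          gnorm σ θ (φ₁ z - z) ≤ C * γ ^ (-2 : ℤ) * gnorm σ θ z ^ 3) ∧
        -- bounds on the differentials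
        (∀ z ∈ domain σ θ M ϱ γ (6 * r), ∀ w : GM M,
          gnorm σ θ (fderiv ℝ φ₀ z w) ≤ 2 ^ (r - 2) * gnorm σ θ w) ∧
        (∀ z ∈ domain σ θ M (2 * ϱ) (γ / 2) (6 * r), ∀ w : GM M,
          gnorm σ θ (fderiv ℝ φ₁ z w) ≤ 2 ^ (r - 2) * gnorm σ θ w) := by
  refine ⟨10 ^ 12, by norm_num, fun σ θ hσ hθ hθ1 r M γ hr hM hγ hγ1 ϱ hϱ => ?_⟩
  obtain ⟨Φ, hΦ⟩ := exists_generator_flow hσ hθ hθ1 hM hr hγ hγ1 hϱ (c := 1) abs_one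
  obtain ⟨Ψ, hΨ⟩ := exists_generator_flow hσ hθ hθ1 hM hr hγ hγ1 hϱ (c := -1) (by simp)
  have hr' : (1 : ℝ) ≤ r := by exact_mod_cast (by omega : 1 ≤ r)
  have hϱ0 : 0 ≤ ϱ := by rw [hϱ]; positivity
  have hone : (1 : ℝ) ∈ Set.Icc (0 : ℝ) 1 := ⟨zero_le_one, le_rfl⟩
  have hsub : domain σ θ M ϱ γ (6 * r) ⊆ domain σ θ M (2 * ϱ) (γ / 2) (6 * r) :=
    domain_subset hϱ0 hγ _
  have hmaps : Set.MapsTo (Ψ 1) (domain σ θ M ϱ γ (6 * r))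
      (domain σ θ M (2 * ϱ) (γ / 2) (6 * r)) := fun z hz =>
    mem_domain_of_gnorm_sub_le hσ hM (by omega) hγ hγ1 hz ((hΨ z (hsub hz)).dist_le 1 hone)
  have hreg : ∀ {c : ℝ} {F : ℝ → GM M → GM M} {z : GM M},
      z ∈ domain σ θ M (2 * ϱ) (γ / 2) (6 * r) →
      IsFlowAt σ θ (γ / (144 * r)) (fun y => c • hamVF (rfun (genQ M r)) y) F z →
      ∀ t ∈ Set.Icc (0 : ℝ) 1, F t z ∈ regularSet M (6 * r) ∧
        gnorm σ θ (hamVF (rfun (genQ M r)) (F t z)) ≤ genBound γ (gnorm σ θ z) :=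
    fun hz h t ht => h.mem_regularSet hσ hθ hθ1 hM hr hγ hγ1 hϱ hz ht
  have hsymp : ∀ {c : ℝ} {F : ℝ → GM M → GM M} {z : GM M},
      z ∈ domain σ θ M (2 * ϱ) (γ / 2) (6 * r) →
      IsFlowAt σ θ (γ / (144 * r)) (fun y => c • hamVF (rfun (genQ M r)) y) F z →
      ∀ v w, l2inner (Complex.I • fderiv ℝ (F 1) z v) (fderiv ℝ (F 1) z w) =
        l2inner (Complex.I • v) w := fun hz h v w =>
    h.l2inner_fderiv (fun t ht => contDiffAt_rfun (ratReal_genQ r) (denClass_genQ hM)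
      (hreg hz h t ht).1) v w hone
  have hclose : ∀ {c : ℝ} {F : ℝ → GM M → GM M} {z : GM M}, |c| = 1 →
      z ∈ domain σ θ M (2 * ϱ) (γ / 2) (6 * r) →
      IsFlowAt σ θ (γ / (144 * r)) (fun y => c • hamVF (rfun (genQ M r)) y) F z →
      gnorm σ θ (F 1 z - z) ≤ 10 ^ 12 * γ ^ (-2 : ℤ) * gnorm σ θ z ^ 3 := fun {c F z} hc hz h =>
    (h.gnorm_sub_le fun t ht => by
      rw [gnorm_smul, hc, one_mul]
      exact (hreg hz h t ht).2).trans
      (smallness hr hγ hϱ (gnorm_pos_of_mem_domain hM (by omega) hz) hz.1 hγ1).2.2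
  have hdiff : ∀ {X : GM M → GM M} {F : ℝ → GM M → GM M} {z : GM M},
      IsFlowAt σ θ (γ / (144 * r)) X F z →
      ∀ w, gnorm σ θ (fderiv ℝ (F 1) z w) ≤ 2 ^ (r - 2) * gnorm σ θ w := fun h w => by
    refine (h.gnorm_fderiv_le w hone).trans (mul_le_mul_of_nonneg_right ?_ (gnorm_nonneg w))
    -- The differentials have norm at most 4/3, which is below 2 ≤ 2^{r-2} since r ≥ 3.
    have h2 : (2 : ℝ) ^ 1 ≤ 2 ^ (r - 2) := pow_le_pow_right₀ one_le_two (by omega)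
    linarith
  have hκ1 : γ / (144 * r) ≤ 1 := by
    rw [div_le_one (by positivity)]
    linarith
  -- φ₀ is the backward flow and φ₁ the forward flow of the same generator. The family L is shifted
  -- by 3 because the terms of order 2q are numbered by n = q - 3.
  refine ⟨Ψ 1, Φ 1, fun q => intPart (nfT (initQ M r) r (q - 3)), remainder r Φ,
    fun z hz => ((hΨ z (hsub hz)).smooth 1 hone).contDiffWithinAt,
    fun z hz => ((hΦ z hz).smooth 1 hone).contDiffWithinAt,
    fun z hz => hsymp (hsub hz) (hΨ z (hsub hz)), fun z hz => hsymp hz (hΦ z hz), hmaps,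
    fun z hz => flow_comp_backward (by positivity) hκ1 (hΨ z (hsub hz)) (hΦ _ (hmaps hz)),
    fun q hq hqr => ?_, fun z _ => truncatedH_eq hr Φ z,
    fun z hz => (contDiffAt_remainder hM (mem_regularSet_of_mem_domain (by positivity) hz)
      (hreg hz (hΦ z hz) 1 hone).1 ((hΦ z hz).smooth 1 hone)).contDiffWithinAt,
    fun z hz => gnorm_hamVF_remainder_le hσ hθ hθ1 hM hr hγ hγ1 hϱ hz (hΦ z hz),
    fun z hz => hclose (by simp) (hsub hz) (hΨ z (hsub hz)),
    fun z hz => hclose abs_one hz (hΦ z hz),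
    fun z hz => hdiff (hΨ z (hsub hz)), fun z hz => hdiff (hΦ z hz)⟩
  have h := isIntegrableRational_intPart (r := r) hM (n := q - 3) (by omega)
  rwa [Nat.sub_add_cancel hq] at h
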